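/- Let $(M,J,g,\omega)$ be a compact connected Kähler manifold of complex dimension $m$ whose scalar curvature $\mathbf{s}(\omega)$ is constant. For a Kähler form $\tilde\omega$ on $M$ let $\mathfrak h$ be the complex vector space of Hamiltonian holomorphic vector fields, i.e. of the holomorphic vector fields $\Xi$ of type $(1,0)$ for which there is a smooth function $\zeta\colon M\to\mathbb C$ with $-\bar\partial\zeta=\tfrac12\,\tilde\omega(\Xi,-)$ (for the Kähler forms in a given Kähler class this space is the same), and let $\xi_{\tilde\omega}\colon M\to\mathfrak h^*$ be the moment map: for $\Xi\in\mathfrak h$ the function $\langle\xi_{\tilde\omega},\Xi\rangle$ is the solution $\zeta$ of this equation with $\int_M\zeta\,d\mathrm{vol}_{\tilde\omega}=0$. Let $\triangle\subset M^n$ be the set of $n$-tuples with two equal entries, and assume that $n\ge\dim_{\mathbb C}\mathfrak h+1$. Then the set of all $((p_1,\dots,p_n),(a_1,\dots,a_n))\in(M^n\setminus\triangle)\times(0,\infty)^n$ for which there is a Kähler form $\tilde\omega\in[\omega]$ with $\mathbf{s}(\tilde\omega)=\mathbf{s}(\omega)$ such that (i) $\xi_{\tilde\omega}(p_1),\dots,\xi_{\tilde\omega}(p_n)$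 span $\mathfrak h^*$ (genericity), (ii) $\sum_{j=1}^n a_j^{m-1}\,\xi_{\tilde\omega}(p_j)=0$ in $\mathfrak h^*$ (balancing), (iii) no nonzero element of $\mathfrak h$ vanishes at every point $p_1,\dots,p_n$ (general position), is open in $(M^n\setminus\triangle)\times(0,\infty)^n$. -/

import Mathlib

open scoped Manifold ContDiff

noncomputable section

namespace KahlerBlowup

/-- The model space `ℂ^m`. It is used both as a complex and as a real normed space. -/
abbrev CSpace (m : ℕ) : Type := Fin m → ℂ

section Forms

variable {m : ℕ} {M : Type*} [TopologicalSpace M] [ChartedSpace (CSpace m) M]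

/-- The almost complex structure `J` on the real tangent space `T_x M`. The charts of a complex
manifold have holomorphic transition maps, so `J` is multiplication by `i` in every chart. -/
def J (x : M) (u : TangentSpace 𝓘(ℝ, CSpace m) x) : TangentSpace 𝓘(ℝ, CSpace m) x :=
  (Complex.I • (show CSpace m from u) : CSpace m)

/-- A vector of the complex tangent space of the complex manifold, seen as a real one. The complex
vector space `(T_x M, J)` is identified with `T_x^{1,0} M` by `X ↦ X - i J X`. -/
def toReal (x : M) (v : TangentSpace 𝓘(ℂ, CSpace m) x) : TangentSpace 𝓘(ℝ, CSpace m) x :=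
  (show CSpace m from v)

variable (m M) in
/-- (Not necessarily continuous) real differential `k`-forms on `M`. -/
abbrev RealForm (k : ℕ) : Type _ :=
  ∀ x : M, TangentSpace 𝓘(ℝ, CSpace m) x [⋀^Fin k]→L[ℝ] ℝ

/-- The expression of a differential form in the preferred chart at `c`: its pullback by the inverse
of that chart. It is meaningful on the target of the chart. -/
def RealForm.inChart {k : ℕ} (α : RealForm m M k) (c : M) (z : CSpace m) :
    CSpace m [⋀^Fin k]→L[ℝ] ℝ :=
  (α ((chartAt (CSpace m) c).symm z)).compContinuousLinearMap
    (mfderiv 𝓘(ℝ, CSpace m) 𝓘(ℝ, CSpace m) (chartAt (CSpace m) c).symm z)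

/-- Smoothness of a differential form. -/
def RealForm.IsSmooth {k : ℕ} (α : RealForm m M k) : Prop :=
  ∀ c : M, ContDiffOn ℝ ∞ (α.inChart c) (chartAt (CSpace m) c).target

/-- `dα = β`. -/
def RealForm.HasExtDeriv {k : ℕ} (α : RealForm m M k) (β : RealForm m M (k + 1)) : Prop :=
  ∀ c : M, ∀ z ∈ (chartAt (CSpace m) c).target, extDeriv (α.inChart c) z = β.inChart c z

variable (m M) in
/-- A Kähler form on `M`: a smooth closed real `2`-form `ω` that is `J`-invariant and positive,
i.e. such that `g(u, v) = ω(u, J v)` is a Riemannian metric. -/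
structure KahlerForm where
  /-- the underlying `2`-form -/
  form : RealForm m M 2
  smooth : form.IsSmooth
  closed : form.HasExtDeriv 0
  invariant : ∀ (x : M) (u v : TangentSpace 𝓘(ℝ, CSpace m) x),
    form x ![J x u, J x v] = form x ![u, v]
  positive : ∀ (x : M) (u : TangentSpace 𝓘(ℝ, CSpace m) x), u ≠ 0 → 0 < form x ![u, J x u]

/-- Two Kähler forms lie in the same Kähler class: their difference is exact. -/
def KahlerForm.SameClass (κ₁ κ₂ : KahlerForm m M) : Prop :=
  ∃ η : RealForm m M 1, η.IsSmooth ∧ η.HasExtDeriv (fun x => κ₁.form x - κ₂.form x)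

end Forms

section Curvature

variable {m : ℕ}

/-- The operator `∂/∂z_j = (∂/∂x_j - i ∂/∂y_j) / 2` on `ℂ^m`. -/
def dz (j : Fin m) (F : CSpace m → ℂ) (z : CSpace m) : ℂ :=
  (1 / 2) * (fderiv ℝ F z (Pi.single j 1) - Complex.I * fderiv ℝ F z (Pi.single j Complex.I))

/-- The operator `∂/∂z̄_j = (∂/∂x_j + i ∂/∂y_j) / 2` on `ℂ^m`. -/
def dzbar (j : Fin m) (F : CSpace m → ℂ) (z : CSpace m) : ℂ :=
  (1 / 2) * (fderiv ℝ F z (Pi.single j 1) + Complex.I * fderiv ℝ F z (Pi.single j Complex.I))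

variable {M : Type*} [TopologicalSpace M] [ChartedSpace (CSpace m) M]

/-- The Hermitian matrix `H_{jk} = g(e_j, e_k) - i ω(e_j, e_k)` of a Kähler form in the chart at
`c`, where `e_j = ∂/∂x_j` and `g(u, v) = ω(u, J v)`. In terms of the usual components
`g_{j k̄} = g(∂/∂z_j, ∂/∂z̄_k)` it is `H_{jk} = 2 g_{j k̄}`. -/
def KahlerForm.herm (κ : KahlerForm m M) (c : M) (z : CSpace m) : Matrix (Fin m) (Fin m) ℂ :=
  fun j k =>
    (κ.form.inChart c z ![Pi.single j 1, Pi.single k Complex.I] : ℂ)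
      - Complex.I * (κ.form.inChart c z ![Pi.single j 1, Pi.single k 1] : ℂ)

/-- The components `R_{j k̄} = - ∂²/∂z_j ∂z̄_k log det (g_{a b̄})` of the Ricci form in the chart
at `c`. -/
def KahlerForm.ricci (κ : KahlerForm m M) (c : M) (z : CSpace m) : Matrix (Fin m) (Fin m) ℂ :=
  fun j k =>
    - dz j (dzbar k fun w => (Real.log (((1 / 2 : ℂ) • κ.herm c w).det.re) : ℂ)) z

/-- The (Riemannian) scalar curvature `2 g^{j k̄} R_{j k̄}` at the point `x`, computed in the
preferred chart at `x`. -/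
def KahlerForm.scal (κ : KahlerForm m M) (x : M) : ℝ :=
  (2 * (((1 / 2 : ℂ) • κ.herm x (chartAt (CSpace m) x x))⁻¹ *
    κ.ricci x (chartAt (CSpace m) x x)).trace).re

/-- The Riemannian measure of `g`: the measure which in each chart has density
`√(det of the real metric) = det H` with respect to the Lebesgue measure of `ℂ^m = ℝ^{2m}`. It is
obtained as the supremum of these measures on the chart domains, which agree on overlaps. -/
def KahlerForm.vol [MeasurableSpace M] (κ : KahlerForm m M) : MeasureTheory.Measure M :=
  ⨆ c : M, MeasureTheory.Measure.map (chartAt (CSpace m) c).symm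
    ((MeasureTheory.volume.restrict (chartAt (CSpace m) c).target).withDensity
      fun z => ENNReal.ofReal (κ.herm c z).det.re)

end Curvature

section Hamiltonian

variable {m : ℕ} {M : Type*} [TopologicalSpace M] [ChartedSpace (CSpace m) M]

/-- The differential of a complex valued function at `x`. -/
def diff (ζ : M → ℂ) (x : M) (u : TangentSpace 𝓘(ℝ, CSpace m) x) : ℂ :=
  mfderiv 𝓘(ℝ, CSpace m) 𝓘(ℝ, ℂ) ζ x u

/-- The `(0,1)`-part of the differential, `∂̄ζ(u) = (dζ(u) + i dζ(J u)) / 2`. -/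
def dbar (ζ : M → ℂ) (x : M) (u : TangentSpace 𝓘(ℝ, CSpace m) x) : ℂ :=
  (1 / 2) * (diff ζ x u + Complex.I * diff ζ x (J x u))

/-- `ω(Ξ, u)` for the `(1,0)`-vector `Ξ = X - i J X`, where `ω` is extended complex linearly. -/
def KahlerForm.contract (κ : KahlerForm m M) (x : M) (X u : TangentSpace 𝓘(ℝ, CSpace m) x) : ℂ :=
  (κ.form x ![X, u] : ℂ) - Complex.I * (κ.form x ![J x X, u] : ℂ)

theorem KahlerForm.contract_add (κ : KahlerForm m M) (x : M)
    (X Y u : TangentSpace 𝓘(ℝ, CSpace m) x) :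
    κ.contract x (X + Y) u = κ.contract x X u + κ.contract x Y u := by
  have hJ : J x (X + Y) = J x X + J x Y := smul_add (M := ℂ) (A := CSpace m) _ _ _
  have h2 (X Y : TangentSpace 𝓘(ℝ, CSpace m) x) :
      κ.form x ![X + Y, u] = κ.form x ![X, u] + κ.form x ![Y, u] := by
    exact (κ.form x).toAlternatingMap.map_vecCons_add ![u] X Y
  rw [contract, contract, contract, hJ, h2, h2]
  push_cast
  ring

theorem KahlerForm.contract_smul (κ : KahlerForm m M) (x : M) (c : ℂ)
    (X : TangentSpace 𝓘(ℂ, CSpace m) x) (u : TangentSpace 𝓘(ℝ, CSpace m) x) :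
    κ.contract x (toReal x (c • X)) u = c * κ.contract x (toReal x X) u := by
  have h2 (X Y : TangentSpace 𝓘(ℝ, CSpace m) x) :
      κ.form x ![X + Y, u] = κ.form x ![X, u] + κ.form x ![Y, u] := by
    exact (κ.form x).toAlternatingMap.map_vecCons_add ![u] X Y
  have h3 (r : ℝ) (X : TangentSpace 𝓘(ℝ, CSpace m) x) :
      κ.form x ![r • X, u] = r * κ.form x ![X, u] := by
    exact (κ.form x).toAlternatingMap.map_vecCons_smul ![u] r X
  set Y := toReal x X with hY
  have e1 : toReal x (c • X) = c.re • Y + c.im • J x Y := by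
    have aux (Z : CSpace m) : c • Z = c.re • Z + c.im • (Complex.I • Z) := by
      ext i
      apply Complex.ext <;> simp <;> try ring
    exact aux X
  have e2 : J x (toReal x (c • X)) = (-c.im) • Y + c.re • J x Y := by
    have aux (Z : CSpace m) :
        Complex.I • (c • Z) = (-c.im) • Z + c.re • (Complex.I • Z) := by
      ext i
      apply Complex.ext <;> simp <;> try ring
    exact aux X
  rw [contract, contract, e2, e1, h2, h2, h3, h3, h3, h3]
  apply Complex.ext <;> simp

variable [IsManifold 𝓘(ℂ, CSpace m) ω M]

variable (m M) in
/-- The complex vector space of holomorphic vector fields `Ξ = X - i J X` on `M`, each given by the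
holomorphic section `X` of the tangent bundle (`C^ω` over `ℂ` means holomorphic). -/
abbrev HolVectorField : Type _ :=
  ContMDiffSection 𝓘(ℂ, CSpace m) (CSpace m) ω (TangentSpace 𝓘(ℂ, CSpace m) : M → Type _)

/-- `ζ` is a complex valued Hamiltonian of `Ξ`: it is smooth and `- ∂̄ζ = (1/2) ω(Ξ, -)`. -/
def KahlerForm.IsHamiltonian (κ : KahlerForm m M) (Ξ : HolVectorField m M) (ζ : M → ℂ) : Prop :=
  ContMDiff 𝓘(ℝ, CSpace m) 𝓘(ℝ, ℂ) ∞ ζ ∧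
    ∀ (x : M) (u : TangentSpace 𝓘(ℝ, CSpace m) x),
      - dbar ζ x u = (1 / 2) * κ.contract x (toReal x (Ξ x)) u

theorem KahlerForm.isHamiltonian_zero (κ : KahlerForm m M) :
    ∃ ζ : M → ℂ, κ.IsHamiltonian 0 ζ := by
  refine ⟨fun _ => 0, contMDiff_const, fun x u => ?_⟩
  have h := κ.contract_smul x 0 0 u
  rw [zero_smul, zero_mul] at h
  have h0 : toReal x ((0 : HolVectorField m M) x) = toReal x 0 := rfl
  rw [h0, h]
  have hd (u : TangentSpace 𝓘(ℝ, CSpace m) x) : diff (fun _ : M => (0 : ℂ)) x u = 0 := by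
    rw [diff, mfderiv_const]
    rfl
  simp [dbar, hd]

theorem KahlerForm.IsHamiltonian.add {κ : KahlerForm m M} {Ξ Ξ' : HolVectorField m M}
    {ζ ζ' : M → ℂ} (h : κ.IsHamiltonian Ξ ζ) (h' : κ.IsHamiltonian Ξ' ζ') :
    κ.IsHamiltonian (Ξ + Ξ') (ζ + ζ') := by
  refine ⟨h.1.add h'.1, fun x u => ?_⟩
  have hd (u : TangentSpace 𝓘(ℝ, CSpace m) x) : diff (ζ + ζ') x u = diff ζ x u + diff ζ' x u := by
    have := mfderiv_add (I := 𝓘(ℝ, CSpace m)) (h.1.mdifferentiable (by simp) x)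
      (h'.1.mdifferentiable (by simp) x)
    exact congrArg (fun L => L u) this
  have h0 : toReal x ((Ξ + Ξ') x) = toReal x (Ξ x) + toReal x (Ξ' x) := rfl
  have h1 := h.2 x u
  have h2 := h'.2 x u
  rw [h0, κ.contract_add, mul_add, ← h1, ← h2]
  simp only [dbar, hd]
  ring

theorem KahlerForm.IsHamiltonian.smul {κ : KahlerForm m M} {Ξ : HolVectorField m M}
    {ζ : M → ℂ} (h : κ.IsHamiltonian Ξ ζ) (c : ℂ) :
    κ.IsHamiltonian (c • Ξ) (fun x => c * ζ x) := by
  have hc : ContMDiff 𝓘(ℝ, ℂ) 𝓘(ℝ, ℂ) ∞ (fun z : ℂ => c * z) :=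
    (contDiff_const.mul contDiff_id).contMDiff
  refine ⟨hc.comp h.1, fun x u => ?_⟩
  have hd (u : TangentSpace 𝓘(ℝ, CSpace m) x) :
      diff (fun x => c * ζ x) x u = c * diff ζ x u := by
    have h1 : HasMFDerivAt 𝓘(ℝ, ℂ) 𝓘(ℝ, ℂ) (fun z : ℂ => c * z) (ζ x)
        (ContinuousLinearMap.mul ℝ ℂ c) :=
      (ContinuousLinearMap.mul ℝ ℂ c).hasFDerivAt.hasMFDerivAt
    have h2 := h1.comp x (h.1.mdifferentiable (by simp) x).hasMFDerivAt
    exact congrArg (fun L => L u) h2.mfderiv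
  have h0 : toReal x ((c • Ξ) x) = toReal x (c • (Ξ x)) := rfl
  have h1 := h.2 x u
  rw [h0, κ.contract_smul]
  simp only [dbar, hd] at h1 ⊢
  linear_combination c * h1

/-- The space `𝔥` of Hamiltonian holomorphic vector fields. -/
def KahlerForm.ham (κ : KahlerForm m M) : Submodule ℂ (HolVectorField m M) where
  carrier := {Ξ | ∃ ζ : M → ℂ, κ.IsHamiltonian Ξ ζ}
  zero_mem' := κ.isHamiltonian_zero
  add_mem' := by
    rintro Ξ Ξ' ⟨ζ, h⟩ ⟨ζ', h'⟩
    exact ⟨_, h.add h'⟩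
  smul_mem' := by
    rintro c Ξ ⟨ζ, h⟩
    exact ⟨_, h.smul c⟩

/-- `ξ : M → 𝔥^*` is the moment map of `κ`: for each `Ξ ∈ 𝔥` the function `⟨ξ, Ξ⟩` is the
Hamiltonian of `Ξ` whose integral over `M` is zero. -/
def KahlerForm.IsMomentMap [MeasurableSpace M] (κ : KahlerForm m M)
    (ξ : M → Module.Dual ℂ κ.ham) : Prop :=
  ∀ Ξ : κ.ham, κ.IsHamiltonian Ξ (fun x => ξ x Ξ) ∧ ∫ x, ξ x Ξ ∂κ.vol = 0

/-- The genericity condition: `ξ(p_1), …, ξ(p_n)` span `𝔥^*`. -/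
def KahlerForm.Generic {n : ℕ} (κ : KahlerForm m M) (ξ : M → Module.Dual ℂ κ.ham)
    (p : Fin n → M) : Prop :=
  Submodule.span ℂ (Set.range fun j => ξ (p j)) = ⊤

/-- The balancing condition: `∑_j a_j^{m-1} ξ(p_j) = 0`. -/
def KahlerForm.Balanced {n : ℕ} (κ : KahlerForm m M) (ξ : M → Module.Dual ℂ κ.ham)
    (p : Fin n → M) (a : Fin n → ℝ) : Prop :=
  ∑ j, ((a j ^ (m - 1) : ℝ) : ℂ) • ξ (p j) = 0

/-- The general position condition: no nonzero element of `𝔥` vanishes at all of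
`p_1, …, p_n`. -/
def KahlerForm.GeneralPosition {n : ℕ} (κ : KahlerForm m M) (p : Fin n → M) : Prop :=
  ∀ Ξ ∈ κ.ham, (∀ j, Ξ (p j) = 0) → Ξ = 0

/-- The points `p_1, …, p_n` and the weights `a_1, …, a_n` satisfy the genericity, balancing and
general position conditions with respect to the Kähler form `κ` and its moment map. -/
def KahlerForm.Admissible [MeasurableSpace M] {n : ℕ} (κ : KahlerForm m M) (p : Fin n → M)
    (a : Fin n → ℝ) : Prop :=
  ∃ ξ : M → Module.Dual ℂ κ.ham, κ.IsMomentMap ξ ∧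
    κ.Generic ξ p ∧ κ.Balanced ξ p a ∧ κ.GeneralPosition p

end Hamiltonian

end KahlerBlowup

end

noncomputable section

namespace KahlerBlowup

/-! ### Holomorphic functions of several variables: Cauchy's formula and Osgood's lemma. -/

section SeveralVariables

open Metric MeasureTheory Complex

variable {F : Type*} [NormedAddCommGroup F] [NormedSpace ℂ F]

/-! Let κ₀ be a Kähler form of the class with the prescribed constant scalar curvature for which a
configuration (p⁰, a⁰) satisfies the three conditions. For a nearby configuration (p, a) the new
Kähler form is sought among the pull-backs φ^*κ₀ by automorphisms φ of M. Such a form has the same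
scalar curvature (`KahlerForm.scal_pullback`), and its moment map is ξ ∘ φ after the induced
identification of the Hamiltonian fields, the normalisation being kept by the invariance of the
volume (`map_vol`). So (p, a) is admissible for φ^*κ₀ as soon as (φ(p), a) satisfies the three
conditions for κ₀ (`admissible_pullback`). Genericity and general position are linear independence
conditions, hence open (`eventually_generic`, `eventually_generalPosition`), and they survive when φ
is close to the identity. Only the balancing condition has to be restored by the choice of φ.

The automorphisms come from 𝔥, which is finite-dimensional because finitely many values of ξ span
its dual. As the scalar curvature is constant, an integrated Bochner formula (`dbarSq_cgrad`,
`KahlerForm.integral_dbarNorm`) shows that the complex conjugate of a holomorphy potential is a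
holomorphy potential (`KahlerForm.IsHamiltonian.exists_conj`); this is the argument of Matsushima
and Lichnerowicz. Hence 𝔥 has a complex basis Z_1, …, Z_d with real potentials u_k
(`KahlerForm.IsMomentMap.exists_real_basis`), and balancing becomes a system of d real equations.
For real t put Z_t = ∑ t_k Z_k and u_t = ∑ t_k u_k. The field -iZ_t is the Riemannian gradient of
u_t. Its flow is holomorphic, and it preserves the Kähler class because the form changes by the
exterior derivative of -dv ∘ J, with v the average of u_t along the flow
(`KahlerForm.IsHamiltonian.sameClass_pullback_flow`).

Let φ_t be the time one map of this flow and F_k(p, a, t) = ∑_j a_j^{m-1} u_k(φ_t(p_j)). The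
derivative of F at (p⁰, a⁰, 0) in the direction t, paired with t, equals ∑_j a_j^{m-1} |∇u_t|²(p_j).
If it is zero, then Z_t vanishes at all the points, and general position gives t = 0. Thus the
partial derivative is invertible and the implicit function theorem yields a small t(p, a) with F = 0
(`exists_balancing_flow`). The required regularity of the flow in the point and in t comes from
solving Picard's equation by the analytic implicit function theorem (`exists_analytic_local_flow`).
-/

theorem differentiableAt_finCons {m : ℕ} (z : ℂ × (Fin m → ℂ)) :
    DifferentiableAt ℂ (fun p : ℂ × (Fin m → ℂ) => (Fin.cons p.1 p.2 : Fin (m + 1) → ℂ)) z := by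
  rw [differentiableAt_pi]
  intro i
  refine Fin.cases ?_ (fun j => ?_) i
  · simp only [Fin.cons_zero]; fun_prop
  · simp only [Fin.cons_succ]; fun_prop

/-- Cauchy's integral formula on a polydisc. -/
theorem torusIntegral_cauchy [CompleteSpace F] {m : ℕ} {f : (Fin m → ℂ) → F} {c : Fin m → ℂ} {R : ℝ}
    (hR : 0 < R) (hf : ∀ z ∈ closedBall c R, DifferentiableAt ℂ f z) {w : Fin m → ℂ}
    (hw : w ∈ ball c R) :
    (∯ z in T(c, fun _ => R), (∏ i, (z i - w i)⁻¹) • f z) = (2 * Real.pi * I : ℂ) ^ m • f w := by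
  induction m with
  | zero =>
    rw [torusIntegral_dim0]
    simp only [Finset.univ_eq_empty, Finset.prod_empty, one_smul, pow_zero]
    congr 1
    exact Subsingleton.elim _ _
  | succ m ih =>
    have hwi : ∀ i, w i ∈ ball (c i) R := by
      intro i
      rw [mem_ball, dist_pi_lt_iff hR] at hw
      exact hw i
    have hint : TorusIntegrable (fun z => (∏ i, (z i - w i)⁻¹) • f z) c (fun _ => R) := by
      refine ContinuousOn.integrableOn_compact isCompact_Icc (Continuous.continuousOn ?_)
      have hT : Continuous (torusMap c fun _ => R) := by
        unfold torusMap
        fun_prop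
      rw [continuous_iff_continuousAt]
      intro θ
      have hd : ∀ i, dist (torusMap c (fun _ => R) θ i) (c i) = R := by
        intro i
        simp [torusMap, Complex.norm_exp, abs_of_pos hR]
      refine ContinuousAt.smul (f := fun θ => ∏ i, (torusMap c (fun _ => R) θ i - w i)⁻¹) ?_ ?_
      · refine tendsto_finsetProd _ fun i _ => ?_
        refine ContinuousAt.inv₀ (f := fun θ => torusMap c (fun _ => R) θ i - w i) ?_ ?_
        · exact (((continuous_apply i).comp hT).sub continuous_const).continuousAt
        · intro h
          have h1 := hwi i
          rw [← sub_eq_zero.1 h, mem_ball, hd i] at h1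
          exact lt_irrefl _ h1
      · refine ContinuousAt.comp (hf _ ?_).continuousAt hT.continuousAt
        rw [mem_closedBall, dist_pi_le_iff hR.le]
        exact fun i => (hd i).le
    rw [torusIntegral_succ hint]
    -- For fixed first coordinate the inner integral runs over the remaining circles and is
    -- evaluated by induction; what is left is the one-variable Cauchy formula in the first
    -- coordinate.
    have key : ∀ x ∈ sphere (c 0) R,
        (∯ y in T(c ∘ Fin.succ, (fun _ => R) ∘ Fin.succ),
          (∏ i, ((Fin.cons x y : Fin (m + 1) → ℂ) i - w i)⁻¹) • f (Fin.cons x y)) =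
        (2 * Real.pi * I : ℂ) ^ m • ((x - w 0)⁻¹ • f (Fin.cons x (fun i => w i.succ))) := by
      intro x hx
      have h1 := ih (f := fun y => f (Fin.cons x y)) (c := c ∘ Fin.succ) (w := fun i => w i.succ)
        ?_ ?_
      · have h2 : ∀ y : Fin m → ℂ,
            (∏ i, ((Fin.cons x y : Fin (m + 1) → ℂ) i - w i)⁻¹) • f (Fin.cons x y)
              = (x - w 0)⁻¹ • ((∏ i, (y i - w i.succ)⁻¹) • f (Fin.cons x y)) := by
          intro y
          rw [Fin.prod_univ_succ, mul_smul]
          simp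
        simp only [h2]
        rw [torusIntegral_smul]
        erw [h1]
        rw [smul_comm]
      · intro z hz
        refine DifferentiableAt.comp z (hf _ ?_) ?_
        · rw [mem_closedBall, dist_pi_le_iff hR.le]
          rw [mem_closedBall, dist_pi_le_iff hR.le] at hz
          intro i
          refine Fin.cases ?_ (fun j => ?_) i
          · simpa using (mem_sphere.1 hx).le
          · simpa using hz j
        · exact (differentiableAt_finCons (x, z)).comp z (by fun_prop)
      · rw [mem_ball, dist_pi_lt_iff hR]
        exact fun i => hwi i.succ
    rw [circleIntegral.integral_congr hR.le key, circleIntegral.integral_smul]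
    have hcau := circleIntegral_sub_inv_smul_of_differentiable_on_off_countable (R := R) (c := c 0)
      (w := w 0) (f := fun x => f (Fin.cons x (fun i => w i.succ))) Set.countable_empty (hwi 0) ?_ ?_
    · rw [hcau, smul_smul, ← pow_succ]
      congr 2
      exact Fin.cons_self_tail w
    all_goals
      have hdiff : ∀ x ∈ closedBall (c 0) R,
          DifferentiableAt ℂ (fun x => f (Fin.cons x (fun i => w i.succ))) x := by
        intro x hx
        refine DifferentiableAt.comp x (hf _ ?_) ?_
        · rw [mem_closedBall, dist_pi_le_iff hR.le]
          intro i
          refine Fin.cases ?_ (fun j => ?_) i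
          · simpa using hx
          · simpa using (hwi j.succ).le
        · exact DifferentiableAt.comp (f := fun x : ℂ => (x, fun i : Fin m => w i.succ)) x
            (differentiableAt_finCons _) (by fun_prop)
    · exact fun x hx => (hdiff x hx).continuousAt.continuousWithinAt
    · exact fun x hx => hdiff x (ball_subset_closedBall hx.1)

/-- Osgood's lemma: a complex differentiable function of several variables is analytic. -/
theorem analyticAt_of_eventually_differentiableAt [CompleteSpace F] {m : ℕ}
    {f : (Fin m → ℂ) → F} {c : Fin m → ℂ} (hf : ∀ᶠ z in nhds c, DifferentiableAt ℂ f z) :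
    AnalyticAt ℂ f c := by
  obtain ⟨R, hR, hball⟩ := Metric.nhds_basis_closedBall.eventually_iff.1 hf
  let K : Set (Fin m → ℝ) := Set.Icc 0 fun _ => 2 * Real.pi
  have : CompactSpace K := isCompact_iff_compactSpace.1 isCompact_Icc
  have hT : Continuous (torusMap c fun _ => R) := by
    unfold torusMap
    fun_prop
  have hd : ∀ θ i, dist (torusMap c (fun _ => R) θ i) (c i) = R := by
    intro θ i
    simp [torusMap, Complex.norm_exp, abs_of_pos hR]
  let Z : Fin m → C(K, ℂ) := fun i =>
    ⟨fun θ => torusMap c (fun _ => R) θ.1 i, (continuous_apply i).comp (hT.comp continuous_subtype_val)⟩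
  -- The Cauchy kernel as an element of the Banach algebra of continuous functions on the torus of
  -- angles. It is analytic in w because inversion is analytic on the units.
  let ker : (Fin m → ℂ) → C(K, ℂ) := fun w => ∏ i, Ring.inverse (Z i - algebraMap ℂ C(K, ℂ) (w i))
  have hunit : ∀ w ∈ ball c R, ∀ i, IsUnit (Z i - algebraMap ℂ C(K, ℂ) (w i)) := by
    intro w hw i
    rw [ContinuousMap.isUnit_iff_forall_ne_zero]
    intro θ h
    have h0 : torusMap c (fun _ => R) θ.1 i - w i = 0 := h
    rw [mem_ball, dist_pi_lt_iff hR] at hw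
    have h1 := hw i
    rw [← sub_eq_zero.1 h0, hd] at h1
    exact lt_irrefl _ h1
  have hker : AnalyticAt ℂ ker c := by
    refine Finset.analyticAt_fun_prod _ fun i _ => ?_
    obtain ⟨u, hu⟩ := hunit c (mem_ball_self hR) i
    have h1 : AnalyticAt ℂ Ring.inverse (Z i - algebraMap ℂ C(K, ℂ) (c i)) := by
      rw [← hu]
      exact analyticAt_inverse u
    refine AnalyticAt.fun_comp h1 (analyticAt_const.sub ?_)
    have h2 : AnalyticAt ℂ (fun w : Fin m → ℂ => ((Algebra.linearMap ℂ C(K, ℂ)).mkContinuous ‖(1 : C(K, ℂ))‖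
      (fun a => by rw [Algebra.linearMap_apply, Algebra.algebraMap_eq_smul_one, norm_smul, mul_comm]) ∘L
      (ContinuousLinearMap.proj (R := ℂ) (φ := fun _ : Fin m => ℂ) i)) w) c := ContinuousLinearMap.analyticAt _ _
    exact h2
  let g : (Fin m → ℝ) → F := fun θ => (∏ i, R * exp (θ i * I) * I : ℂ) • f (torusMap c (fun _ => R) θ)
  have hg : Continuous g := by
    refine Continuous.smul (by fun_prop) ?_
    rw [continuous_iff_continuousAt]
    intro θ
    refine ContinuousAt.comp (hball ?_).continuousAt hT.continuousAt
    rw [mem_closedBall, dist_pi_le_iff hR.le]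
    exact fun i => (hd θ i).le
  have hint : ∀ k : C(K, ℂ), Integrable (fun θ : K => k θ • g θ.1) (volume.comap Subtype.val) := by
    intro k
    have hc : Continuous (fun θ : K => k θ • g θ.1) :=
      k.continuous.smul (hg.comp continuous_subtype_val)
    have : IsFiniteMeasure (Measure.comap (Subtype.val : K → Fin m → ℝ) volume) := by
      refine ⟨?_⟩
      rw [comap_subtype_coe_apply (measurableSet_Icc) _ _, Set.image_univ, Subtype.range_coe]
      exact measure_Icc_lt_top
    exact hc.integrable_of_hasCompactSupport (HasCompactSupport.of_compactSpace _)
  let Llin : C(K, ℂ) →ₗ[ℂ] F :=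
    { toFun := fun k => ∫ θ : K, k θ • g θ.1 ∂(volume.comap Subtype.val)
      map_add' := fun k l => by
        rw [← integral_add (hint k) (hint l)]
        simp [add_smul]
      map_smul' := fun a k => by
        rw [RingHom.id_apply, ← integral_smul]
        simp [smul_smul] }
  -- Integration against f is a continuous linear map, so Cauchy's formula writes f as a linear map
  -- composed with the analytic kernel; no series has to be differentiated.
  let L : C(K, ℂ) →L[ℂ] F := Llin.mkContinuous
    (∫ θ : K, ‖g θ.1‖ ∂(volume.comap Subtype.val)) (fun k => by
      have h1 : Integrable (fun θ : K => ‖g θ.1‖) (volume.comap Subtype.val) := by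
        simpa using (hint 1).norm
      calc ‖Llin k‖ ≤ ∫ θ : K, ‖k‖ * ‖g θ.1‖ ∂(volume.comap Subtype.val) := by
            refine norm_integral_le_of_norm_le (h1.const_mul _) (Filter.Eventually.of_forall ?_)
            intro θ
            rw [norm_smul]
            gcongr
            exact k.norm_coe_le_norm θ
        _ = _ := by rw [integral_const_mul, mul_comm])
  have hrep : ∀ᶠ w in nhds c, f w = ((2 * Real.pi * I : ℂ) ^ m)⁻¹ • L (ker w) := by
    filter_upwards [ball_mem_nhds c hR] with w hw
    have h1 := torusIntegral_cauchy hR (fun z hz => hball hz) hw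
    rw [eq_inv_smul_iff₀ (by simp [Real.pi_ne_zero]), ← h1]
    change _ = ∫ θ : K, ker w θ • g θ.1 ∂(volume.comap Subtype.val)
    have h2 : ∀ θ : K, ker w θ • g θ.1 = (fun θ : Fin m → ℝ => (∏ i, R * exp (θ i * I) * I : ℂ) •
        ((∏ i, (torusMap c (fun _ => R) θ i - w i)⁻¹) • f (torusMap c (fun _ => R) θ))) θ.1 := by
      intro θ
      have h3 : ker w θ = ∏ i, (torusMap c (fun _ => R) θ.1 i - w i)⁻¹ := by
        change (∏ i, Ring.inverse (Z i - algebraMap ℂ C(K, ℂ) (w i))) θ = _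
        rw [ContinuousMap.prod_apply]
        refine Finset.prod_congr rfl fun i _ => ?_
        refine eq_inv_of_mul_eq_one_left ?_
        have h4 := Ring.inverse_mul_cancel _ (hunit w hw i)
        exact congrArg (fun k : C(K, ℂ) => k θ) h4
      rw [h3, smul_comm]
    simp only [h2]
    rw [integral_subtype_comap measurableSet_Icc (fun θ : Fin m → ℝ => (∏ i, R * exp (θ i * I) * I : ℂ) •
        ((∏ i, (torusMap c (fun _ => R) θ i - w i)⁻¹) • f (torusMap c (fun _ => R) θ)))]
    rfl
  refine AnalyticAt.congr ?_ (hrep.mono fun _ h => h.symm)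
  exact AnalyticAt.const_smul ((L.analyticAt _).comp hker)

end SeveralVariables

end KahlerBlowup

end

noncomputable section

namespace KahlerBlowup

/-! ### Analytic dependence of local flows on parameters and initial values. -/

section LocalFlow

open Metric MeasureTheory Topology

variable {E F : Type*} [NormedAddCommGroup E] [NormedSpace ℂ E] [NormedAddCommGroup F]
  [NormedSpace ℂ F]

/-- The pointwise application of a multilinear map to continuous functions. -/
def liftMultilinear (K : Type*) [TopologicalSpace K] [CompactSpace K] {n : ℕ}
    (p : E [×n]→L[ℂ] F) : C(K, E) [×n]→L[ℂ] C(K, F) :=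
  MultilinearMap.mkContinuous
    { toFun := fun η => ⟨fun s => p fun i => η i s, by fun_prop⟩
      map_update_add' := by
        intro _ η i a b
        ext s
        simp only [ContinuousMap.coe_mk, ContinuousMap.add_apply]
        have e : ∀ c : C(K, E), (fun j => (@Function.update _ (fun _ => C(K, E)) _ η i c j) s)
            = Function.update (fun j => η j s) i (c s) := by
          intro c
          funext j
          by_cases hj : j = i
          · subst hj; simp
          · simp [Function.update_of_ne hj]
        rw [e, e, e, ContinuousMap.add_apply]
        exact p.map_update_add _ _ _ _
      map_update_smul' := by
        intro _ η i a b
        ext s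
        have e : ∀ c : C(K, E), (fun j => (@Function.update _ (fun _ => C(K, E)) _ η i c j) s)
            = Function.update (fun j => η j s) i (c s) := by
          intro c
          funext j
          by_cases hj : j = i
          · subst hj; simp
          · simp [Function.update_of_ne hj]
        simp only [ContinuousMap.coe_mk, ContinuousMap.smul_apply]
        rw [e, e, ContinuousMap.smul_apply]
        exact p.map_update_smul _ _ _ _ }
    ‖p‖ (by
      intro η
      rw [ContinuousMap.norm_le _ (by positivity)]
      intro s
      refine (p.le_opNorm _).trans ?_
      gcongr with i
      exact (η i).norm_coe_le_norm s)

theorem norm_liftMultilinear_le (K : Type*) [TopologicalSpace K] [CompactSpace K] {n : ℕ}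
    (p : E [×n]→L[ℂ] F) : ‖liftMultilinear K p‖ ≤ ‖p‖ :=
  MultilinearMap.mkContinuous_norm_le _ (norm_nonneg _) _

/-- Composition with an analytic function is an analytic map between spaces of continuous functions
on a compact space, near a constant function. -/
theorem exists_analyticAt_superposition [CompleteSpace F] (K : Type*) [TopologicalSpace K]
    [CompactSpace K] {f : E → F} {x₀ : E} (hf : AnalyticAt ℂ f x₀) :
    ∃ N : C(K, E) → C(K, F), AnalyticAt ℂ N (ContinuousMap.const K x₀) ∧
      ∀ᶠ γ in 𝓝 (ContinuousMap.const K x₀), ∀ s, N γ s = f (γ s) := by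
  obtain ⟨p, r, hp⟩ := hf
  -- The Taylor series of f applied pointwise; the coefficients do not grow in norm, so its radius
  -- is at least that of f.
  let q : FormalMultilinearSeries ℂ C(K, E) C(K, F) := fun n => liftMultilinear K (p n)
  have hrad : p.radius ≤ q.radius := by
    refine ENNReal.le_of_forall_nnreal_lt fun r hr => ?_
    obtain ⟨C, -, hC⟩ := p.norm_mul_pow_le_of_lt_radius hr
    refine q.le_radius_of_bound C fun n => le_trans ?_ (hC n)
    gcongr
    exact norm_liftMultilinear_le K (p n)
  have hpos : 0 < q.radius := (hp.r_pos.trans_le hp.r_le).trans_le hrad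
  have hq := q.hasFPowerSeriesOnBall hpos
  refine ⟨fun γ => q.sum (γ - ContinuousMap.const K x₀), ?_, ?_⟩
  · have h1 : AnalyticAt ℂ q.sum (ContinuousMap.const K x₀ - ContinuousMap.const K x₀) := by
      rw [sub_self]; exact hq.analyticAt
    exact AnalyticAt.fun_comp h1 (analyticAt_id.sub analyticAt_const)
  · have hball : Metric.eball (ContinuousMap.const K x₀) r ∈ 𝓝 (ContinuousMap.const K x₀) :=
      Metric.eball_mem_nhds _ hp.r_pos
    filter_upwards [hball] with γ hγ s
    have hη : γ - ContinuousMap.const K x₀ ∈ Metric.eball (0 : C(K, E)) r := by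
      rw [Metric.mem_eball, edist_zero_right]
      rwa [Metric.mem_eball, edist_eq_enorm_sub] at hγ
    have hs : γ s - x₀ ∈ Metric.eball (0 : E) r := by
      rw [Metric.mem_eball, edist_zero_right] at hη ⊢
      refine lt_of_le_of_lt ?_ hη
      rw [enorm_le_iff_norm_le]
      exact (γ - ContinuousMap.const K x₀).norm_coe_le_norm s
    have h1 := hq.hasSum (y := γ - ContinuousMap.const K x₀)
      (Metric.eball_subset_eball (hp.r_le.trans hrad) hη)
    have h2 := h1.mapL (ContinuousMap.evalCLM ℂ s)
    have h3 := hp.hasSum hs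
    rw [add_sub_cancel] at h3
    rw [zero_add] at h1 h2
    exact h2.unique h3

/-- The primitive vanishing at `0` of a continuous function on `[-2, 2]`. -/
def primitiveCLM (E : Type*) [NormedAddCommGroup E] [NormedSpace ℂ E] :
    C(Set.Icc (-2 : ℝ) 2, E) →L[ℂ] C(Set.Icc (-2 : ℝ) 2, E) :=
  LinearMap.mkContinuous
    { toFun := fun η => ⟨fun s => ∫ τ in (0 : ℝ)..s, η (Set.projIcc (-2) 2 (by norm_num) τ), by
        have hc : Continuous fun τ : ℝ => η (Set.projIcc (-2 : ℝ) 2 (by norm_num) τ) :=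
          η.continuous.comp continuous_projIcc
        exact (intervalIntegral.continuous_primitive
          (fun a b => hc.intervalIntegrable a b) 0).comp continuous_subtype_val⟩
      map_add' := fun η η' => by
        ext s
        have hc (η : C(Set.Icc (-2 : ℝ) 2, E)) :
            Continuous fun τ : ℝ => η (Set.projIcc (-2 : ℝ) 2 (by norm_num) τ) :=
          η.continuous.comp continuous_projIcc
        exact intervalIntegral.integral_add ((hc η).intervalIntegrable _ _)
          ((hc η').intervalIntegrable _ _)
      map_smul' := fun c η => by
        ext s
        exact intervalIntegral.integral_smul c _ }
    2 (fun η => by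
      rw [ContinuousMap.norm_le _ (by positivity)]
      intro s
      refine (intervalIntegral.norm_integral_le_of_norm_le_const
        (C := ‖η‖) (fun τ _ => η.norm_coe_le_norm _)).trans ?_
      rw [mul_comm, sub_zero]
      gcongr
      exact abs_le.2 s.2)

theorem hasDerivAt_of_eq_add_primitive [CompleteSpace E] (η : C(Set.Icc (-2 : ℝ) 2, E)) (s : ℝ)
    (hs : s ∈ Set.Ioo (-2 : ℝ) 2) :
    HasDerivAt (fun s => primitiveCLM E η (Set.projIcc (-2) 2 (by norm_num) s))
      (η ⟨s, Set.Ioo_subset_Icc_self hs⟩) s := by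
  have hc : Continuous fun τ : ℝ => η (Set.projIcc (-2 : ℝ) 2 (by norm_num) τ) :=
    η.continuous.comp continuous_projIcc
  have h1 := intervalIntegral.integral_hasDerivAt_right (hc.intervalIntegrable 0 s)
    (hc.stronglyMeasurableAtFilter _ _) hc.continuousAt
  rw [Set.projIcc_of_mem _ (Set.Ioo_subset_Icc_self hs)] at h1
  refine h1.congr_of_eventuallyEq ?_
  filter_upwards [Ioo_mem_nhds hs.1 hs.2] with τ hτ
  rw [Set.projIcc_of_mem _ (Set.Ioo_subset_Icc_self hτ)]
  rfl

/-- The flow of a finite-dimensional family of analytic vector fields is analytic in the parameter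
and in the initial value. -/
theorem exists_analytic_local_flow [CompleteSpace E] {d : ℕ} (X : Fin d → E → E) (z₀ : E)
    (hX : ∀ k, AnalyticAt ℂ (X k) z₀) {V : Set E} (hV : V ∈ 𝓝 z₀) :
    ∃ Ψ : (Fin d → ℂ) × E → E, AnalyticAt ℂ Ψ (0, z₀) ∧
      ∀ᶠ p in 𝓝 ((0 : Fin d → ℂ), z₀), ∃ γ : ℝ → E, γ 0 = p.2 ∧ γ 1 = Ψ p ∧
        ∀ s ∈ Set.Ioo (-2 : ℝ) 2, γ s ∈ V ∧ HasDerivAt γ (∑ k, p.1 k • X k (γ s)) s := by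
  -- The interval is fixed and contains time 1 in its interior; small parameters take over the role
  -- of a short time.
  let K := Set.Icc (-2 : ℝ) 2
  choose N hN hNe using fun k => exists_analyticAt_superposition K (hX k)
  let cst : E →L[ℂ] C(K, E) := LinearMap.mkContinuous
    { toFun := fun z => ContinuousMap.const K z
      map_add' := fun _ _ => rfl
      map_smul' := fun _ _ => rfl } 1 (fun z => by
        rw [ContinuousMap.norm_le _ (by positivity)]
        intro s
        rw [one_mul]
        exact le_rfl)
  -- Picard's integral equation G = 0 for the curve, with the vector fields replaced by their
  -- superposition operators.
  let G : ((Fin d → ℂ) × E) × C(K, E) → C(K, E) := fun u =>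
    u.2 - cst u.1.2 - ∑ k, u.1.1 k • primitiveCLM E (N k u.2)
  let u₀ : ((Fin d → ℂ) × E) × C(K, E) := ((0, z₀), ContinuousMap.const K z₀)
  have hG : ContDiffAt ℂ ω G u₀ := by
    have hNk : ∀ k, ContDiffAt ℂ ω (fun u : ((Fin d → ℂ) × E) × C(K, E) => N k u.2) u₀ := fun k =>
      ((hN k).contDiffAt).comp u₀ contDiffAt_snd
    have h1 : ContDiffAt ℂ ω (fun u : ((Fin d → ℂ) × E) × C(K, E) =>
        ∑ k, u.1.1 k • primitiveCLM E (N k u.2)) u₀ := by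
      refine ContDiffAt.sum fun k _ => ContDiffAt.fun_smul ?_ ?_
      · fun_prop
      · exact (primitiveCLM E).contDiff.contDiffAt.comp u₀ (hNk k)
    refine ContDiffAt.sub (ContDiffAt.sub contDiffAt_snd ?_) h1
    exact cst.contDiff.contDiffAt.comp u₀ (by fun_prop)
  -- At parameter zero the integral term is absent, so G is the identity in the curve up to a
  -- constant and the implicit function theorem applies.
  have hinr : fderiv ℂ G u₀ ∘L .inr ℂ ((Fin d → ℂ) × E) C(K, E) = ContinuousLinearMap.id ℂ _ := by
    have h1 : HasFDerivAt (fun γ : C(K, E) => G (((0 : Fin d → ℂ), z₀), γ))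
        (fderiv ℂ G u₀ ∘L .inr ℂ ((Fin d → ℂ) × E) C(K, E)) (ContinuousMap.const K z₀) := by
      have hd : HasFDerivAt G (fderiv ℂ G u₀) u₀ :=
        (hG.differentiableAt (by simp)).hasFDerivAt
      exact HasFDerivAt.comp (ContinuousMap.const K z₀) hd
        (hasFDerivAt_prodMk_right ((0 : Fin d → ℂ), z₀) (ContinuousMap.const K z₀))
    have h2 : HasFDerivAt (fun γ : C(K, E) => G (((0 : Fin d → ℂ), z₀), γ))
        (ContinuousLinearMap.id ℂ _) (ContinuousMap.const K z₀) := by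
      have : (fun γ : C(K, E) => G (((0 : Fin d → ℂ), z₀), γ)) = fun γ => γ - cst z₀ := by
        funext γ
        simp [G]
      rw [this]
      exact (hasFDerivAt_id _).sub_const _
    exact h1.unique h2
  have hinv : (fderiv ℂ G u₀ ∘L .inr ℂ ((Fin d → ℂ) × E) C(K, E)).IsInvertible := by
    rw [hinr]
    exact ⟨ContinuousLinearEquiv.refl ℂ _, rfl⟩
  let ψ := hG.implicitFunction (by simp) hinv
  have hψ : ContDiffAt ℂ ω ψ ((0 : Fin d → ℂ), z₀) :=
    hG.contDiffAt_implicitFunction (by simp) hinv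
  have hψ0 : ψ ((0 : Fin d → ℂ), z₀) = ContinuousMap.const K z₀ :=
    hG.implicitFunction_apply_self (by simp) hinv
  have hψe : ∀ᶠ p in 𝓝 ((0 : Fin d → ℂ), z₀), G (p, ψ p) = G u₀ :=
    hG.eventually_apply_implicitFunction (by simp) hinv
  have hG0 : G u₀ = 0 := by
    have : cst z₀ = ContinuousMap.const K z₀ := rfl
    simp [G, u₀, this]
  refine ⟨fun p => ψ p ⟨1, by norm_num, by norm_num⟩, ?_, ?_⟩
  · have h1 : ContDiffAt ℂ ω (fun p => ContinuousMap.evalCLM (M := E) ℂ (⟨1, by norm_num, by norm_num⟩ : K) (ψ p))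
        ((0 : Fin d → ℂ), z₀) :=
      (ContinuousLinearMap.contDiff _).contDiffAt.comp _ hψ
    exact h1.analyticAt
  · have hcont : Filter.Tendsto ψ (𝓝 ((0 : Fin d → ℂ), z₀)) (𝓝 (ContinuousMap.const K z₀)) := by
      rw [← hψ0]
      exact hψ.continuousAt
    obtain ⟨ε, hε, hεV⟩ := Metric.mem_nhds_iff.1 hV
    have hnear : ∀ᶠ γ in 𝓝 (ContinuousMap.const K z₀), ∀ s, γ s ∈ V := by
      filter_upwards [Metric.ball_mem_nhds (ContinuousMap.const K z₀) hε] with γ hγ s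
      exact hεV (lt_of_le_of_lt (ContinuousMap.dist_apply_le_dist s) hγ)
    filter_upwards [hψe, hcont.eventually hnear,
      hcont.eventually (Filter.eventually_all.2 hNe)] with p hp hpV hpN
    have hproj (s : ℝ) (hs : s ∈ Set.Icc (-2 : ℝ) 2) :
        Set.projIcc (-2 : ℝ) 2 (by norm_num) s = ⟨s, hs⟩ := Set.projIcc_of_mem _ hs
    have heq : ψ p = cst p.2 + ∑ k, p.1 k • primitiveCLM E (N k (ψ p)) := by
      rw [hG0] at hp
      have : ψ p - cst p.2 - ∑ k, p.1 k • primitiveCLM E (N k (ψ p)) = 0 := hp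
      rw [sub_sub, sub_eq_zero] at this
      exact this
    have heqs (s : K) : ψ p s = p.2 + ∑ k, p.1 k • primitiveCLM E (N k (ψ p)) s := by
      have := congrArg (fun γ : C(K, E) => ContinuousMap.evalCLM (M := E) ℂ s γ) heq
      simp only [map_add, map_sum, map_smul] at this
      exact this
    refine ⟨fun s => ψ p (Set.projIcc (-2) 2 (by norm_num) s), ?_, ?_, ?_⟩
    · simp only []
      rw [hproj 0 (by norm_num), heqs]
      have : ∀ k, primitiveCLM E (N k (ψ p)) ⟨0, by norm_num⟩ = 0 := fun k =>
        intervalIntegral.integral_same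
      simp [this]
    · simp only []
      rw [hproj 1 (by norm_num)]
    · intro s hs
      refine ⟨hpV _, ?_⟩
      have h1 : HasDerivAt (fun s => p.2 + ∑ k, p.1 k •
          primitiveCLM E (N k (ψ p)) (Set.projIcc (-2) 2 (by norm_num) s))
          (∑ k, p.1 k • N k (ψ p) ⟨s, Set.Ioo_subset_Icc_self hs⟩) s := by
        refine HasDerivAt.const_add _ (HasDerivAt.fun_sum fun k _ => ?_)
        exact (hasDerivAt_of_eq_add_primitive (N k (ψ p)) s hs).const_smul (p.1 k)
      simp only [heqs]
      convert h1 using 3 with k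
      rw [hpN k, hproj s (Set.Ioo_subset_Icc_self hs), heqs]

end LocalFlow

end KahlerBlowup

end

noncomputable section

namespace KahlerBlowup

open Topology

/-! ### Maps and vector fields in charts. -/

section Charts

variable {𝕜 : Type*} [NontriviallyNormedField 𝕜] {E : Type*} [NormedAddCommGroup E]
  [NormedSpace 𝕜 E] {E' : Type*} [NormedAddCommGroup E'] [NormedSpace 𝕜 E']
  {M : Type*} [TopologicalSpace M] [ChartedSpace E M]
  {N : Type*} [TopologicalSpace N] [ChartedSpace E' N]

/-- A map between manifolds in the preferred charts at two points. -/
def inCharts (E E' : Type*) [NormedAddCommGroup E] [NormedAddCommGroup E'] {M N : Type*}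
    [TopologicalSpace M] [ChartedSpace E M] [TopologicalSpace N] [ChartedSpace E' N]
    (φ : M → N) (c : M) (c' : N) (z : E) : E' :=
  chartAt E' c' (φ ((chartAt E c).symm z))

theorem contMDiffAt_iff_inCharts {n : ℕ∞ω} [IsManifold 𝓘(𝕜, E) n M] [IsManifold 𝓘(𝕜, E') n N]
    {φ : M → N} {x c : M} {c' : N} (hx : x ∈ (chartAt E c).source)
    (hc' : φ x ∈ (chartAt E' c').source) :
    ContMDiffAt 𝓘(𝕜, E) 𝓘(𝕜, E') n φ x ↔
      ContinuousAt φ x ∧ ContDiffAt 𝕜 n (inCharts E E' φ c c') (chartAt E c x) := by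
  rw [contMDiffAt_iff_of_mem_source hx hc']
  simp only [extChartAt, OpenPartialHomeomorph.extend, modelWithCornersSelf_partialEquiv,
    PartialEquiv.trans_refl, modelWithCornersSelf_coe, Set.range_id, contDiffWithinAt_univ]
  rfl

theorem mfderiv_eq_fderiv_inCharts {φ : M → N} {x : M}
    (h : MDifferentiableAt 𝓘(𝕜, E) 𝓘(𝕜, E') φ x) :
    mfderiv 𝓘(𝕜, E) 𝓘(𝕜, E') φ x = fderiv 𝕜 (inCharts E E' φ x (φ x)) (chartAt E x x) := by
  rw [h.mfderiv]
  simp only [writtenInExtChartAt, extChartAt, OpenPartialHomeomorph.extend,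
    modelWithCornersSelf_partialEquiv,
    PartialEquiv.trans_refl, modelWithCornersSelf_coe, Set.range_id, fderivWithin_univ]
  rfl

theorem contMDiffAt_iff_comp_chart_symm {n : ℕ∞ω} [IsManifold 𝓘(𝕜, E) n M]
    {ζ : M → E'} {x c : M} (hx : x ∈ (chartAt E c).source) :
    ContMDiffAt 𝓘(𝕜, E) 𝓘(𝕜, E') n ζ x ↔
      ContDiffAt 𝕜 n (ζ ∘ (chartAt E c).symm) (chartAt E c x) := by
  have h := contMDiffAt_iff_inCharts (𝕜 := 𝕜) (E := E) (E' := E') (n := n) (φ := ζ) (c := c)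
    (c' := ζ x) hx (by simp)
  rw [h]
  have e : inCharts E E' ζ c (ζ x) = ζ ∘ (chartAt E c).symm := by
    funext z
    rw [inCharts, chartAt_self_eq]
    rfl
  rw [e]
  refine ⟨fun h => h.2, fun h => ⟨?_, h⟩⟩
  have h1 : ContinuousAt ((ζ ∘ (chartAt E c).symm) ∘ chartAt E c) x :=
    ContinuousAt.comp h.continuousAt ((chartAt E c).continuousAt hx)
  refine h1.congr ?_
  filter_upwards [(chartAt E c).open_source.mem_nhds hx] with y hy
  simp [hy]

theorem mfderiv_eq_fderiv_comp_chart_symm {ζ : M → E'} {x : M}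
    (h : MDifferentiableAt 𝓘(𝕜, E) 𝓘(𝕜, E') ζ x) :
    mfderiv 𝓘(𝕜, E) 𝓘(𝕜, E') ζ x = fderiv 𝕜 (ζ ∘ (chartAt E x).symm) (chartAt E x x) := by
  rw [mfderiv_eq_fderiv_inCharts h]
  rfl

/-- The coordinates in the chart at `c` of a vector field that is given at each point by its
coordinates in the preferred chart. -/
def coord (𝕜 : Type*) [NontriviallyNormedField 𝕜] {E : Type*} [NormedAddCommGroup E]
    [NormedSpace 𝕜 E] {M : Type*} [TopologicalSpace M] [ChartedSpace E M]
    (c : M) (v : M → E) (z : E) : E :=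
  fderiv 𝕜 (inCharts E E (id : M → M) ((chartAt E c).symm z) c)
    (chartAt E ((chartAt E c).symm z) ((chartAt E c).symm z)) (v ((chartAt E c).symm z))

theorem coord_self [IsManifold 𝓘(𝕜, E) 1 M] (x : M) (v : M → E) :
    coord 𝕜 x v (chartAt E x x) = v x := by
  have e : (chartAt E x).symm (chartAt E x x) = x := by simp
  rw [coord, e]
  have h : inCharts E E (id : M → M) x x =ᶠ[𝓝 (chartAt E x x)] id := by
    filter_upwards [(chartAt E x).open_target.mem_nhds (mem_chart_target E x)] with z hz
    simp [inCharts, hz]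
  rw [h.fderiv_eq, fderiv_id]
  rfl

/-- The trivialization of the tangent bundle over the chart at c acts on a tangent vector by the
differential of the change from the preferred chart, which is how `coord` is defined. -/
theorem contMDiff_section_iff {n : ℕ∞ω} [IsManifold 𝓘(𝕜, E) (n + 1) M] [IsManifold 𝓘(𝕜, E) 1 M]
    [IsManifold 𝓘(𝕜, E) n M]
    (v : ∀ x : M, TangentSpace 𝓘(𝕜, E) x) :
    ContMDiff 𝓘(𝕜, E) 𝓘(𝕜, E).tangent n (fun x => (⟨x, v x⟩ : TangentBundle 𝓘(𝕜, E) M)) ↔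
      ∀ c : M, ContDiffOn 𝕜 n (coord 𝕜 c v) (chartAt E c).target := by
  have : ContMDiffVectorBundle n E (TangentSpace 𝓘(𝕜, E) : M → Type _) 𝓘(𝕜, E) :=
    TangentBundle.contMDiffVectorBundle
  have key (c x : M) (hx : x ∈ (chartAt E c).source) :
      ContMDiffAt 𝓘(𝕜, E) 𝓘(𝕜, E).tangent n (fun x => (⟨x, v x⟩ : TangentBundle 𝓘(𝕜, E) M)) x ↔
        ContDiffAt 𝕜 n (coord 𝕜 c v) (chartAt E c x) := by
    have h1 := Bundle.Trivialization.contMDiffAt_iff (n := n) (𝕜 := 𝕜) (IB := 𝓘(𝕜, E))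
      (IM := 𝓘(𝕜, E))
      (e := trivializationAt E (TangentSpace 𝓘(𝕜, E) : M → Type _) c)
      (f := fun x => (⟨x, v x⟩ : TangentBundle 𝓘(𝕜, E) M)) (x₀ := x) (by simpa using hx)
    refine h1.trans ?_
    have h2 : ContMDiffAt 𝓘(𝕜, E) 𝓘(𝕜, E) n (fun x : M => x) x := contMDiffAt_id
    simp only [TangentBundle.trivializationAt_apply]
    rw [and_iff_right h2, contMDiffAt_iff_comp_chart_symm hx]
    simp only [OpenPartialHomeomorph.extend, modelWithCornersSelf_partialEquiv,
      PartialEquiv.trans_refl, modelWithCornersSelf_coe, Set.range_id, fderivWithin_univ]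
    rfl
  constructor
  · intro h c z hz
    have h1 := (key c ((chartAt E c).symm z) ((chartAt E c).map_target hz)).1 (h _)
    rw [(chartAt E c).right_inv hz] at h1
    exact h1.contDiffWithinAt
  · intro h x
    refine (key x x (mem_chart_source E x)).2 ?_
    exact (h x).contDiffAt ((chartAt E x).open_target.mem_nhds (mem_chart_target E x))

/-- Only an identity of germs: the intermediate chart can be undone where φ takes values in its
source, which continuity guarantees near the point. -/
theorem eventually_inCharts_comp {E'' N' : Type*} [NormedAddCommGroup E''] [TopologicalSpace N'] [ChartedSpace E'' N']
    {φ : M → N} {ψ : N → N'} {x c : M} {c' : N} {c'' : N'}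
    (hx : x ∈ (chartAt E c).source) (hφ : ContinuousAt φ x) (hc' : φ x ∈ (chartAt E' c').source) :
    inCharts E E'' (ψ ∘ φ) c c'' =ᶠ[𝓝 (chartAt E c x)]
      inCharts E' E'' ψ c' c'' ∘ inCharts E E' φ c c' := by
  have h1 : ∀ᶠ z in 𝓝 (chartAt E c x), φ ((chartAt E c).symm z) ∈ (chartAt E' c').source := by
    have h2 : ContinuousAt (φ ∘ (chartAt E c).symm) (chartAt E c x) := by
      refine ContinuousAt.comp ?_ ((chartAt E c).continuousAt_symm ((chartAt E c).map_source hx))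
      rwa [(chartAt E c).left_inv hx]
    refine h2.eventually_mem ((chartAt E' c').open_source.mem_nhds ?_)
    simpa [hx] using hc'
  filter_upwards [h1] with z hz
  simp [inCharts, hz]

/-- Change of charts for the coordinates of a vector field, and more generally its
transformation under a map. -/
theorem fderiv_inCharts_coord [IsManifold 𝓘(𝕜, E) 1 M] [IsManifold 𝓘(𝕜, E') 1 N]
    {φ : M → N} {v : M → E} {w : N → E'} {c : M} {c' : N} {z : E}
    (hz : z ∈ (chartAt E c).target) (hφ : ContMDiffAt 𝓘(𝕜, E) 𝓘(𝕜, E') 1 φ ((chartAt E c).symm z))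
    (hc' : φ ((chartAt E c).symm z) ∈ (chartAt E' c').source)
    (hvw : mfderiv 𝓘(𝕜, E) 𝓘(𝕜, E') φ ((chartAt E c).symm z) (v ((chartAt E c).symm z))
      = w (φ ((chartAt E c).symm z))) :
    fderiv 𝕜 (inCharts E E' φ c c') z (coord 𝕜 c v z)
      = coord 𝕜 c' w (inCharts E E' φ c c' z) := by
  set x := (chartAt E c).symm z with hx
  have hxs : x ∈ (chartAt E c).source := (chartAt E c).map_target hz
  have hcx : chartAt E c x = z := (chartAt E c).right_inv hz
  have hd (a b : M) (y : M) (ha : y ∈ (chartAt E a).source) (hb : y ∈ (chartAt E b).source) :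
      DifferentiableAt 𝕜 (inCharts E E (id : M → M) a b) (chartAt E a y) :=
    ((contMDiffAt_iff_inCharts (𝕜 := 𝕜) (n := 1) (φ := (id : M → M)) ha hb).1 contMDiffAt_id).2.differentiableAt one_ne_zero
  have hd' (a b : N) (y : N) (ha : y ∈ (chartAt E' a).source) (hb : y ∈ (chartAt E' b).source) :
      DifferentiableAt 𝕜 (inCharts E' E' (id : N → N) a b) (chartAt E' a y) :=
    ((contMDiffAt_iff_inCharts (𝕜 := 𝕜) (n := 1) (φ := (id : N → N)) ha hb).1 contMDiffAt_id).2.differentiableAt one_ne_zero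
  have hφd (a : M) (b : N) (ha : x ∈ (chartAt E a).source) (hb : φ x ∈ (chartAt E' b).source) :
      DifferentiableAt 𝕜 (inCharts E E' φ a b) (chartAt E a x) :=
    ((contMDiffAt_iff_inCharts (𝕜 := 𝕜) (n := 1) ha hb).1 hφ).2.differentiableAt one_ne_zero
  -- The expression of φ from the preferred chart at x to the chart at c' is factored in two ways,
  -- through the chart at c and through the preferred chart at φ x; the chain rule compares the two.
  have e1 : inCharts E E' φ x c' =ᶠ[𝓝 (chartAt E x x)]
      inCharts E E' φ c c' ∘ inCharts E E (id : M → M) x c :=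
    eventually_inCharts_comp (φ := (id : M → M)) (ψ := φ) (mem_chart_source E x) continuousAt_id hxs
  have e2 : inCharts E E' φ x c' =ᶠ[𝓝 (chartAt E x x)]
      inCharts E' E' (id : N → N) (φ x) c' ∘ inCharts E E' φ x (φ x) :=
    eventually_inCharts_comp (φ := φ) (ψ := (id : N → N)) (mem_chart_source E x) hφ.continuousAt
      (mem_chart_source E' (φ x))
  have hcc : inCharts E E (id : M → M) x c (chartAt E x x) = z := by
    simp [inCharts, hcx]
  have hcc' : inCharts E E' φ x (φ x) (chartAt E x x) = chartAt E' (φ x) (φ x) := by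
    simp [inCharts]
  have hxc' : (chartAt E' c').symm (inCharts E E' φ c c' z) = φ x := by
    rw [inCharts, ← hx, (chartAt E' c').left_inv hc']
  rw [coord, coord, hxc', ← hx, ← hvw, mfderiv_eq_fderiv_inCharts (hφ.mdifferentiableAt one_ne_zero)]
  have f1 : fderiv 𝕜 (inCharts E E' φ x c') (chartAt E x x) =
      (fderiv 𝕜 (inCharts E E' φ c c') z).comp
        (fderiv 𝕜 (inCharts E E (id : M → M) x c) (chartAt E x x)) := by
    rw [e1.fderiv_eq, fderiv_comp, hcc]
    · rw [hcc]
      have := hφd c c' hxs hc'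
      rwa [hcx] at this
    · exact hd x c x (mem_chart_source E x) hxs
  have f2 : fderiv 𝕜 (inCharts E E' φ x c') (chartAt E x x) =
      (fderiv 𝕜 (inCharts E' E' (id : N → N) (φ x) c') (chartAt E' (φ x) (φ x))).comp
        (fderiv 𝕜 (inCharts E E' φ x (φ x)) (chartAt E x x)) := by
    rw [e2.fderiv_eq, fderiv_comp, hcc']
    · rw [hcc']
      exact hd' (φ x) c' (φ x) (mem_chart_source E' _) hc'
    · exact hφd x (φ x) (mem_chart_source E x) (mem_chart_source E' _)
  have h3 := congrArg (fun L => L (v x)) (f1.symm.trans f2)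
  exact h3

theorem fderiv_inCharts_id_coord [IsManifold 𝓘(𝕜, E) 1 M] {v : M → E} {c c' : M} {z : E}
    (hz : z ∈ (chartAt E c).target) (hc' : (chartAt E c).symm z ∈ (chartAt E c').source) :
    fderiv 𝕜 (inCharts E E (id : M → M) c c') z (coord 𝕜 c v z)
      = coord 𝕜 c' v (inCharts E E (id : M → M) c c' z) := by
  refine fderiv_inCharts_coord (φ := (id : M → M)) hz contMDiffAt_id hc' ?_
  have h := mfderiv_id (I := 𝓘(𝕜, E)) (x := (chartAt E c).symm z)
  exact congrArg (fun L => L (v ((chartAt E c).symm z))) h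

end Charts

end KahlerBlowup

end

noncomputable section

namespace KahlerBlowup

open Topology

/-! ### Linear algebra of J-invariant 2-forms and Hermitian matrices. -/

section HermitianForms

variable {m : ℕ}

/-- The Hermitian matrix of a real `2`-form on `ℂ^m`. -/
def hermOf (β : CSpace m [⋀^Fin 2]→L[ℝ] ℝ) : Matrix (Fin m) (Fin m) ℂ := fun j k =>
  (β ![Pi.single j 1, Pi.single k Complex.I] : ℂ)
    - Complex.I * (β ![Pi.single j 1, Pi.single k 1] : ℂ)

theorem form2_add_left (β : CSpace m [⋀^Fin 2]→L[ℝ] ℝ) (u u' v : CSpace m) :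
    β ![u + u', v] = β ![u, v] + β ![u', v] :=
  β.toAlternatingMap.map_vecCons_add ![v] u u'

theorem form2_smul_left (β : CSpace m [⋀^Fin 2]→L[ℝ] ℝ) (r : ℝ) (u v : CSpace m) :
    β ![r • u, v] = r * β ![u, v] :=
  β.toAlternatingMap.map_vecCons_smul ![v] r u

theorem form2_swap (β : CSpace m [⋀^Fin 2]→L[ℝ] ℝ) (u v : CSpace m) :
    β ![u, v] = - β ![v, u] := by
  have h := β.toAlternatingMap.map_swap ![v, u] (i := 0) (j := 1) (by simp)
  have e : (![v, u] : Fin 2 → CSpace m) ∘ Equiv.swap 0 1 = ![u, v] := by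
    funext i
    fin_cases i <;> simp
  rw [e] at h
  exact h

theorem form2_add_right (β : CSpace m [⋀^Fin 2]→L[ℝ] ℝ) (u v v' : CSpace m) :
    β ![u, v + v'] = β ![u, v] + β ![u, v'] := by
  rw [form2_swap, form2_add_left, form2_swap β v, form2_swap β v']
  ring

theorem form2_smul_right (β : CSpace m [⋀^Fin 2]→L[ℝ] ℝ) (r : ℝ) (u v : CSpace m) :
    β ![u, r • v] = r * β ![u, v] := by
  rw [form2_swap, form2_smul_left, form2_swap β v]
  ring

theorem form2_self (β : CSpace m [⋀^Fin 2]→L[ℝ] ℝ) (u : CSpace m) : β ![u, u] = 0 := by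
  have := form2_swap β u u
  linarith

theorem complex_smul_eq (a : ℂ) (u : CSpace m) :
    a • u = a.re • u + a.im • (Complex.I • u) := by
  ext i
  apply Complex.ext <;> simp <;> ring

/-- The complex linear extension of `β` in its first argument, evaluated on `u - i J u`. -/
def contr (β : CSpace m [⋀^Fin 2]→L[ℝ] ℝ) (u v : CSpace m) : ℂ :=
  (β ![u, v] : ℂ) - Complex.I * (β ![Complex.I • u, v] : ℂ)

theorem contr_add_left (β : CSpace m [⋀^Fin 2]→L[ℝ] ℝ) (u u' v : CSpace m) :
    contr β (u + u') v = contr β u v + contr β u' v := by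
  simp only [contr, smul_add, form2_add_left]
  push_cast
  ring

theorem contr_smul_left (β : CSpace m [⋀^Fin 2]→L[ℝ] ℝ) (a : ℂ) (u v : CSpace m) :
    contr β (a • u) v = a * contr β u v := by
  have e : Complex.I • a • u = (-a.im) • u + a.re • (Complex.I • u) := by
    ext i
    apply Complex.ext <;> simp <;> ring
  rw [contr, contr, e, complex_smul_eq]
  simp only [form2_add_left, form2_smul_left]
  apply Complex.ext <;> simp

variable {β : CSpace m [⋀^Fin 2]→L[ℝ] ℝ}

theorem contr_add_right (β : CSpace m [⋀^Fin 2]→L[ℝ] ℝ) (u v v' : CSpace m) :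
    contr β u (v + v') = contr β u v + contr β u v' := by
  simp only [contr, form2_add_right]
  push_cast
  ring

theorem form2_I_left (hβ : ∀ u v, β ![Complex.I • u, Complex.I • v] = β ![u, v]) (u v : CSpace m) :
    β ![Complex.I • u, v] = - β ![u, Complex.I • v] := by
  rw [← hβ u (Complex.I • v), smul_smul, Complex.I_mul_I, neg_one_smul,
    ← neg_one_smul ℝ v, form2_smul_right]
  ring

/-- Invariance moves multiplication by i to the other slot with a sign. Together with linearity on
the left this makes `contr` sesquilinear, hence determined by its matrix. -/
theorem contr_smul_right (hβ : ∀ u v, β ![Complex.I • u, Complex.I • v] = β ![u, v])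
    (a : ℂ) (u v : CSpace m) :
    contr β u (a • v) = (starRingEnd ℂ) a * contr β u v := by
  have e : Complex.I • (a.re • v + a.im • (Complex.I • v)) = a.re • (Complex.I • v) + (-a.im) • v := by
    ext i
    apply Complex.ext <;> simp <;> ring
  rw [contr, contr, complex_smul_eq, form2_I_left hβ, form2_I_left hβ, e]
  simp only [form2_add_right, form2_smul_right]
  apply Complex.ext <;> simp

theorem contr_single (hβ : ∀ u v, β ![Complex.I • u, Complex.I • v] = β ![u, v]) (j k : Fin m) :
    contr β (Pi.single j 1) (Pi.single k 1) = Complex.I * hermOf β j k := by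
  have e : (Pi.single k Complex.I : CSpace m) = Complex.I • Pi.single k 1 := by
    rw [← Pi.single_smul, smul_eq_mul, mul_one]
  rw [contr, hermOf, form2_I_left hβ, e]
  push_cast
  linear_combination ((β ![Pi.single j 1, Pi.single k 1] : ℂ)) * Complex.I_mul_I

theorem contr_eq_sum (hβ : ∀ u v, β ![Complex.I • u, Complex.I • v] = β ![u, v])
    (u v : CSpace m) :
    contr β u v = Complex.I * ∑ j, ∑ k, hermOf β j k * u j * (starRingEnd ℂ) (v k) := by
  have hu : ∀ u : CSpace m, u = ∑ j, u j • (Pi.single j 1 : CSpace m) := fun u => by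
    conv_lhs => rw [← Finset.univ_sum_single u]
    refine Finset.sum_congr rfl fun j _ => ?_
    rw [← Pi.single_smul, smul_eq_mul, mul_one]
  have h1 : ∀ (s : Finset (Fin m)) (f : Fin m → CSpace m) (v : CSpace m),
      contr β (∑ j ∈ s, f j) v = ∑ j ∈ s, contr β (f j) v := fun s f v =>
    map_sum (AddMonoidHom.mk' (fun u => contr β u v) (fun a b => contr_add_left β a b v)) f s
  have h2 : ∀ (s : Finset (Fin m)) (f : Fin m → CSpace m) (u : CSpace m),
      contr β u (∑ j ∈ s, f j) = ∑ j ∈ s, contr β u (f j) := fun s f u =>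
    map_sum (AddMonoidHom.mk' (fun v => contr β u v) (fun a b => contr_add_right β u a b)) f s
  conv_lhs => rw [hu u, hu v]
  rw [h1, Finset.mul_sum]
  refine Finset.sum_congr rfl fun j _ => ?_
  rw [h2, Finset.mul_sum]
  refine Finset.sum_congr rfl fun k _ => ?_
  rw [contr_smul_left, contr_smul_right hβ, contr_single hβ]
  ring

/-- By invariance and alternation `contr` at (u, iu) reduces to β(u, iu), while conjugate linearity
produces a factor -i that cancels the i of `contr_eq_sum`. This gives the metric as the quadratic
form of `hermOf`. -/
theorem contr_I_self (hβ : ∀ u v, β ![Complex.I • u, Complex.I • v] = β ![u, v]) (u : CSpace m) :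
    (β ![u, Complex.I • u] : ℂ) = ∑ j, ∑ k, hermOf β j k * u j * (starRingEnd ℂ) (u k) := by
  have h := contr_smul_right hβ Complex.I u u
  rw [contr_eq_sum hβ u u] at h
  rw [contr, hβ, form2_self β] at h
  simp only [Complex.conj_I, Complex.ofReal_zero, mul_zero, sub_zero] at h
  linear_combination h - (∑ j, ∑ k, hermOf β j k * u j * (starRingEnd ℂ) (u k)) * Complex.I_mul_I

theorem hermOf_isHermitian (hβ : ∀ u v, β ![Complex.I • u, Complex.I • v] = β ![u, v]) :
    (hermOf β).IsHermitian := by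
  ext j k
  have e (k : Fin m) : (Pi.single k Complex.I : CSpace m) = Complex.I • Pi.single k 1 := by
    rw [← Pi.single_smul, smul_eq_mul, mul_one]
  rw [Matrix.conjTranspose_apply, hermOf, hermOf, e, e, form2_swap β (Pi.single j 1) (Pi.single k 1),
    form2_swap β (Pi.single j 1) (Complex.I • Pi.single k 1), form2_I_left hβ]
  apply Complex.ext <;> simp

open scoped ComplexOrder in
theorem hermOf_posDef (hβ : ∀ u v, β ![Complex.I • u, Complex.I • v] = β ![u, v])
    (hpos : ∀ u, u ≠ 0 → 0 < β ![u, Complex.I • u]) : (hermOf β).PosDef := by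
  refine Matrix.PosDef.of_dotProduct_mulVec_pos (hermOf_isHermitian hβ) fun x hx => ?_
  -- The quadratic form is linear in u_j and conjugate linear in u_k, the opposite of the matrix
  -- convention x^* H x, so it is evaluated at the conjugate of x.
  have h1 := contr_I_self hβ (star x)
  have h2 := hpos (star x) (by simpa using hx)
  have h3 : star x ⬝ᵥ (hermOf β).mulVec x = (β ![star x, Complex.I • star x] : ℂ) := by
    rw [h1]
    simp only [dotProduct, Matrix.mulVec, Finset.mul_sum]
    refine Finset.sum_congr rfl fun j _ => Finset.sum_congr rfl fun k _ => ?_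
    simp
    ring
  rw [h3]
  exact_mod_cast h2

/-- The matrix of a complex linear endomorphism of `ℂ^m`. -/
def cmat (A : CSpace m →L[ℂ] CSpace m) : Matrix (Fin m) (Fin m) ℂ := fun a j => A (Pi.single j 1) a

theorem cmat_mulVec (A : CSpace m →L[ℂ] CSpace m) (u : CSpace m) : (cmat A).mulVec u = A u := by
  have h : (cmat A) = LinearMap.toMatrix' (A : CSpace m →ₗ[ℂ] CSpace m) := by
    ext a j
    simp [cmat, LinearMap.toMatrix'_apply]
  rw [h, ← Matrix.toLin'_apply, Matrix.toLin'_toMatrix']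
  rfl

/-- Complex linearity of A lets it pass through the sesquilinear form, so the conjugate falls on the
right factor only. With A a holomorphic Jacobian this is the transformation law of Kähler metrics.
-/
theorem hermOf_comp {β' : CSpace m [⋀^Fin 2]→L[ℝ] ℝ}
    (hβ' : ∀ u v, β' ![Complex.I • u, Complex.I • v] = β' ![u, v]) (A : CSpace m →L[ℂ] CSpace m)
    (h : ∀ u v, β ![u, v] = β' ![A u, A v]) :
    hermOf β = (cmat A).transpose * hermOf β' * (cmat A).map (starRingEnd ℂ) := by
  have hβ : ∀ u v, β ![Complex.I • u, Complex.I • v] = β ![u, v] := fun u v => by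
    rw [h, h, map_smul, map_smul, hβ']
  ext j k
  have h1 := contr_single hβ j k
  have h2 : contr β (Pi.single j 1) (Pi.single k 1) =
      contr β' (A (Pi.single j 1)) (A (Pi.single k 1)) := by
    rw [contr, contr, h, h, map_smul]
  rw [h2, contr_eq_sum hβ'] at h1
  rw [← mul_left_cancel₀ Complex.I_ne_zero h1]
  simp only [Matrix.mul_apply, Matrix.transpose_apply, Matrix.map_apply, Finset.sum_mul]
  rw [Finset.sum_comm]
  refine Finset.sum_congr rfl fun a _ => Finset.sum_congr rfl fun b _ => ?_
  simp only [cmat]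
  ring

end HermitianForms

end KahlerBlowup

end

noncomputable section

namespace KahlerBlowup

open Topology

/-! ### Calculus of Wirtinger derivatives. -/

section Wirtinger

variable {m : ℕ}

/-- The operators `∂/∂z_j` (for `s = -1`) and `∂/∂z̄_j` (for `s = 1`). -/
def wd (s : ℂ) (j : Fin m) (F : CSpace m → ℂ) (z : CSpace m) : ℂ :=
  (1 / 2) * (fderiv ℝ F z (Pi.single j 1) + s * Complex.I * fderiv ℝ F z (Pi.single j Complex.I))

theorem dz_eq_wd (j : Fin m) (F : CSpace m → ℂ) : dz j F = wd (-1) j F := by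
  funext z
  rw [dz, wd]
  ring

theorem dzbar_eq_wd (j : Fin m) (F : CSpace m → ℂ) : dzbar j F = wd 1 j F := by
  funext z
  rw [dzbar, wd]
  ring

variable {s s' : ℂ} {j k : Fin m} {F F' : CSpace m → ℂ} {z : CSpace m} {U : Set (CSpace m)}

theorem wd_congr (h : F =ᶠ[𝓝 z] F') : wd s j F z = wd s j F' z := by
  rw [wd, wd, h.fderiv_eq]

theorem wd_congr_on (hU : IsOpen U) (hz : z ∈ U) (h : ∀ w ∈ U, F w = F' w) :
    wd s j F z = wd s j F' z :=
  wd_congr (Filter.eventuallyEq_of_mem (hU.mem_nhds hz) h)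

theorem wd_const (a : ℂ) : wd s j (fun _ => a) z = 0 := by
  simp [wd]

theorem wd_add (h : DifferentiableAt ℝ F z) (h' : DifferentiableAt ℝ F' z) :
    wd s j (fun w => F w + F' w) z = wd s j F z + wd s j F' z := by
  simp only [wd, fderiv_fun_add h h', _root_.add_apply]
  ring

theorem wd_neg : wd s j (fun w => - F w) z = - wd s j F z := by
  simp only [wd, fderiv_fun_neg, _root_.neg_apply]
  ring

theorem wd_mul (h : DifferentiableAt ℝ F z) (h' : DifferentiableAt ℝ F' z) :
    wd s j (fun w => F w * F' w) z = wd s j F z * F' z + F z * wd s j F' z := by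
  simp only [wd, fderiv_fun_mul h h', _root_.add_apply,
    _root_.smul_apply, smul_eq_mul]
  ring

theorem wd_sum {ι : Type*} (t : Finset ι) {f : ι → CSpace m → ℂ}
    (h : ∀ i ∈ t, DifferentiableAt ℝ (f i) z) :
    wd s j (fun w => ∑ i ∈ t, f i w) z = ∑ i ∈ t, wd s j (f i) z := by
  simp only [wd, fderiv_fun_sum h, _root_.sum_apply]
  rw [Finset.mul_sum, ← Finset.sum_add_distrib, Finset.mul_sum]

/-- Conjugation is real linear and commutes with the real differential; conjugating the coefficient
s·i replaces s by the negative of its conjugate, which exchanges the two types of derivative. -/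
theorem wd_conj (h : DifferentiableAt ℝ F z) :
    wd s j (fun w => (starRingEnd ℂ) (F w)) z = (starRingEnd ℂ) (wd (-(starRingEnd ℂ) s) j F z) := by
  have h1 : HasFDerivAt (fun w => (starRingEnd ℂ) (F w))
      ((Complex.conjCLE : ℂ →L[ℝ] ℂ).comp (fderiv ℝ F z)) z :=
    (Complex.conjCLE : ℂ →L[ℝ] ℂ).hasFDerivAt.comp z h.hasFDerivAt
  have h2 : (starRingEnd ℂ) (1 / 2 : ℂ) = 1 / 2 := by
    apply Complex.ext <;> simp
  rw [wd, wd, h1.fderiv, map_mul, h2]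
  simp

theorem dz_conj (h : DifferentiableAt ℝ F z) :
    wd (-1) j (fun w => (starRingEnd ℂ) (F w)) z = (starRingEnd ℂ) (wd 1 j F z) := by
  rw [wd_conj h]; simp

theorem dzbar_conj (h : DifferentiableAt ℝ F z) :
    wd 1 j (fun w => (starRingEnd ℂ) (F w)) z = (starRingEnd ℂ) (wd (-1) j F z) := by
  rw [wd_conj h]; simp

theorem contDiffOn_wd (hU : IsOpen U) (h : ContDiffOn ℝ ∞ F U) : ContDiffOn ℝ ∞ (wd s j F) U := by
  have h1 : ContDiffOn ℝ ∞ (fderiv ℝ F) U := h.fderiv_of_isOpen hU (by simp)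
  unfold wd
  exact contDiffOn_const.mul ((h1.clm_apply contDiffOn_const).add
    (contDiffOn_const.mul (h1.clm_apply contDiffOn_const)))

theorem _root_.ContDiffOn.differentiableAt_of_isOpen {E G : Type*} [NormedAddCommGroup E]
    [NormedSpace ℝ E] [NormedAddCommGroup G] [NormedSpace ℝ G] {f : E → G} {V : Set E} {x : E}
    (h : ContDiffOn ℝ ∞ f V) (hV : IsOpen V) (hx : x ∈ V) : DifferentiableAt ℝ f x :=
  (h.contDiffAt (hV.mem_nhds hx)).differentiableAt (by simp)

theorem wd_comm (hU : IsOpen U) (h : ContDiffOn ℝ ∞ F U) (hz : z ∈ U) :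
    wd s j (wd s' k F) z = wd s' k (wd s j F) z := by
  have h1 : ContDiffOn ℝ ∞ (fderiv ℝ F) U := h.fderiv_of_isOpen hU (by simp)
  have h2 : DifferentiableAt ℝ (fderiv ℝ F) z := h1.differentiableAt_of_isOpen hU hz
  have h3 : IsSymmSndFDerivAt ℝ F z := by
    refine (h.contDiffAt (hU.mem_nhds hz)).isSymmSndFDerivAt ?_
    rw [minSmoothness_of_isRCLikeNormedField]
    exact WithTop.coe_le_coe.2 le_top
  have h4 (s : ℂ) (k : Fin m) (v : CSpace m) : fderiv ℝ (wd s k F) z v =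
      (1 / 2) * (fderiv ℝ (fderiv ℝ F) z v (Pi.single k 1) +
        s * Complex.I * fderiv ℝ (fderiv ℝ F) z v (Pi.single k Complex.I)) := by
    have hv (u : CSpace m) : HasFDerivAt (fun w => fderiv ℝ F w u)
        ((ContinuousLinearMap.apply ℝ ℂ u).comp (fderiv ℝ (fderiv ℝ F) z)) z :=
      (ContinuousLinearMap.apply ℝ ℂ u).hasFDerivAt.comp z h2.hasFDerivAt
    have h5 : HasFDerivAt (wd s k F) _ z :=
      ((hv (Pi.single k 1)).add ((hv (Pi.single k Complex.I)).const_mul (s * Complex.I))).const_mul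
        (1 / 2 : ℂ)
    rw [h5.fderiv]
    simp [mul_add]
  have h6 (u v : CSpace m) : fderiv ℝ (fderiv ℝ F) z u v = fderiv ℝ (fderiv ℝ F) z v u := h3 u v
  rw [wd, wd, h4, h4, h4, h4, h6 (Pi.single k 1), h6 (Pi.single k Complex.I),
    h6 (Pi.single k 1), h6 (Pi.single k Complex.I)]
  ring

theorem sum_single_one_smul (v : CSpace m) : v = ∑ j, v j • (Pi.single j 1 : CSpace m) := by
  conv_lhs => rw [← Finset.univ_sum_single v]
  refine Finset.sum_congr rfl fun j _ => ?_
  rw [← Pi.single_smul, smul_eq_mul, mul_one]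

/-- The differential in terms of the Wirtinger derivatives. -/
theorem fderiv_eq_sum_wd (F : CSpace m → ℂ) (z v : CSpace m) :
    fderiv ℝ F z v = ∑ a, (wd (-1) a F z * v a + wd 1 a F z * (starRingEnd ℂ) (v a)) := by
  conv_lhs => rw [sum_single_one_smul v, map_sum]
  refine Finset.sum_congr rfl fun a _ => ?_
  have e : v a • (Pi.single a 1 : CSpace m) =
      (v a).re • (Pi.single a 1 : CSpace m) + (v a).im • (Pi.single a Complex.I : CSpace m) := by
    rw [complex_smul_eq, ← Pi.single_smul a Complex.I, smul_eq_mul, mul_one]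
  rw [e, map_add, map_smul, map_smul, wd, wd]
  conv_rhs => rw [← Complex.re_add_im (v a)]
  simp only [map_add, map_mul, Complex.conj_ofReal, Complex.conj_I, Complex.real_smul]
  linear_combination ((v a).im * fderiv ℝ F z (Pi.single a Complex.I)) * Complex.I_mul_I

theorem fderiv_real_eq {E G : Type*} [NormedAddCommGroup E] [NormedSpace ℂ E]
    [NormedAddCommGroup G] [NormedSpace ℂ G] {f : E → G} {x : E}
    (h : DifferentiableAt ℂ f x) : fderiv ℝ f x = (fderiv ℂ f x).restrictScalars ℝ :=
  (h.hasFDerivAt.restrictScalars ℝ).fderiv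

theorem dzbar_eq_zero (h : DifferentiableAt ℂ F z) : wd 1 j F z = 0 := by
  have e : (Pi.single j Complex.I : CSpace m) = Complex.I • Pi.single j 1 := by
    rw [← Pi.single_smul, smul_eq_mul, mul_one]
  rw [wd, fderiv_real_eq h, e]
  simp only [ContinuousLinearMap.coe_restrictScalars', map_smul, smul_eq_mul]
  linear_combination (1 / 2 * fderiv ℂ F z (Pi.single j 1)) * Complex.I_mul_I

theorem dz_eq_fderiv (h : DifferentiableAt ℂ F z) : wd (-1) j F z = fderiv ℂ F z (Pi.single j 1) := by
  have e : (Pi.single j Complex.I : CSpace m) = Complex.I • Pi.single j 1 := by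
    rw [← Pi.single_smul, smul_eq_mul, mul_one]
  rw [wd, fderiv_real_eq h, e]
  simp only [ContinuousLinearMap.coe_restrictScalars', map_smul, smul_eq_mul]
  linear_combination (-1 / 2 * fderiv ℂ F z (Pi.single j 1)) * Complex.I_mul_I

/-- By `fderiv_eq_sum_wd` the ∂̄-derivatives are the coefficients of the conjugate linear part of
the real differential; without them it is complex linear. -/
theorem differentiableAt_complex_of_dzbar (h : DifferentiableAt ℝ F z) (h0 : ∀ a, wd 1 a F z = 0) :
    DifferentiableAt ℂ F z := by
  rw [differentiableAt_iff_restrictScalars ℝ h]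
  refine ⟨∑ a, (wd (-1) a F z) • (ContinuousLinearMap.proj a : CSpace m →L[ℂ] ℂ), ?_⟩
  ext v
  rw [fderiv_eq_sum_wd]
  simp [h0]

variable {τ : CSpace m → CSpace m}

/-- The differential of τ commutes with i, so ∂- and ∂̄-derivatives do not mix in the chain rule. -/
theorem dz_comp (hF : DifferentiableAt ℝ F (τ z)) (hτ : DifferentiableAt ℂ τ z) :
    wd (-1) j (F ∘ τ) z = ∑ a, wd (-1) a F (τ z) * cmat (fderiv ℂ τ z) a j := by
  have e : (Pi.single j Complex.I : CSpace m) = Complex.I • Pi.single j 1 := by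
    rw [← Pi.single_smul, smul_eq_mul, mul_one]
  have h1 : ∀ v, fderiv ℝ (F ∘ τ) z v = fderiv ℝ F (τ z) (fderiv ℂ τ z v) := fun v => by
    rw [fderiv_comp z hF (hτ.restrictScalars ℝ), fderiv_real_eq hτ]
    rfl
  rw [wd, h1, h1, e, map_smul, fderiv_eq_sum_wd, fderiv_eq_sum_wd, Finset.mul_sum,
    ← Finset.sum_add_distrib, Finset.mul_sum]
  refine Finset.sum_congr rfl fun a _ => ?_
  simp only [Pi.smul_apply, smul_eq_mul, map_mul, Complex.conj_I, cmat]
  linear_combination (-1 / 2 * wd (-1) a F (τ z) * (fderiv ℂ τ z) (Pi.single j 1) a +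
    1 / 2 * wd 1 a F (τ z) * (starRingEnd ℂ) ((fderiv ℂ τ z) (Pi.single j 1) a)) * Complex.I_mul_I

theorem dzbar_comp (hF : DifferentiableAt ℝ F (τ z)) (hτ : DifferentiableAt ℂ τ z) :
    wd 1 j (F ∘ τ) z = ∑ a, wd 1 a F (τ z) * (starRingEnd ℂ) (cmat (fderiv ℂ τ z) a j) := by
  have e : (Pi.single j Complex.I : CSpace m) = Complex.I • Pi.single j 1 := by
    rw [← Pi.single_smul, smul_eq_mul, mul_one]
  have h1 : ∀ v, fderiv ℝ (F ∘ τ) z v = fderiv ℝ F (τ z) (fderiv ℂ τ z v) := fun v => by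
    rw [fderiv_comp z hF (hτ.restrictScalars ℝ), fderiv_real_eq hτ]
    rfl
  rw [wd, h1, h1, e, map_smul, fderiv_eq_sum_wd, fderiv_eq_sum_wd, Finset.mul_sum,
    ← Finset.sum_add_distrib, Finset.mul_sum]
  refine Finset.sum_congr rfl fun a _ => ?_
  simp only [Pi.smul_apply, smul_eq_mul, map_mul, Complex.conj_I, cmat]
  linear_combination (1 / 2 * wd (-1) a F (τ z) * (fderiv ℂ τ z) (Pi.single j 1) a -
    1 / 2 * wd 1 a F (τ z) * (starRingEnd ℂ) ((fderiv ℂ τ z) (Pi.single j 1) a)) * Complex.I_mul_I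

end Wirtinger

/-! ### Derivatives of inverses and determinants of matrix-valued functions. -/

section MatrixFunctions

variable {m : ℕ} {s : ℂ} {l : Fin m} {A B : CSpace m → Matrix (Fin m) (Fin m) ℂ} {z : CSpace m}
  {U : Set (CSpace m)}

/-- The entrywise Wirtinger derivative of a matrix-valued function. -/
def wdM (s : ℂ) (l : Fin m) (A : CSpace m → Matrix (Fin m) (Fin m) ℂ) (z : CSpace m) :
    Matrix (Fin m) (Fin m) ℂ := fun j k => wd s l (fun w => A w j k) z

/-- Entrywise smoothness of a matrix-valued function. -/
def SmoothM (U : Set (CSpace m)) (A : CSpace m → Matrix (Fin m) (Fin m) ℂ) : Prop :=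
  ∀ j k, ContDiffOn ℝ ∞ (fun w => A w j k) U

theorem SmoothM.differentiableAt (hA : SmoothM U A) (hU : IsOpen U) (hz : z ∈ U) (j k : Fin m) :
    DifferentiableAt ℝ (fun w => A w j k) z :=
  (hA j k).differentiableAt_of_isOpen hU hz

theorem SmoothM.mul (hA : SmoothM U A) (hB : SmoothM U B) : SmoothM U (fun w => A w * B w) := by
  intro j k
  simp only [Matrix.mul_apply]
  exact ContDiffOn.sum fun i _ => (hA j i).mul (hB i k)

theorem wdM_mul (hA : SmoothM U A) (hB : SmoothM U B) (hU : IsOpen U) (hz : z ∈ U) :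
    wdM s l (fun w => A w * B w) z = wdM s l A z * B z + A z * wdM s l B z := by
  ext j k
  simp only [wdM, Matrix.add_apply, Matrix.mul_apply]
  rw [wd_sum _ fun i _ => (hA.differentiableAt hU hz j i).fun_mul (hB.differentiableAt hU hz i k),
    ← Finset.sum_add_distrib]
  exact Finset.sum_congr rfl fun i _ =>
    wd_mul (hA.differentiableAt hU hz j i) (hB.differentiableAt hU hz i k)

theorem SmoothM.det (hA : SmoothM U A) : ContDiffOn ℝ ∞ (fun w => (A w).det) U := by
  simp only [Matrix.det_apply]
  refine ContDiffOn.sum fun σ _ => ContDiffOn.const_smul _ ?_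
  exact contDiffOn_prod fun i _ => hA _ _

theorem SmoothM.inv (hA : SmoothM U A) (h : ∀ w ∈ U, (A w).det ≠ 0) :
    SmoothM U (fun w => (A w)⁻¹) := by
  intro j k
  have e : ∀ w, (A w)⁻¹ j k = ((A w).det)⁻¹ * (A w).adjugate j k := fun w => by
    rw [Matrix.inv_def, Matrix.smul_apply, Ring.inverse_eq_inv', smul_eq_mul]
  simp only [e]
  refine ContDiffOn.mul (hA.det.inv h) ?_
  simp only [Matrix.adjugate_apply]
  refine SmoothM.det fun a b => ?_
  by_cases ha : a = k
  · subst ha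
    simp only [Matrix.updateRow_self]
    exact contDiffOn_const
  · simp only [Matrix.updateRow_ne ha]
    exact hA a b

/-- Differentiate A⁻¹A = 1, which holds on a neighbourhood of the point. -/
theorem wdM_inv (hA : SmoothM U A) (h : ∀ w ∈ U, (A w).det ≠ 0) (hU : IsOpen U) (hz : z ∈ U) :
    wdM s l (fun w => (A w)⁻¹) z = - ((A z)⁻¹ * wdM s l A z * (A z)⁻¹) := by
  have h1 := wdM_mul (s := s) (l := l) (hA.inv h) hA hU hz
  have h2 : wdM s l (fun w => (A w)⁻¹ * A w) z = 0 := by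
    ext j k
    rw [wdM, wd_congr_on (F' := fun _ => (1 : Matrix (Fin m) (Fin m) ℂ) j k) hU hz, wd_const]
    · rfl
    · intro w hw
      rw [Matrix.nonsing_inv_mul _ (isUnit_iff_ne_zero.2 (h w hw))]
  rw [h2] at h1
  have h3 := congrArg (fun X => X * (A z)⁻¹) h1
  simp only [Matrix.zero_mul, Matrix.add_mul, Matrix.mul_assoc,
    Matrix.mul_nonsing_inv _ (isUnit_iff_ne_zero.2 (h z hz)), Matrix.mul_one] at h3
  rw [Matrix.mul_assoc]
  exact eq_neg_of_add_eq_zero_left h3.symm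

/-- Jacobi's formula. -/
theorem wd_det (hA : SmoothM U A) (hU : IsOpen U) (hz : z ∈ U) :
    wd s l (fun w => (A w).det) z = ((A z).adjugate * wdM s l A z).trace := by
  have hd := fun j k => hA.differentiableAt hU hz j k
  have h1 : ∀ v, fderiv ℝ (fun w => (A w).det) z v =
      ((A z).adjugate * Matrix.of fun j k => fderiv ℝ (fun w => A w j k) z v).trace := by
    intro v
    simp only [Matrix.det_apply]
    have h2 : ∀ σ : Equiv.Perm (Fin m), HasFDerivAt (fun w => Equiv.Perm.sign σ • ∏ i, A w (σ i) i)
        (Equiv.Perm.sign σ • ∑ i, (∏ j ∈ Finset.univ.erase i, A z (σ j) j) •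
          fderiv ℝ (fun w => A w (σ i) i) z) z := fun σ => by
      have h3 := HasFDerivAt.finsetProd (u := Finset.univ) (g := fun i w => A w (σ i) i)
        (fun i _ => (hd (σ i) i).hasFDerivAt)
      rcases Int.units_eq_one_or (Equiv.Perm.sign σ) with h | h
      · simpa [h] using h3
      · simpa [h, Units.smul_def] using h3.fun_neg
    rw [(HasFDerivAt.fun_sum fun σ _ => h2 σ).fderiv]
    simp only [_root_.sum_apply, _root_.smul_apply, Matrix.trace,
      Matrix.diag_apply]
    -- By Cramer's rule a diagonal entry is the determinant with one column differentiated; their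
    -- sum is the Leibniz rule for the determinant.
    have h4 : ∀ i, ((A z).adjugate * Matrix.of fun j k => fderiv ℝ (fun w => A w j k) z v) i i =
        ((A z).updateCol i fun j => fderiv ℝ (fun w => A w j i) z v).det := by
      intro i
      rw [← Matrix.cramer_apply, Matrix.cramer_eq_adjugate_mulVec]
      rfl
    simp only [h4, Matrix.det_apply]
    rw [Finset.sum_comm]
    refine Finset.sum_congr rfl fun σ _ => ?_
    rw [Units.smul_def, Finset.smul_sum]
    refine Finset.sum_congr rfl fun i _ => ?_
    rw [Units.smul_def]
    congr 1
    rw [← Finset.mul_prod_erase _ _ (Finset.mem_univ i), Matrix.updateCol_self,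
      smul_eq_mul, mul_comm]
    congr 1
    refine Finset.prod_congr rfl fun j hj => ?_
    rw [Matrix.updateCol_ne (Finset.ne_of_mem_erase hj)]
  rw [wd, h1, h1]
  simp only [Matrix.trace, Matrix.diag_apply, Matrix.mul_apply, Matrix.of_apply, wdM, wd,
    Finset.mul_sum, ← Finset.sum_add_distrib]
  refine Finset.sum_congr rfl fun i _ => Finset.sum_congr rfl fun j _ => ?_
  ring

end MatrixFunctions

end KahlerBlowup

end

noncomputable section

namespace KahlerBlowup

open Topology

/-! ### Local Kähler geometry: divergence, Laplacian, Ricci form, Bochner and Bianchi identities. -/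

section LocalKahler

variable {m : ℕ}

open scoped ComplexOrder in
/-- A Kähler metric on an open subset of `ℂ^m`, given by its Hermitian matrix. -/
structure IsLocalKahler (U : Set (CSpace m)) (H : CSpace m → Matrix (Fin m) (Fin m) ℂ) : Prop where
  isOpen : IsOpen U
  smooth : SmoothM U H
  posDef : ∀ z ∈ U, (H z).PosDef
  kahler : ∀ z ∈ U, ∀ j l k, wd (-1) l (fun w => H w j k) z = wd (-1) j (fun w => H w l k) z

/-- The logarithm of the volume density. -/
def logDet (H : CSpace m → Matrix (Fin m) (Fin m) ℂ) (z : CSpace m) : ℂ :=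
  (Real.log (H z).det.re : ℂ)

/-- The complex Hessian `∂_j ∂_k̄ f`. -/
def hess (f : CSpace m → ℂ) (z : CSpace m) : Matrix (Fin m) (Fin m) ℂ :=
  fun j k => wd (-1) j (wd 1 k f) z

/-- The components of the Ricci form. -/
def ric (H : CSpace m → Matrix (Fin m) (Fin m) ℂ) (z : CSpace m) : Matrix (Fin m) (Fin m) ℂ :=
  - hess (logDet H) z

/-- The Ricci form with both indices raised. -/
def ricUp (H : CSpace m → Matrix (Fin m) (Fin m) ℂ) (z : CSpace m) : Matrix (Fin m) (Fin m) ℂ :=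
  (H z)⁻¹ * ric H z * (H z)⁻¹

/-- The vector field with components `∑_k S_{kj} ∂_k̄ f`. -/
def raise (S : CSpace m → Matrix (Fin m) (Fin m) ℂ) (f : CSpace m → ℂ) (z : CSpace m) : CSpace m :=
  fun j => ∑ k, S z k j * wd 1 k f z

/-- The `(1,0)`-gradient of a function. -/
def cgrad (H : CSpace m → Matrix (Fin m) (Fin m) ℂ) (f : CSpace m → ℂ) : CSpace m → CSpace m :=
  raise (fun w => (H w)⁻¹) f

/-- The divergence of a `(1,0)`-vector field with respect to the volume density `det H`. -/
def cdiv (H : CSpace m → Matrix (Fin m) (Fin m) ℂ) (Y : CSpace m → CSpace m) (z : CSpace m) : ℂ :=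
  ∑ j, (wd (-1) j (fun w => Y w j) z + Y z j * wd (-1) j (logDet H) z)

/-- The complex Laplacian. -/
def clap (H : CSpace m → Matrix (Fin m) (Fin m) ℂ) (f : CSpace m → ℂ) (z : CSpace m) : ℂ :=
  ((H z)⁻¹ * hess f z).trace

/-- `∇_{Ȳ} Y`. -/
def cconv (Y : CSpace m → CSpace m) (z : CSpace m) : CSpace m :=
  fun j => ∑ l, (starRingEnd ℂ) (Y z l) * wd 1 l (fun w => Y w j) z

/-- `tr (∂̄Y · conj ∂̄Y)`. -/
def dbarSq (Y : CSpace m → CSpace m) (z : CSpace m) : ℂ :=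
  ∑ j, ∑ l, (starRingEnd ℂ) (wd 1 j (fun w => Y w l) z) * wd 1 l (fun w => Y w j) z

/-- Componentwise smoothness of a vector field. -/
def SmoothV (U : Set (CSpace m)) (Y : CSpace m → CSpace m) : Prop :=
  ∀ j, ContDiffOn ℝ ∞ (fun w => Y w j) U

variable {U : Set (CSpace m)} {H : CSpace m → Matrix (Fin m) (Fin m) ℂ} {f g : CSpace m → ℂ}
  {Y : CSpace m → CSpace m} {z : CSpace m}

theorem _root_.ContDiffOn.conj_complex {E : Type*} [NormedAddCommGroup E] [NormedSpace ℝ E]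
    {f : E → ℂ} {V : Set E} (hf : ContDiffOn ℝ ∞ f V) :
    ContDiffOn ℝ ∞ (fun w => (starRingEnd ℂ) (f w)) V :=
  (Complex.conjCLE : ℂ →L[ℝ] ℂ).contDiff.comp_contDiffOn hf

open scoped ComplexOrder in
theorem IsLocalKahler.det_pos (h : IsLocalKahler U H) (hz : z ∈ U) :
    0 < (H z).det.re ∧ (H z).det = ((H z).det.re : ℂ) := by
  have h1 := Complex.pos_iff.1 (h.posDef z hz).det_pos
  exact ⟨h1.1, Complex.ext rfl (by rw [Complex.ofReal_im]; exact h1.2.symm)⟩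

theorem IsLocalKahler.det_ne_zero (h : IsLocalKahler U H) (hz : z ∈ U) : (H z).det ≠ 0 := by
  intro h0
  have := (h.det_pos hz).1
  rw [h0] at this
  exact lt_irrefl _ this

theorem IsLocalKahler.smooth_inv (h : IsLocalKahler U H) : SmoothM U (fun w => (H w)⁻¹) :=
  h.smooth.inv fun _ hw => h.det_ne_zero hw

open scoped ComplexOrder in
theorem IsLocalKahler.conj_apply (h : IsLocalKahler U H) (hz : z ∈ U) (j k : Fin m) :
    (starRingEnd ℂ) (H z j k) = H z k j := by
  have := (h.posDef z hz).isHermitian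
  exact congrFun (congrFun this k) j

open scoped ComplexOrder in
theorem IsLocalKahler.conj_inv_apply (h : IsLocalKahler U H) (hz : z ∈ U) (j k : Fin m) :
    (starRingEnd ℂ) ((H z)⁻¹ j k) = (H z)⁻¹ k j := by
  have := (h.posDef z hz).isHermitian.inv
  exact congrFun (congrFun this k) j

/-- The complex conjugate of the Kähler identity, since H is Hermitian on all of U. -/
theorem IsLocalKahler.kahler_conj (h : IsLocalKahler U H) (hz : z ∈ U) (j l k : Fin m) :
    wd 1 l (fun w => H w j k) z = wd 1 k (fun w => H w j l) z := by
  have e : ∀ l k, wd 1 l (fun w => H w j k) z = (starRingEnd ℂ) (wd (-1) l (fun w => H w k j) z) := by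
    intro l k
    rw [← dzbar_conj (h.smooth.differentiableAt h.isOpen hz k j)]
    exact wd_congr_on h.isOpen hz fun w hw => (h.conj_apply hw k j).symm
  rw [e, e, h.kahler z hz]

theorem IsLocalKahler.smooth_logDet (h : IsLocalKahler U H) : ContDiffOn ℝ ∞ (logDet H) U := by
  have h1 : ContDiffOn ℝ ∞ (fun w => (H w).det.re) U :=
    Complex.reCLM.contDiff.comp_contDiffOn h.smooth.det
  have h2 : ContDiffOn ℝ ∞ (fun w => Real.log (H w).det.re) U :=
    h1.log fun w hw => (h.det_pos hw).1.ne'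
  exact Complex.ofRealCLM.contDiff.comp_contDiffOn h2

/-- The determinant is real on U, so taking its real part inside the logarithm loses nothing and the
logarithmic derivative is given by Jacobi's formula. -/
theorem wd_logDet (h : IsLocalKahler U H) (hz : z ∈ U) (s : ℂ) (l : Fin m) :
    wd s l (logDet H) z = ((H z)⁻¹ * wdM s l H z).trace := by
  have hD := h.smooth.det
  have hd : DifferentiableAt ℝ (fun w => (H w).det) z := hD.differentiableAt_of_isOpen h.isOpen hz
  have hdr : HasFDerivAt (fun w => (H w).det.re)
      (Complex.reCLM.comp (fderiv ℝ (fun w => (H w).det) z)) z :=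
    Complex.reCLM.hasFDerivAt.comp z hd.hasFDerivAt
  have h1 : HasFDerivAt (logDet H) (Complex.ofRealCLM.comp (((H z).det.re)⁻¹ •
      (Complex.reCLM.comp (fderiv ℝ (fun w => (H w).det) z)))) z :=
    Complex.ofRealCLM.hasFDerivAt.comp z (hdr.log (h.det_pos hz).1.ne')
  have h2 : fderiv ℝ (fun w => (H w).det) z =
      Complex.ofRealCLM.comp (Complex.reCLM.comp (fderiv ℝ (fun w => (H w).det) z)) := by
    have h3 : HasFDerivAt (fun w => (((H w).det.re : ℝ) : ℂ))
      (Complex.ofRealCLM.comp (Complex.reCLM.comp (fderiv ℝ (fun w => (H w).det) z))) z :=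
      Complex.ofRealCLM.hasFDerivAt.comp z hdr
    refine (h3.congr_of_eventuallyEq ?_).fderiv
    exact Filter.eventuallyEq_of_mem (h.isOpen.mem_nhds hz) fun w hw => (h.det_pos hw).2
  have h4 : ∀ v, fderiv ℝ (logDet H) z v = (H z).det⁻¹ * fderiv ℝ (fun w => (H w).det) z v := by
    intro v
    rw [h1.fderiv]
    conv_rhs => rw [h2, (h.det_pos hz).2]
    simp
  have h5 : wd s l (logDet H) z = (H z).det⁻¹ * wd s l (fun w => (H w).det) z := by
    rw [wd, wd, h4, h4]
    ring
  rw [h5, wd_det h.smooth h.isOpen hz, Matrix.inv_def, Matrix.smul_mul, Matrix.trace_smul,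
    Ring.inverse_eq_inv', smul_eq_mul]

theorem trace_mul_eq_sum (A B : Matrix (Fin m) (Fin m) ℂ) :
    (A * B).trace = ∑ j, ∑ k, A k j * B j k := by
  rw [Matrix.trace, Finset.sum_comm]
  rfl

theorem contDiffOn_hess (hU : IsOpen U) (hf : ContDiffOn ℝ ∞ f U) : SmoothM U (hess f) :=
  fun _ _ => contDiffOn_wd hU (contDiffOn_wd hU hf)

theorem IsLocalKahler.smooth_ric (h : IsLocalKahler U H) : SmoothM U (ric H) := fun j k =>
  (contDiffOn_hess h.isOpen h.smooth_logDet j k).neg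

theorem IsLocalKahler.smooth_ricUp (h : IsLocalKahler U H) : SmoothM U (ricUp H) :=
  (h.smooth_inv.mul h.smooth_ric).mul h.smooth_inv

theorem SmoothM.raise {S : CSpace m → Matrix (Fin m) (Fin m) ℂ} (hU : IsOpen U) (hS : SmoothM U S)
    (hf : ContDiffOn ℝ ∞ f U) : SmoothV U (raise S f) := fun j =>
  ContDiffOn.sum fun k _ => (hS k j).mul (contDiffOn_wd hU hf)

theorem IsLocalKahler.smooth_cgrad (h : IsLocalKahler U H) (hf : ContDiffOn ℝ ∞ f U) :
    SmoothV U (cgrad H f) := h.smooth_inv.raise h.isOpen hf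

theorem IsLocalKahler.smooth_clap (h : IsLocalKahler U H) (hf : ContDiffOn ℝ ∞ f U) :
    ContDiffOn ℝ ∞ (clap H f) U := by
  have h1 := h.smooth_inv.mul (contDiffOn_hess h.isOpen hf)
  have h2 : ContDiffOn ℝ ∞ (fun w => ∑ k, ((H w)⁻¹ * hess f w) k k) U :=
    ContDiffOn.sum fun k _ => h1 k k
  exact h2

/-- The divergence of a raised differential. -/
theorem cdiv_raise {S : CSpace m → Matrix (Fin m) (Fin m) ℂ} (hU : IsOpen U) (hS : SmoothM U S)
    (hf : ContDiffOn ℝ ∞ f U) (hz : z ∈ U) :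
    cdiv H (raise S f) z = (S z * hess f z).trace +
      ∑ k, (∑ j, (wd (-1) j (fun w => S w k j) z + S z k j * wd (-1) j (logDet H) z)) *
        wd 1 k f z := by
  have h1 : ∀ j, wd (-1) j (fun w => raise S f w j) z =
      ∑ k, (wd (-1) j (fun w => S w k j) z * wd 1 k f z + S z k j * hess f z j k) := by
    intro j
    have hd (k : Fin m) := (hS k j).differentiableAt_of_isOpen hU hz
    have hd' (k : Fin m) := (contDiffOn_wd (s := 1) (j := k) hU hf).differentiableAt_of_isOpen hU hz
    simp only [raise]
    rw [wd_sum _ fun k _ => (hd k).fun_mul (hd' k)]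
    exact Finset.sum_congr rfl fun k _ => wd_mul (hd k) (hd' k)
  simp only [cdiv, h1, trace_mul_eq_sum]
  simp only [Finset.sum_add_distrib, raise, Finset.sum_mul, add_mul]
  rw [Finset.sum_comm (f := fun k j => wd (-1) j (fun w => S w k j) z * wd 1 k f z),
    Finset.sum_comm (f := fun k j => S z k j * wd (-1) j (logDet H) z * wd 1 k f z)]
  have : ∀ j k, S z k j * wd 1 k f z * wd (-1) j (logDet H) z =
      S z k j * wd (-1) j (logDet H) z * wd 1 k f z := fun j k => by ring
  simp only [this]
  ring

/-- The inverse of a Kähler metric is divergence free. -/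
theorem div_inv_eq_zero (h : IsLocalKahler U H) (hz : z ∈ U) (k : Fin m) :
    ∑ j, (wd (-1) j (fun w => (H w)⁻¹ k j) z + (H z)⁻¹ k j * wd (-1) j (logDet H) z) = 0 := by
  have h1 : ∀ j, wd (-1) j (fun w => (H w)⁻¹ k j) z =
      - ∑ b, ∑ a, (H z)⁻¹ k a * wd (-1) a (fun w => H w j b) z * (H z)⁻¹ b j := by
    intro j
    have h2 := congrFun (congrFun (wdM_inv (s := -1) (l := j) h.smooth
      (fun w hw => h.det_ne_zero hw) h.isOpen hz) k) j
    have h3 : wdM (-1) j (fun w => (H w)⁻¹) z k j = wd (-1) j (fun w => (H w)⁻¹ k j) z := rfl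
    rw [← h3, h2]
    simp only [Matrix.neg_apply, Matrix.mul_apply, Finset.sum_mul, wdM]
    congr 1
    refine Finset.sum_congr rfl fun b _ => Finset.sum_congr rfl fun a _ => ?_
    -- The Kähler identity exchanges the differentiation index with a matrix index, after which the
    -- sum over j is the trace that `wd_logDet` attaches to the index a, with the opposite sign.
    rw [h.kahler z hz a j b]
  simp only [h1, wd_logDet h hz, trace_mul_eq_sum, wdM, Finset.sum_add_distrib,
    Finset.sum_neg_distrib]
  rw [neg_add_eq_zero]
  simp only [Finset.mul_sum]
  refine Finset.sum_comm.trans ?_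
  have e : ∀ b, ∑ j, ∑ a, (H z)⁻¹ k a * wd (-1) a (fun w => H w j b) z * (H z)⁻¹ b j =
      ∑ a, ∑ j, (H z)⁻¹ k a * wd (-1) a (fun w => H w j b) z * (H z)⁻¹ b j := fun b =>
    Finset.sum_comm
  simp only [e]
  refine Finset.sum_comm.trans ?_
  refine Finset.sum_congr rfl fun a _ => ?_
  refine Finset.sum_comm.trans ?_
  refine Finset.sum_congr rfl fun j _ => Finset.sum_congr rfl fun b _ => ?_
  ring

/-- The first order terms in `cdiv_raise` carry the divergence of the inverse metric, which is zero;
only the complex Hessian remains. -/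
theorem cdiv_cgrad (h : IsLocalKahler U H) (hf : ContDiffOn ℝ ∞ f U) (hz : z ∈ U) :
    cdiv H (cgrad H f) z = clap H f z := by
  rw [cgrad, cdiv_raise h.isOpen h.smooth_inv hf hz]
  simp only [div_inv_eq_zero h hz, zero_mul, Finset.sum_const_zero, add_zero]
  rfl

theorem cdiv_smul (hU : IsOpen U) (hg : ContDiffOn ℝ ∞ g U) (hY : SmoothV U Y) (hz : z ∈ U) :
    cdiv H (fun w => g w • Y w) z = g z * cdiv H Y z + ∑ j, Y z j * wd (-1) j g z := by
  simp only [cdiv, Pi.smul_apply, smul_eq_mul, Finset.mul_sum, ← Finset.sum_add_distrib]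
  refine Finset.sum_congr rfl fun j _ => ?_
  rw [wd_mul (hg.differentiableAt_of_isOpen hU hz) ((hY j).differentiableAt_of_isOpen hU hz)]
  ring

theorem SmoothV.cconv (hU : IsOpen U) (hY : SmoothV U Y) : SmoothV U (cconv Y) := fun j =>
  ContDiffOn.sum fun l _ => (hY l).conj_complex.mul (contDiffOn_wd hU (hY j))

/-- A Bochner formula for `(1,0)`-vector fields. -/
theorem cdiv_cconv (h : IsLocalKahler U H) (hY : SmoothV U Y) (hz : z ∈ U) :
    cdiv H (cconv Y) z = dbarSq Y z + ∑ l, (starRingEnd ℂ) (Y z l) * wd 1 l (cdiv H Y) z +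
      ∑ j, ∑ l, ric H z j l * Y z j * (starRingEnd ℂ) (Y z l) := by
  have hU := h.isOpen
  have hdY (j : Fin m) : DifferentiableAt ℝ (fun w => Y w j) z :=
    (hY j).differentiableAt_of_isOpen hU hz
  have hdYc (j : Fin m) : DifferentiableAt ℝ (fun w => (starRingEnd ℂ) (Y w j)) z :=
    (hY j).conj_complex.differentiableAt_of_isOpen hU hz
  have hdE (s : ℂ) (l j : Fin m) : DifferentiableAt ℝ (wd s l (fun w => Y w j)) z :=
    (contDiffOn_wd hU (hY j)).differentiableAt_of_isOpen hU hz
  have hdL (s : ℂ) (l : Fin m) : DifferentiableAt ℝ (wd s l (logDet H)) z :=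
    (contDiffOn_wd hU h.smooth_logDet).differentiableAt_of_isOpen hU hz
  have h1 : ∀ j, wd (-1) j (fun w => cconv Y w j) z =
      ∑ l, ((starRingEnd ℂ) (wd 1 j (fun w => Y w l) z) * wd 1 l (fun w => Y w j) z +
        (starRingEnd ℂ) (Y z l) * wd (-1) j (wd 1 l (fun w => Y w j)) z) := by
    intro j
    simp only [cconv]
    rw [wd_sum _ fun l _ => (hdYc l).fun_mul (hdE 1 l j)]
    refine Finset.sum_congr rfl fun l _ => ?_
    rw [wd_mul (hdYc l) (hdE 1 l j), dz_conj (hdY l)]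
  -- Curvature enters here: applying ∂̄_l to the divergence hits the derivative of log det H, and
  -- the mixed second derivative is minus the Ricci form.
  have h2 : ∀ l, wd 1 l (cdiv H Y) z = ∑ j, (wd (-1) j (wd 1 l (fun w => Y w j)) z +
      (wd 1 l (fun w => Y w j) z * wd (-1) j (logDet H) z - Y z j * ric H z j l)) := by
    intro l
    have e : cdiv H Y = fun w => ∑ j, (wd (-1) j (fun w => Y w j) w + Y w j * wd (-1) j (logDet H) w) :=
      rfl
    rw [e, wd_sum _ fun j _ => (hdE (-1) j j).fun_add ((hdY j).fun_mul (hdL (-1) j))]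
    refine Finset.sum_congr rfl fun j _ => ?_
    rw [wd_add (hdE (-1) j j) ((hdY j).fun_mul (hdL (-1) j)), wd_mul (hdY j) (hdL (-1) j),
      wd_comm hU (hY j) hz, wd_comm hU h.smooth_logDet hz]
    have e2 : ric H z j l = - wd (-1) j (wd 1 l (logDet H)) z := rfl
    rw [e2]
    ring
  have h3 : ∑ l, (starRingEnd ℂ) (Y z l) * wd 1 l (cdiv H Y) z = ∑ j, ∑ l, (starRingEnd ℂ) (Y z l) *
      (wd (-1) j (wd 1 l (fun w => Y w j)) z +
        (wd 1 l (fun w => Y w j) z * wd (-1) j (logDet H) z - Y z j * ric H z j l)) := by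
    simp only [h2, Finset.mul_sum]
    exact Finset.sum_comm
  rw [h3, cdiv]
  simp only [h1]
  simp only [dbarSq, cconv, Finset.sum_mul, ← Finset.sum_add_distrib]
  refine Finset.sum_congr rfl fun j _ => Finset.sum_congr rfl fun l _ => ?_
  ring

/-- The Ricci form is a complex Hessian, so this is symmetry of third derivatives of log det H. It
plays the part of the second Bianchi identity. -/
theorem ric_isClosed (h : IsLocalKahler U H) (hz : z ∈ U) (j l k : Fin m) :
    wd (-1) l (fun w => ric H w j k) z = wd (-1) j (fun w => ric H w l k) z := by
  have e : ∀ j k, (fun w => ric H w j k) = fun w => - wd (-1) j (wd 1 k (logDet H)) w := fun _ _ => rfl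
  rw [e, e, wd_neg, wd_neg, wd_comm h.isOpen (contDiffOn_wd h.isOpen h.smooth_logDet) hz]

/-- The contracted Bianchi identity. -/
theorem div_ricUp (h : IsLocalKahler U H) (hz : z ∈ U) (k : Fin m) :
    ∑ j, (wd (-1) j (fun w => ricUp H w k j) z + ricUp H z k j * wd (-1) j (logDet H) z) =
      ∑ a, (H z)⁻¹ k a * wd (-1) a (fun w => ((H w)⁻¹ * ric H w).trace) z := by
  have hU := h.isOpen
  have hK := h.smooth_inv
  have hR := h.smooth_ric
  have hKR := hK.mul hR
  have hdK := fun j k => hK.differentiableAt hU hz j k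
  have hdKR := fun j k => hKR.differentiableAt hU hz j k
  have hdR := fun j k => hR.differentiableAt hU hz j k
  set K := (H z)⁻¹ with hKdef
  have hinv : ∀ l a b, wd (-1) l (fun w => (H w)⁻¹ a b) z =
      - ∑ q, ∑ p, K a p * wd (-1) l (fun w => H w p q) z * K q b := by
    intro l a b
    have h2 := congrFun (congrFun (wdM_inv (s := -1) (l := l) h.smooth
      (fun w hw => h.det_ne_zero hw) hU hz) a) b
    refine h2.trans ?_
    simp only [Matrix.neg_apply, Matrix.mul_apply, Finset.sum_mul, wdM]
    rfl
  -- derivative of the product in the two ways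
  have h1 : ∀ j, wd (-1) j (fun w => ricUp H w k j) z =
      ∑ p, (wd (-1) j (fun w => ((H w)⁻¹ * ric H w) k p) z * K p j +
        (K * ric H z) k p * wd (-1) j (fun w => (H w)⁻¹ p j) z) := by
    intro j
    have e : (fun w => ricUp H w k j) = fun w => ∑ p, ((H w)⁻¹ * ric H w) k p * (H w)⁻¹ p j := rfl
    rw [e, wd_sum _ fun p _ => (hdKR k p).fun_mul (hdK p j)]
    exact Finset.sum_congr rfl fun p _ => wd_mul (hdKR k p) (hdK p j)
  have h2 : ∀ j, ricUp H z k j = ∑ p, (K * ric H z) k p * K p j := fun j => rfl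
  -- The derivative of the last factor H⁻¹ and the log det term together form the divergence of H⁻¹
  -- and drop out.
  have h3 : ∑ j, (wd (-1) j (fun w => ricUp H w k j) z + ricUp H z k j * wd (-1) j (logDet H) z) =
      ∑ j, ∑ p, wd (-1) j (fun w => ((H w)⁻¹ * ric H w) k p) z * K p j := by
    have h4 : ∑ p, (K * ric H z) k p * ∑ j, (wd (-1) j (fun w => (H w)⁻¹ p j) z +
        K p j * wd (-1) j (logDet H) z) = 0 := by
      simp only [hKdef, div_inv_eq_zero h hz, mul_zero, Finset.sum_const_zero]
    rw [← add_zero (∑ j, ∑ p, _), ← h4]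
    simp only [Finset.mul_sum]
    rw [Finset.sum_comm (f := fun p j => (K * ric H z) k p * _), ← Finset.sum_add_distrib]
    refine Finset.sum_congr rfl fun j _ => ?_
    rw [h1, h2, Finset.sum_mul, ← Finset.sum_add_distrib, ← Finset.sum_add_distrib]
    refine Finset.sum_congr rfl fun p _ => ?_
    ring
  rw [h3]
  have h5 : ∀ j p, wd (-1) j (fun w => ((H w)⁻¹ * ric H w) k p) z = ∑ a,
      (wd (-1) j (fun w => (H w)⁻¹ k a) z * ric H z a p + K k a * wd (-1) j (fun w => ric H w a p) z) := by
    intro j p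
    have e : (fun w => ((H w)⁻¹ * ric H w) k p) = fun w => ∑ a, (H w)⁻¹ k a * ric H w a p := rfl
    rw [e, wd_sum _ fun a _ => (hdK k a).fun_mul (hdR a p)]
    exact Finset.sum_congr rfl fun a _ => wd_mul (hdK k a) (hdR a p)
  have h6 : ∀ a, wd (-1) a (fun w => ((H w)⁻¹ * ric H w).trace) z = ∑ j, ∑ p,
      (wd (-1) a (fun w => (H w)⁻¹ p j) z * ric H z j p + K p j * wd (-1) a (fun w => ric H w j p) z) := by
    intro a
    simp only [trace_mul_eq_sum]
    rw [wd_sum _ fun j _ => DifferentiableAt.fun_sum fun p _ => (hdK p j).fun_mul (hdR j p)]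
    refine Finset.sum_congr rfl fun j _ => ?_
    rw [wd_sum _ fun p _ => (hdK p j).fun_mul (hdR j p)]
    exact Finset.sum_congr rfl fun p _ => wd_mul (hdK p j) (hdR j p)
  simp only [h5, h6, Finset.sum_mul, Finset.mul_sum, add_mul, mul_add, Finset.sum_add_distrib]
  rw [add_comm]
  -- Terms with a derivative of the Ricci form match by its closedness.
  have hA : ∑ j, ∑ p, ∑ a, K k a * wd (-1) j (fun w => ric H w a p) z * K p j =
      ∑ a, ∑ j, ∑ p, K k a * (K p j * wd (-1) a (fun w => ric H w j p) z) := by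
    have e1 : ∀ j, ∑ p, ∑ a, K k a * wd (-1) j (fun w => ric H w a p) z * K p j =
      ∑ a, ∑ p, K k a * wd (-1) j (fun w => ric H w a p) z * K p j := fun j => Finset.sum_comm
    simp only [e1]
    rw [Finset.sum_comm]
    refine Finset.sum_congr rfl fun a _ => Finset.sum_congr rfl fun j _ =>
      Finset.sum_congr rfl fun p _ => ?_
    rw [ric_isClosed h hz a j p]
    ring
  -- Terms with a derivative of H⁻¹ match by the Kähler identity for H, after expanding that
  -- derivative; the rest is a permutation of five summation indices.
  have hB : ∑ j, ∑ p, ∑ a, wd (-1) j (fun w => (H w)⁻¹ k a) z * ric H z a p * K p j =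
      ∑ a, ∑ j, ∑ p, K k a * (wd (-1) a (fun w => (H w)⁻¹ p j) z * ric H z j p) := by
    simp only [hinv, Finset.sum_mul, Finset.mul_sum, neg_mul, mul_neg, Finset.sum_neg_distrib]
    congr 1
    -- LHS: j p a q b ; RHS: b a p q j
    have e1 : ∀ j p a q b, K k b * wd (-1) j (fun w => H w b q) z * K q a * ric H z a p * K p j =
        K k b * (K p j * wd (-1) b (fun w => H w j q) z * K q a * ric H z a p) := fun j p a q b => by
      rw [h.kahler z hz b j q]; ring
    simp only [e1]
    calc _ = ∑ j, ∑ b, ∑ a, ∑ p, ∑ q,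
          K k b * (K p j * wd (-1) b (fun w => H w j q) z * K q a * ric H z a p) := by
          refine Finset.sum_congr rfl fun j _ => ?_
          calc _ = ∑ p, ∑ b, ∑ a, ∑ q,
                K k b * (K p j * wd (-1) b (fun w => H w j q) z * K q a * ric H z a p) := by
                refine Finset.sum_congr rfl fun p _ => ?_
                calc _ = ∑ a, ∑ b, ∑ q,
                      K k b * (K p j * wd (-1) b (fun w => H w j q) z * K q a * ric H z a p) :=
                      Finset.sum_congr rfl fun a _ => Finset.sum_comm
                  _ = _ := Finset.sum_comm
            _ = ∑ b, ∑ p, ∑ a, ∑ q,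
                K k b * (K p j * wd (-1) b (fun w => H w j q) z * K q a * ric H z a p) :=
                Finset.sum_comm
            _ = _ := Finset.sum_congr rfl fun b _ => Finset.sum_comm
      _ = ∑ b, ∑ j, ∑ a, ∑ p, ∑ q,
          K k b * (K p j * wd (-1) b (fun w => H w j q) z * K q a * ric H z a p) := Finset.sum_comm
      _ = _ := by
          refine Finset.sum_congr rfl fun b _ => ?_
          rw [Finset.sum_comm]
          refine Finset.sum_congr rfl fun a _ => ?_
          rw [Finset.sum_comm]
          refine Finset.sum_congr rfl fun p _ => ?_
          rw [Finset.sum_comm]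
  rw [hA, hB, add_comm]

end LocalKahler

end KahlerBlowup

end

noncomputable section

namespace KahlerBlowup

open Topology

/-! ### The pointwise Bochner identity behind the Matsushima–Lichnerowicz theorem. -/

section Matsushima

variable {m : ℕ} {U : Set (CSpace m)} {H : CSpace m → Matrix (Fin m) (Fin m) ℂ}
  {f g : CSpace m → ℂ} {Y : CSpace m → CSpace m} {z : CSpace m}

theorem hess_conj (hU : IsOpen U) (hf : ContDiffOn ℝ ∞ f U) (hz : z ∈ U) (j k : Fin m) :
    hess (fun w => (starRingEnd ℂ) (f w)) z j k = (starRingEnd ℂ) (hess f z k j) := by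
  have hd (s : ℂ) (l : Fin m) : DifferentiableAt ℝ (wd s l f) z :=
    (contDiffOn_wd hU hf).differentiableAt_of_isOpen hU hz
  have e : wd (-1) j (wd 1 k (fun w => (starRingEnd ℂ) (f w))) z =
      wd (-1) j (fun w => (starRingEnd ℂ) (wd (-1) k f w)) z :=
    wd_congr_on hU hz fun w hw => dzbar_conj (hf.differentiableAt_of_isOpen hU hw)
  rw [hess, e, dz_conj (hd _ _), wd_comm hU hf hz]
  rfl

theorem IsLocalKahler.conj_ric (h : IsLocalKahler U H) (hz : z ∈ U) (j k : Fin m) :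
    (starRingEnd ℂ) (ric H z j k) = ric H z k j := by
  have e : (fun w => (starRingEnd ℂ) (logDet H w)) = logDet H := by
    funext w
    exact Complex.conj_ofReal _
  have h1 := hess_conj h.isOpen h.smooth_logDet hz k j
  rw [e] at h1
  rw [ric, Matrix.neg_apply, Matrix.neg_apply, h1, map_neg]

theorem IsLocalKahler.conj_ricUp (h : IsLocalKahler U H) (hz : z ∈ U) (j k : Fin m) :
    (starRingEnd ℂ) (ricUp H z j k) = ricUp H z k j := by
  have h1 : ∀ A B : Matrix (Fin m) (Fin m) ℂ, (∀ a b, (starRingEnd ℂ) (A a b) = A b a) →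
      (∀ a b, (starRingEnd ℂ) (B a b) = B b a) → ∀ a b,
      (starRingEnd ℂ) ((A * B * A) a b) = (A * B * A) b a := by
    intro A B hA hB a b
    have hA' : A.conjTranspose = A := by ext a b; exact hA b a
    have hB' : B.conjTranspose = B := by ext a b; exact hB b a
    have : (A * B * A).conjTranspose = A * B * A := by
      rw [Matrix.conjTranspose_mul, Matrix.conjTranspose_mul, hA', hB', Matrix.mul_assoc]
    exact congrFun (congrFun this b) a
  exact h1 _ _ (h.conj_inv_apply hz) (h.conj_ric hz) j k

theorem conj_trace_mul_hess (hU : IsOpen U) (hf : ContDiffOn ℝ ∞ f U) (hz : z ∈ U)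
    {A : Matrix (Fin m) (Fin m) ℂ} (hA : ∀ a b, (starRingEnd ℂ) (A a b) = A b a) :
    (A * hess (fun w => (starRingEnd ℂ) (f w)) z).trace = (starRingEnd ℂ) (A * hess f z).trace := by
  rw [trace_mul_eq_sum, trace_mul_eq_sum]
  simp only [map_sum, map_mul, hess_conj hU hf hz, hA]
  exact Finset.sum_comm

/-- `|Δf|² + f̄ ⟨Ric, i∂∂̄f⟩`. -/
def ricciEnergy (H : CSpace m → Matrix (Fin m) (Fin m) ℂ) (f : CSpace m → ℂ) (z : CSpace m) : ℂ :=
  (starRingEnd ℂ) (clap H f z) * clap H f z +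
    (starRingEnd ℂ) (f z) * (ricUp H z * hess f z).trace

/-- The Laplacian and the contraction of the Hessian with the Ricci form are real operators. This
symmetry transfers the vanishing of the integrated Bochner formula from f to its conjugate. -/
theorem ricciEnergy_conj (h : IsLocalKahler U H) (hf : ContDiffOn ℝ ∞ f U) (hz : z ∈ U) :
    ricciEnergy H (fun w => (starRingEnd ℂ) (f w)) z = (starRingEnd ℂ) (ricciEnergy H f z) := by
  have h1 : clap H (fun w => (starRingEnd ℂ) (f w)) z = (starRingEnd ℂ) (clap H f z) :=
    conj_trace_mul_hess h.isOpen hf hz (h.conj_inv_apply hz)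
  rw [ricciEnergy, ricciEnergy, h1, conj_trace_mul_hess h.isOpen hf hz (h.conj_ricUp hz)]
  simp only [map_add, map_mul, Complex.conj_conj]

/-- The integrated Bochner formula for the gradient of a function, before integration. -/
theorem dbarSq_cgrad (h : IsLocalKahler U H) (hf : ContDiffOn ℝ ∞ f U)
    (hs : ∃ s : ℂ, ∀ w ∈ U, ((H w)⁻¹ * ric H w).trace = s) (hz : z ∈ U) :
    dbarSq (cgrad H f) z - ricciEnergy H f z =
      cdiv H (fun w => cconv (cgrad H f) w - (starRingEnd ℂ) (f w) • raise (ricUp H) f w) z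
        + (starRingEnd ℂ)
          (cdiv H (fun w => (- (starRingEnd ℂ) (clap H f w)) • cgrad H f w) z) := by
  have hU := h.isOpen
  have hY := h.smooth_cgrad hf
  have hu := h.smooth_clap hf
  have hZ : SmoothV U (raise (ricUp H) f) := h.smooth_ricUp.raise hU hf
  obtain ⟨s, hs⟩ := hs
  have hsub : cdiv H (fun w => cconv (cgrad H f) w - (starRingEnd ℂ) (f w) • raise (ricUp H) f w) z =
      cdiv H (cconv (cgrad H f)) z -
        cdiv H (fun w => (starRingEnd ℂ) (f w) • raise (ricUp H) f w) z := by
    simp only [cdiv, ← Finset.sum_sub_distrib]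
    refine Finset.sum_congr rfl fun j _ => ?_
    have h1 := (hY.cconv hU j).differentiableAt_of_isOpen hU hz
    have h2 := (hf.conj_complex.mul (hZ j)).differentiableAt_of_isOpen hU hz
    have h3 := wd_add (s := -1) (j := j) h1 h2.fun_neg
    rw [wd_neg] at h3
    simp only [Pi.sub_apply, Pi.smul_apply, smul_eq_mul, sub_eq_add_neg]
    rw [h3]
    ring
  have hneg : cdiv H (fun w => (- (starRingEnd ℂ) (clap H f w)) • cgrad H f w) z =
      - (starRingEnd ℂ) (clap H f z) * clap H f z -
        ∑ j, cgrad H f z j * (starRingEnd ℂ) (wd 1 j (clap H f) z) := by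
    rw [cdiv_smul hU hu.conj_complex.neg hY hz, cdiv_cgrad h hf hz, sub_eq_add_neg,
      ← Finset.sum_neg_distrib]
    congr 1
    refine Finset.sum_congr rfl fun j _ => ?_
    rw [wd_neg, dz_conj (hu.differentiableAt_of_isOpen hU hz)]
    ring
  -- The first order term is the divergence of the Ricci tensor; by the contracted Bianchi identity
  -- it is a gradient of the scalar curvature. This is where constancy of the scalar curvature is
  -- used.
  have hdivZ : cdiv H (raise (ricUp H) f) z = (ricUp H z * hess f z).trace := by
    rw [cdiv_raise hU h.smooth_ricUp hf hz]
    have h0 : ∀ a, wd (-1) a (fun w => ((H w)⁻¹ * ric H w).trace) z = 0 := fun a => by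
      rw [wd_congr_on hU hz hs, wd_const]
    simp only [div_ricUp h hz, h0, mul_zero, zero_mul, Finset.sum_const_zero, add_zero]
  -- The curvature term Ric(Y, Ȳ) of the Bochner formula equals the term arising when the factor f̄
  -- in front of the Ricci field is differentiated, so the two cancel in the final identity.
  have hRic : ∑ j, ∑ l, ric H z j l * cgrad H f z j * (starRingEnd ℂ) (cgrad H f z l) =
      ∑ j, raise (ricUp H) f z j * (starRingEnd ℂ) (wd 1 j f z) := by
    have e1 : ∀ j, raise (ricUp H) f z j =
        ∑ b, ∑ a, cgrad H f z a * ric H z a b * (H z)⁻¹ b j := by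
      intro j
      simp only [raise, cgrad, ricUp, Matrix.mul_apply, Finset.sum_mul]
      refine Finset.sum_comm.trans (Finset.sum_congr rfl fun b _ => ?_)
      refine Finset.sum_comm.trans (Finset.sum_congr rfl fun a _ => ?_)
      refine Finset.sum_congr rfl fun k _ => ?_
      ring
    have e2 : ∀ l, (starRingEnd ℂ) (cgrad H f z l) =
        ∑ j, (H z)⁻¹ l j * (starRingEnd ℂ) (wd 1 j f z) := by
      intro l
      simp only [cgrad, raise, map_sum, map_mul, h.conj_inv_apply hz]
    simp only [e1, e2, Finset.sum_mul, Finset.mul_sum]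
    calc _ = ∑ l, ∑ j, ∑ k, ric H z j l * cgrad H f z j * ((H z)⁻¹ l k *
          (starRingEnd ℂ) (wd 1 k f z)) := Finset.sum_comm
      _ = ∑ l, ∑ k, ∑ j, ric H z j l * cgrad H f z j * ((H z)⁻¹ l k *
          (starRingEnd ℂ) (wd 1 k f z)) := Finset.sum_congr rfl fun _ _ => Finset.sum_comm
      _ = ∑ k, ∑ l, ∑ j, ric H z j l * cgrad H f z j * ((H z)⁻¹ l k *
          (starRingEnd ℂ) (wd 1 k f z)) := Finset.sum_comm
      _ = _ := by
          refine Finset.sum_congr rfl fun j _ => Finset.sum_congr rfl fun b _ =>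
            Finset.sum_congr rfl fun a _ => ?_
          ring
  have hfZ : cdiv H (fun w => (starRingEnd ℂ) (f w) • raise (ricUp H) f w) z =
      (starRingEnd ℂ) (f z) * (ricUp H z * hess f z).trace +
        ∑ j, raise (ricUp H) f z j * (starRingEnd ℂ) (wd 1 j f z) := by
    rw [cdiv_smul hU hf.conj_complex hZ hz, hdivZ]
    congr 1
    refine Finset.sum_congr rfl fun j _ => ?_
    rw [dz_conj (hf.differentiableAt_of_isOpen hU hz)]
  have hB := cdiv_cconv h hY hz
  have hu' : ∀ l, wd 1 l (cdiv H (cgrad H f)) z = wd 1 l (clap H f) z := fun l =>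
    wd_congr_on hU hz fun w hw => cdiv_cgrad h hf hw
  simp only [hu'] at hB
  rw [hsub, hneg, hfZ, hB, hRic, ricciEnergy]
  simp only [map_sub, map_neg, map_mul, map_sum, Complex.conj_conj]
  ring

open scoped MatrixOrder Matrix.Norms.L2Operator ComplexOrder in
-- Positive elements of a C*-algebra have the form B^*B; the factor is invertible because the
-- determinant of K is.
theorem exists_conjTranspose_mul_self_of_posDef {K : Matrix (Fin m) (Fin m) ℂ} (hK : K.PosDef) :
    ∃ B : Matrix (Fin m) (Fin m) ℂ, IsUnit B ∧ K = B.conjTranspose * B := by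
  obtain ⟨B, hB⟩ := CStarAlgebra.nonneg_iff_eq_star_mul_self.1 hK.posSemidef.nonneg
  refine ⟨B, ?_, hB⟩
  have h1 : IsUnit (B.conjTranspose.det * B.det) := by
    rw [← Matrix.det_mul]
    exact (Matrix.isUnit_iff_isUnit_det _).1 (hB ▸ hK.isUnit)
  exact (Matrix.isUnit_iff_isUnit_det _).2 (isUnit_of_mul_isUnit_right h1)

open scoped ComplexOrder in
-- For a general field tr(∂̄Y · conj ∂̄Y) has no sign. For a gradient, lowering an index turns ∂̄Y
-- into the (0,2)-Hessian of g, which is symmetric by symmetry of second derivatives and the Kähler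
-- identity. Writing H⁻¹ = B^*B, the trace becomes the squared Hilbert–Schmidt norm of a matrix C
-- equivalent to that Hessian.
theorem dbarSq_nonneg (h : IsLocalKahler U H) (hg : ContDiffOn ℝ ∞ g U) (hz : z ∈ U) :
    0 ≤ dbarSq (cgrad H g) z ∧
      (dbarSq (cgrad H g) z = 0 → ∀ j l, wd 1 l (fun w => cgrad H g w j) z = 0) := by
  have hU := h.isOpen
  have hY := h.smooth_cgrad hg
  have hdH (j k : Fin m) := h.smooth.differentiableAt hU hz j k
  have hdY (j : Fin m) := (hY j).differentiableAt_of_isOpen hU hz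
  have h1 : ∀ w ∈ U, ∀ q, ∑ j, cgrad H g w j * H w j q = wd 1 q g w := by
    intro w hw q
    have h2 : (H w)⁻¹ * H w = 1 :=
      Matrix.nonsing_inv_mul _ (isUnit_iff_ne_zero.2 (h.det_ne_zero hw))
    have h3 : ∀ k, ∑ j, (H w)⁻¹ k j * H w j q = (1 : Matrix (Fin m) (Fin m) ℂ) k q := fun k => by
      rw [← h2]; rfl
    simp only [cgrad, raise, Finset.sum_mul]
    refine Finset.sum_comm.trans ?_
    calc _ = ∑ k, wd 1 k g w * ∑ j, (H w)⁻¹ k j * H w j q := by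
          simp only [Finset.mul_sum]
          refine Finset.sum_congr rfl fun k _ => Finset.sum_congr rfl fun j _ => ?_
          ring
      _ = _ := by
          simp only [h3]
          simp [Matrix.one_apply]
  let P : Matrix (Fin m) (Fin m) ℂ := fun l j => wd 1 l (fun w => cgrad H g w j) z
  have h2 : ∀ l q, (P * H z) l q = wd 1 l (wd 1 q g) z -
      ∑ j, cgrad H g z j * wd 1 l (fun w => H w j q) z := by
    intro l q
    have e : wd 1 l (wd 1 q g) z = wd 1 l (fun w => ∑ j, cgrad H g w j * H w j q) z :=
      wd_congr_on hU hz fun w hw => (h1 w hw q).symm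
    rw [e, wd_sum _ fun j _ => (hdY j).fun_mul (hdH j q), eq_sub_iff_add_eq, Matrix.mul_apply,
      ← Finset.sum_add_distrib]
    exact Finset.sum_congr rfl fun j _ => (wd_mul (hdY j) (hdH j q)).symm
  have hsymm : (P * H z).transpose = P * H z := by
    ext l q
    rw [Matrix.transpose_apply, h2, h2, wd_comm hU hg hz]
    congr 1
    exact Finset.sum_congr rfl fun j _ => by rw [h.kahler_conj hz]
  have hKpos := (h.posDef z hz).inv
  obtain ⟨B, hBu, hB⟩ := exists_conjTranspose_mul_self_of_posDef hKpos
  set A := P * H z with hA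
  have hPA : P = A * (H z)⁻¹ := by
    rw [hA, Matrix.mul_assoc,
      Matrix.mul_nonsing_inv _ (isUnit_iff_ne_zero.2 (h.det_ne_zero hz)), Matrix.mul_one]
  let C : Matrix (Fin m) (Fin m) ℂ := B.conjTranspose.transpose * A * B.conjTranspose
  have hC : C.conjTranspose = B * A.conjTranspose * B.transpose := by
    simp only [C, Matrix.conjTranspose_mul, Matrix.conjTranspose_conjTranspose, Matrix.mul_assoc]
    have e : B.conjTranspose.transpose.conjTranspose = B.transpose := by
      ext a b
      simp
    rw [e]
  have hPc : P.conjTranspose.transpose = A.conjTranspose * (B.transpose * B.conjTranspose.transpose) := by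
    have h3 : P.conjTranspose.transpose = A.conjTranspose.transpose *
        (H z)⁻¹.conjTranspose.transpose := by
      rw [hPA, Matrix.conjTranspose_mul, Matrix.transpose_mul]
    have h4 : A.conjTranspose.transpose = A.conjTranspose := by
      conv_rhs => rw [← hsymm]
      rfl
    rw [h3, h4, hKpos.isHermitian.eq, hB, Matrix.transpose_mul]
  have htr : dbarSq (cgrad H g) z = (C * C.conjTranspose).trace := by
    have h5 : dbarSq (cgrad H g) z = (P * P.conjTranspose.transpose).trace := by
      rw [trace_mul_eq_sum]
      refine Finset.sum_congr rfl fun j _ => Finset.sum_congr rfl fun l _ => ?_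
      rw [mul_comm]
      rfl
    rw [h5, hPc, hPA, hC, hB]
    simp only [C]
    rw [Matrix.trace_mul_comm]
    simp only [Matrix.mul_assoc]
    rw [Matrix.trace_mul_comm]
    simp only [Matrix.mul_assoc]
    rw [Matrix.trace_mul_comm]
    simp only [Matrix.mul_assoc]
  refine ⟨?_, fun h0 => ?_⟩
  · rw [htr]
    exact (Matrix.posSemidef_self_mul_conjTranspose C).trace_nonneg
  · rw [htr, Matrix.trace_mul_conjTranspose_self_eq_zero_iff] at h0
    have hBu1 : IsUnit B.conjTranspose := hBu.star
    have hBu2 : IsUnit B.conjTranspose.transpose := by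
      rw [Matrix.isUnit_transpose]; exact hBu1
    have hA0 : A = 0 := by
      have h6 := (hBu1.mul_left_eq_zero).1 h0
      exact (hBu2.mul_right_eq_zero).1 h6
    intro j l
    have hP0 : P = 0 := by rw [hPA, hA0, Matrix.zero_mul]
    exact congrFun (congrFun hP0 l) j

end Matsushima

end KahlerBlowup

end

noncomputable section

namespace KahlerBlowup

open Topology

/-! ### Invariance of the local constructions under holomorphic isometries. -/

section Naturality

variable {m : ℕ} {U U' V : Set (CSpace m)} {H H' : CSpace m → Matrix (Fin m) (Fin m) ℂ}
  {f g : CSpace m → ℂ} {Y Y' : CSpace m → CSpace m} {τ : CSpace m → CSpace m} {z : CSpace m}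

/-- The complex Jacobian matrix. -/
def jac (τ : CSpace m → CSpace m) (z : CSpace m) : Matrix (Fin m) (Fin m) ℂ :=
  cmat (fderiv ℂ τ z)

/-- The entrywise complex conjugate of a matrix. -/
def bar (A : Matrix (Fin m) (Fin m) ℂ) : Matrix (Fin m) (Fin m) ℂ := A.map (starRingEnd ℂ)

theorem bar_mul (A B : Matrix (Fin m) (Fin m) ℂ) : bar (A * B) = bar A * bar B := Matrix.map_mul

theorem det_bar (A : Matrix (Fin m) (Fin m) ℂ) : (bar A).det = (starRingEnd ℂ) A.det :=
  ((starRingEnd ℂ).map_det A).symm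

theorem IsLocalKahler.mono (h : IsLocalKahler U H) (hV : IsOpen V) (hVU : V ⊆ U) :
    IsLocalKahler V H :=
  ⟨hV, fun j k => (h.smooth j k).mono hVU, fun z hz => h.posDef z (hVU hz),
    fun z hz => h.kahler z (hVU hz)⟩

/-- A holomorphic local isometry. -/
structure IsHolIsometry (U : Set (CSpace m)) (H : CSpace m → Matrix (Fin m) (Fin m) ℂ)
    (U' : Set (CSpace m)) (H' : CSpace m → Matrix (Fin m) (Fin m) ℂ) (τ : CSpace m → CSpace m) :
    Prop where
  left : IsLocalKahler U H
  right : IsLocalKahler U' H'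
  hol : AnalyticOnNhd ℂ τ U
  maps : Set.MapsTo τ U U'
  metric : ∀ z ∈ U, H z = (jac τ z).transpose * H' (τ z) * bar (jac τ z)

namespace IsHolIsometry

variable (h : IsHolIsometry U H U' H' τ)
include h

theorem differentiableAt (hz : z ∈ U) : DifferentiableAt ℂ τ z := (h.hol z hz).differentiableAt

theorem differentiableAt_jac (hz : z ∈ U) (a j : Fin m) :
    DifferentiableAt ℂ (fun w => jac τ w a j) z := by
  have h1 : DifferentiableAt ℂ (fderiv ℂ τ) z := (h.hol z hz).fderiv.differentiableAt
  have h2 : DifferentiableAt ℂ (fun w => fderiv ℂ τ w (Pi.single j 1)) z :=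
    h1.clm_apply (differentiableAt_const _)
  exact differentiableAt_pi.1 h2 a

theorem det_eq (hz : z ∈ U) :
    (H z).det = (jac τ z).det * (H' (τ z)).det * (starRingEnd ℂ) (jac τ z).det := by
  rw [h.metric z hz, Matrix.det_mul, Matrix.det_mul, Matrix.det_transpose, det_bar]

theorem det_jac_ne_zero (hz : z ∈ U) : (jac τ z).det ≠ 0 := by
  intro h0
  have := h.left.det_ne_zero hz
  rw [h.det_eq hz, h0, zero_mul, zero_mul] at this
  exact this rfl

theorem isUnit_jac (hz : z ∈ U) : IsUnit (jac τ z).det := isUnit_iff_ne_zero.2 (h.det_jac_ne_zero hz)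

theorem isUnit_bar (hz : z ∈ U) : IsUnit (bar (jac τ z)).det := by
  rw [det_bar]
  exact (h.isUnit_jac hz).map (starRingEnd ℂ)

theorem differentiableAt_conj_jac (hz : z ∈ U) (a j : Fin m) :
    DifferentiableAt ℝ (fun w => (starRingEnd ℂ) (jac τ w a j)) z :=
  (Complex.conjCLE : ℂ →L[ℝ] ℂ).differentiableAt.comp z
    ((h.differentiableAt_jac hz a j).restrictScalars ℝ)

theorem smooth_comp (hf : ContDiffOn ℝ ∞ f U') : ContDiffOn ℝ ∞ (f ∘ τ) U := by
  intro z hz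
  have h1 : ContDiffAt ℝ ∞ τ z := ((h.hol z hz).contDiffAt (n := ∞)).restrict_scalars ℝ
  have h2 : ContDiffAt ℝ ∞ f (τ z) := hf.contDiffAt (h.right.isOpen.mem_nhds (h.maps hz))
  exact (h2.comp z h1).contDiffWithinAt

theorem wd_comp (hf : ContDiffOn ℝ ∞ f U') (hz : z ∈ U) (k : Fin m) :
    wd 1 k (f ∘ τ) z = ∑ a, wd 1 a f (τ z) * (starRingEnd ℂ) (jac τ z a k) :=
  dzbar_comp (hf.differentiableAt_of_isOpen h.right.isOpen (h.maps hz)) (h.differentiableAt hz)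

/-- The conjugate Jacobian produced by ∂̄ is antiholomorphic and is not seen by ∂, so no first order
term appears. -/
theorem hess_comp (hf : ContDiffOn ℝ ∞ f U') (hz : z ∈ U) :
    hess (f ∘ τ) z = (jac τ z).transpose * hess f (τ z) * bar (jac τ z) := by
  have hU := h.left.isOpen
  ext j k
  have hdf (a : Fin m) : DifferentiableAt ℝ (wd 1 a f) (τ z) :=
    (contDiffOn_wd h.right.isOpen hf).differentiableAt_of_isOpen h.right.isOpen (h.maps hz)
  have hdfc (a : Fin m) : DifferentiableAt ℝ (fun w => wd 1 a f (τ w)) z :=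
    (hdf a).comp z ((h.differentiableAt hz).restrictScalars ℝ)
  have e : wd (-1) j (wd 1 k (f ∘ τ)) z =
      wd (-1) j (fun w => ∑ a, wd 1 a f (τ w) * (starRingEnd ℂ) (jac τ w a k)) z :=
    wd_congr_on hU hz fun w hw => h.wd_comp hf hw k
  have e2 : ∀ a, wd (-1) j (fun w => wd 1 a f (τ w)) z =
      ∑ b, hess f (τ z) b a * jac τ z b j := fun a => dz_comp (hdf a) (h.differentiableAt hz)
  rw [hess, e, wd_sum _ fun a _ => (hdfc a).fun_mul (h.differentiableAt_conj_jac hz a k),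
    Matrix.mul_apply]
  refine Finset.sum_congr rfl fun a _ => ?_
  rw [wd_mul (hdfc a) (h.differentiableAt_conj_jac hz a k),
    dz_conj ((h.differentiableAt_jac hz a k).restrictScalars ℝ),
    dzbar_eq_zero (h.differentiableAt_jac hz a k), map_zero, mul_zero, add_zero, e2,
    Matrix.mul_apply]
  congr 1
  exact Finset.sum_congr rfl fun b _ => mul_comm _ _

/-- The determinant of the metric is multiplied by the squared modulus of the holomorphic Jacobian
determinant, which is nonzero. -/
theorem logDet_eq (hz : z ∈ U) :
    logDet H z = logDet H' (τ z) + (Real.log (Complex.normSq (jac τ z).det) : ℂ) := by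
  have h1 := (h.right.det_pos (h.maps hz))
  have h2 : (H z).det.re = (H' (τ z)).det.re * Complex.normSq (jac τ z).det := by
    have h3 : (H z).det = (((H' (τ z)).det.re * Complex.normSq (jac τ z).det : ℝ) : ℂ) := by
      rw [h.det_eq hz, mul_right_comm, Complex.mul_conj, mul_comm]
      conv_lhs => rw [h1.2]
      push_cast
      rfl
    rw [h3, Complex.ofReal_re]
  rw [logDet, logDet, h2, Real.log_mul h1.1.ne' (by simpa using h.det_jac_ne_zero hz)]
  push_cast
  rfl

end IsHolIsometry

theorem _root_.DifferentiableAt.det_complex {E : Type*} [NormedAddCommGroup E] [NormedSpace ℂ E]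
    {A : E → Matrix (Fin m) (Fin m) ℂ} {x : E} (hA : ∀ a j, DifferentiableAt ℂ (fun w => A w a j) x) :
    DifferentiableAt ℂ (fun w => (A w).det) x := by
  simp only [Matrix.det_apply]
  refine DifferentiableAt.fun_sum fun σ _ => ?_
  refine DifferentiableAt.const_smul ?_ _
  exact (HasFDerivAt.finsetProd fun i _ => (hA (σ i) i).hasFDerivAt).differentiableAt

/-- The logarithm of the square of the absolute value of a holomorphic function is
pluriharmonic. -/
theorem hess_log_normSq (hU : IsOpen U) (hg : ∀ w ∈ U, DifferentiableAt ℂ g w)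
    (hg0 : ∀ w ∈ U, g w ≠ 0) (hz : z ∈ U) :
    hess (fun w => (Real.log (Complex.normSq (g w)) : ℂ)) z = 0 := by
  have hgr : ∀ w ∈ U, DifferentiableAt ℝ g w := fun w hw => (hg w hw).restrictScalars ℝ
  -- The first ∂̄-derivative is the conjugate of the holomorphic function (∂_k g)/g, so the
  -- following ∂-derivative is zero.
  have h1 : ∀ w ∈ U, ∀ k, wd 1 k (fun w => (Real.log (Complex.normSq (g w)) : ℂ)) w =
      (starRingEnd ℂ) ((g w)⁻¹ * wd (-1) k g w) := by
    intro w hw k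
    have hN : Complex.normSq (g w) ≠ 0 := by simpa using hg0 w hw
    have hr : DifferentiableAt ℝ (fun w => Complex.normSq (g w)) w := by
      simp only [Complex.normSq_apply]
      have h1 : DifferentiableAt ℝ (fun w => (g w).re) w :=
        Complex.reCLM.differentiableAt.comp w (hgr w hw)
      have h2 : DifferentiableAt ℝ (fun w => (g w).im) w :=
        Complex.imCLM.differentiableAt.comp w (hgr w hw)
      exact (h1.fun_mul h1).fun_add (h2.fun_mul h2)
    have hl : HasFDerivAt (fun w => (Real.log (Complex.normSq (g w)) : ℂ))
        (Complex.ofRealCLM.comp ((Complex.normSq (g w))⁻¹ •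
          fderiv ℝ (fun w => Complex.normSq (g w)) w)) w :=
      Complex.ofRealCLM.hasFDerivAt.comp w (hr.hasFDerivAt.log hN)
    have hc : HasFDerivAt (fun w => (Complex.normSq (g w) : ℂ))
        (Complex.ofRealCLM.comp (fderiv ℝ (fun w => Complex.normSq (g w)) w)) w :=
      Complex.ofRealCLM.hasFDerivAt.comp w hr.hasFDerivAt
    have e1 : wd 1 k (fun w => (Real.log (Complex.normSq (g w)) : ℂ)) w =
        (Complex.normSq (g w) : ℂ)⁻¹ * wd 1 k (fun w => (Complex.normSq (g w) : ℂ)) w := by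
      rw [wd, wd, hl.fderiv, hc.fderiv]
      simp
      ring
    have e2 : (fun w => (Complex.normSq (g w) : ℂ)) = fun w => g w * (starRingEnd ℂ) (g w) := by
      funext w
      rw [Complex.mul_conj]
    have hgc : DifferentiableAt ℝ (fun w => (starRingEnd ℂ) (g w)) w :=
      (Complex.conjCLE : ℂ →L[ℝ] ℂ).differentiableAt.comp w (hgr w hw)
    rw [e1, e2, wd_mul (hgr w hw) hgc, dzbar_eq_zero (hg w hw), dzbar_conj (hgr w hw),
      ← Complex.mul_conj, map_mul, map_inv₀]
    have := hg0 w hw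
    field_simp
    ring
  ext j k
  have hdg : DifferentiableAt ℂ (fun w => (g w)⁻¹ * fderiv ℂ g w (Pi.single k 1)) z := by
    have hg' : AnalyticAt ℂ g z := analyticAt_of_eventually_differentiableAt
      (Filter.eventually_of_mem (hU.mem_nhds hz) hg)
    exact ((hg z hz).fun_inv (hg0 z hz)).fun_mul
      (hg'.fderiv.differentiableAt.clm_apply (differentiableAt_const _))
  have e : wd (-1) j (wd 1 k (fun w => (Real.log (Complex.normSq (g w)) : ℂ))) z =
      wd (-1) j (fun w => (starRingEnd ℂ) ((g w)⁻¹ * fderiv ℂ g w (Pi.single k 1))) z :=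
    wd_congr_on hU hz fun w hw => by rw [h1 w hw k, dz_eq_fderiv (hg w hw)]
  rw [hess, e, dz_conj (hdg.restrictScalars ℝ), dzbar_eq_zero hdg, map_zero]
  rfl

namespace IsHolIsometry

variable (h : IsHolIsometry U H U' H' τ)
include h

/-- The two volume densities differ by the logarithm of the squared modulus of a holomorphic
function, whose complex Hessian vanishes by `hess_log_normSq`. -/
theorem ric_comp (hz : z ∈ U) :
    ric H z = (jac τ z).transpose * ric H' (τ z) * bar (jac τ z) := by
  have hU := h.left.isOpen
  have hg : ∀ w ∈ U, DifferentiableAt ℂ (fun w => (jac τ w).det) w := fun w hw =>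
    DifferentiableAt.det_complex fun a j => h.differentiableAt_jac hw a j
  have hL := h.smooth_comp h.right.smooth_logDet
  have hlog : ∀ w ∈ U, (Real.log (Complex.normSq (jac τ w).det) : ℂ) =
      logDet H w - (logDet H' ∘ τ) w := fun w hw => by
    rw [h.logDet_eq hw, Function.comp, add_sub_cancel_left]
  have h0 := hess_log_normSq hU hg (fun w hw => h.det_jac_ne_zero hw) hz
  have h1 : hess (logDet H) z = hess (logDet H' ∘ τ) z := by
    ext j k
    have e1 : wd (-1) j (wd 1 k (fun w => (Real.log (Complex.normSq (jac τ w).det) : ℂ))) z =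
        wd (-1) j (wd 1 k (fun w => logDet H w + - (logDet H' ∘ τ) w)) z :=
      wd_congr_on hU hz fun w hw => wd_congr_on hU hw fun v hv => by
        rw [hlog v hv, sub_eq_add_neg]
    have e2 : wd (-1) j (wd 1 k (fun w => logDet H w + - (logDet H' ∘ τ) w)) z =
        wd (-1) j (fun w => wd 1 k (logDet H) w + - wd 1 k (logDet H' ∘ τ) w) z :=
      wd_congr_on hU hz fun w hw => by
        rw [wd_add (h.left.smooth_logDet.differentiableAt_of_isOpen hU hw)
          (hL.differentiableAt_of_isOpen hU hw).fun_neg, wd_neg]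
    rw [wd_add ((contDiffOn_wd hU h.left.smooth_logDet).differentiableAt_of_isOpen hU hz)
      ((contDiffOn_wd hU hL).differentiableAt_of_isOpen hU hz).fun_neg, wd_neg] at e2
    have e3 := congrFun (congrFun h0 j) k
    rw [hess, e1, e2] at e3
    exact add_neg_eq_zero.1 e3
  rw [ric, ric, h1, h.hess_comp h.right.smooth_logDet hz,
    Matrix.mul_neg, Matrix.neg_mul]

theorem inv_eq (hz : z ∈ U) :
    (H z)⁻¹ = (bar (jac τ z))⁻¹ * (H' (τ z))⁻¹ * ((jac τ z).transpose)⁻¹ := by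
  rw [h.metric z hz, Matrix.mul_inv_rev, Matrix.mul_inv_rev, Matrix.mul_assoc]

theorem inv_mul_eq (hz : z ∈ U) {A A' : Matrix (Fin m) (Fin m) ℂ}
    (hA : A = (jac τ z).transpose * A' * bar (jac τ z)) :
    (H z)⁻¹ * A = (bar (jac τ z))⁻¹ * ((H' (τ z))⁻¹ * A') * bar (jac τ z) := by
  have hJ : IsUnit (jac τ z).transpose.det := by
    rw [Matrix.det_transpose]; exact h.isUnit_jac hz
  rw [h.inv_eq hz, hA]
  simp only [Matrix.mul_assoc]
  rw [Matrix.nonsing_inv_mul_cancel_left _ _ hJ]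

/-- For any tensor transforming like the metric, H⁻¹A changes by conjugation with the conjugate
Jacobian. It covers both the scalar curvature and the Laplacian. -/
theorem trace_eq (hz : z ∈ U) {A A' : Matrix (Fin m) (Fin m) ℂ}
    (hA : A = (jac τ z).transpose * A' * bar (jac τ z)) :
    ((H z)⁻¹ * A).trace = ((H' (τ z))⁻¹ * A').trace := by
  rw [h.inv_mul_eq hz hA, Matrix.trace_mul_comm, ← Matrix.mul_assoc,
    Matrix.mul_nonsing_inv _ (h.isUnit_bar hz), Matrix.one_mul]

theorem trace_ric (hz : z ∈ U) :
    ((H z)⁻¹ * ric H z).trace = ((H' (τ z))⁻¹ * ric H' (τ z)).trace :=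
  h.trace_eq hz (h.ric_comp hz)

theorem clap_comp (hf : ContDiffOn ℝ ∞ f U') (hz : z ∈ U) : clap H (f ∘ τ) z = clap H' f (τ z) :=
  h.trace_eq hz (h.hess_comp hf hz)

theorem ricUp_eq (hz : z ∈ U) :
    ricUp H z = (bar (jac τ z))⁻¹ * ricUp H' (τ z) * ((jac τ z).transpose)⁻¹ := by
  rw [ricUp, h.inv_mul_eq hz (h.ric_comp hz), h.inv_eq hz, ricUp]
  simp only [Matrix.mul_assoc]
  rw [Matrix.mul_nonsing_inv_cancel_left _ _ (h.isUnit_bar hz)]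

theorem ricciEnergy_comp (hf : ContDiffOn ℝ ∞ f U') (hz : z ∈ U) :
    ricciEnergy H (f ∘ τ) z = ricciEnergy H' f (τ z) := by
  have h1 : (ricUp H z * hess (f ∘ τ) z).trace = (ricUp H' (τ z) * hess f (τ z)).trace := by
    have hJ : IsUnit (jac τ z).transpose.det := by
      rw [Matrix.det_transpose]; exact h.isUnit_jac hz
    rw [h.ricUp_eq hz, h.hess_comp hf hz]
    simp only [Matrix.mul_assoc]
    rw [Matrix.nonsing_inv_mul_cancel_left _ _ hJ, Matrix.trace_mul_comm]
    simp only [Matrix.mul_assoc]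
    rw [Matrix.mul_nonsing_inv _ (h.isUnit_bar hz), Matrix.mul_one]
  rw [ricciEnergy, ricciEnergy, h1, h.clap_comp hf hz]
  rfl

/-- The conjugate Jacobian from the chain rule for ∂̄f cancels against the one in the transformation
of S; the holomorphic factor that remains is the push-forward. It serves S = H⁻¹ and the raised
Ricci tensor. -/
theorem raise_comp {S S' : CSpace m → Matrix (Fin m) (Fin m) ℂ} (hf : ContDiffOn ℝ ∞ f U')
    (hz : z ∈ U) (hS : S z = (bar (jac τ z))⁻¹ * S' (τ z) * ((jac τ z).transpose)⁻¹) :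
    (jac τ z).mulVec (raise S (f ∘ τ) z) = raise S' f (τ z) := by
  have e1 : ∀ (S : CSpace m → Matrix (Fin m) (Fin m) ℂ) (f : CSpace m → ℂ) z,
      raise S f z = (S z).transpose.mulVec fun k => wd 1 k f z := fun _ _ _ => rfl
  have e2 : (fun k => wd 1 k (f ∘ τ) z) =
      (bar (jac τ z)).transpose.mulVec fun a => wd 1 a f (τ z) := by
    funext k
    rw [h.wd_comp hf hz]
    exact Finset.sum_congr rfl fun a _ => mul_comm _ _
  have hb : IsUnit (bar (jac τ z)).transpose.det := by
    rw [Matrix.det_transpose]; exact h.isUnit_bar hz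
  rw [e1, e1, e2, hS, Matrix.transpose_mul, Matrix.transpose_mul, Matrix.transpose_nonsing_inv,
    Matrix.transpose_nonsing_inv, Matrix.transpose_transpose, Matrix.mulVec_mulVec,
    Matrix.mulVec_mulVec, Matrix.mul_assoc, Matrix.mul_assoc, Matrix.mul_assoc,
    Matrix.nonsing_inv_mul _ hb, Matrix.mul_one,
    Matrix.mul_nonsing_inv_cancel_left _ _ (h.isUnit_jac hz)]

theorem cgrad_comp (hf : ContDiffOn ℝ ∞ f U') (hz : z ∈ U) :
    (jac τ z).mulVec (cgrad H (f ∘ τ) z) = cgrad H' f (τ z) :=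
  h.raise_comp hf hz (h.inv_eq hz)

theorem raise_ricUp_comp (hf : ContDiffOn ℝ ∞ f U') (hz : z ∈ U) :
    (jac τ z).mulVec (raise (ricUp H) (f ∘ τ) z) = raise (ricUp H') f (τ z) :=
  h.raise_comp hf hz (h.ricUp_eq hz)

/-- Antiholomorphic derivatives of related vector fields. -/
theorem sum_jac_mul_wd (hY : SmoothV U Y) (hY' : SmoothV U' Y')
    (hYY' : ∀ w ∈ U, (jac τ w).mulVec (Y w) = Y' (τ w)) (hz : z ∈ U) (b l : Fin m) :
    ∑ j, jac τ z b j * wd 1 l (fun w => Y w j) z =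
      ∑ a, wd 1 a (fun w => Y' w b) (τ z) * (starRingEnd ℂ) (jac τ z a l) := by
  have hU := h.left.isOpen
  rw [← h.wd_comp (hY' b) hz l]
  have e : wd 1 l ((fun w => Y' w b) ∘ τ) z = wd 1 l (fun w => ∑ j, jac τ w b j * Y w j) z :=
    wd_congr_on hU hz fun w hw => (congrFun (hYY' w hw) b).symm
  have hd (j : Fin m) : DifferentiableAt ℝ (fun w => jac τ w b j) z :=
    (h.differentiableAt_jac hz b j).restrictScalars ℝ
  have hdY (j : Fin m) : DifferentiableAt ℝ (fun w => Y w j) z :=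
    (hY j).differentiableAt_of_isOpen hU hz
  rw [e, wd_sum _ fun j _ => (hd j).fun_mul (hdY j)]
  refine Finset.sum_congr rfl fun j _ => ?_
  rw [wd_mul (hd j) (hdY j), dzbar_eq_zero (h.differentiableAt_jac hz b j), zero_mul, zero_add]

theorem cconv_comp (hY : SmoothV U Y) (hY' : SmoothV U' Y')
    (hYY' : ∀ w ∈ U, (jac τ w).mulVec (Y w) = Y' (τ w)) (hz : z ∈ U) :
    (jac τ z).mulVec (cconv Y z) = cconv Y' (τ z) := by
  funext b
  have e : ∀ a, Y' (τ z) a = ∑ l, jac τ z a l * Y z l := fun a => (congrFun (hYY' z hz) a).symm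
  have e1 : (jac τ z).mulVec (cconv Y z) b =
      ∑ l, (starRingEnd ℂ) (Y z l) * ∑ j, jac τ z b j * wd 1 l (fun w => Y w j) z := by
    simp only [Matrix.mulVec, dotProduct, cconv, Finset.mul_sum]
    refine Finset.sum_comm.trans (Finset.sum_congr rfl fun l _ => Finset.sum_congr rfl fun j _ => ?_)
    ring
  rw [e1]
  simp only [h.sum_jac_mul_wd hY hY' hYY' hz, cconv, e, map_sum, map_mul, Finset.mul_sum,
    Finset.sum_mul]
  refine Finset.sum_comm.trans (Finset.sum_congr rfl fun l _ => Finset.sum_congr rfl fun j _ => ?_)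
  ring

/-- With E the matrix of ∂̄Y, the change of coordinates is E' = J E J̄⁻¹, and tr(E Ē) is invariant
under such twisted conjugation. -/
theorem dbarSq_comp (hY : SmoothV U Y) (hY' : SmoothV U' Y')
    (hYY' : ∀ w ∈ U, (jac τ w).mulVec (Y w) = Y' (τ w)) (hz : z ∈ U) :
    dbarSq Y z = dbarSq Y' (τ z) := by
  let E : Matrix (Fin m) (Fin m) ℂ := fun j l => wd 1 l (fun w => Y w j) z
  let E' : Matrix (Fin m) (Fin m) ℂ := fun j l => wd 1 l (fun w => Y' w j) (τ z)
  have h1 : jac τ z * E = E' * bar (jac τ z) := by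
    ext b l
    exact h.sum_jac_mul_wd hY hY' hYY' hz b l
  have h2 : dbarSq Y z = (E * bar E).trace := by
    rw [trace_mul_eq_sum]
    refine Finset.sum_comm.trans (Finset.sum_congr rfl fun j _ => Finset.sum_congr rfl fun l _ => ?_)
    rw [mul_comm]
    rfl
  have h3 : dbarSq Y' (τ z) = (E' * bar E').trace := by
    rw [trace_mul_eq_sum]
    refine Finset.sum_comm.trans (Finset.sum_congr rfl fun j _ => Finset.sum_congr rfl fun l _ => ?_)
    rw [mul_comm]
    rfl
  have hbb : ∀ A : Matrix (Fin m) (Fin m) ℂ, bar (bar A) = A := fun A => by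
    ext a b
    exact Complex.conj_conj _
  have h4 : bar (jac τ z) * bar E = bar E' * jac τ z := by
    rw [← bar_mul, h1, bar_mul, hbb]
  have h5 : E = (jac τ z)⁻¹ * (E' * bar (jac τ z)) := by
    rw [← h1, Matrix.nonsing_inv_mul_cancel_left _ _ (h.isUnit_jac hz)]
  rw [h2, h3, h5, Matrix.mul_assoc, Matrix.mul_assoc, ← h5, h4, Matrix.trace_mul_comm]
  simp only [Matrix.mul_assoc]
  rw [Matrix.mul_nonsing_inv _ (h.isUnit_jac hz), Matrix.mul_one]

end IsHolIsometry

end Naturality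

end KahlerBlowup

end

noncomputable section

namespace KahlerBlowup

open Topology

/-! ### The underlying real manifold of a complex manifold. -/

section RealStructure

variable {m : ℕ} {M : Type*} [TopologicalSpace M] [ChartedSpace (CSpace m) M]

/-- The real analytic manifold underlying a complex manifold. -/
instance isManifold_real [IsManifold 𝓘(ℂ, CSpace m) ω M] : IsManifold 𝓘(ℝ, CSpace m) ω M := by
  refine isManifold_of_contDiffOn _ _ _ fun e e' he he' => ?_
  have h := (contDiffGroupoid ω 𝓘(ℂ, CSpace m)).compatible he he'
  have h1 : ContDiffOn ℂ ω (e.symm ≫ₕ e') (e.symm ≫ₕ e').source := by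
    have h2 := (contDiffGroupoid ω 𝓘(ℂ, CSpace m)).compatible he he'
    rw [contDiffGroupoid, mem_groupoid_of_pregroupoid] at h2
    have h3 := h2.1
    simpa [contDiffPregroupoid] using h3
  simpa using h1.restrict_scalars ℝ

variable {φ : M → M}

theorem mfderiv_real_eq {x : M} (h : MDifferentiableAt 𝓘(ℂ, CSpace m) 𝓘(ℂ, CSpace m) φ x)
    (hr : MDifferentiableAt 𝓘(ℝ, CSpace m) 𝓘(ℝ, CSpace m) φ x) (u : CSpace m) :
    (mfderiv 𝓘(ℝ, CSpace m) 𝓘(ℝ, CSpace m) φ x : CSpace m →L[ℝ] CSpace m) u =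
      (mfderiv 𝓘(ℂ, CSpace m) 𝓘(ℂ, CSpace m) φ x : CSpace m →L[ℂ] CSpace m) u := by
  rw [mfderiv_eq_fderiv_inCharts hr, mfderiv_eq_fderiv_inCharts h]
  have h1 : DifferentiableAt ℂ (inCharts (CSpace m) (CSpace m) φ x (φ x))
      (chartAt (CSpace m) x x) := by
    have h2 := h.differentiableWithinAt_writtenInExtChartAt
    simp only [writtenInExtChartAt, extChartAt, OpenPartialHomeomorph.extend,
      modelWithCornersSelf_partialEquiv,
      PartialEquiv.trans_refl, modelWithCornersSelf_coe, Set.range_id,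
      differentiableWithinAt_univ] at h2
    exact h2
  rw [fderiv_real_eq h1]
  rfl

variable [IsManifold 𝓘(ℂ, CSpace m) ω M]

theorem contMDiffAt_real {x : M} (h : ContMDiffAt 𝓘(ℂ, CSpace m) 𝓘(ℂ, CSpace m) ω φ x) :
    ContMDiffAt 𝓘(ℝ, CSpace m) 𝓘(ℝ, CSpace m) ω φ x := by
  have hx := mem_chart_source (CSpace m) x
  have hx' := mem_chart_source (CSpace m) (φ x)
  obtain ⟨h1, h2⟩ := (contMDiffAt_iff_inCharts hx hx').1 h
  exact (contMDiffAt_iff_inCharts hx hx').2 ⟨h1, h2.restrict_scalars ℝ⟩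

theorem contMDiff_real (h : ContMDiff 𝓘(ℂ, CSpace m) 𝓘(ℂ, CSpace m) ω φ) :
    ContMDiff 𝓘(ℝ, CSpace m) 𝓘(ℝ, CSpace m) ω φ := fun x => contMDiffAt_real (h x)

theorem analyticAt_inCharts (h : ContMDiff 𝓘(ℂ, CSpace m) 𝓘(ℂ, CSpace m) ω φ) {c c' : M}
    {z : CSpace m} (hz : z ∈ (chartAt (CSpace m) c).target)
    (hc' : φ ((chartAt (CSpace m) c).symm z) ∈ (chartAt (CSpace m) c').source) :
    AnalyticAt ℂ (inCharts (CSpace m) (CSpace m) φ c c') z := by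
  have h1 := ((contMDiffAt_iff_inCharts ((chartAt (CSpace m) c).map_target hz) hc').1 (h _)).2
  rw [(chartAt (CSpace m) c).right_inv hz] at h1
  exact h1.analyticAt

end RealStructure

/-! ### Pull-back of differential forms and their chart expressions. -/

section Pullback

variable {m : ℕ} {M : Type*} [TopologicalSpace M] [ChartedSpace (CSpace m) M] {k : ℕ}

/-- The pull-back of a differential form. -/
def RealForm.pullback (φ : M → M) (α : RealForm m M k) : RealForm m M k := fun x =>
  (α (φ x)).compContinuousLinearMap (mfderiv 𝓘(ℝ, CSpace m) 𝓘(ℝ, CSpace m) φ x)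

theorem RealForm.congr_point (α : RealForm m M k) {x y : M} (h : x = y)
    (v : Fin k → CSpace m) :
    (α x : CSpace m [⋀^Fin k]→L[ℝ] ℝ) v = (α y : CSpace m [⋀^Fin k]→L[ℝ] ℝ) v := by
  rw [h]

theorem RealForm.pullback_id (α : RealForm m M k) : RealForm.pullback (id : M → M) α = α := by
  funext x
  rw [RealForm.pullback, mfderiv_id]
  rfl

variable [IsManifold 𝓘(ℂ, CSpace m) ω M]

theorem mdifferentiableAt_chart_symm {c : M} {z : CSpace m} (hz : z ∈ (chartAt (CSpace m) c).target) :
    MDifferentiableAt 𝓘(ℝ, CSpace m) 𝓘(ℝ, CSpace m) (chartAt (CSpace m) c).symm z :=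
  ((contMDiffOn_chart_symm (I := 𝓘(ℝ, CSpace m)) (n := 1)).contMDiffAt
    ((chartAt (CSpace m) c).open_target.mem_nhds hz)).mdifferentiableAt one_ne_zero

/-- The composites of φ with the inverse chart at c, and of the inverse chart at c' with the local
expression of φ, agree near z; the chain rule is applied to both. The case of the identity is the
change of charts. -/
theorem RealForm.inChart_pullback (α : RealForm m M k) {φ : M → M} {c c' : M} {z : CSpace m}
    (hφ : ContMDiffAt 𝓘(ℝ, CSpace m) 𝓘(ℝ, CSpace m) 1 φ ((chartAt (CSpace m) c).symm z))
    (hz : z ∈ (chartAt (CSpace m) c).target)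
    (hc' : φ ((chartAt (CSpace m) c).symm z) ∈ (chartAt (CSpace m) c').source) :
    (RealForm.pullback φ α).inChart c z =
      (α.inChart c' (inCharts (CSpace m) (CSpace m) φ c c' z)).compContinuousLinearMap
        (fderiv ℝ (inCharts (CSpace m) (CSpace m) φ c c') z) := by
  set τ := inCharts (CSpace m) (CSpace m) φ c c' with hτ
  set e := chartAt (CSpace m) c with he
  set e' := chartAt (CSpace m) c' with he'
  have hφd := hφ.mdifferentiableAt one_ne_zero
  have hed := mdifferentiableAt_chart_symm (c := c) hz
  have hτd : DifferentiableAt ℝ τ z := by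
    have h1 := ((contMDiffAt_iff_inCharts (e.map_target hz) hc').1 hφ).2
    rw [e.right_inv hz] at h1
    exact h1.differentiableAt one_ne_zero
  have hτz : τ z ∈ e'.target := e'.map_source hc'
  have he'd := mdifferentiableAt_chart_symm (c := c') hτz
  have hpt : e'.symm (τ z) = φ (e.symm z) := e'.left_inv hc'
  have h1 : mfderiv 𝓘(ℝ, CSpace m) 𝓘(ℝ, CSpace m) (φ ∘ e.symm) z =
      (mfderiv 𝓘(ℝ, CSpace m) 𝓘(ℝ, CSpace m) φ (e.symm z)).comp
        (mfderiv 𝓘(ℝ, CSpace m) 𝓘(ℝ, CSpace m) e.symm z) := mfderiv_comp z hφd hed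
  have h2 : mfderiv 𝓘(ℝ, CSpace m) 𝓘(ℝ, CSpace m) (e'.symm ∘ τ) z =
      (mfderiv 𝓘(ℝ, CSpace m) 𝓘(ℝ, CSpace m) e'.symm (τ z)).comp
        (mfderiv 𝓘(ℝ, CSpace m) 𝓘(ℝ, CSpace m) τ z) :=
    mfderiv_comp z he'd hτd.mdifferentiableAt
  have h3 : (φ ∘ e.symm) =ᶠ[𝓝 z] (e'.symm ∘ τ) := by
    have hc : ContinuousAt (φ ∘ e.symm) z := hφd.continuousAt.comp hed.continuousAt
    filter_upwards [hc.preimage_mem_nhds (e'.open_source.mem_nhds hc')] with w hw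
    exact (e'.left_inv hw).symm
  have h4 : mfderiv 𝓘(ℝ, CSpace m) 𝓘(ℝ, CSpace m) (φ ∘ e.symm) z =
      mfderiv 𝓘(ℝ, CSpace m) 𝓘(ℝ, CSpace m) (e'.symm ∘ τ) z := h3.mfderiv_eq
  rw [mfderiv_eq_fderiv (f := τ)] at h2
  ext v
  have hv : ∀ u : CSpace m,
      (mfderiv 𝓘(ℝ, CSpace m) 𝓘(ℝ, CSpace m) φ (e.symm z) : CSpace m →L[ℝ] CSpace m)
        ((mfderiv 𝓘(ℝ, CSpace m) 𝓘(ℝ, CSpace m) e.symm z : CSpace m →L[ℝ] CSpace m) u) =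
      (mfderiv 𝓘(ℝ, CSpace m) 𝓘(ℝ, CSpace m) e'.symm (τ z) : CSpace m →L[ℝ] CSpace m)
        (fderiv ℝ τ z u) := fun u => by
    have h5 := h1.symm.trans (h4.trans h2)
    exact congrArg (fun L : CSpace m →L[ℝ] CSpace m => L u) h5
  have hL : (RealForm.pullback φ α).inChart c z v = (α (φ (e.symm z)) : CSpace m [⋀^Fin k]→L[ℝ] ℝ)
      (fun i => (mfderiv 𝓘(ℝ, CSpace m) 𝓘(ℝ, CSpace m) φ (e.symm z) : CSpace m →L[ℝ] CSpace m)
        ((mfderiv 𝓘(ℝ, CSpace m) 𝓘(ℝ, CSpace m) e.symm z : CSpace m →L[ℝ] CSpace m) (v i))) := rfl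
  have hR : ((α.inChart c' (τ z)).compContinuousLinearMap (fderiv ℝ τ z)) v =
      (α (e'.symm (τ z)) : CSpace m [⋀^Fin k]→L[ℝ] ℝ)
      (fun i => (mfderiv 𝓘(ℝ, CSpace m) 𝓘(ℝ, CSpace m) e'.symm (τ z) : CSpace m →L[ℝ] CSpace m)
        (fderiv ℝ τ z (v i))) := rfl
  exact hL.trans ((α.congr_point hpt.symm _).trans ((congrArg
    (α (e'.symm (τ z)) : CSpace m [⋀^Fin k]→L[ℝ] ℝ) (funext fun i => hv (v i))).trans hR.symm))

theorem RealForm.inChart_change (α : RealForm m M k) {c c' : M} {z : CSpace m}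
    (hz : z ∈ (chartAt (CSpace m) c).target)
    (hc' : (chartAt (CSpace m) c).symm z ∈ (chartAt (CSpace m) c').source) :
    α.inChart c z =
      (α.inChart c' (inCharts (CSpace m) (CSpace m) (id : M → M) c c' z)).compContinuousLinearMap
        (fderiv ℝ (inCharts (CSpace m) (CSpace m) (id : M → M) c c') z) := by
  have h := α.inChart_pullback (φ := (id : M → M)) (c := c) (c' := c') contMDiffAt_id hz hc'
  rwa [RealForm.pullback_id] at h

/-- Tangent vectors at x are represented in the preferred chart at x, so the differential of its
inverse at the base point is the identity. -/
theorem RealForm.inChart_self (α : RealForm m M k) (x : M) :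
    α.inChart x (chartAt (CSpace m) x x) = α x := by
  have e : (chartAt (CSpace m) x).symm (chartAt (CSpace m) x x) = x := by simp
  have hd : (mfderiv 𝓘(ℝ, CSpace m) 𝓘(ℝ, CSpace m) (chartAt (CSpace m) x).symm
      (chartAt (CSpace m) x x) : CSpace m →L[ℝ] CSpace m) = ContinuousLinearMap.id ℝ (CSpace m) := by
    have h1 := mdifferentiableAt_chart_symm (c := x) (mem_chart_target (CSpace m) x)
    have h2 := mfderiv_eq_fderiv_inCharts h1
    rw [h2]
    have h3 : inCharts (CSpace m) (CSpace m) (chartAt (CSpace m) x).symm (chartAt (CSpace m) x x)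
        ((chartAt (CSpace m) x).symm (chartAt (CSpace m) x x)) =ᶠ[𝓝 (chartAt (CSpace m) x x)] id := by
      rw [e]
      filter_upwards [(chartAt (CSpace m) x).open_target.mem_nhds (mem_chart_target _ x)] with z hz
      simp [inCharts, hz, chartAt_self_eq]
    rw [chartAt_self_eq]
    exact h3.fderiv_eq.trans fderiv_id
  ext v
  have hL : α.inChart x (chartAt (CSpace m) x x) v =
      (α ((chartAt (CSpace m) x).symm (chartAt (CSpace m) x x)) : CSpace m [⋀^Fin k]→L[ℝ] ℝ)
      (fun i => (mfderiv 𝓘(ℝ, CSpace m) 𝓘(ℝ, CSpace m) (chartAt (CSpace m) x).symm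
      (chartAt (CSpace m) x x) : CSpace m →L[ℝ] CSpace m) (v i)) := rfl
  rw [hL, hd]
  exact α.congr_point e v

/-- The expression of a form in a chart, in terms of its values. -/
theorem RealForm.inChart_eq_apply (α : RealForm m M k) {c : M} {z : CSpace m}
    (hz : z ∈ (chartAt (CSpace m) c).target) :
    α.inChart c z = (α ((chartAt (CSpace m) c).symm z) : CSpace m [⋀^Fin k]→L[ℝ] ℝ).compContinuousLinearMap
        (fderiv ℝ (inCharts (CSpace m) (CSpace m) (id : M → M) c ((chartAt (CSpace m) c).symm z)) z) := by
  rw [α.inChart_change hz (mem_chart_source _ _)]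
  have e : inCharts (CSpace m) (CSpace m) (id : M → M) c ((chartAt (CSpace m) c).symm z) z =
    chartAt (CSpace m) ((chartAt (CSpace m) c).symm z) ((chartAt (CSpace m) c).symm z) := rfl
  rw [e, RealForm.inChart_self]
  rfl

end Pullback

end KahlerBlowup

end

noncomputable section

namespace KahlerBlowup

open Topology

/-! ### From closed positive (1,1)-forms to local Kähler metrics. -/

section LocalKahlerOfForm

variable {m : ℕ}

theorem fderiv_form_cyclic {β : CSpace m → CSpace m [⋀^Fin 2]→L[ℝ] ℝ} {z : CSpace m}
    (hd : DifferentiableAt ℝ β z) (hcl : extDeriv β z = 0) (a b c : CSpace m) :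
    fderiv ℝ (fun w => β w ![b, c]) z a - fderiv ℝ (fun w => β w ![a, c]) z b +
      fderiv ℝ (fun w => β w ![a, b]) z c = 0 := by
  have h := extDeriv_apply hd ![a, b, c]
  rw [hcl, Fin.sum_univ_three] at h
  have e0 : (0 : Fin 3).removeNth ![a, b, c] = ![b, c] := by
    funext i; fin_cases i <;> rfl
  have e1 : (1 : Fin 3).removeNth ![a, b, c] = ![a, c] := by
    funext i; fin_cases i <;> rfl
  have e2 : (2 : Fin 3).removeNth ![a, b, c] = ![a, b] := by
    funext i; fin_cases i <;> rfl
  rw [e0, e1, e2] at h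
  simp at h
  linarith

theorem form2_comp (β : CSpace m [⋀^Fin 2]→L[ℝ] ℝ) (L : CSpace m →L[ℝ] CSpace m) (u v : CSpace m) :
    β.compContinuousLinearMap L ![u, v] = β ![L u, L v] := by
  rw [ContinuousAlternatingMap.compContinuousLinearMap_apply]
  congr 1
  funext i
  fin_cases i <;> rfl

theorem differentiableAt_form_apply {k : ℕ} {β : CSpace m → CSpace m [⋀^Fin k]→L[ℝ] ℝ} {z : CSpace m}
    (hd : DifferentiableAt ℝ β z) (v : Fin k → CSpace m) :
    DifferentiableAt ℝ (fun w => β w v) z :=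
  (ContinuousAlternatingMap.apply ℝ (CSpace m) ℝ v).differentiableAt.comp z hd

theorem contDiffOn_form_apply {k : ℕ} {β : CSpace m → CSpace m [⋀^Fin k]→L[ℝ] ℝ}
    {U : Set (CSpace m)} (hd : ContDiffOn ℝ ∞ β U) (v : Fin k → CSpace m) :
    ContDiffOn ℝ ∞ (fun w => β w v) U :=
  (ContinuousAlternatingMap.apply ℝ (CSpace m) ℝ v).contDiff.comp_contDiffOn hd

/-- A closed positive `(1,1)`-form on an open subset of `ℂ^m` defines a Kähler metric. -/
theorem isLocalKahler_hermOf {β : CSpace m → CSpace m [⋀^Fin 2]→L[ℝ] ℝ} {U : Set (CSpace m)}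
    (hU : IsOpen U) (hs : ContDiffOn ℝ ∞ β U) (hcl : ∀ z ∈ U, extDeriv β z = 0)
    (hinv : ∀ z ∈ U, ∀ u v, β z ![Complex.I • u, Complex.I • v] = β z ![u, v])
    (hpos : ∀ z ∈ U, ∀ u, u ≠ 0 → 0 < β z ![u, Complex.I • u]) :
    IsLocalKahler U (fun w => hermOf (β w)) := by
  refine ⟨hU, fun j k => ?_, fun z hz => hermOf_posDef (hinv z hz) (hpos z hz), ?_⟩
  · have h1 := Complex.ofRealCLM.contDiff.comp_contDiffOn
      (contDiffOn_form_apply hs ![Pi.single j 1, Pi.single k Complex.I])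
    have h2 := Complex.ofRealCLM.contDiff.comp_contDiffOn
      (contDiffOn_form_apply hs ![Pi.single j 1, Pi.single k 1])
    exact h1.sub (contDiffOn_const.mul h2)
  · intro z hz j l k
    have hd : DifferentiableAt ℝ β z := hs.differentiableAt_of_isOpen hU hz
    have hb (u v : CSpace m) := differentiableAt_form_apply hd ![u, v]
    have hI (j : Fin m) : (Pi.single j Complex.I : CSpace m) = Complex.I • Pi.single j 1 := by
      rw [← Pi.single_smul, smul_eq_mul, mul_one]
    let d : CSpace m → CSpace m → CSpace m → ℝ := fun a u v => fderiv ℝ (fun w => β w ![u, v]) z a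
    have hH : ∀ j a, fderiv ℝ (fun w => hermOf (β w) j k) z a =
        - Complex.I * d a (Pi.single j 1) (Pi.single k 1) -
          d a (Complex.I • Pi.single j 1) (Pi.single k 1) := by
      intro j a
      have e : (fun w => hermOf (β w) j k) =ᶠ[𝓝 z] fun w =>
          - Complex.I * ((β w ![Pi.single j 1, Pi.single k 1] : ℝ) : ℂ) -
          ((β w ![Complex.I • Pi.single j 1, Pi.single k 1] : ℝ) : ℂ) := by
        filter_upwards [hU.mem_nhds hz] with w hw
        rw [form2_I_left (hinv w hw), hermOf, hI]
        push_cast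
        ring
      have h1 : HasFDerivAt (fun w => ((β w ![Pi.single j 1, Pi.single k 1] : ℝ) : ℂ)) _ z :=
        Complex.ofRealCLM.hasFDerivAt.comp z (hb (Pi.single j 1) (Pi.single k 1)).hasFDerivAt
      have h2 : HasFDerivAt (fun w => ((β w ![Complex.I • Pi.single j 1, Pi.single k 1] : ℝ) : ℂ)) _ z :=
        Complex.ofRealCLM.hasFDerivAt.comp z
          (hb (Complex.I • Pi.single j 1) (Pi.single k 1)).hasFDerivAt
      rw [e.fderiv_eq, ((h1.const_mul (- Complex.I)).fun_sub h2).fderiv]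
      simp [d]
    have T : ∀ a b c, (d a b c : ℂ) - d b a c + d c a b = 0 := fun a b c => by
      exact_mod_cast fderiv_form_cyclic hd (hcl z hz) a b c
    have s1 : ∀ a u v, d a (Complex.I • u) (Complex.I • v) = d a u v := fun a u v => by
      have e : (fun w => β w ![Complex.I • u, Complex.I • v]) =ᶠ[𝓝 z] fun w => β w ![u, v] := by
        filter_upwards [hU.mem_nhds hz] with w hw using hinv w hw u v
      simp only [d, e.fderiv_eq]
    have s2 : ∀ a u v, d a (Complex.I • u) v = - d a u (Complex.I • v) := fun a u v => by
      have e : (fun w => β w ![Complex.I • u, v]) =ᶠ[𝓝 z] fun w => - β w ![u, Complex.I • v] := by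
        filter_upwards [hU.mem_nhds hz] with w hw using form2_I_left (hinv w hw) u v
      simp only [d, e.fderiv_eq, fderiv_fun_neg]
      rfl
    rw [wd, wd, hH, hH, hH, hH, hI, hI]
    -- Closedness on e_l, e_j, e_k with each of the first two vectors optionally multiplied by i.
    -- The combination below is -i/2 times dβ on (e_l - i·Ie_l, e_j - i·Ie_j, e_k), that is,
    -- closedness on two vectors of type (1,0).
    have t1 := T (Pi.single l 1) (Pi.single j 1) (Pi.single k 1)
    have t2 := T (Pi.single l 1) (Complex.I • Pi.single j 1) (Pi.single k 1)
    have t3 := T (Complex.I • Pi.single l 1) (Pi.single j 1) (Pi.single k 1)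
    have t4 := T (Complex.I • Pi.single l 1) (Complex.I • Pi.single j 1) (Pi.single k 1)
    rw [s1 (Pi.single k 1)] at t4
    rw [s2 (Pi.single k 1)] at t3
    push_cast at t3
    linear_combination (-Complex.I / 2) * t1 - (1 / 2) * t2 - (1 / 2) * t3 + (Complex.I / 2) * t4 +
      (1 / 2) * ((d (Complex.I • Pi.single l 1) (Pi.single j 1) (Pi.single k 1) : ℂ) -
        d (Complex.I • Pi.single j 1) (Pi.single l 1) (Pi.single k 1)) * Complex.I_mul_I

end LocalKahlerOfForm

/-! ### Kähler forms in charts. -/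

section KahlerManifold

variable {m : ℕ} {M : Type*} [TopologicalSpace M] [ChartedSpace (CSpace m) M]
  [IsManifold 𝓘(ℂ, CSpace m) ω M] {φ ψ : M → M} {c c' x : M} {z : CSpace m}

omit [IsManifold 𝓘(ℂ, CSpace m) ω M] in
theorem contMDiff_id_complex : ContMDiff 𝓘(ℂ, CSpace m) 𝓘(ℂ, CSpace m) ω (id : M → M) :=
  contMDiff_id

/-- The differential in charts of a map with a left inverse is injective. -/
theorem fderiv_inCharts_ne_zero (hφ : ContMDiff 𝓘(ℂ, CSpace m) 𝓘(ℂ, CSpace m) ω φ)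
    (hψ : ContMDiff 𝓘(ℂ, CSpace m) 𝓘(ℂ, CSpace m) ω ψ) (hψφ : Function.LeftInverse ψ φ)
    (hz : z ∈ (chartAt (CSpace m) c).target)
    (hc' : φ ((chartAt (CSpace m) c).symm z) ∈ (chartAt (CSpace m) c').source) {u : CSpace m}
    (hu : u ≠ 0) : fderiv ℂ (inCharts (CSpace m) (CSpace m) φ c c') z u ≠ 0 := by
  intro h0
  have hx := (chartAt (CSpace m) c).map_target hz
  have h1 := eventually_inCharts_comp (E := CSpace m) (E' := CSpace m) (E'' := CSpace m) (c'' := c)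
    (ψ := ψ) hx hφ.continuous.continuousAt hc'
  rw [(chartAt (CSpace m) c).right_inv hz] at h1
  have h2 : inCharts (CSpace m) (CSpace m) (ψ ∘ φ) c c =ᶠ[𝓝 z] id := by
    filter_upwards [(chartAt (CSpace m) c).open_target.mem_nhds hz] with w hw
    simp [inCharts, hw, hψφ _]
  have ha1 := (analyticAt_inCharts hφ hz hc').differentiableAt
  have hτz : inCharts (CSpace m) (CSpace m) φ c c' z ∈ (chartAt (CSpace m) c').target :=
    (chartAt (CSpace m) c').map_source hc'
  have ha2 : DifferentiableAt ℂ (inCharts (CSpace m) (CSpace m) ψ c' c)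
      (inCharts (CSpace m) (CSpace m) φ c c' z) := by
    refine (analyticAt_inCharts hψ hτz ?_).differentiableAt
    rw [inCharts, (chartAt (CSpace m) c').left_inv hc', hψφ]
    exact hx
  have h3 := (h1.symm.trans h2).fderiv_eq (𝕜 := ℂ)
  rw [fderiv_comp z ha2 ha1, fderiv_id] at h3
  have h4 := congrArg (fun L : CSpace m →L[ℂ] CSpace m => L u) h3
  simp only [ContinuousLinearMap.comp_apply, h0, map_zero] at h4
  exact hu h4.symm

theorem fderiv_inCharts_real (hφ : ContMDiff 𝓘(ℂ, CSpace m) 𝓘(ℂ, CSpace m) ω φ)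
    (hz : z ∈ (chartAt (CSpace m) c).target)
    (hc' : φ ((chartAt (CSpace m) c).symm z) ∈ (chartAt (CSpace m) c').source) :
    fderiv ℝ (inCharts (CSpace m) (CSpace m) φ c c') z =
      (fderiv ℂ (inCharts (CSpace m) (CSpace m) φ c c') z).restrictScalars ℝ :=
  fderiv_real_eq (analyticAt_inCharts hφ hz hc').differentiableAt

theorem form2_inChart_eq_apply (α : RealForm m M 2) (hz : z ∈ (chartAt (CSpace m) c).target)
    (u v : CSpace m) : α.inChart c z ![u, v] =
      (α ((chartAt (CSpace m) c).symm z) : CSpace m [⋀^Fin 2]→L[ℝ] ℝ)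
        ![fderiv ℂ (inCharts (CSpace m) (CSpace m) (id : M → M) c
            ((chartAt (CSpace m) c).symm z)) z u,
          fderiv ℂ (inCharts (CSpace m) (CSpace m) (id : M → M) c
            ((chartAt (CSpace m) c).symm z)) z v] := by
  have h := fderiv_inCharts_real (φ := (id : M → M)) (c' := (chartAt (CSpace m) c).symm z)
    contMDiff_id_complex hz (mem_chart_source _ _)
  rw [α.inChart_eq_apply hz]
  refine (congrArg (fun L => ((α ((chartAt (CSpace m) c).symm z) :
    CSpace m [⋀^Fin 2]→L[ℝ] ℝ).compContinuousLinearMap L) ![u, v]) h).trans ?_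
  exact form2_comp _ _ u v

variable (κ : KahlerForm m M)

theorem KahlerForm.inChart_invariant (hz : z ∈ (chartAt (CSpace m) c).target) (u v : CSpace m) :
    κ.form.inChart c z ![Complex.I • u, Complex.I • v] = κ.form.inChart c z ![u, v] := by
  rw [form2_inChart_eq_apply _ hz, form2_inChart_eq_apply _ hz, map_smul, map_smul]
  exact κ.invariant _ _ _

theorem KahlerForm.inChart_pos (hz : z ∈ (chartAt (CSpace m) c).target) (u : CSpace m)
    (hu : u ≠ 0) : 0 < κ.form.inChart c z ![u, Complex.I • u] := by
  rw [form2_inChart_eq_apply _ hz, map_smul]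
  exact κ.positive _ _ (fderiv_inCharts_ne_zero contMDiff_id_complex contMDiff_id_complex
    (fun _ => rfl) hz (mem_chart_source _ _) hu)

omit [IsManifold 𝓘(ℂ, CSpace m) ω M] in
theorem KahlerForm.extDeriv_inChart (hz : z ∈ (chartAt (CSpace m) c).target) :
    extDeriv (κ.form.inChart c) z = 0 := by
  rw [κ.closed c z hz]
  rfl

theorem KahlerForm.isLocalKahler (c : M) :
    IsLocalKahler (chartAt (CSpace m) c).target (κ.herm c) :=
  isLocalKahler_hermOf (chartAt (CSpace m) c).open_target (κ.smooth c)
    (fun _ hz => κ.extDeriv_inChart hz) (fun _ hz => κ.inChart_invariant hz)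
    (fun _ hz => κ.inChart_pos hz)

/-- The part of a chart that a map sends to another chart. -/
def overlap (φ : M → M) (c c' : M) : Set (CSpace m) :=
  (chartAt (CSpace m) c).target ∩ (fun z => φ ((chartAt (CSpace m) c).symm z)) ⁻¹'
    (chartAt (CSpace m) c').source

omit [IsManifold 𝓘(ℂ, CSpace m) ω M] in
theorem isOpen_overlap (hφ : Continuous φ) : IsOpen (overlap φ c c' : Set (CSpace m)) :=
  (hφ.comp_continuousOn (chartAt (CSpace m) c).continuousOn_symm).isOpen_inter_preimage
    (chartAt (CSpace m) c).open_target (chartAt (CSpace m) c').open_source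

/-- This lets one set of local naturality lemmas serve twice: for the identity they give
independence of the chart, for an automorphism they give invariance under pull-back. -/
theorem isHolIsometry_inCharts {κ κ' : KahlerForm m M}
    (hφ : ContMDiff 𝓘(ℂ, CSpace m) 𝓘(ℂ, CSpace m) ω φ)
    (h : κ'.form = RealForm.pullback φ κ.form) (c c' : M) :
    IsHolIsometry (overlap φ c c') (κ'.herm c) (chartAt (CSpace m) c').target (κ.herm c')
      (inCharts (CSpace m) (CSpace m) φ c c') where
  left := (κ'.isLocalKahler c).mono (isOpen_overlap hφ.continuous) Set.inter_subset_left
  right := κ.isLocalKahler c'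
  hol := fun z hz => analyticAt_inCharts hφ hz.1 hz.2
  maps := fun z hz => (chartAt (CSpace m) c').map_source hz.2
  metric := fun z hz => by
    refine hermOf_comp (κ.inChart_invariant ((chartAt (CSpace m) c').map_source hz.2)) _ fun u v => ?_
    rw [h, κ.form.inChart_pullback ((contMDiff_real hφ _).of_le (by simp)) hz.1 hz.2,
      fderiv_inCharts_real hφ hz.1 hz.2, form2_comp]
    rfl

theorem KahlerForm.isHolIsometry_change (c c' : M) :
    IsHolIsometry (overlap id c c') (κ.herm c) (chartAt (CSpace m) c').target (κ.herm c')
      (inCharts (CSpace m) (CSpace m) (id : M → M) c c') :=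
  isHolIsometry_inCharts contMDiff_id_complex (RealForm.pullback_id _).symm c c'

end KahlerManifold

end KahlerBlowup

end

noncomputable section

namespace KahlerBlowup

open Topology

/-! ### Smoothness of form-valued maps. -/

section SmoothForms

variable {m k : ℕ} {G : Type*} [NormedAddCommGroup G] [NormedSpace ℝ G]

/-- A map into the alternating forms is smooth if all its values on vectors are. -/
theorem contDiffAt_form_of_apply {n : ℕ∞ω} {β : G → CSpace m [⋀^Fin k]→L[ℝ] ℝ} {z : G}
    (h : ∀ v : Fin k → CSpace m, ContDiffAt ℝ n (fun w => β w v) z) : ContDiffAt ℝ n β z := by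
  let b := Module.finBasis ℝ (CSpace m)
  let L : (CSpace m [⋀^Fin k]→L[ℝ] ℝ) →ₗ[ℝ] ((Fin k → Fin (Module.finrank ℝ (CSpace m))) → ℝ) :=
    { toFun := fun β i => β fun a => b (i a)
      map_add' := fun _ _ => rfl
      map_smul' := fun _ _ => rfl }
  have hL : Function.Injective L := by
    intro β β' hβ
    apply ContinuousAlternatingMap.toAlternatingMap_injective
    refine Module.Basis.ext_alternating b fun v _ => ?_
    exact congrFun hβ v
  have : FiniteDimensional ℝ (CSpace m [⋀^Fin k]→L[ℝ] ℝ) := FiniteDimensional.of_injective L hL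
  obtain ⟨R, hR⟩ := LinearMap.exists_leftInverse_of_injective L (LinearMap.ker_eq_bot.2 hL)
  have e : β = fun w => R.toContinuousLinearMap fun i => β w fun a => b (i a) := by
    funext w
    exact (LinearMap.congr_fun hR (β w)).symm
  rw [e]
  exact R.toContinuousLinearMap.contDiff.contDiffAt.comp z (contDiffAt_pi.2 fun i => h _)

theorem _root_.ContDiffAt.compForm {n : ℕ∞ω} {β : G → CSpace m [⋀^Fin k]→L[ℝ] ℝ}
    {L : G → CSpace m →L[ℝ] CSpace m} {z : G} (hβ : ContDiffAt ℝ n β z) (hL : ContDiffAt ℝ n L z) :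
    ContDiffAt ℝ n (fun w => (β w).compContinuousLinearMap (L w)) z := by
  refine contDiffAt_form_of_apply fun v => ?_
  have h1 : ContDiffAt ℝ n (fun w => (β w).toContinuousMultilinearMap) z :=
    (ContinuousAlternatingMap.toContinuousMultilinearMapCLM ℝ :
      (CSpace m [⋀^Fin k]→L[ℝ] ℝ) →L[ℝ] _).contDiff.contDiffAt.comp z hβ
  have h2 : ContDiffAt ℝ n (fun w =>
      ContinuousMultilinearMap.compContinuousLinearMapContinuousMultilinear ℝ
        (fun _ : Fin k => CSpace m) (fun _ => CSpace m) ℝ (fun _ => L w)) z :=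
    (ContinuousMultilinearMap.contDiff _).contDiffAt.comp z (contDiffAt_pi.2 fun _ => hL)
  have h3 := h2.clm_apply h1
  exact (ContinuousMultilinearMap.apply ℝ (fun _ : Fin k => CSpace m) ℝ v).contDiff.contDiffAt.comp z h3

end SmoothForms

/-! ### Scalar curvature and pull-back of Kähler forms. -/

section Scal

variable {m : ℕ} {M : Type*} [TopologicalSpace M] [ChartedSpace (CSpace m) M]
  [IsManifold 𝓘(ℂ, CSpace m) ω M] {φ ψ : M → M} {c c' x : M} {z : CSpace m}
variable (κ : KahlerForm m M)

/-- Halving the matrix changes log det by an additive constant, which the derivatives do not see. -/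
theorem KahlerForm.ricci_eq (hz : z ∈ (chartAt (CSpace m) c).target) :
    κ.ricci c z = ric (κ.herm c) z := by
  have hU := (chartAt (CSpace m) c).open_target
  have hK := κ.isLocalKahler c
  have e : ∀ w ∈ (chartAt (CSpace m) c).target,
      (Real.log (((1 / 2 : ℂ) • κ.herm c w).det.re) : ℂ) =
        (Real.log ((1 / 2 : ℝ) ^ m) : ℂ) + logDet (κ.herm c) w := by
    intro w hw
    have h1 := hK.det_pos hw
    have h2 : ((1 / 2 : ℂ) • κ.herm c w).det.re = (1 / 2 : ℝ) ^ m * (κ.herm c w).det.re := by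
      rw [Matrix.det_smul, Fintype.card_fin, h1.2]
      have : (1 / 2 : ℂ) ^ m = (((1 / 2 : ℝ) ^ m : ℝ) : ℂ) := by push_cast; rfl
      rw [this, ← Complex.ofReal_mul, Complex.ofReal_re]
      simp
    rw [h2, Real.log_mul (by positivity) h1.1.ne', logDet]
    push_cast
    rfl
  have e2 : ∀ w ∈ (chartAt (CSpace m) c).target, ∀ k,
      dzbar k (fun w => (Real.log (((1 / 2 : ℂ) • κ.herm c w).det.re) : ℂ)) w =
        wd 1 k (logDet (κ.herm c)) w := by
    intro w hw k
    rw [dzbar_eq_wd, wd_congr_on hU hw e,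
      wd_add (by fun_prop) (hK.smooth_logDet.differentiableAt_of_isOpen hU hw), wd_const, zero_add]
  ext j k
  rw [KahlerForm.ricci, dz_eq_wd, wd_congr_on hU hz fun w hw => e2 w hw k]
  rfl

theorem IsLocalKahler.conj_trace_ric {U : Set (CSpace m)}
    {H : CSpace m → Matrix (Fin m) (Fin m) ℂ} (h : IsLocalKahler U H) (hz : z ∈ U) :
    (starRingEnd ℂ) ((H z)⁻¹ * ric H z).trace = ((H z)⁻¹ * ric H z).trace := by
  rw [trace_mul_eq_sum]
  simp only [map_sum, map_mul, h.conj_inv_apply hz, h.conj_ric hz]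
  exact Finset.sum_comm

/-- One factor 2 is in the definition of the scalar curvature, the other comes from inverting H/2.
Invariance of the trace allows any chart around the point in place of the preferred one. -/
theorem KahlerForm.scal_eq (hz : z ∈ (chartAt (CSpace m) c).target) :
    (κ.scal ((chartAt (CSpace m) c).symm z) : ℂ) =
      4 * ((κ.herm c z)⁻¹ * ric (κ.herm c) z).trace := by
  set x := (chartAt (CSpace m) c).symm z with hx
  have hxt := mem_chart_target (CSpace m) x
  have hK := κ.isLocalKahler x
  have h2 : ((1 / 2 : ℂ) • κ.herm x (chartAt (CSpace m) x x))⁻¹ =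
      (2 : ℂ) • (κ.herm x (chartAt (CSpace m) x x))⁻¹ := by
    refine Matrix.inv_eq_left_inv ?_
    rw [Matrix.smul_mul, Matrix.mul_smul, smul_smul,
      Matrix.nonsing_inv_mul _ (isUnit_iff_ne_zero.2 (hK.det_ne_zero hxt))]
    norm_num
  have hch := (κ.isHolIsometry_change c x).trace_ric (z := z) ⟨hz, mem_chart_source _ _⟩
  have e : inCharts (CSpace m) (CSpace m) (id : M → M) c x z = chartAt (CSpace m) x x := rfl
  rw [hch, e, KahlerForm.scal, h2, κ.ricci_eq hxt, Matrix.smul_mul, Matrix.trace_smul, smul_eq_mul]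
  have hr := Complex.conj_eq_iff_re.1 (hK.conj_trace_ric hxt)
  rw [← mul_assoc, ← hr, ← Complex.ofReal_ofNat, ← Complex.ofReal_mul, ← Complex.ofReal_mul,
    Complex.ofReal_re]
  push_cast
  ring

theorem KahlerForm.scal_pullback {κ κ' : KahlerForm m M}
    (hφ : ContMDiff 𝓘(ℂ, CSpace m) 𝓘(ℂ, CSpace m) ω φ)
    (h : κ'.form = RealForm.pullback φ κ.form) (x : M) : κ'.scal x = κ.scal (φ x) := by
  have h1 := (isHolIsometry_inCharts hφ h x (φ x)).trace_ric (z := chartAt (CSpace m) x x)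
    ⟨mem_chart_target _ _, by simp⟩
  have h2 := κ'.scal_eq (c := x) (mem_chart_target (CSpace m) x)
  have h3 := κ.scal_eq (c := φ x) (mem_chart_target (CSpace m) (φ x))
  have e : inCharts (CSpace m) (CSpace m) φ x (φ x) (chartAt (CSpace m) x x) =
      chartAt (CSpace m) (φ x) (φ x) := by simp [inCharts]
  rw [(chartAt (CSpace m) x).left_inv (mem_chart_source _ _), h1, e] at h2
  rw [(chartAt (CSpace m) (φ x)).left_inv (mem_chart_source _ _)] at h3
  exact_mod_cast h2.trans h3.symm

/-- The real differential, as a continuous linear endomorphism of `ℂ^m`. -/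
def rderiv (φ : M → M) (x : M) : CSpace m →L[ℝ] CSpace m :=
  mfderiv 𝓘(ℝ, CSpace m) 𝓘(ℝ, CSpace m) φ x

theorem rderiv_smul (hφ : ContMDiff 𝓘(ℂ, CSpace m) 𝓘(ℂ, CSpace m) ω φ) (x : M) (a : ℂ)
    (u : CSpace m) : rderiv φ x (a • u) = a • rderiv φ x u := by
  have h1 : ∀ u, rderiv φ x u =
      (mfderiv 𝓘(ℂ, CSpace m) 𝓘(ℂ, CSpace m) φ x : CSpace m →L[ℂ] CSpace m) u :=
    mfderiv_real_eq ((hφ x).mdifferentiableAt (by simp))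
      ((contMDiff_real hφ x).mdifferentiableAt (by simp))
  rw [h1, h1]
  exact map_smul (mfderiv 𝓘(ℂ, CSpace m) 𝓘(ℂ, CSpace m) φ x : CSpace m →L[ℂ] CSpace m) a u

theorem rderiv_comp (hφ : ContMDiff 𝓘(ℂ, CSpace m) 𝓘(ℂ, CSpace m) ω φ)
    (hψ : ContMDiff 𝓘(ℂ, CSpace m) 𝓘(ℂ, CSpace m) ω ψ) (x : M) :
    (rderiv (ψ ∘ φ) x : CSpace m →L[ℝ] CSpace m) = (rderiv ψ (φ x)).comp (rderiv φ x) :=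
  mfderiv_comp x ((contMDiff_real hψ _).mdifferentiableAt (by simp))
    ((contMDiff_real hφ x).mdifferentiableAt (by simp))

omit [IsManifold 𝓘(ℂ, CSpace m) ω M] in
theorem rderiv_id (x : M) : rderiv (id : M → M) x = ContinuousLinearMap.id ℝ (CSpace m) :=
  mfderiv_id

theorem rderiv_ne_zero (hφ : ContMDiff 𝓘(ℂ, CSpace m) 𝓘(ℂ, CSpace m) ω φ)
    (hψ : ContMDiff 𝓘(ℂ, CSpace m) 𝓘(ℂ, CSpace m) ω ψ) (hψφ : Function.LeftInverse ψ φ) (x : M)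
    {u : CSpace m} (hu : u ≠ 0) : rderiv φ x u ≠ 0 := by
  intro h0
  have h5 := rderiv_comp hφ hψ x
  rw [hψφ.comp_eq_id, rderiv_id] at h5
  have h6 : u = rderiv ψ (φ x) (rderiv φ x u) :=
    congrArg (fun L : CSpace m →L[ℝ] CSpace m => L u) h5
  rw [h0, map_zero] at h6
  exact hu h6

/-- The pull-back of a Kähler form by a biholomorphic map. -/
def KahlerForm.pullback (φ ψ : M → M) (hφ : ContMDiff 𝓘(ℂ, CSpace m) 𝓘(ℂ, CSpace m) ω φ)
    (hψ : ContMDiff 𝓘(ℂ, CSpace m) 𝓘(ℂ, CSpace m) ω ψ) (hψφ : Function.LeftInverse ψ φ) :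
    KahlerForm m M :=
  -- Near each point the pull-back is the chart expression of κ pulled back by a holomorphic map
  -- between open sets of ℂ^m; smoothness and closedness are read off from this.
  have hloc : ∀ c z, z ∈ (chartAt (CSpace m) c).target →
      (RealForm.pullback φ κ.form).inChart c =ᶠ[𝓝 z] fun w =>
        (κ.form.inChart (φ ((chartAt (CSpace m) c).symm z)) (inCharts (CSpace m) (CSpace m) φ c
          (φ ((chartAt (CSpace m) c).symm z)) w)).compContinuousLinearMap
        (fderiv ℝ (inCharts (CSpace m) (CSpace m) φ c (φ ((chartAt (CSpace m) c).symm z))) w) := by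
    intro c z hz
    filter_upwards [(isOpen_overlap (c := c) (c' := φ ((chartAt (CSpace m) c).symm z))
      hφ.continuous).mem_nhds ⟨hz, mem_chart_source _ _⟩] with w hw
    exact κ.form.inChart_pullback ((contMDiff_real hφ _).of_le (by simp)) hw.1 hw.2
  have hτ : ∀ c z, z ∈ (chartAt (CSpace m) c).target → ContDiffAt ℝ ω
      (inCharts (CSpace m) (CSpace m) φ c (φ ((chartAt (CSpace m) c).symm z))) z := fun c z hz =>
    ((analyticAt_inCharts hφ hz (mem_chart_source _ _)).contDiffAt).restrict_scalars ℝ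
  { form := RealForm.pullback φ κ.form
    smooth := fun c z hz => by
      refine ContDiffAt.contDiffWithinAt (ContDiffAt.congr_of_eventuallyEq ?_ (hloc c z hz))
      refine ContDiffAt.compForm ?_ ((hτ c z hz).fderiv_right (by simp))
      refine ContDiffAt.comp z (g := κ.form.inChart (φ ((chartAt (CSpace m) c).symm z))) ?_
        ((hτ c z hz).of_le (by simp))
      exact (κ.smooth _).contDiffAt ((chartAt (CSpace m) _).open_target.mem_nhds
        ((chartAt (CSpace m) _).map_source (mem_chart_source _ _)))
    closed := fun c z hz => by
      have hmem : inCharts (CSpace m) (CSpace m) φ c (φ ((chartAt (CSpace m) c).symm z)) z ∈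
          (chartAt (CSpace m) (φ ((chartAt (CSpace m) c).symm z))).target :=
        (chartAt (CSpace m) _).map_source (mem_chart_source _ _)
      rw [(hloc c z hz).extDeriv_eq, extDeriv_pullback (r := ω) ?_ (hτ c z hz) (by simp),
        κ.extDeriv_inChart hmem]
      · rfl
      · exact (κ.smooth _).differentiableAt_of_isOpen (chartAt (CSpace m) _).open_target hmem
    invariant := fun x u v => by
      have h2 := form2_comp (κ.form (φ x)) (rderiv φ x)
      refine (h2 _ _).trans (Eq.trans ?_ (h2 u v).symm)
      refine Eq.trans ?_ (κ.invariant (φ x) (rderiv φ x u) (rderiv φ x v))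
      exact congrArg₂ (fun a b => (κ.form (φ x) : CSpace m [⋀^Fin 2]→L[ℝ] ℝ) ![a, b])
        (rderiv_smul hφ x Complex.I u) (rderiv_smul hφ x Complex.I v)
    positive := fun x u hu => by
      have h2 := form2_comp (κ.form (φ x)) (rderiv φ x)
      refine lt_of_lt_of_eq (κ.positive (φ x) _ (rderiv_ne_zero hφ hψ hψφ x hu))
        (Eq.trans ?_ (h2 _ _).symm)
      exact congrArg (fun b => (κ.form (φ x) : CSpace m [⋀^Fin 2]→L[ℝ] ℝ) ![rderiv φ x u, b])
        (rderiv_smul hφ x Complex.I u).symm }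

end Scal

end KahlerBlowup

end

noncomputable section

namespace KahlerBlowup

open Topology

/-! ### Hamiltonian fields as holomorphic gradients. -/

section HamiltonianInCharts

variable {m : ℕ}

theorem cgrad_congr {H : CSpace m → Matrix (Fin m) (Fin m) ℂ} {f g : CSpace m → ℂ} {z : CSpace m}
    (h : f =ᶠ[𝓝 z] g) : cgrad H f z = cgrad H g z := by
  funext j
  simp only [cgrad, raise]
  exact Finset.sum_congr rfl fun k _ => by rw [wd_congr h]

/-- The right-hand side is the Hamiltonian equation in coordinates, -∂̄f = (i/2) HᵀX. Inverting Hᵀ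
solves it for X and explains the factor 2i. -/
theorem eq_smul_cgrad_iff {U : Set (CSpace m)} {H : CSpace m → Matrix (Fin m) (Fin m) ℂ}
    (h : IsLocalKahler U H) {f : CSpace m → ℂ} {z : CSpace m} (hz : z ∈ U) (X : CSpace m) :
    X = (2 * Complex.I) • cgrad H f z ↔
      ∀ k, - wd 1 k f z = (1 / 2) * (Complex.I * ∑ j, H z j k * X j) := by
  have hu : IsUnit (H z).transpose.det := by
    rw [Matrix.det_transpose]
    exact isUnit_iff_ne_zero.2 (h.det_ne_zero hz)
  have e1 : cgrad H f z = ((H z).transpose)⁻¹.mulVec fun k => wd 1 k f z := by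
    rw [← Matrix.transpose_nonsing_inv]
    rfl
  have e2 : ∀ k, ∑ j, H z j k * X j = ((H z).transpose.mulVec X) k := fun k => rfl
  simp only [e1, e2]
  constructor
  · intro hX k
    have h3 : (H z).transpose.mulVec X = (2 * Complex.I) • fun k => wd 1 k f z := by
      rw [hX, Matrix.mulVec_smul, Matrix.mulVec_mulVec, Matrix.mul_nonsing_inv _ hu,
        Matrix.one_mulVec]
    rw [h3, Pi.smul_apply, smul_eq_mul]
    linear_combination (- wd 1 k f z) * Complex.I_mul_I
  · intro hX
    have h3 : (H z).transpose.mulVec X = (2 * Complex.I) • fun k => wd 1 k f z := by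
      funext k
      rw [Pi.smul_apply, smul_eq_mul]
      linear_combination (2 * Complex.I) * hX k + ((H z).transpose.mulVec X k) * Complex.I_mul_I
    rw [← Matrix.mulVec_smul, ← h3, Matrix.mulVec_mulVec, Matrix.nonsing_inv_mul _ hu,
      Matrix.one_mulVec]

variable {M : Type*} [TopologicalSpace M] [ChartedSpace (CSpace m) M]
  [IsManifold 𝓘(ℂ, CSpace m) ω M] {φ ψ : M → M} {c c' x : M} {z : CSpace m}
  {κ κ' : KahlerForm m M} {ζ : M → ℂ}

theorem contDiffOn_comp_chart_symm (hζ : ContMDiff 𝓘(ℝ, CSpace m) 𝓘(ℝ, ℂ) ∞ ζ) (c : M) :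
    ContDiffOn ℝ ∞ (ζ ∘ (chartAt (CSpace m) c).symm) (chartAt (CSpace m) c).target := fun z hz => by
  have h := (contMDiffAt_iff_comp_chart_symm ((chartAt (CSpace m) c).map_target hz)).1
    (hζ ((chartAt (CSpace m) c).symm z))
  rw [(chartAt (CSpace m) c).right_inv hz] at h
  exact h.contDiffWithinAt

theorem jac_mulVec (τ : CSpace m → CSpace m) (z u : CSpace m) :
    (jac τ z).mulVec u = fderiv ℂ τ z u := cmat_mulVec _ _

omit [IsManifold 𝓘(ℂ, CSpace m) ω M] in
theorem eventually_comp_inCharts (hφ : Continuous φ) (ζ : M → ℂ) (hz : z ∈ overlap φ c c') :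
    (ζ ∘ φ) ∘ (chartAt (CSpace m) c).symm =ᶠ[𝓝 z]
      (ζ ∘ (chartAt (CSpace m) c').symm) ∘ inCharts (CSpace m) (CSpace m) φ c c' := by
  filter_upwards [(isOpen_overlap hφ).mem_nhds hz] with w hw
  have h : (chartAt (CSpace m) c').symm (chartAt (CSpace m) c'
      (φ ((chartAt (CSpace m) c).symm w))) = φ ((chartAt (CSpace m) c).symm w) :=
    (chartAt (CSpace m) c').left_inv hw.2
  simp only [Function.comp, inCharts, h]

theorem fderiv_cgrad (hφ : ContMDiff 𝓘(ℂ, CSpace m) 𝓘(ℂ, CSpace m) ω φ)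
    (h : κ'.form = RealForm.pullback φ κ.form) (hζ : ContMDiff 𝓘(ℝ, CSpace m) 𝓘(ℝ, ℂ) ∞ ζ)
    (hz : z ∈ overlap φ c c') :
    fderiv ℂ (inCharts (CSpace m) (CSpace m) φ c c') z
      (cgrad (κ'.herm c) ((ζ ∘ φ) ∘ (chartAt (CSpace m) c).symm) z) =
      cgrad (κ.herm c') (ζ ∘ (chartAt (CSpace m) c').symm)
        (inCharts (CSpace m) (CSpace m) φ c c' z) := by
  rw [cgrad_congr (eventually_comp_inCharts hφ.continuous ζ hz), ← jac_mulVec]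
  exact (isHolIsometry_inCharts hφ h c c').cgrad_comp (contDiffOn_comp_chart_symm hζ c') hz

theorem fderiv_cgrad_change (κ : KahlerForm m M) (hζ : ContMDiff 𝓘(ℝ, CSpace m) 𝓘(ℝ, ℂ) ∞ ζ)
    (hz : z ∈ overlap (id : M → M) c c') :
    fderiv ℂ (inCharts (CSpace m) (CSpace m) (id : M → M) c c') z
      (cgrad (κ.herm c) (ζ ∘ (chartAt (CSpace m) c).symm) z) =
      cgrad (κ.herm c') (ζ ∘ (chartAt (CSpace m) c').symm)
        (inCharts (CSpace m) (CSpace m) (id : M → M) c c' z) :=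
  fderiv_cgrad (φ := id) contMDiff_id_complex (RealForm.pullback_id _).symm hζ hz

/-- The coordinates of a vector field at each point in the preferred chart. -/
def vec (Ξ : HolVectorField m M) (x : M) : CSpace m := Ξ x

/-- A vector field is Hamiltonian if it is the gradient of its potential, up to a constant. -/
theorem KahlerForm.isHamiltonian_iff (κ : KahlerForm m M) (Ξ : HolVectorField m M) (ζ : M → ℂ) :
    κ.IsHamiltonian Ξ ζ ↔ ContMDiff 𝓘(ℝ, CSpace m) 𝓘(ℝ, ℂ) ∞ ζ ∧
      ∀ x, vec Ξ x = (2 * Complex.I) •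
        cgrad (κ.herm x) (ζ ∘ (chartAt (CSpace m) x).symm) (chartAt (CSpace m) x x) := by
  refine and_congr_right fun hζ => forall_congr' fun x => ?_
  rw [eq_smul_cgrad_iff (κ.isLocalKahler x) (mem_chart_target _ x)]
  have hinv : ∀ u v : CSpace m, (κ.form x : CSpace m [⋀^Fin 2]→L[ℝ] ℝ) ![Complex.I • u, Complex.I • v] =
      (κ.form x : CSpace m [⋀^Fin 2]→L[ℝ] ℝ) ![u, v] := κ.invariant x
  have hH : κ.herm x (chartAt (CSpace m) x x) = hermOf (κ.form x) := by
    have : κ.herm x (chartAt (CSpace m) x x) =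
      hermOf (κ.form.inChart x (chartAt (CSpace m) x x)) := rfl
    rw [this, RealForm.inChart_self]
  have hd : ∀ u : CSpace m, diff ζ x u =
      fderiv ℝ (ζ ∘ (chartAt (CSpace m) x).symm) (chartAt (CSpace m) x x) u := fun u =>
    congrArg (fun L : CSpace m →L[ℝ] ℂ => L u)
      (mfderiv_eq_fderiv_comp_chart_symm ((hζ x).mdifferentiableAt (by simp)))
  have hdbar : ∀ u : CSpace m, dbar ζ x u =
      ∑ k, wd 1 k (ζ ∘ (chartAt (CSpace m) x).symm) (chartAt (CSpace m) x x) *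
        (starRingEnd ℂ) (u k) := by
    intro u
    have hJ : diff ζ x (J x u) = fderiv ℝ (ζ ∘ (chartAt (CSpace m) x).symm) (chartAt (CSpace m) x x)
        (Complex.I • u) := hd (Complex.I • u)
    have hdb : dbar ζ x u = (1 / 2) * (diff ζ x u + Complex.I * diff ζ x (J x u)) := rfl
    rw [hdb, hJ, hd, fderiv_eq_sum_wd, fderiv_eq_sum_wd, Finset.mul_sum,
      ← Finset.sum_add_distrib, Finset.mul_sum]
    refine Finset.sum_congr rfl fun k _ => ?_
    simp only [Pi.smul_apply, smul_eq_mul, map_mul, Complex.conj_I]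
    linear_combination (1 / 2 * wd (-1) k (ζ ∘ (chartAt (CSpace m) x).symm) (chartAt (CSpace m) x x) *
      u k - 1 / 2 * wd 1 k (ζ ∘ (chartAt (CSpace m) x).symm) (chartAt (CSpace m) x x) *
      (starRingEnd ℂ) (u k)) * Complex.I_mul_I
  have hcontr : ∀ u : CSpace m, κ.contract x (toReal x (vec Ξ x)) u =
      Complex.I * ∑ j, ∑ k, κ.herm x (chartAt (CSpace m) x x) j k * vec Ξ x j *
        (starRingEnd ℂ) (u k) := fun u => by
    rw [hH]
    exact contr_eq_sum hinv (vec Ξ x) u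
  -- Both sides are conjugate linear in u, so the equation need only be tested on the standard
  -- basis.
  have key : (∀ u : CSpace m, - ∑ k, wd 1 k (ζ ∘ (chartAt (CSpace m) x).symm)
      (chartAt (CSpace m) x x) * (starRingEnd ℂ) (u k) = (1 / 2) * (Complex.I * ∑ j, ∑ k,
        κ.herm x (chartAt (CSpace m) x x) j k * vec Ξ x j * (starRingEnd ℂ) (u k))) ↔
      ∀ k, - wd 1 k (ζ ∘ (chartAt (CSpace m) x).symm) (chartAt (CSpace m) x x) =
        (1 / 2) * (Complex.I * ∑ j, κ.herm x (chartAt (CSpace m) x x) j k * vec Ξ x j) := by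
    constructor
    · intro h k
      simpa [Pi.single_apply, apply_ite] using h (Pi.single k 1)
    · intro h u
      have e : ∑ j, ∑ k, κ.herm x (chartAt (CSpace m) x x) j k * vec Ξ x j *
          (starRingEnd ℂ) (u k) = ∑ k, (∑ j, κ.herm x (chartAt (CSpace m) x x) j k *
            vec Ξ x j) * (starRingEnd ℂ) (u k) := by
        simp only [Finset.sum_mul]
        exact Finset.sum_comm
      rw [e, ← Finset.sum_neg_distrib, Finset.mul_sum, Finset.mul_sum]
      refine Finset.sum_congr rfl fun k _ => ?_
      linear_combination ((starRingEnd ℂ) (u k)) * h k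
  refine Iff.trans (forall_congr' fun u : CSpace m => ?_) key
  exact iff_of_eq (congrArg₂ Eq (congrArg Neg.neg (hdbar u))
    (congrArg ((1 / 2 : ℂ) * ·) (hcontr u)))

theorem coord_eq_smul_cgrad {v : M → CSpace m} (κ : KahlerForm m M)
    (hζ : ContMDiff 𝓘(ℝ, CSpace m) 𝓘(ℝ, ℂ) ∞ ζ) {a : ℂ}
    (hv : ∀ x, v x = a • cgrad (κ.herm x) (ζ ∘ (chartAt (CSpace m) x).symm) (chartAt (CSpace m) x x))
    (hz : z ∈ (chartAt (CSpace m) c).target) :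
    coord ℂ c v z = a • cgrad (κ.herm c) (ζ ∘ (chartAt (CSpace m) c).symm) z := by
  have hx := (chartAt (CSpace m) c).map_target hz
  rw [coord, hv, map_smul, fderiv_cgrad_change κ hζ ⟨mem_chart_target _ _, by simpa using hx⟩]
  congr 2
  simp [inCharts, hz]

theorem KahlerForm.IsHamiltonian.coord_eq {Ξ : HolVectorField m M} (h : κ.IsHamiltonian Ξ ζ)
    (hz : z ∈ (chartAt (CSpace m) c).target) :
    coord ℂ c (vec Ξ) z =
      (2 * Complex.I) • cgrad (κ.herm c) (ζ ∘ (chartAt (CSpace m) c).symm) z := by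
  have h' := (κ.isHamiltonian_iff Ξ ζ).1 h
  exact coord_eq_smul_cgrad κ h'.1 h'.2 hz

theorem HolVectorField.contDiffOn_coord (Ξ : HolVectorField m M) (c : M) :
    ContDiffOn ℂ ω (coord ℂ c (vec Ξ)) (chartAt (CSpace m) c).target :=
  (contMDiff_section_iff (𝕜 := ℂ) (E := CSpace m) (n := ω) (fun x => Ξ x)).1 Ξ.contMDiff c

/-- A vector field with holomorphic coordinates in all charts. -/
def HolVectorField.ofCoord (v : M → CSpace m)
    (h : ∀ c, ContDiffOn ℂ ω (coord ℂ c v) (chartAt (CSpace m) c).target) : HolVectorField m M where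
  toFun := v
  contMDiff_toFun := (contMDiff_section_iff (𝕜 := ℂ) (E := CSpace m) (n := ω) v).2 h

/-- A function whose gradient is holomorphic in all charts is a Hamiltonian. -/
theorem KahlerForm.exists_isHamiltonian (κ : KahlerForm m M)
    (hζ : ContMDiff 𝓘(ℝ, CSpace m) 𝓘(ℝ, ℂ) ∞ ζ)
    (h : ∀ c, ∀ z ∈ (chartAt (CSpace m) c).target, ∀ j l,
      wd 1 l (fun w => cgrad (κ.herm c) (ζ ∘ (chartAt (CSpace m) c).symm) w j) z = 0) :
    ∃ Ξ : HolVectorField m M, κ.IsHamiltonian Ξ ζ := by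
  let v : M → CSpace m := fun x => (2 * Complex.I) •
    cgrad (κ.herm x) (ζ ∘ (chartAt (CSpace m) x).symm) (chartAt (CSpace m) x x)
  have hv : ∀ c, ContDiffOn ℂ ω (coord ℂ c v) (chartAt (CSpace m) c).target := by
    intro c z hz
    -- Vanishing ∂̄-derivatives only give complex differentiability; Osgood's lemma supplies the
    -- analyticity required of a holomorphic section.
    have h1 : AnalyticAt ℂ (cgrad (κ.herm c) (ζ ∘ (chartAt (CSpace m) c).symm)) z := by
      refine analyticAt_of_eventually_differentiableAt ?_
      filter_upwards [(chartAt (CSpace m) c).open_target.mem_nhds hz] with w hw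
      refine differentiableAt_pi.2 fun j => differentiableAt_complex_of_dzbar ?_ (h c w hw j)
      exact (((κ.isLocalKahler c).smooth_cgrad (contDiffOn_comp_chart_symm hζ c)) j).differentiableAt_of_isOpen
        (chartAt (CSpace m) c).open_target hw
    have h2 : ContDiffAt ℂ ω (fun w => (2 * Complex.I) •
        cgrad (κ.herm c) (ζ ∘ (chartAt (CSpace m) c).symm) w) z := h1.contDiffAt.const_smul _
    refine (h2.congr_of_eventuallyEq ?_).contDiffWithinAt
    filter_upwards [(chartAt (CSpace m) c).open_target.mem_nhds hz] with w hw
    exact coord_eq_smul_cgrad κ hζ (fun _ => rfl) hw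
  exact ⟨HolVectorField.ofCoord v hv, (κ.isHamiltonian_iff _ ζ).2 ⟨hζ, fun _ => rfl⟩⟩

end HamiltonianInCharts

/-! ### Push-forward of holomorphic vector fields by automorphisms. -/

section Pushforward

variable {m : ℕ} {M : Type*} [TopologicalSpace M] [ChartedSpace (CSpace m) M]
  [IsManifold 𝓘(ℂ, CSpace m) ω M] {φ ψ : M → M}

/-- The complex differential, as a continuous linear endomorphism of `ℂ^m`. -/
def cderiv (φ : M → M) (x : M) : CSpace m →L[ℂ] CSpace m :=
  mfderiv 𝓘(ℂ, CSpace m) 𝓘(ℂ, CSpace m) φ x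

/-- The push-forward of a vector field by a biholomorphic map `φ` with inverse `ψ`. -/
def pushVec (φ ψ : M → M) (v : M → CSpace m) (y : M) : CSpace m := cderiv φ (ψ y) (v (ψ y))

theorem coord_pushVec (hφ : ContMDiff 𝓘(ℂ, CSpace m) 𝓘(ℂ, CSpace m) ω φ)
    (hψφ : Function.LeftInverse ψ φ) (v : M → CSpace m) {c c' : M} {z : CSpace m}
    (hz : z ∈ overlap φ c c') :
    fderiv ℂ (inCharts (CSpace m) (CSpace m) φ c c') z (coord ℂ c v z) =
      coord ℂ c' (pushVec φ ψ v) (inCharts (CSpace m) (CSpace m) φ c c' z) := by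
  refine fderiv_inCharts_coord (𝕜 := ℂ) hz.1 ((hφ _).of_le le_top) hz.2 ?_
  rw [pushVec, hψφ]
  rfl

/-- The push-forward of a holomorphic vector field by a biholomorphic map `φ` with inverse `ψ`. -/
def pushField (φ ψ : M → M) (hφ : ContMDiff 𝓘(ℂ, CSpace m) 𝓘(ℂ, CSpace m) ω φ)
    (hψ : ContMDiff 𝓘(ℂ, CSpace m) 𝓘(ℂ, CSpace m) ω ψ) (hψφ : Function.LeftInverse ψ φ)
    (hφψ : Function.RightInverse ψ φ) :
    HolVectorField m M →ₗ[ℂ] HolVectorField m M where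
  toFun Ξ := HolVectorField.ofCoord (pushVec φ ψ (vec Ξ)) fun c' w hw => by
    set c := ψ ((chartAt (CSpace m) c').symm w) with hc
    have hwo : w ∈ overlap ψ c' c := ⟨hw, mem_chart_source _ _⟩
    have hmem : ∀ w ∈ overlap ψ c' c, inCharts (CSpace m) (CSpace m) ψ c' c w ∈ overlap φ c c' ∧
        inCharts (CSpace m) (CSpace m) φ c c' (inCharts (CSpace m) (CSpace m) ψ c' c w) = w := by
      intro w hw
      have e : (chartAt (CSpace m) c).symm (inCharts (CSpace m) (CSpace m) ψ c' c w) =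
        ψ ((chartAt (CSpace m) c').symm w) := (chartAt (CSpace m) c).left_inv hw.2
      refine ⟨⟨(chartAt (CSpace m) c).map_source hw.2, ?_⟩, ?_⟩
      · rw [Set.mem_preimage, e, hφψ]
        exact (chartAt (CSpace m) c').map_target hw.1
      · rw [inCharts, e, hφψ, (chartAt (CSpace m) c').right_inv hw.1]
    have hσ := analyticAt_inCharts hψ hwo.1 hwo.2
    have hτ := analyticAt_inCharts hφ (hmem w hwo).1.1 (hmem w hwo).1.2
    have hΞ : ContDiffAt ℂ ω (coord ℂ c (vec Ξ))
        (inCharts (CSpace m) (CSpace m) ψ c' c w) :=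
      (Ξ.contDiffOn_coord c).contDiffAt
        ((chartAt (CSpace m) c).open_target.mem_nhds (hmem w hwo).1.1)
    have h1 : ContDiffAt ℂ ω (fun w =>
        fderiv ℂ (inCharts (CSpace m) (CSpace m) φ c c') (inCharts (CSpace m) (CSpace m) ψ c' c w)
          (coord ℂ c (vec Ξ) (inCharts (CSpace m) (CSpace m) ψ c' c w))) w := by
      refine ContDiffAt.clm_apply ?_ (hΞ.comp w hσ.contDiffAt)
      exact (hτ.fderiv.contDiffAt (n := ω)).comp w hσ.contDiffAt
    refine (h1.congr_of_eventuallyEq ?_).contDiffWithinAt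
    filter_upwards [(isOpen_overlap hψ.continuous).mem_nhds hwo] with v hv
    rw [coord_pushVec hφ hψφ _ (hmem v hv).1, (hmem v hv).2]
  map_add' Ξ Ξ' := by
    ext y : 1
    exact map_add (cderiv φ (ψ y)) (vec Ξ (ψ y)) (vec Ξ' (ψ y))
  map_smul' a Ξ := by
    ext y : 1
    exact map_smul (cderiv φ (ψ y)) a (vec Ξ (ψ y))

/-- Gradients correspond under the holomorphic isometry φ, and its differential is injective, so the
gradient equation at x for one form is equivalent to that at φ x for the other. -/
theorem isHamiltonian_pushField {κ κ' : KahlerForm m M}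
    (hφ : ContMDiff 𝓘(ℂ, CSpace m) 𝓘(ℂ, CSpace m) ω φ)
    (hψ : ContMDiff 𝓘(ℂ, CSpace m) 𝓘(ℂ, CSpace m) ω ψ) (hψφ : Function.LeftInverse ψ φ)
    (hφψ : Function.RightInverse ψ φ) (h : κ'.form = RealForm.pullback φ κ.form)
    (Ξ : HolVectorField m M) (ζ : M → ℂ) :
    κ.IsHamiltonian (pushField φ ψ hφ hψ hψφ hφψ Ξ) ζ ↔ κ'.IsHamiltonian Ξ (ζ ∘ φ) := by
  have hφr : ContMDiff 𝓘(ℝ, CSpace m) 𝓘(ℝ, CSpace m) ∞ φ := (contMDiff_real hφ).of_le (by simp)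
  have hψr : ContMDiff 𝓘(ℝ, CSpace m) 𝓘(ℝ, CSpace m) ∞ ψ := (contMDiff_real hψ).of_le (by simp)
  rw [κ.isHamiltonian_iff, κ'.isHamiltonian_iff]
  have hs : ContMDiff 𝓘(ℝ, CSpace m) 𝓘(ℝ, ℂ) ∞ (ζ ∘ φ) ↔
      ContMDiff 𝓘(ℝ, CSpace m) 𝓘(ℝ, ℂ) ∞ ζ := by
    refine ⟨fun h1 => ?_, fun h1 => h1.comp hφr⟩
    have h2 := h1.comp hψr
    rwa [Function.comp_assoc, hφψ.comp_eq_id] at h2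
  rw [hs]
  refine and_congr_right fun hζ => ?_
  have key : ∀ x, vec (pushField φ ψ hφ hψ hψφ hφψ Ξ) (φ x) = (2 * Complex.I) •
        cgrad (κ.herm (φ x)) (ζ ∘ (chartAt (CSpace m) (φ x)).symm) (chartAt (CSpace m) (φ x) (φ x)) ↔
      vec Ξ x = (2 * Complex.I) •
        cgrad (κ'.herm x) ((ζ ∘ φ) ∘ (chartAt (CSpace m) x).symm) (chartAt (CSpace m) x x) := by
    intro x
    have hz : chartAt (CSpace m) x x ∈ overlap φ x (φ x) := ⟨mem_chart_target _ _, by simp⟩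
    have e : inCharts (CSpace m) (CSpace m) φ x (φ x) (chartAt (CSpace m) x x) =
      chartAt (CSpace m) (φ x) (φ x) := by simp [inCharts]
    have h1 := coord_pushVec hφ hψφ (vec Ξ) hz
    rw [e, coord_self, coord_self] at h1
    have h2 := fderiv_cgrad hφ h hζ hz
    rw [e] at h2
    have h3 : vec (pushField φ ψ hφ hψ hψφ hφψ Ξ) (φ x) =
      pushVec φ ψ (vec Ξ) (φ x) := rfl
    rw [h3, ← h1, ← h2, ← map_smul]
    refine ⟨fun h4 => ?_, fun h4 => by rw [h4]⟩
    rw [← sub_eq_zero, ← map_sub] at h4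
    by_contra hne
    exact fderiv_inCharts_ne_zero hφ hψ hψφ hz.1 hz.2 (sub_ne_zero.2 hne) h4
  constructor
  · exact fun h1 x => (key x).1 (h1 (φ x))
  · intro h1 y
    have h2 := (key (ψ y)).2 (h1 (ψ y))
    rwa [hφψ] at h2

theorem pushField_pushField (hφ : ContMDiff 𝓘(ℂ, CSpace m) 𝓘(ℂ, CSpace m) ω φ)
    (hψ : ContMDiff 𝓘(ℂ, CSpace m) 𝓘(ℂ, CSpace m) ω ψ) (hψφ : Function.LeftInverse ψ φ)
    (hφψ : Function.RightInverse ψ φ) (Ξ : HolVectorField m M) :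
    pushField φ ψ hφ hψ hψφ hφψ (pushField ψ φ hψ hφ hφψ hψφ Ξ) = Ξ := by
  ext y : 1
  have h1 : cderiv φ (ψ y) (cderiv ψ (φ (ψ y)) (vec Ξ (φ (ψ y)))) = vec Ξ y := by
    rw [hφψ]
    have h5 : mfderiv 𝓘(ℂ, CSpace m) 𝓘(ℂ, CSpace m) (φ ∘ ψ) y =
        (mfderiv 𝓘(ℂ, CSpace m) 𝓘(ℂ, CSpace m) φ (ψ y)).comp
          (mfderiv 𝓘(ℂ, CSpace m) 𝓘(ℂ, CSpace m) ψ y) :=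
      mfderiv_comp y ((hφ _).mdifferentiableAt (by simp)) ((hψ y).mdifferentiableAt (by simp))
    rw [hφψ.comp_eq_id, mfderiv_id] at h5
    exact congrArg (fun L : CSpace m →L[ℂ] CSpace m => L (vec Ξ y)) h5.symm
  exact h1

end Pushforward

end KahlerBlowup

end

noncomputable section

namespace KahlerBlowup

open Topology MeasureTheory

/-! ### The Riemannian measure and its invariance. -/

section Volume

variable {m : ℕ}

/-- The real determinant of a complex linear map is the norm from ℂ to ℝ of its complex determinant.
-/
theorem det_real_fderiv {τ : CSpace m → CSpace m} {z : CSpace m} (h : DifferentiableAt ℂ τ z) :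
    (fderiv ℝ τ z).det = Complex.normSq (jac τ z).det := by
  have h1 : (fderiv ℂ τ z : CSpace m →ₗ[ℂ] CSpace m) = Matrix.toLin' (jac τ z) := by
    refine LinearMap.ext fun u => ?_
    exact (jac_mulVec τ z u).symm
  have h2 : ((fderiv ℝ τ z : CSpace m →L[ℝ] CSpace m) : CSpace m →ₗ[ℝ] CSpace m) =
      (Matrix.toLin' (jac τ z)).restrictScalars ℝ := by
    rw [fderiv_real_eq h, ← h1]
    rfl
  rw [ContinuousLinearMap.det, h2, LinearMap.det_restrictScalars, LinearMap.det_toLin',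
    Algebra.norm_complex_apply]

theorem measurableSet_inter_preimage {X Y : Type*} [TopologicalSpace X] [MeasurableSpace X]
    [BorelSpace X] [TopologicalSpace Y] [MeasurableSpace Y] [BorelSpace Y] {f : X → Y} {U : Set X}
    (hU : MeasurableSet U) (hf : ContinuousOn f U) {E : Set Y} (hE : MeasurableSet E) :
    MeasurableSet (U ∩ f ⁻¹' E) := by
  have h1 : Measurable (U.domRestrict f) := (continuousOn_iff_continuous_domRestrict.1 hf).measurable
  have h2 := hU.subtype_image (h1 hE)
  rw [show U.domRestrict f ⁻¹' E = Subtype.val ⁻¹' (f ⁻¹' E) from rfl,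
    Subtype.image_preimage_coe] at h2
  exact h2

variable {M : Type*} [TopologicalSpace M] [ChartedSpace (CSpace m) M]
  [IsManifold 𝓘(ℂ, CSpace m) ω M] [MeasurableSpace M] [BorelSpace M]
  {φ ψ : M → M} {c c' x : M} {κ κ' : KahlerForm m M} {E : Set M}

/-- The volume measure on the domain of a chart. -/
def KahlerForm.chartMeasure (κ : KahlerForm m M) (c : M) : Measure M :=
  Measure.map (chartAt (CSpace m) c).symm ((volume.restrict (chartAt (CSpace m) c).target).withDensity
      fun z => ENNReal.ofReal (κ.herm c z).det.re)

omit [IsManifold 𝓘(ℂ, CSpace m) ω M] [BorelSpace M] in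
theorem KahlerForm.vol_eq_iSup (κ : KahlerForm m M) : κ.vol = ⨆ c, κ.chartMeasure c := rfl

omit [IsManifold 𝓘(ℂ, CSpace m) ω M] in
theorem aemeasurable_chart_symm (κ : KahlerForm m M) (c : M) :
    AEMeasurable (chartAt (CSpace m) c).symm
      ((volume.restrict (chartAt (CSpace m) c).target).withDensity
      fun z => ENNReal.ofReal (κ.herm c z).det.re) :=
  ((chartAt (CSpace m) c).continuousOn_symm.aemeasurable
    (chartAt (CSpace m) c).open_target.measurableSet).mono_ac (withDensity_absolutelyContinuous _ _)

omit [IsManifold 𝓘(ℂ, CSpace m) ω M] in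
theorem KahlerForm.chartMeasure_apply (κ : KahlerForm m M) (c : M) (hE : MeasurableSet E) :
    κ.chartMeasure c E = ∫⁻ z in (chartAt (CSpace m) c).target ∩ (chartAt (CSpace m) c).symm ⁻¹' E,
      ENNReal.ofReal (κ.herm c z).det.re := by
  rw [chartMeasure, Measure.map_apply_of_aemeasurable (aemeasurable_chart_symm κ c) hE,
    withDensity_apply', Measure.restrict_restrict' (chartAt (CSpace m) c).open_target.measurableSet,
    Set.inter_comm]

omit [IsManifold 𝓘(ℂ, CSpace m) ω M] in
theorem KahlerForm.chartMeasure_inter_source (κ : KahlerForm m M) (c : M) (hE : MeasurableSet E) :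
    κ.chartMeasure c (E ∩ (chartAt (CSpace m) c).source) = κ.chartMeasure c E := by
  rw [κ.chartMeasure_apply c hE,
    κ.chartMeasure_apply c (hE.inter (chartAt (CSpace m) c).open_source.measurableSet)]
  congr 2
  ext z
  constructor
  · exact fun h => ⟨h.1, h.2.1⟩
  · exact fun h => ⟨h.1, h.2, (chartAt (CSpace m) c).map_target h.1⟩

/-- Change of variables: the real Jacobian |det J|² is the factor by which the density det H changes
under a holomorphic isometry. -/
theorem chartMeasure_preimage (hφ : ContMDiff 𝓘(ℂ, CSpace m) 𝓘(ℂ, CSpace m) ω φ)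
    (hψ : Continuous ψ) (hψφ : Function.LeftInverse ψ φ)
    (hφψ : Function.RightInverse ψ φ) (h : κ'.form = RealForm.pullback φ κ.form)
    (hE : MeasurableSet E) (hEc : E ⊆ (chartAt (CSpace m) c).source)
    (hEc' : E ⊆ φ ⁻¹' (chartAt (CSpace m) c').source) :
    κ'.chartMeasure c E = κ.chartMeasure c' (ψ ⁻¹' E) := by
  have hI := isHolIsometry_inCharts hφ h c c'
  set e := chartAt (CSpace m) c with he
  set e' := chartAt (CSpace m) c' with he'
  set τ := inCharts (CSpace m) (CSpace m) φ c c' with hτ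
  rw [κ'.chartMeasure_apply c hE, κ.chartMeasure_apply c' (hψ.measurable hE), ← he, ← he']
  set S := e.target ∩ e.symm ⁻¹' E with hS
  have hSo : S ⊆ overlap φ c c' := fun z hz => ⟨hz.1, hEc' hz.2⟩
  have hSm : MeasurableSet S :=
    measurableSet_inter_preimage e.open_target.measurableSet e.continuousOn_symm hE
  have himg : e'.target ∩ e'.symm ⁻¹' (ψ ⁻¹' E) = τ '' S := by
    ext w
    constructor
    · rintro ⟨hw, hwE⟩
      have hw' : e.symm (e (ψ (e'.symm w))) = ψ (e'.symm w) := e.left_inv (hEc hwE)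
      refine ⟨e (ψ (e'.symm w)), ⟨e.map_source (hEc hwE), ?_⟩, ?_⟩
      · rw [Set.mem_preimage, hw']
        exact hwE
      · rw [hτ, inCharts, ← he, ← he', hw', hφψ, e'.right_inv hw]
    · rintro ⟨z, hz, rfl⟩
      refine ⟨e'.map_source (hEc' hz.2), ?_⟩
      have hw' : e'.symm (τ z) = φ (e.symm z) := e'.left_inv (hEc' hz.2)
      rw [Set.mem_preimage, Set.mem_preimage, hw', hψφ]
      exact hz.2
  have hinj : Set.InjOn τ S := by
    intro z hz w hw hzw
    have h1 : φ (e.symm z) = φ (e.symm w) := e'.injOn (hEc' hz.2) (hEc' hw.2) hzw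
    exact e.symm.injOn hz.1 hw.1 (hψφ.injective h1)
  have hd : ∀ z ∈ S, HasFDerivWithinAt τ (fderiv ℝ τ z) S z := fun z hz =>
    ((hI.differentiableAt (hSo hz)).restrictScalars ℝ).hasFDerivAt.hasFDerivWithinAt
  rw [himg, lintegral_image_eq_lintegral_abs_det_fderiv_mul volume hSm hd hinj]
  refine setLIntegral_congr_fun hSm fun z hz => ?_
  have hzo := hSo hz
  have hdet := hI.det_eq hzo
  have hpos := hI.right.det_pos (hI.maps hzo)
  have e1 : (κ'.herm c z).det.re =
      Complex.normSq (jac τ z).det * (κ.herm c' (τ z)).det.re := by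
    have : (κ'.herm c z).det =
        ((Complex.normSq (jac τ z).det * (κ.herm c' (τ z)).det.re : ℝ) : ℂ) := by
      rw [hdet, mul_right_comm, Complex.mul_conj]
      conv_lhs => rw [hpos.2]
      push_cast
      rfl
    rw [this, Complex.ofReal_re]
  rw [det_real_fderiv (hI.differentiableAt hzo), abs_of_nonneg (Complex.normSq_nonneg _), e1,
    ENNReal.ofReal_mul (Complex.normSq_nonneg _)]

theorem chartMeasure_congr (κ : KahlerForm m M) (hE : MeasurableSet E)
    (hEc : E ⊆ (chartAt (CSpace m) c).source) (hEc' : E ⊆ (chartAt (CSpace m) c').source) :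
    κ.chartMeasure c E = κ.chartMeasure c' E :=
  chartMeasure_preimage (φ := id) (ψ := id) contMDiff_id_complex continuous_id (fun _ => rfl)
    (fun _ => rfl) (RealForm.pullback_id _).symm hE hEc hEc'

theorem _root_.exists_nat_iUnion_eq_univ {X : Type*} [TopologicalSpace X] [LindelofSpace X] [Nonempty X]
    {O : X → Set X} (hO : ∀ x, O x ∈ 𝓝 x) : ∃ c : ℕ → X, ⋃ n, O (c n) = Set.univ := by
  obtain ⟨s, hs, hsu⟩ := isLindelof_univ.elim_nhds_subcover O fun x _ => hO x
  have hne : s.Nonempty := by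
    obtain ⟨x⟩ := ‹Nonempty X›
    obtain ⟨y, hy, -⟩ := Set.mem_iUnion₂.1 (hsu.2 (Set.mem_univ x))
    exact ⟨y, hy⟩
  obtain ⟨c, rfl⟩ := hs.exists_eq_range hne
  refine ⟨c, Set.eq_univ_of_univ_subset (hsu.2.trans ?_)⟩
  intro x hx
  obtain ⟨y, ⟨n, rfl⟩, hy⟩ := Set.mem_iUnion₂.1 hx
  exact Set.mem_iUnion.2 ⟨n, hy⟩

variable [CompactSpace M] [Nonempty M]

/-- In a chart the volume measure is the measure with density `det H`. -/
theorem KahlerForm.vol_apply (κ : KahlerForm m M) (hE : MeasurableSet E)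
    (hEc : E ⊆ (chartAt (CSpace m) c).source) : κ.vol E = κ.chartMeasure c E := by
  obtain ⟨d, hd⟩ := exists_nat_iUnion_eq_univ (X := M) (O := fun x => (chartAt (CSpace m) x).source)
    fun x => (chartAt (CSpace m) x).open_source.mem_nhds (mem_chart_source _ x)
  let P : ℕ → Set M := disjointed fun n => (chartAt (CSpace m) (d n)).source
  have hPs : ∀ n, P n ⊆ (chartAt (CSpace m) (d n)).source := fun n => disjointed_subset _ n
  have hPm : ∀ n, MeasurableSet (P n) := fun n =>
    MeasurableSet.disjointed (fun k => (chartAt (CSpace m) (d k)).open_source.measurableSet) n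
  have hPd : Pairwise (Function.onFun Disjoint P) := disjoint_disjointed _
  have hPu : ⋃ n, P n = Set.univ := (iUnion_disjointed).trans hd
  -- Chart measures glued along a countable partition subordinate to charts. Each chart measure
  -- agrees with ν on its own chart, so ν bounds the supremum defining the volume, and on a chart
  -- all of them coincide.
  let ν : Measure M := Measure.sum fun n => (κ.chartMeasure (d n)).restrict (P n)
  have hsplit : ∀ (μ : Measure M) (F : Set M), MeasurableSet F → μ F = ∑' n, μ (F ∩ P n) := by
    intro μ F hF
    rw [← measure_iUnion (fun i j hij => ((hPd hij).mono Set.inter_subset_right Set.inter_subset_right))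
      fun n => hF.inter (hPm n), ← Set.inter_iUnion, hPu, Set.inter_univ]
  have hν : ∀ F, MeasurableSet F → ν F = ∑' n, κ.chartMeasure (d n) (F ∩ P n) := fun F hF => by
    rw [Measure.sum_apply _ hF]
    exact tsum_congr fun n => Measure.restrict_apply hF
  have hc : ∀ c F, MeasurableSet F → F ⊆ (chartAt (CSpace m) c).source → κ.chartMeasure c F = ν F := by
    intro c F hF hFc
    rw [hν F hF, hsplit _ F hF]
    exact tsum_congr fun n => chartMeasure_congr κ (hF.inter (hPm n))
      (Set.inter_subset_left.trans hFc) (Set.inter_subset_right.trans (hPs n))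
  have hle : κ.vol ≤ ν := by
    rw [κ.vol_eq_iSup]
    refine iSup_le fun c => Measure.le_iff.2 fun F hF => ?_
    rw [← κ.chartMeasure_inter_source c hF,
      hc c _ (hF.inter (chartAt (CSpace m) c).open_source.measurableSet) Set.inter_subset_right]
    exact measure_mono Set.inter_subset_left
  refine le_antisymm ?_ ?_
  · rw [hc c E hE hEc]
    exact hle E
  · exact (le_iSup κ.chartMeasure c) E

theorem KahlerForm.restrict_vol (κ : KahlerForm m M) (c : M) :
    κ.vol.restrict (chartAt (CSpace m) c).source = κ.chartMeasure c := by
  ext F hF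
  rw [Measure.restrict_apply hF, κ.vol_apply (hF.inter (chartAt (CSpace m) c).open_source.measurableSet)
    Set.inter_subset_right, κ.chartMeasure_inter_source c hF]

/-- A biholomorphic map preserves the volume. -/
theorem map_vol (hφ : ContMDiff 𝓘(ℂ, CSpace m) 𝓘(ℂ, CSpace m) ω φ)
    (hψ : Continuous ψ) (hψφ : Function.LeftInverse ψ φ)
    (hφψ : Function.RightInverse ψ φ) (h : κ'.form = RealForm.pullback φ κ.form) :
    Measure.map φ κ'.vol = κ.vol := by
  have hφm := hφ.continuous.measurable
  -- Sets lying in a single chart whose image also lies in a single chart; countably many cover M,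
  -- and measures are compared piece by piece.
  let O : M → Set M := fun x => (chartAt (CSpace m) x).source ∩ φ ⁻¹' (chartAt (CSpace m) (φ x)).source
  have hO : ∀ x, IsOpen (O x) := fun x => (chartAt (CSpace m) x).open_source.inter
    ((chartAt (CSpace m) (φ x)).open_source.preimage hφ.continuous)
  obtain ⟨d, hd⟩ := exists_nat_iUnion_eq_univ (X := M) (O := O)
    fun x => (hO x).mem_nhds ⟨mem_chart_source _ _, mem_chart_source _ _⟩
  have hu : ⋃ n, ψ ⁻¹' (O (d n)) = Set.univ := by
    rw [← Set.preimage_iUnion, hd, Set.preimage_univ]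
  refine (Measure.ext_iff_of_iUnion_eq_univ hu).2 fun n => ?_
  ext F hF
  have hOm := (hψ.measurable (hO (d n)).measurableSet)
  rw [Measure.restrict_apply hF, Measure.restrict_apply hF, Measure.map_apply hφm (hF.inter hOm)]
  have e1 : φ ⁻¹' (F ∩ ψ ⁻¹' O (d n)) = φ ⁻¹' F ∩ O (d n) := by
    ext x
    simp [hψφ x]
  have e2 : F ∩ ψ ⁻¹' O (d n) = ψ ⁻¹' (φ ⁻¹' F ∩ O (d n)) := by
    ext x
    simp [hφψ x]
  have hm : MeasurableSet (φ ⁻¹' F ∩ O (d n)) := (hφm hF).inter (hO (d n)).measurableSet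
  rw [e1, e2, κ'.vol_apply (c := d n) hm (fun x hx => hx.2.1),
    chartMeasure_preimage (c' := φ (d n)) hφ hψ hψφ hφψ h hm (fun x hx => hx.2.1) (fun x hx => hx.2.2),
    κ.vol_apply (c := φ (d n)) (hψ.measurable hm)]
  intro y hy
  have := hy.2.2
  rwa [Set.mem_preimage, hφψ] at this

theorem KahlerForm.vol_lt_top (κ : KahlerForm m M) : κ.vol Set.univ < ⊤ := by
  refine isCompact_univ.measure_lt_top_of_nhdsWithin fun x _ => ?_
  have hK := κ.isLocalKahler x
  obtain ⟨r, hr, hball⟩ := Metric.nhds_basis_closedBall.mem_iff.1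
    ((chartAt (CSpace m) x).open_target.mem_nhds (mem_chart_target (CSpace m) x))
  have hB : IsCompact (Metric.closedBall (chartAt (CSpace m) x x) r) := isCompact_closedBall _ _
  set W := (chartAt (CSpace m) x).source ∩
    chartAt (CSpace m) x ⁻¹' Metric.ball (chartAt (CSpace m) x x) r with hW
  have hWo : IsOpen W := (chartAt (CSpace m) x).isOpen_inter_preimage Metric.isOpen_ball
  refine ⟨W, mem_nhdsWithin_of_mem_nhds (hWo.mem_nhds ⟨mem_chart_source _ _,
    Metric.mem_ball_self hr⟩), ?_⟩
  rw [κ.vol_apply hWo.measurableSet Set.inter_subset_left, κ.chartMeasure_apply x hWo.measurableSet]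
  have hcont : ContinuousOn (fun z => (κ.herm x z).det.re)
      (Metric.closedBall (chartAt (CSpace m) x x) r) :=
    (Complex.continuous_re.comp_continuousOn hK.smooth.det.continuousOn).mono hball
  have hint := (hcont.integrableOn_compact hB (μ := volume)).lintegral_lt_top
  refine lt_of_le_of_lt (lintegral_mono_set ?_) hint
  rintro z ⟨hz, hz2⟩
  have := hz2.2
  rw [Set.mem_preimage, (chartAt (CSpace m) x).right_inv hz] at this
  exact Metric.ball_subset_closedBall this

instance (κ : KahlerForm m M) : IsFiniteMeasure κ.vol := ⟨κ.vol_lt_top⟩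

instance (κ : KahlerForm m M) : κ.vol.IsOpenPosMeasure := by
  refine ⟨fun O hO ⟨x, hx⟩ h0 => ?_⟩
  have hK := κ.isLocalKahler x
  set W := O ∩ (chartAt (CSpace m) x).source with hW
  have hWo : IsOpen W := hO.inter (chartAt (CSpace m) x).open_source
  have h1 : κ.vol W = 0 := measure_mono_null Set.inter_subset_left h0
  rw [κ.vol_apply hWo.measurableSet Set.inter_subset_right, κ.chartMeasure_apply x hWo.measurableSet] at h1
  have hVo : IsOpen ((chartAt (CSpace m) x).target ∩ (chartAt (CSpace m) x).symm ⁻¹' W) :=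
    (chartAt (CSpace m) x).symm.isOpen_inter_preimage hWo
  have h2 : volume ((chartAt (CSpace m) x).target ∩ (chartAt (CSpace m) x).symm ⁻¹' W) = 0 := by
    have hae : AEMeasurable (fun z => ENNReal.ofReal (κ.herm x z).det.re)
        (volume.restrict ((chartAt (CSpace m) x).target ∩ (chartAt (CSpace m) x).symm ⁻¹' W)) := by
      refine ENNReal.measurable_ofReal.comp_aemeasurable (ContinuousOn.aemeasurable ?_ hVo.measurableSet)
      exact (Complex.continuous_re.comp_continuousOn hK.smooth.det.continuousOn).mono
        Set.inter_subset_left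
    rw [lintegral_eq_zero_iff' hae] at h1
    have h3 : ∀ᵐ z ∂(volume.restrict ((chartAt (CSpace m) x).target ∩
        (chartAt (CSpace m) x).symm ⁻¹' W)), False := by
      filter_upwards [h1, ae_restrict_mem hVo.measurableSet] with z hz hz2
      have := (hK.det_pos hz2.1).1
      simp only [Pi.zero_apply, ENNReal.ofReal_eq_zero] at hz
      exact absurd hz (not_le.2 this)
    rw [ae_iff] at h3
    simpa using h3
  refine (hVo.measure_pos volume ⟨chartAt (CSpace m) x x, mem_chart_target _ _, ?_⟩).ne' h2
  rw [Set.mem_preimage, (chartAt (CSpace m) x).left_inv (mem_chart_source _ _)]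
  exact ⟨hx, mem_chart_source _ _⟩

/-- Integration in a chart of a function supported in its domain. -/
theorem KahlerForm.integral_eq_chart (κ : KahlerForm m M) {f : M → ℂ} (hf : Continuous f)
    (hs : Function.support f ⊆ (chartAt (CSpace m) c).source) :
    ∫ x, f x ∂κ.vol = ∫ z in (chartAt (CSpace m) c).target,
      (κ.herm c z).det * f ((chartAt (CSpace m) c).symm z) := by
  have hK := κ.isLocalKahler c
  have htm := (chartAt (CSpace m) c).open_target.measurableSet
  rw [← setIntegral_eq_integral_of_forall_compl_eq_zero (s := (chartAt (CSpace m) c).source)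
    (fun x hx => by_contra fun h => hx (hs h)), κ.restrict_vol c, chartMeasure,
    integral_map (aemeasurable_chart_symm κ c) hf.aestronglyMeasurable,
    integral_withDensity_eq_integral_toReal_smul₀ ?_ (by simp)]
  · refine setIntegral_congr_fun htm fun z hz => ?_
    have h1 := hK.det_pos hz
    rw [ENNReal.toReal_ofReal h1.1.le, Complex.real_smul, ← h1.2]
  · refine ENNReal.measurable_ofReal.comp_aemeasurable (ContinuousOn.aemeasurable ?_ htm)
    exact Complex.continuous_re.comp_continuousOn hK.smooth.det.continuousOn

end Volume

end KahlerBlowup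

end

noncomputable section

namespace KahlerBlowup

open Topology MeasureTheory

/-! ### The divergence theorem in a chart. -/

section LocalDivergence

variable {m : ℕ} {U K : Set (CSpace m)} {H : CSpace m → Matrix (Fin m) (Fin m) ℂ}
  {r F : CSpace m → ℂ} {W : CSpace m → CSpace m} {z : CSpace m}

/-- Integration by parts against the constant function 1. -/
theorem integral_fderiv_eq_zero {E : Type*} [NormedAddCommGroup E] [NormedSpace ℝ E]
    [FiniteDimensional ℝ E] [MeasurableSpace E] [BorelSpace E] {μ : Measure E} [μ.IsAddHaarMeasure]
    {G : E → ℂ} (hG : ContDiff ℝ 1 G) (hc : HasCompactSupport G) (v : E) :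
    ∫ x, fderiv ℝ G x v ∂μ = 0 := by
  have h1 : Integrable (fun x => fderiv ℝ G x v) μ :=
    ((hG.continuous_fderiv (by simp)).clm_apply continuous_const).integrable_of_hasCompactSupport
      (hc.fderiv_apply ℝ v)
  have h2 : Integrable G μ := hG.continuous.integrable_of_hasCompactSupport hc
  have h := integral_mul_fderiv_eq_neg_fderiv_mul_of_integrable (μ := μ) (f := fun _ : E => (1 : ℂ))
    (g := G) (v := v) (by simp) (by simpa using h1) (by simpa using h2)
    (fun x _ => differentiableAt_const _) (fun x _ => hG.differentiable (by simp) x)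
  simpa using h

/-- Extension by zero is smooth because the complement of the compact set K is an open neighbourhood
of every point outside U. -/
theorem contDiff_indicator (hU : IsOpen U) (hK : IsCompact K) (hKU : K ⊆ U)
    (hF : ContDiffOn ℝ ∞ F U) (h0 : ∀ z ∈ U, z ∉ K → F z = 0) :
    ContDiff ℝ ∞ (U.indicator F) ∧ HasCompactSupport (U.indicator F) := by
  have hz0 : ∀ z, z ∉ K → U.indicator F z = 0 := fun z hz => by
    by_cases hzU : z ∈ U
    · rw [Set.indicator_of_mem hzU, h0 z hzU hz]
    · rw [Set.indicator_of_notMem hzU]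
  refine ⟨contDiff_iff_contDiffAt.2 fun z => ?_, HasCompactSupport.intro hK hz0⟩
  by_cases hz : z ∈ U
  · refine (hF.contDiffAt (hU.mem_nhds hz)).congr_of_eventuallyEq ?_
    filter_upwards [hU.mem_nhds hz] with w hw using Set.indicator_of_mem hw _
  · refine (contDiffAt_const (c := (0 : ℂ))).congr_of_eventuallyEq ?_
    filter_upwards [hK.isClosed.isOpen_compl.mem_nhds fun h => hz (hKU h)] with w hw using hz0 w hw

theorem setIntegral_wd_eq_zero (hU : IsOpen U) (hK : IsCompact K) (hKU : K ⊆ U)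
    (hF : ContDiffOn ℝ ∞ F U) (h0 : ∀ z ∈ U, z ∉ K → F z = 0) (s : ℂ) (j : Fin m) :
    IntegrableOn (wd s j F) U ∧ ∫ z in U, wd s j F z = 0 := by
  obtain ⟨h1, h2⟩ := contDiff_indicator hU hK hKU hF h0
  have hi (v : CSpace m) : Integrable (fun x => fderiv ℝ (U.indicator F) x v) :=
    ((h1.continuous_fderiv (by simp)).clm_apply continuous_const).integrable_of_hasCompactSupport
      (h2.fderiv_apply ℝ v)
  have hI : Integrable (wd s j (U.indicator F)) :=
    ((hi _).add ((hi _).const_mul _)).const_mul _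
  have he : ∀ z ∈ U, wd s j (U.indicator F) z = wd s j F z := fun z hz =>
    wd_congr_on hU hz fun w hw => Set.indicator_of_mem hw _
  have hz0 : ∀ z, z ∉ U → wd s j (U.indicator F) z = 0 := fun z hz => by
    have e : U.indicator F =ᶠ[𝓝 z] fun _ => 0 := by
      filter_upwards [hK.isClosed.isOpen_compl.mem_nhds fun h => hz (hKU h)] with w hw
      by_cases hwU : w ∈ U
      · rw [Set.indicator_of_mem hwU, h0 w hwU hw]
      · rw [Set.indicator_of_notMem hwU]
    rw [wd_congr e, wd_const]
  refine ⟨hI.integrableOn.congr_fun he hU.measurableSet, ?_⟩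
  rw [← setIntegral_congr_fun hU.measurableSet he, setIntegral_eq_integral_of_forall_compl_eq_zero hz0]
  simp only [wd]
  rw [integral_const_mul, integral_add (hi _) ((hi _).const_mul _), integral_const_mul,
    integral_fderiv_eq_zero (h1.of_le (by simp)) h2, integral_fderiv_eq_zero (h1.of_le (by simp)) h2]
  simp

theorem wd_det_eq_mul_wd_logDet (h : IsLocalKahler U H) (hz : z ∈ U) (s : ℂ) (l : Fin m) :
    wd s l (fun w => (H w).det) z = (H z).det * wd s l (logDet H) z := by
  have hu : IsUnit (H z).det := isUnit_iff_ne_zero.2 (h.det_ne_zero hz)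
  rw [wd_det h.smooth h.isOpen hz, wd_logDet h hz, Matrix.inv_def, Matrix.smul_mul,
    Matrix.trace_smul, smul_eq_mul, ← mul_assoc, Ring.mul_inverse_cancel _ hu, one_mul]

/-- The divergence theorem for a compactly supported multiple of a vector field. -/
theorem setIntegral_det_mul_cdiv (h : IsLocalKahler U H) (hK : IsCompact K) (hKU : K ⊆ U)
    (hr : ContDiffOn ℝ ∞ r U) (h0 : ∀ z ∈ U, z ∉ K → r z = 0) (hW : SmoothV U W) :
    IntegrableOn (fun z => (H z).det * (r z * cdiv H W z + ∑ j, W z j * wd (-1) j r z)) U ∧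
      ∫ z in U, (H z).det * (r z * cdiv H W z + ∑ j, W z j * wd (-1) j r z) = 0 := by
  have hU := h.isOpen
  have hD := h.smooth.det
  have hrW (j : Fin m) : ContDiffOn ℝ ∞ (fun w => r w * W w j) U := hr.mul (hW j)
  -- The log det term of `cdiv` absorbs the density: det H times the divergence of rW is the
  -- coordinate divergence of det H · rW.
  have e : ∀ z ∈ U, (H z).det * (r z * cdiv H W z + ∑ j, W z j * wd (-1) j r z) =
      ∑ j, wd (-1) j (fun w => (H w).det * (r w * W w j)) z := by
    intro z hz
    rw [← cdiv_smul hU hr hW hz, cdiv, Finset.mul_sum]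
    refine Finset.sum_congr rfl fun j _ => ?_
    rw [wd_mul (hD.differentiableAt_of_isOpen hU hz) ((hrW j).differentiableAt_of_isOpen hU hz),
      wd_det_eq_mul_wd_logDet h hz]
    simp only [Pi.smul_apply, smul_eq_mul]
    ring
  rw [setIntegral_congr_fun hU.measurableSet e, integrableOn_congr_fun e hU.measurableSet]
  have hj (j : Fin m) := setIntegral_wd_eq_zero hU hK hKU (hD.mul (hrW j))
    (fun z hz hzK => by rw [h0 z hz hzK]; ring) (-1) j
  refine ⟨integrable_finsetSum _ fun j _ => (hj j).1, ?_⟩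
  rw [integral_finsetSum _ fun j _ => (hj j).1]
  exact Finset.sum_eq_zero fun j _ => (hj j).2

end LocalDivergence

/-! ### The global divergence theorem. -/

section Divergence

variable {m : ℕ} {M : Type*} [TopologicalSpace M] [ChartedSpace (CSpace m) M]
  [IsManifold 𝓘(ℂ, CSpace m) ω M]

/-- The coordinates in all charts of a smooth `(1,0)`-vector field. -/
structure IsSmoothField (W : M → CSpace m → CSpace m) : Prop where
  smooth : ∀ c, SmoothV (chartAt (CSpace m) c).target (W c)
  change : ∀ c c', ∀ z ∈ overlap (id : M → M) c c',
    (jac (inCharts (CSpace m) (CSpace m) (id : M → M) c c') z).mulVec (W c z) =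
      W c' (inCharts (CSpace m) (CSpace m) (id : M → M) c c' z)

/-- The derivative of a function along a `(1,0)`-vector field. -/
def fieldDeriv (W : M → CSpace m → CSpace m) (ρ : M → ℂ) (x : M) : ℂ :=
  ∑ j, W x (chartAt (CSpace m) x x) j *
    wd (-1) j (ρ ∘ (chartAt (CSpace m) x).symm) (chartAt (CSpace m) x x)

variable {W : M → CSpace m → CSpace m} {ρ : M → ℂ} {c : M} {z : CSpace m}

/-- The definition uses a different chart at every point. The Jacobians in W and in ∂ρ compensate
each other, so one chart computes the derivative on its whole domain, which yields continuity. -/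
theorem IsSmoothField.fieldDeriv_chart_symm (hW : IsSmoothField W)
    (hρ : ContMDiff 𝓘(ℝ, CSpace m) 𝓘(ℝ, ℂ) ∞ ρ) (hz : z ∈ (chartAt (CSpace m) c).target) :
    fieldDeriv W ρ ((chartAt (CSpace m) c).symm z) =
      ∑ j, W c z j * wd (-1) j (ρ ∘ (chartAt (CSpace m) c).symm) z := by
  set x := (chartAt (CSpace m) c).symm z with hx
  have hzo : z ∈ overlap (id : M → M) c x := ⟨hz, mem_chart_source _ _⟩
  set τ := inCharts (CSpace m) (CSpace m) (id : M → M) c x with hτ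
  have hτz : τ z = chartAt (CSpace m) x x := rfl
  have hτd : DifferentiableAt ℂ τ z :=
    (analyticAt_inCharts contMDiff_id_complex hzo.1 hzo.2).differentiableAt
  have hρd : DifferentiableAt ℝ (ρ ∘ (chartAt (CSpace m) x).symm) (τ z) :=
    (contDiffOn_comp_chart_symm hρ x).differentiableAt_of_isOpen (chartAt (CSpace m) x).open_target
      (mem_chart_target _ _)
  have e : ∀ j, wd (-1) j (ρ ∘ (chartAt (CSpace m) c).symm) z =
      ∑ a, wd (-1) a (ρ ∘ (chartAt (CSpace m) x).symm) (τ z) * jac τ z a j := fun j => by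
    exact (wd_congr (eventually_comp_inCharts (φ := id) continuous_id ρ hzo)).trans (dz_comp hρd hτd)
  have e2 : ∀ a, W x (chartAt (CSpace m) x x) a = ∑ j, jac τ z a j * W c z j := fun a =>
    (congrFun (hW.change c x z hzo) a).symm
  simp only [fieldDeriv, e, e2, Finset.sum_mul, Finset.mul_sum]
  rw [Finset.sum_comm]
  refine Finset.sum_congr rfl fun j _ => Finset.sum_congr rfl fun a _ => ?_
  rw [hτz]
  ring

omit [IsManifold 𝓘(ℂ, CSpace m) ω M] in
theorem continuous_of_chart_symm {X : Type*} [TopologicalSpace X] {f : M → X}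
    (h : ∀ c, ContinuousOn (f ∘ (chartAt (CSpace m) c).symm) (chartAt (CSpace m) c).target) :
    Continuous f := by
  refine continuous_iff_continuousAt.2 fun x => ?_
  have h1 := (h x).continuousAt ((chartAt (CSpace m) x).open_target.mem_nhds (mem_chart_target _ x))
  have h2 := ContinuousAt.comp h1 ((chartAt (CSpace m) x).continuousAt (mem_chart_source _ x))
  refine h2.congr ?_
  filter_upwards [(chartAt (CSpace m) x).open_source.mem_nhds (mem_chart_source _ x)] with y hy
  simp [(chartAt (CSpace m) x).left_inv hy]

theorem IsSmoothField.continuous_fieldDeriv (hW : IsSmoothField W)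
    (hρ : ContMDiff 𝓘(ℝ, CSpace m) 𝓘(ℝ, ℂ) ∞ ρ) : Continuous (fieldDeriv W ρ) := by
  refine continuous_of_chart_symm (m := m) fun c => ?_
  refine ContinuousOn.congr ?_ fun z hz => hW.fieldDeriv_chart_symm hρ hz
  exact continuousOn_finsetSum _ fun j _ => (hW.smooth c j).continuousOn.mul
    (contDiffOn_wd (chartAt (CSpace m) c).open_target (contDiffOn_comp_chart_symm hρ c)).continuousOn

omit [IsManifold 𝓘(ℂ, CSpace m) ω M] in
theorem support_fieldDeriv (W : M → CSpace m → CSpace m) (ρ : M → ℂ) :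
    Function.support (fieldDeriv W ρ) ⊆ tsupport ρ := by
  intro x hx
  by_contra h
  refine hx (Finset.sum_eq_zero fun j _ => ?_)
  have e : ρ ∘ (chartAt (CSpace m) x).symm =ᶠ[𝓝 (chartAt (CSpace m) x x)] fun _ => 0 := by
    have h1 := ((chartAt (CSpace m) x).continuousAt_symm (mem_chart_target _ x))
    have h2 : ∀ᶠ y in 𝓝 ((chartAt (CSpace m) x).symm (chartAt (CSpace m) x x)), ρ y = 0 := by
      rw [(chartAt (CSpace m) x).left_inv (mem_chart_source _ x)]
      exact notMem_tsupport_iff_eventuallyEq.1 h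
    exact h1.eventually h2
  rw [wd_congr e, wd_const, mul_zero]

variable [T2Space M] [CompactSpace M] [Nonempty M] [MeasurableSpace M] [BorelSpace M]

omit [T2Space M] in
theorem KahlerForm.integrable_of_continuous (κ : KahlerForm m M) {f : M → ℂ} (hf : Continuous f) :
    Integrable f κ.vol :=
  hf.integrable_of_hasCompactSupport (HasCompactSupport.of_compactSpace f)

omit [IsManifold 𝓘(ℂ, CSpace m) ω M] [T2Space M] [MeasurableSpace M] [BorelSpace M] [Nonempty M] in
theorem isCompact_image_tsupport (h : tsupport ρ ⊆ (chartAt (CSpace m) c).source) :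
    IsCompact (chartAt (CSpace m) c '' tsupport ρ) ∧
      chartAt (CSpace m) c '' tsupport ρ ⊆ (chartAt (CSpace m) c).target ∧
      ∀ z ∈ (chartAt (CSpace m) c).target, z ∉ chartAt (CSpace m) c '' tsupport ρ →
        (ρ ∘ (chartAt (CSpace m) c).symm) z = 0 := by
  refine ⟨(isClosed_tsupport ρ).isCompact.image_of_continuousOn
    ((chartAt (CSpace m) c).continuousOn.mono h), ?_, fun z hz hzK => ?_⟩
  · rintro _ ⟨x, hx, rfl⟩
    exact (chartAt (CSpace m) c).map_source (h hx)
  · exact image_eq_zero_of_notMem_tsupport (f := ρ) (x := (chartAt (CSpace m) c).symm z)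
      fun hx => hzK ⟨_, hx, (chartAt (CSpace m) c).right_inv hz⟩

/-- The divergence theorem on a compact Kähler manifold. -/
theorem KahlerForm.integral_cdiv_eq_zero (κ : KahlerForm m M) {W W' : M → CSpace m → CSpace m}
    (hW : IsSmoothField W) (hW' : IsSmoothField W') {f : M → ℂ} (hf : Continuous f)
    (h : ∀ c, ∀ z ∈ (chartAt (CSpace m) c).target, f ((chartAt (CSpace m) c).symm z) =
      cdiv (κ.herm c) (W c) z + (starRingEnd ℂ) (cdiv (κ.herm c) (W' c) z)) :
    ∫ x, f x ∂κ.vol = 0 := by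
  obtain ⟨P, hP⟩ := SmoothPartitionOfUnity.exists_isSubordinate_chartAt_source
    𝓘(ℝ, CSpace m) M
  have hfin : {i | (Function.support (P i)).Nonempty}.Finite :=
    P.locallyFinite.finite_nonempty_of_compact
  set s := hfin.toFinset with hs
  have hsum : ∀ x, ∑ i ∈ s, (P i x : ℂ) = 1 := fun x => by
    have h1 := P.sum_eq_one (Set.mem_univ x)
    rw [finsum_eq_sum_of_support_subset (s := s)] at h1
    · exact_mod_cast congrArg (fun t : ℝ => (t : ℂ)) h1
    · intro i hi
      simp only [hs, Set.Finite.coe_toFinset]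
      exact ⟨x, hi⟩
  let ρ : M → M → ℂ := fun i x => (P i x : ℂ)
  have hρ : ∀ i, ContMDiff 𝓘(ℝ, CSpace m) 𝓘(ℝ, ℂ) ∞ (ρ i) := fun i =>
    Complex.ofRealCLM.contDiff.contMDiff.comp (P i).contMDiff
  have hρs : ∀ i, tsupport (ρ i) ⊆ (chartAt (CSpace m) i).source := fun i => by
    refine (closure_mono fun x hx => ?_).trans (hP i)
    exact fun h0 => hx (by simp only [ρ]; exact_mod_cast h0)
  -- The terms D i sum to zero because the ρ i sum to one. Adding D i to ρ i · f gives the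
  -- divergence of the cut-off fields ρ i · W and ρ i · W', which are compactly supported in one
  -- chart.
  let D : M → M → ℂ := fun i x => fieldDeriv W (ρ i) x + (starRingEnd ℂ) (fieldDeriv W' (ρ i) x)
  have hD : ∀ i, Continuous (D i) := fun i => ((hW.continuous_fieldDeriv (hρ i))).add
    (Complex.continuous_conj.comp (hW'.continuous_fieldDeriv (hρ i)))
  have hDs : ∀ i, Function.support (D i) ⊆ (chartAt (CSpace m) i).source := fun i x hx => by
    refine hρs i ?_
    by_contra h0
    have h1 : ∀ V : M → CSpace m → CSpace m, fieldDeriv V (ρ i) x = 0 := fun V =>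
      by_contra fun h2 => h0 (support_fieldDeriv V (ρ i) h2)
    exact hx (by simp only [D, h1, map_zero, add_zero])
  have hDsum : ∀ x, ∑ i ∈ s, D i x = 0 := fun x => by
    have key : ∀ V : M → CSpace m → CSpace m, ∑ i ∈ s, fieldDeriv V (ρ i) x = 0 := fun V => by
      simp only [fieldDeriv]
      rw [Finset.sum_comm]
      refine Finset.sum_eq_zero fun j _ => ?_
      rw [← Finset.mul_sum, ← wd_sum]
      · have : (fun w => ∑ i ∈ s, (ρ i ∘ (chartAt (CSpace m) x).symm) w) = fun _ => 1 := by
          funext w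
          exact hsum _
        rw [this, wd_const, mul_zero]
      · exact fun i _ => (contDiffOn_comp_chart_symm (hρ i) x).differentiableAt_of_isOpen
          (chartAt (CSpace m) x).open_target (mem_chart_target _ _)
    simp only [D]
    rw [Finset.sum_add_distrib, ← map_sum, key, key]
    simp
  have hint : ∀ i, ∫ x, (ρ i x * f x + D i x) ∂κ.vol = 0 := fun i => by
    have hK := κ.isLocalKahler i
    obtain ⟨c1, c2, c3⟩ := isCompact_image_tsupport (hρs i)
    have hr := contDiffOn_comp_chart_symm (hρ i) i
    let A : (M → CSpace m → CSpace m) → CSpace m → ℂ := fun W z => (κ.herm i z).det *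
      ((ρ i ∘ (chartAt (CSpace m) i).symm) z * cdiv (κ.herm i) (W i) z +
        ∑ j, W i z j * wd (-1) j (ρ i ∘ (chartAt (CSpace m) i).symm) z)
    have i1 : IntegrableOn (A W) _ ∧ ∫ z in _, A W z = 0 := setIntegral_det_mul_cdiv hK c1 c2 hr c3 (hW.smooth i)
    have i2 : IntegrableOn (A W') _ ∧ ∫ z in _, A W' z = 0 := setIntegral_det_mul_cdiv hK c1 c2 hr c3 (hW'.smooth i)
    rw [κ.integral_eq_chart (f := fun x => ρ i x * f x + D i x)
      (((hρ i).continuous.mul hf).add (hD i)) (c := i) ?_]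
    · have e : ∀ z ∈ (chartAt (CSpace m) i).target, (κ.herm i z).det *
          (ρ i ((chartAt (CSpace m) i).symm z) * f ((chartAt (CSpace m) i).symm z) +
            D i ((chartAt (CSpace m) i).symm z)) = A W z + (starRingEnd ℂ) (A W' z) := fun z hz => by
        have hr1 : (starRingEnd ℂ) ((ρ i ∘ (chartAt (CSpace m) i).symm) z) =
          (ρ i ∘ (chartAt (CSpace m) i).symm) z := Complex.conj_ofReal _
        have hdet : (starRingEnd ℂ) (κ.herm i z).det = (κ.herm i z).det := by
          rw [(hK.det_pos hz).2, Complex.conj_ofReal]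
        simp only [A, D, map_mul, map_add, hr1, hdet]
        rw [hW.fieldDeriv_chart_symm (hρ i) hz, hW'.fieldDeriv_chart_symm (hρ i) hz, h i z hz]
        simp only [Function.comp_apply]
        ring
      have hc : IntegrableOn (fun z => (starRingEnd ℂ) (A W' z)) (chartAt (CSpace m) i).target :=
        (Complex.conjCLE : ℂ →L[ℝ] ℂ).integrable_comp i2.1
      rw [setIntegral_congr_fun (chartAt (CSpace m) i).open_target.measurableSet e,
        integral_add i1.1 hc, integral_conj,
        i1.2, i2.2, map_zero, add_zero]
    · intro x hx
      by_contra h0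
      refine hx ?_
      have h1 : ρ i x = 0 := by_contra fun h2 => h0 (hρs i (subset_tsupport _ h2))
      have h2 : D i x = 0 := by_contra fun h2 => h0 (hDs i h2)
      simp only [h1, h2, zero_mul, add_zero]
  have hsplit : ∫ x, f x ∂κ.vol = ∑ i ∈ s, ∫ x, (ρ i x * f x + D i x) ∂κ.vol := by
    rw [← integral_finsetSum]
    · refine integral_congr_ae (Filter.Eventually.of_forall fun x => ?_)
      simp only
      rw [Finset.sum_add_distrib, hDsum, ← Finset.sum_mul, add_zero]
      rw [hsum, one_mul]
    · exact fun i _ => κ.integrable_of_continuous (((hρ i).continuous.mul hf).add (hD i))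
  rw [hsplit]
  exact Finset.sum_eq_zero fun i _ => hint i

end Divergence

end KahlerBlowup

end

noncomputable section

namespace KahlerBlowup

open Topology MeasureTheory

/-! ### The integrated Bochner formula and conjugation of holomorphy potentials. -/

section Bochner

variable {m : ℕ} {U : Set (CSpace m)} {H : CSpace m → Matrix (Fin m) (Fin m) ℂ}
  {S : CSpace m → Matrix (Fin m) (Fin m) ℂ} {f g : CSpace m → ℂ} {z : CSpace m}
  {Y : CSpace m → CSpace m}

theorem raise_congr (h : f =ᶠ[𝓝 z] g) : raise S f z = raise S g z := by
  funext j
  exact Finset.sum_congr rfl fun k _ => by rw [wd_congr h]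

theorem hess_congr (h : f =ᶠ[𝓝 z] g) : hess f z = hess g z := by
  ext j k
  refine wd_congr ?_
  filter_upwards [h.eventuallyEq_nhds] with w hw using wd_congr hw

theorem clap_congr (h : f =ᶠ[𝓝 z] g) : clap H f z = clap H g z := by
  rw [clap, clap, hess_congr h]

theorem ricciEnergy_congr (h : f =ᶠ[𝓝 z] g) : ricciEnergy H f z = ricciEnergy H g z := by
  rw [ricciEnergy, ricciEnergy, clap_congr h, hess_congr h, h.eq_of_nhds]

theorem SmoothV.dbarSq (hU : IsOpen U) (hY : SmoothV U Y) : ContDiffOn ℝ ∞ (dbarSq Y) U :=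
  ContDiffOn.sum fun j _ => ContDiffOn.sum fun l _ =>
    (contDiffOn_wd hU (hY l)).conj_complex.mul (contDiffOn_wd hU (hY j))

theorem IsLocalKahler.smooth_ricciEnergy (h : IsLocalKahler U H) (hf : ContDiffOn ℝ ∞ f U) :
    ContDiffOn ℝ ∞ (ricciEnergy H f) U := by
  have h1 := h.smooth_ricUp.mul (contDiffOn_hess h.isOpen hf)
  have h2 : ContDiffOn ℝ ∞ (fun w => ∑ k, (ricUp H w * hess f w) k k) U :=
    ContDiffOn.sum fun k _ => h1 k k
  exact ((h.smooth_clap hf).conj_complex.mul (h.smooth_clap hf)).add (hf.conj_complex.mul h2)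

variable {M : Type*} [TopologicalSpace M] [ChartedSpace (CSpace m) M]
  [IsManifold 𝓘(ℂ, CSpace m) ω M] {ζ : M → ℂ} {c c' : M}

/-- The coordinate expression of a function. -/
def localFun (ζ : M → ℂ) (c : M) : CSpace m → ℂ := ζ ∘ (chartAt (CSpace m) c).symm

omit [IsManifold 𝓘(ℂ, CSpace m) ω M] in
theorem eventually_localFun (ζ : M → ℂ) (hz : z ∈ overlap (id : M → M) c c') :
    localFun ζ c =ᶠ[𝓝 z] localFun ζ c' ∘ inCharts (CSpace m) (CSpace m) (id : M → M) c c' :=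
  eventually_comp_inCharts (φ := id) continuous_id ζ hz

theorem jac_cgrad_change (κ : KahlerForm m M) (hζ : ContMDiff 𝓘(ℝ, CSpace m) 𝓘(ℝ, ℂ) ∞ ζ)
    (hz : z ∈ overlap (id : M → M) c c') :
    (jac (inCharts (CSpace m) (CSpace m) (id : M → M) c c') z).mulVec
      (cgrad (κ.herm c) (localFun ζ c) z) = cgrad (κ.herm c') (localFun ζ c')
        (inCharts (CSpace m) (CSpace m) (id : M → M) c c' z) :=
  (jac_mulVec _ _ _).trans (fderiv_cgrad_change κ hζ hz)

/-- The vector field `∇_{Ȳ} Y - f̄ Ric(Y)` with `Y` the gradient of `f`. -/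
def KahlerForm.bochnerField (κ : KahlerForm m M) (ζ : M → ℂ) (c : M) (w : CSpace m) : CSpace m :=
  cconv (cgrad (κ.herm c) (localFun ζ c)) w -
    (starRingEnd ℂ) (localFun ζ c w) • raise (ricUp (κ.herm c)) (localFun ζ c) w

/-- The gradient of `f` multiplied by the conjugate of its Laplacian. -/
def KahlerForm.laplacianField (κ : KahlerForm m M) (ζ : M → ℂ) (c : M) (w : CSpace m) : CSpace m :=
  (- (starRingEnd ℂ) (clap (κ.herm c) (localFun ζ c) w)) • cgrad (κ.herm c) (localFun ζ c) w

theorem KahlerForm.isSmoothField_bochnerField (κ : KahlerForm m M)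
    (hζ : ContMDiff 𝓘(ℝ, CSpace m) 𝓘(ℝ, ℂ) ∞ ζ) : IsSmoothField (κ.bochnerField ζ) where
  smooth c := by
    have h := κ.isLocalKahler c
    have hf := contDiffOn_comp_chart_symm hζ c
    exact fun j => ((h.smooth_cgrad hf).cconv h.isOpen j).sub
      (hf.conj_complex.mul (h.smooth_ricUp.raise h.isOpen hf j))
  change c c' z hz := by
    have hI := κ.isHolIsometry_change c c'
    have hf := contDiffOn_comp_chart_symm hζ c
    have hf' := contDiffOn_comp_chart_symm hζ c'
    have e := eventually_localFun ζ hz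
    have h1 := hI.cconv_comp (((κ.isLocalKahler c).smooth_cgrad hf · |>.mono Set.inter_subset_left))
      ((κ.isLocalKahler c').smooth_cgrad hf') (fun w hw => jac_cgrad_change κ hζ hw) hz
    have h2 := hI.raise_ricUp_comp hf' hz
    have h3 := e.eq_of_nhds
    rw [bochnerField, bochnerField, Matrix.mulVec_sub, Matrix.mulVec_smul]
    refine congrArg₂ _ h1 ?_
    refine congrArg₂ _ (congrArg _ h3) (Eq.trans ?_ h2)
    exact congrArg _ (raise_congr e)

theorem KahlerForm.isSmoothField_laplacianField (κ : KahlerForm m M)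
    (hζ : ContMDiff 𝓘(ℝ, CSpace m) 𝓘(ℝ, ℂ) ∞ ζ) : IsSmoothField (κ.laplacianField ζ) where
  smooth c := by
    have h := κ.isLocalKahler c
    have hf := contDiffOn_comp_chart_symm hζ c
    exact fun j => (h.smooth_clap hf).conj_complex.neg.mul (h.smooth_cgrad hf j)
  change c c' z hz := by
    have hI := κ.isHolIsometry_change c c'
    have hf' := contDiffOn_comp_chart_symm hζ c'
    have e := eventually_localFun ζ hz
    have h1 := (clap_congr e).trans (hI.clap_comp hf' hz)
    rw [laplacianField, laplacianField, Matrix.mulVec_smul]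
    exact congrArg₂ _ (congrArg (fun t => -(starRingEnd ℂ) t) h1) (jac_cgrad_change κ hζ hz)

/-- The square norm of the antiholomorphic derivative of the gradient. -/
def KahlerForm.dbarNorm (κ : KahlerForm m M) (ζ : M → ℂ) (x : M) : ℂ :=
  dbarSq (cgrad (κ.herm x) (localFun ζ x)) (chartAt (CSpace m) x x)

/-- The density `|Δf|² + f̄ ⟨Ric, i∂∂̄f⟩`. -/
def KahlerForm.energy (κ : KahlerForm m M) (ζ : M → ℂ) (x : M) : ℂ :=
  ricciEnergy (κ.herm x) (localFun ζ x) (chartAt (CSpace m) x x)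

theorem KahlerForm.dbarNorm_chart_symm (κ : KahlerForm m M)
    (hζ : ContMDiff 𝓘(ℝ, CSpace m) 𝓘(ℝ, ℂ) ∞ ζ) (hz : z ∈ (chartAt (CSpace m) c).target) :
    κ.dbarNorm ζ ((chartAt (CSpace m) c).symm z) = dbarSq (cgrad (κ.herm c) (localFun ζ c)) z := by
  set x := (chartAt (CSpace m) c).symm z with hx
  have hI := κ.isHolIsometry_change c x
  have hf := contDiffOn_comp_chart_symm hζ c
  have hf' := contDiffOn_comp_chart_symm hζ x
  exact (hI.dbarSq_comp (((κ.isLocalKahler c).smooth_cgrad hf · |>.mono Set.inter_subset_left))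
      ((κ.isLocalKahler x).smooth_cgrad hf') (fun w hw => jac_cgrad_change κ hζ hw)
      (z := z) ⟨hz, mem_chart_source _ _⟩).symm

theorem KahlerForm.energy_chart_symm (κ : KahlerForm m M)
    (hζ : ContMDiff 𝓘(ℝ, CSpace m) 𝓘(ℝ, ℂ) ∞ ζ) (hz : z ∈ (chartAt (CSpace m) c).target) :
    κ.energy ζ ((chartAt (CSpace m) c).symm z) = ricciEnergy (κ.herm c) (localFun ζ c) z := by
  set x := (chartAt (CSpace m) c).symm z with hx
  have hI := κ.isHolIsometry_change c x
  have hzo : z ∈ overlap (id : M → M) c x := ⟨hz, mem_chart_source _ _⟩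
  exact ((ricciEnergy_congr (eventually_localFun ζ hzo)).trans
    (hI.ricciEnergy_comp (contDiffOn_comp_chart_symm hζ x) hzo)).symm

theorem KahlerForm.continuous_dbarNorm (κ : KahlerForm m M)
    (hζ : ContMDiff 𝓘(ℝ, CSpace m) 𝓘(ℝ, ℂ) ∞ ζ) : Continuous (κ.dbarNorm ζ) := by
  refine continuous_of_chart_symm (m := m) fun c => ?_
  have h := κ.isLocalKahler c
  exact ((h.smooth_cgrad (contDiffOn_comp_chart_symm hζ c)).dbarSq h.isOpen).continuousOn.congr
    fun z hz => κ.dbarNorm_chart_symm hζ hz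

theorem KahlerForm.continuous_energy (κ : KahlerForm m M)
    (hζ : ContMDiff 𝓘(ℝ, CSpace m) 𝓘(ℝ, ℂ) ∞ ζ) : Continuous (κ.energy ζ) := by
  refine continuous_of_chart_symm (m := m) fun c => ?_
  have h := κ.isLocalKahler c
  exact (h.smooth_ricciEnergy (contDiffOn_comp_chart_symm hζ c)).continuousOn.congr
    fun z hz => κ.energy_chart_symm hζ hz

omit [IsManifold 𝓘(ℂ, CSpace m) ω M] in
theorem conj_contMDiff (hζ : ContMDiff 𝓘(ℝ, CSpace m) 𝓘(ℝ, ℂ) ∞ ζ) :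
    ContMDiff 𝓘(ℝ, CSpace m) 𝓘(ℝ, ℂ) ∞ fun x => (starRingEnd ℂ) (ζ x) :=
  ((Complex.conjCLE : ℂ →L[ℝ] ℂ).contDiff.contMDiff).comp hζ

theorem KahlerForm.energy_conj (κ : KahlerForm m M)
    (hζ : ContMDiff 𝓘(ℝ, CSpace m) 𝓘(ℝ, ℂ) ∞ ζ) (x : M) :
    κ.energy (fun y => (starRingEnd ℂ) (ζ y)) x = (starRingEnd ℂ) (κ.energy ζ x) :=
  ricciEnergy_conj (κ.isLocalKahler x) (contDiffOn_comp_chart_symm hζ x) (mem_chart_target _ _)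

variable [T2Space M] [CompactSpace M] [Nonempty M] [MeasurableSpace M] [BorelSpace M]

/-- By `dbarSq_cgrad` the difference of the integrands is the divergence of `bochnerField` plus the
conjugate of the divergence of `laplacianField`; both fields are globally defined. -/
theorem KahlerForm.integral_dbarNorm (κ : KahlerForm m M) (hκ : ∃ s : ℝ, ∀ x, κ.scal x = s)
    (hζ : ContMDiff 𝓘(ℝ, CSpace m) 𝓘(ℝ, ℂ) ∞ ζ) :
    ∫ x, κ.dbarNorm ζ x ∂κ.vol = ∫ x, κ.energy ζ x ∂κ.vol := by
  obtain ⟨s, hs⟩ := hκ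
  rw [← sub_eq_zero, ← integral_sub (κ.integrable_of_continuous (κ.continuous_dbarNorm hζ))
    (κ.integrable_of_continuous (κ.continuous_energy hζ))]
  refine κ.integral_cdiv_eq_zero (κ.isSmoothField_bochnerField hζ) (κ.isSmoothField_laplacianField hζ)
    ((κ.continuous_dbarNorm hζ).sub (κ.continuous_energy hζ)) fun c z hz => ?_
  have h := κ.isLocalKahler c
  rw [κ.dbarNorm_chart_symm hζ hz, κ.energy_chart_symm hζ hz]
  refine dbarSq_cgrad h (contDiffOn_comp_chart_symm hζ c) ⟨(s : ℂ) / 4, fun w hw => ?_⟩ hz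
  have := κ.scal_eq hw
  rw [hs] at this
  rw [this]
  ring

omit [T2Space M] [CompactSpace M] [Nonempty M] [MeasurableSpace M] [BorelSpace M] in
theorem KahlerForm.IsHamiltonian.wd_cgrad_eq_zero {κ : KahlerForm m M} {Ξ : HolVectorField m M}
    (h : κ.IsHamiltonian Ξ ζ) (hz : z ∈ (chartAt (CSpace m) c).target) (j l : Fin m) :
    wd 1 l (fun w => cgrad (κ.herm c) (localFun ζ c) w j) z = 0 := by
  have ho := (chartAt (CSpace m) c).open_target
  have e : ∀ w ∈ (chartAt (CSpace m) c).target, cgrad (κ.herm c) (localFun ζ c) w j =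
      (2 * Complex.I)⁻¹ * coord ℂ c (vec Ξ) w j := fun w hw => by
    have h1 := congrFun (h.coord_eq hw) j
    rw [h1, Pi.smul_apply, smul_eq_mul, ← mul_assoc, inv_mul_cancel₀ (by simp), one_mul]
    rfl
  rw [wd_congr_on ho hz e]
  refine dzbar_eq_zero (DifferentiableAt.const_mul ?_ _)
  have h2 := (Ξ.contDiffOn_coord c).contDiffAt (ho.mem_nhds hz)
  exact differentiableAt_pi.1 (h2.differentiableAt (by simp)) j

/-- On a compact Kähler manifold of constant scalar curvature the complex conjugate of a
holomorphy potential is a holomorphy potential. -/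
theorem KahlerForm.IsHamiltonian.exists_conj {κ : KahlerForm m M} (hκ : ∃ s : ℝ, ∀ x, κ.scal x = s)
    {Ξ : HolVectorField m M} (h : κ.IsHamiltonian Ξ ζ) :
    ∃ Ξ' : HolVectorField m M, κ.IsHamiltonian Ξ' fun x => (starRingEnd ℂ) (ζ x) := by
  have hζ := h.1
  have hζ' := conj_contMDiff hζ
  -- The gradient of ζ is holomorphic, so the left side of the integrated formula is zero.
  have h1 : ∫ x, κ.energy ζ x ∂κ.vol = 0 := by
    rw [← κ.integral_dbarNorm hκ hζ]
    have : κ.dbarNorm ζ = fun _ => 0 := by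
      funext x
      rw [dbarNorm, dbarSq]
      refine Finset.sum_eq_zero fun j _ => Finset.sum_eq_zero fun l _ => ?_
      rw [h.wd_cgrad_eq_zero (mem_chart_target _ x) j l, mul_zero]
    rw [this, integral_zero]
  -- The formula is now read for the conjugate function, whose energy is the conjugate of that of ζ.
  have h2 : ∫ x, κ.dbarNorm (fun y => (starRingEnd ℂ) (ζ y)) x ∂κ.vol = 0 := by
    rw [κ.integral_dbarNorm hκ hζ', ← map_zero (starRingEnd ℂ), ← h1, ← integral_conj]
    exact integral_congr_ae (Filter.Eventually.of_forall fun x => κ.energy_conj hζ x)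
  set F := κ.dbarNorm (fun y => (starRingEnd ℂ) (ζ y)) with hF
  have hFc : Continuous F := κ.continuous_dbarNorm hζ'
  have hpos := fun x => dbarSq_nonneg (κ.isLocalKahler x) (contDiffOn_comp_chart_symm hζ' x)
    (mem_chart_target (CSpace m) x)
  have h3 : ∀ x, 0 ≤ (F x).re ∧ (F x).im = 0 := fun x => by
    have := Complex.nonneg_iff.1 (hpos x).1
    exact ⟨this.1, this.2.symm⟩
  have h4 : ∫ x, (F x).re ∂κ.vol = 0 := by
    have := integral_re (𝕜 := ℂ) (κ.integrable_of_continuous hFc)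
    rw [h2] at this
    simpa using this
  -- A nonnegative continuous function with zero integral vanishes everywhere, since the volume
  -- charges every nonempty open set.
  have h5 : (fun x => (F x).re) = fun _ => 0 := by
    have hc : Continuous fun x => (F x).re := Complex.continuous_re.comp hFc
    refine hc.ae_eq_iff_eq κ.vol continuous_const |>.1 ?_
    exact (integral_eq_zero_iff_of_nonneg (fun x => (h3 x).1)
      (hc.integrable_of_hasCompactSupport (HasCompactSupport.of_compactSpace _))).1 h4
  have h6 : ∀ x, F x = 0 := fun x => Complex.ext (congrFun h5 x) (h3 x).2
  refine κ.exists_isHamiltonian hζ' fun c z hz j l => ?_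
  have h7 := κ.dbarNorm_chart_symm hζ' hz
  rw [← hF, h6] at h7
  exact (dbarSq_nonneg (κ.isLocalKahler c) (contDiffOn_comp_chart_symm hζ' c) hz).2 h7.symm j l

end Bochner

end KahlerBlowup

end

noncomputable section

namespace KahlerBlowup

open Topology MeasureTheory

/-! ### Uniqueness and reality of holomorphy potentials. -/

section Potentials

variable {m : ℕ} {M : Type*} [TopologicalSpace M] [ChartedSpace (CSpace m) M]
  [IsManifold 𝓘(ℂ, CSpace m) ω M] {κ : KahlerForm m M} {Ξ : HolVectorField m M} {ζ ζ' : M → ℂ}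

/-- For the zero field the Hamiltonian equation says ∂̄ζ = 0. On a compact connected manifold such a
function is constant, whence uniqueness of potentials up to constants. -/
theorem KahlerForm.IsHamiltonian.mdifferentiable_of_eq_zero (h : κ.IsHamiltonian 0 ζ) :
    MDifferentiable 𝓘(ℂ, CSpace m) 𝓘(ℂ, ℂ) ζ := by
  intro x
  have hx := mem_chart_target (CSpace m) x
  have hd : DifferentiableAt ℂ (ζ ∘ (chartAt (CSpace m) x).symm) (chartAt (CSpace m) x x) := by
    refine differentiableAt_complex_of_dzbar ((contDiffOn_comp_chart_symm h.1 x).differentiableAt_of_isOpen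
      (chartAt (CSpace m) x).open_target hx) fun k => ?_
    have h1 := (eq_smul_cgrad_iff (κ.isLocalKahler x) hx 0).1
      (((κ.isHamiltonian_iff 0 ζ).1 h).2 x) k
    simpa using h1
  have h1 := hd.mdifferentiableAt.comp x
    (mdifferentiableAt_atlas (I := 𝓘(ℂ, CSpace m)) (chart_mem_atlas (CSpace m) x)
      (mem_chart_source (CSpace m) x))
  refine h1.congr_of_eventuallyEq ?_
  filter_upwards [(chartAt (CSpace m) x).open_source.mem_nhds (mem_chart_source _ x)] with y hy
  simp [(chartAt (CSpace m) x).left_inv hy]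

theorem KahlerForm.IsHamiltonian.sub (h : κ.IsHamiltonian Ξ ζ) (h' : κ.IsHamiltonian Ξ ζ') :
    κ.IsHamiltonian 0 (ζ + fun x => (-1) * ζ' x) := by
  have h1 := h.add (h'.smul (-1))
  rwa [neg_one_smul, add_neg_cancel] at h1

variable [CompactSpace M] [ConnectedSpace M]

/-- Holomorphy potentials are unique up to constants. -/
theorem KahlerForm.IsHamiltonian.exists_eq_add_const (h : κ.IsHamiltonian Ξ ζ)
    (h' : κ.IsHamiltonian Ξ ζ') : ∃ a : ℂ, ∀ x, ζ x = ζ' x + a := by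
  obtain ⟨a, ha⟩ := (h.sub h').mdifferentiable_of_eq_zero.exists_eq_const_of_compactSpace
  refine ⟨a, fun x => ?_⟩
  have := congrFun ha x
  simp only [Pi.add_apply, Function.const_apply] at this
  linear_combination this

variable [MeasurableSpace M] [BorelSpace M]

theorem KahlerForm.IsHamiltonian.eq_of_integral_eq (h : κ.IsHamiltonian Ξ ζ)
    (h' : κ.IsHamiltonian Ξ ζ') (hi : ∫ x, ζ x ∂κ.vol = ∫ x, ζ' x ∂κ.vol) : ζ = ζ' := by
  obtain ⟨a, ha⟩ := h.exists_eq_add_const h'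
  have h1 : ∫ x, ζ x ∂κ.vol = ∫ x, ζ' x ∂κ.vol + κ.vol.real Set.univ • a := by
    rw [← integral_const, ← integral_add (κ.integrable_of_continuous h'.1.continuous)
      (integrable_const a)]
    exact integral_congr_ae (Filter.Eventually.of_forall ha)
  rw [hi, left_eq_add, smul_eq_zero] at h1
  have h2 : κ.vol.real Set.univ ≠ 0 := by
    rw [Measure.real, ENNReal.toReal_ne_zero]
    exact ⟨(isOpen_univ.measure_pos _ Set.univ_nonempty).ne', κ.vol_lt_top.ne⟩
  funext x
  rw [ha x, h1.resolve_left h2, add_zero]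

variable [T2Space M]

/-- The conjugate potential also has mean zero, so it is the normalised potential of its field and
not merely equal to it up to a constant. -/
theorem KahlerForm.IsMomentMap.exists_conj {ξ : M → Module.Dual ℂ κ.ham} (hξ : κ.IsMomentMap ξ)
    (hκ : ∃ s : ℝ, ∀ x, κ.scal x = s) (Ξ : κ.ham) :
    ∃ Ξ' : κ.ham, ∀ x, ξ x Ξ' = (starRingEnd ℂ) (ξ x Ξ) := by
  obtain ⟨Ξ', h⟩ := (hξ Ξ).1.exists_conj hκ
  refine ⟨⟨Ξ', _, h⟩, fun x => ?_⟩
  refine congrFun ((hξ ⟨Ξ', _, h⟩).1.eq_of_integral_eq h ?_) x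
  rw [(hξ _).2, integral_conj, (hξ Ξ).2, map_zero]

/-- The Hamiltonian fields have a basis with real potentials if the scalar curvature is constant. -/
theorem KahlerForm.IsMomentMap.exists_real_basis {ξ : M → Module.Dual ℂ κ.ham}
    (hξ : κ.IsMomentMap ξ) (hκ : ∃ s : ℝ, ∀ x, κ.scal x = s) [Module.Finite ℂ κ.ham] :
    ∃ (d : ℕ) (Z : Fin d → κ.ham), (∀ k x, (starRingEnd ℂ) (ξ x (Z k)) = ξ x (Z k)) ∧
      Submodule.span ℂ (Set.range Z) = ⊤ ∧ LinearIndependent ℂ Z := by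
  set T : Set κ.ham := {Ξ | ∀ x, (starRingEnd ℂ) (ξ x Ξ) = ξ x Ξ} with hT
  have hspan : Submodule.span ℂ T = ⊤ := by
    refine eq_top_iff.2 fun Ξ _ => ?_
    obtain ⟨Ξ', h⟩ := hξ.exists_conj hκ Ξ
    have h1 : Ξ + Ξ' ∈ T := fun x => by
      rw [map_add, h, map_add, Complex.conj_conj, add_comm]
    have h2 : Complex.I • (Ξ - Ξ') ∈ T := fun x => by
      rw [map_smul, map_sub, h, smul_eq_mul, map_mul, map_sub, Complex.conj_conj, Complex.conj_I]
      ring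
    -- Decomposition according to real and imaginary parts of the potential.
    have e : Ξ = (1 / 2 : ℂ) • (Ξ + Ξ') + (- Complex.I / 2) • (Complex.I • (Ξ - Ξ')) := by
      rw [smul_smul]
      have : (- Complex.I / 2) * Complex.I = 1 / 2 := by
        rw [div_mul_eq_mul_div, neg_mul, Complex.I_mul_I, neg_neg]
      rw [this, ← smul_add]
      module
    rw [e]
    exact Submodule.add_mem _ (Submodule.smul_mem _ _ (Submodule.subset_span h1))
      (Submodule.smul_mem _ _ (Submodule.subset_span h2))
  obtain ⟨Z, hZ, hZs, hZi⟩ := Submodule.exists_fun_fin_finrank_span_eq ℂ T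
  exact ⟨_, Z, hZ, hZs.trans hspan, hZi⟩

end Potentials

end KahlerBlowup

end

noncomputable section

namespace KahlerBlowup

open Topology

/-! ### Flows of holomorphic vector fields on a compact manifold. -/

section Flow

variable {m : ℕ} {M : Type*} [TopologicalSpace M] [ChartedSpace (CSpace m) M]
  [IsManifold 𝓘(ℂ, CSpace m) ω M] {Ξ : HolVectorField m M} {x c : M} {z : CSpace m}

/-- A holomorphic vector field as a real vector field. -/
def realField (Ξ : HolVectorField m M) (x : M) : TangentSpace 𝓘(ℝ, CSpace m) x := vec Ξ x

instance isManifold_real_one : IsManifold 𝓘(ℝ, CSpace m) 1 M := IsManifold.of_le (n := ω) le_top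

theorem coord_real_eq (v : M → CSpace m) (hz : z ∈ (chartAt (CSpace m) c).target) :
    coord ℝ c v z = coord ℂ c v z := by
  set y := (chartAt (CSpace m) c).symm z with hy
  have h : AnalyticAt ℂ (inCharts (CSpace m) (CSpace m) (id : M → M) y c) (chartAt (CSpace m) y y) := by
    refine analyticAt_inCharts contMDiff_id_complex (mem_chart_target _ _) ?_
    rw [(chartAt (CSpace m) y).left_inv (mem_chart_source _ _)]
    exact (chartAt (CSpace m) c).map_target hz
  rw [coord, coord, ← hy, fderiv_real_eq h.differentiableAt]
  rfl

theorem contMDiff_realField (Ξ : HolVectorField m M) :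
    ContMDiff 𝓘(ℝ, CSpace m) 𝓘(ℝ, CSpace m).tangent 1
      (fun x => (⟨x, realField Ξ x⟩ : TangentBundle 𝓘(ℝ, CSpace m) M)) := by
  have : IsManifold 𝓘(ℝ, CSpace m) (1 + 1) M := IsManifold.of_le (n := ω) le_top
  refine (contMDiff_section_iff (𝕜 := ℝ) (E := CSpace m) (n := 1) _).2 fun c => ?_
  refine (((Ξ.contDiffOn_coord c).restrict_scalars ℝ).of_le le_top).congr fun z hz => ?_
  exact coord_real_eq _ hz

theorem mfderiv_chart_symm_coord (v : M → CSpace m) (hz : z ∈ (chartAt (CSpace m) c).target) :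
    DFunLike.coe (F := CSpace m →L[ℝ] CSpace m)
      (mfderiv 𝓘(ℝ, CSpace m) 𝓘(ℝ, CSpace m) (chartAt (CSpace m) c).symm z)
      (coord ℝ c v z) = v ((chartAt (CSpace m) c).symm z) := by
  have h1 := mdifferentiableAt_chart_symm hz
  have h2 := mfderiv_eq_fderiv_inCharts h1
  have h3 := fderiv_inCharts_id_coord (𝕜 := ℝ) (E := CSpace m) (v := v) hz
    (mem_chart_source (CSpace m) ((chartAt (CSpace m) c).symm z))
  have h4 := coord_self (𝕜 := ℝ) (E := CSpace m) ((chartAt (CSpace m) c).symm z) v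
  refine Eq.trans ?_ (h3.trans h4)
  exact congrArg (fun L : CSpace m →L[ℝ] CSpace m => L (coord ℝ c v z)) h2

theorem mfderiv_chart_apply (v : M → CSpace m) (hx : x ∈ (chartAt (CSpace m) c).source) :
    DFunLike.coe (F := CSpace m →L[ℝ] CSpace m)
      (mfderiv 𝓘(ℝ, CSpace m) 𝓘(ℝ, CSpace m) (chartAt (CSpace m) c) x) (v x) = coord ℝ c v (chartAt (CSpace m) c x) := by
  have h1 : MDifferentiableAt 𝓘(ℝ, CSpace m) 𝓘(ℝ, CSpace m) (chartAt (CSpace m) c) x :=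
    mdifferentiableAt_atlas (chart_mem_atlas _ c) hx
  have h2 := mfderiv_eq_fderiv_inCharts h1
  rw [coord, (chartAt (CSpace m) c).left_inv hx]
  exact congrArg (fun L : CSpace m →L[ℝ] CSpace m => L (v x)) h2

/-- An integral curve in a chart is an integral curve. -/
theorem isMIntegralCurveOn_chart_symm_comp {γ : ℝ → CSpace m} {s : Set ℝ}
    (h : ∀ r ∈ s, γ r ∈ (chartAt (CSpace m) c).target ∧
      HasDerivAt γ (coord ℂ c (vec Ξ) (γ r)) r) :
    IsMIntegralCurveOn ((chartAt (CSpace m) c).symm ∘ γ) (realField Ξ) s := by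
  intro r hr
  obtain ⟨h1, h2⟩ := h r hr
  have h3 := (mdifferentiableAt_chart_symm h1).hasMFDerivAt.comp r h2.hasFDerivAt.hasMFDerivAt
  refine HasMFDerivAt.hasMFDerivWithinAt ?_
  refine h3.congr_mfderiv ?_
  have h4 := mfderiv_chart_symm_coord (vec Ξ) h1
  rw [coord_real_eq _ h1] at h4
  obtain ⟨L, hL⟩ : ∃ L : CSpace m →L[ℝ] CSpace m,
    L = mfderiv 𝓘(ℝ, CSpace m) 𝓘(ℝ, CSpace m) (chartAt (CSpace m) c).symm (γ r) := ⟨_, rfl⟩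
  rw [← hL] at h4
  have h5 : ∀ a : ℝ, L (a • coord ℂ c (vec Ξ) (γ r)) = a • vec Ξ ((chartAt (CSpace m) c).symm (γ r)) :=
    fun a => by rw [map_smul, h4]
  refine ContinuousLinearMap.ext fun a => ?_
  refine Eq.trans ?_ (h5 a)
  rw [hL]
  rfl

theorem _root_.IsMIntegralCurve.hasDerivAt_chart {γ : ℝ → M} (h : IsMIntegralCurve γ (realField Ξ)) {r : ℝ}
    (hr : γ r ∈ (chartAt (CSpace m) c).source) :
    HasDerivAt (fun r => chartAt (CSpace m) c (γ r)) (coord ℂ c (vec Ξ) (chartAt (CSpace m) c (γ r))) r := by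
  have h1 : MDifferentiableAt 𝓘(ℝ, CSpace m) 𝓘(ℝ, CSpace m) (chartAt (CSpace m) c) (γ r) :=
    mdifferentiableAt_atlas (chart_mem_atlas _ c) hr
  have h2 := mfderiv_chart_apply (vec Ξ) hr
  rw [coord_real_eq _ ((chartAt (CSpace m) c).map_source hr)] at h2
  rw [← h2]
  obtain ⟨L, hL⟩ : ∃ L : CSpace m →L[ℝ] CSpace m,
    L = mfderiv 𝓘(ℝ, CSpace m) 𝓘(ℝ, CSpace m) (chartAt (CSpace m) c) (γ r) := ⟨_, rfl⟩
  have h3 : HasFDerivAt (fun r => chartAt (CSpace m) c (γ r))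
      (L.comp ((1 : ℝ →L[ℝ] ℝ).smulRight (vec Ξ (γ r)))) r := by
    rw [hL]
    exact (h1.hasMFDerivAt.comp r (h r)).hasFDerivAt
  rw [← hL]
  simpa using h3.hasDerivAt

theorem coord_sum_smul {d : ℕ} (t : Fin d → ℂ) (X : Fin d → HolVectorField m M) :
    coord ℂ c (vec (∑ k, t k • X k)) z = ∑ k, t k • coord ℂ c (vec (X k)) z := by
  have e : ∀ y, vec (∑ k, t k • X k) y = ∑ k, t k • vec (X k) y := fun y => by
    have : ∀ s : Finset (Fin d), vec (∑ k ∈ s, t k • X k) y = ∑ k ∈ s, t k • vec (X k) y := fun s => by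
      induction s using Finset.induction_on with
      | empty => rfl
      | insert a s ha ih =>
        rw [Finset.sum_insert ha, Finset.sum_insert ha, ← ih]
        rfl
    exact this _
  rw [coord, e, map_sum]
  exact Finset.sum_congr rfl fun k _ => map_smul _ _ _

/-- Real linear combinations of holomorphic vector fields. -/
def combine {d : ℕ} (X : Fin d → HolVectorField m M) (t : Fin d → ℝ) : HolVectorField m M :=
  ∑ k, (t k : ℂ) • X k

/-- The local flow of a finite-dimensional family of vector fields, as an analytic family. -/
theorem exists_isMIntegralCurveOn_family {d : ℕ} (X : Fin d → HolVectorField m M) (x₀ : M) :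
    ∃ Ψ : (Fin d → ℂ) × CSpace m → CSpace m, AnalyticAt ℂ Ψ (0, chartAt (CSpace m) x₀ x₀) ∧
      ∀ᶠ p in 𝓝 ((0 : Fin d → ℝ), x₀), ∃ γ : ℝ → M, γ 0 = p.2 ∧
        Ψ (fun k => (p.1 k : ℂ), chartAt (CSpace m) x₀ p.2) ∈ (chartAt (CSpace m) x₀).target ∧
        γ 1 = (chartAt (CSpace m) x₀).symm (Ψ (fun k => (p.1 k : ℂ), chartAt (CSpace m) x₀ p.2)) ∧
        IsMIntegralCurveOn γ (realField (combine X p.1)) (Set.Ioo (-2) 2) := by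
  have ho := (chartAt (CSpace m) x₀).open_target
  have hx₀ := mem_chart_target (CSpace m) x₀
  obtain ⟨Ψ, hΨ, hev⟩ := exists_analytic_local_flow
    (fun k => coord ℂ x₀ (vec (X k))) (chartAt (CSpace m) x₀ x₀)
    (fun k => (((X k).contDiffOn_coord x₀).contDiffAt (ho.mem_nhds hx₀)).analyticAt) (ho.mem_nhds hx₀)
  refine ⟨Ψ, hΨ, ?_⟩
  have hcont : ContinuousAt (fun p : (Fin d → ℝ) × M =>
      ((fun k => (p.1 k : ℂ)), chartAt (CSpace m) x₀ p.2)) (0, x₀) := by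
    refine ContinuousAt.prodMk ?_ ?_
    · exact (continuous_pi fun k => Complex.continuous_ofReal.comp
        ((continuous_apply k).comp continuous_fst)).continuousAt
    · exact ContinuousAt.comp (x := ((0 : Fin d → ℝ), x₀))
        ((chartAt (CSpace m) x₀).continuousAt (mem_chart_source _ _)) continuousAt_snd
  have hv : (fun k => (((0 : Fin d → ℝ) k : ℝ) : ℂ)) = (0 : Fin d → ℂ) := by
    funext k
    simp
  rw [← hv] at hev
  have h1 := hcont.eventually hev
  have h2 : ∀ᶠ p in 𝓝 ((0 : Fin d → ℝ), x₀), p.2 ∈ (chartAt (CSpace m) x₀).source :=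
    continuousAt_snd.eventually ((chartAt (CSpace m) x₀).open_source.mem_nhds (mem_chart_source _ _))
  filter_upwards [h1, h2] with p ⟨γ, h0, h1, hγ⟩ hp
  refine ⟨(chartAt (CSpace m) x₀).symm ∘ γ, ?_, ?_, ?_, ?_⟩
  · rw [Function.comp_apply, h0, (chartAt (CSpace m) x₀).left_inv hp]
  · rw [← h1]
    exact (hγ 1 (by norm_num)).1
  · rw [Function.comp_apply, h1]
  · refine isMIntegralCurveOn_chart_symm_comp fun r hr => ⟨(hγ r hr).1, ?_⟩
    rw [combine, coord_sum_smul]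
    exact (hγ r hr).2

variable [T2Space M] [CompactSpace M]

omit [T2Space M] [CompactSpace M] in
theorem realField_smul (r : ℝ) (Ξ : HolVectorField m M) :
    realField ((r : ℂ) • Ξ) = r • realField Ξ := by
  funext x
  change ((r : ℂ) • vec Ξ x : CSpace m) = r • vec Ξ x
  exact Complex.coe_smul _ _

/-- By compactness one r > 0 works for all starting points: integral curves of rΞ exist on (-2, 2),
hence those of Ξ on (-2r, 2r). A uniform existence time implies completeness. -/
theorem exists_isMIntegralCurve (Ξ : HolVectorField m M) (x : M) :
    ∃ γ : ℝ → M, γ 0 = x ∧ IsMIntegralCurve γ (realField Ξ) := by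
  have h1 : ∀ᶠ t in 𝓝 (0 : Fin 1 → ℝ), ∀ x ∈ (Set.univ : Set M), ∃ γ : ℝ → M, γ 0 = x ∧
      IsMIntegralCurveOn γ (realField (combine (fun _ => Ξ) t)) (Set.Ioo (-2) 2) := by
    refine isCompact_univ.eventually_forall_of_forall_eventually fun x₀ _ => ?_
    obtain ⟨Ψ, -, hev⟩ := exists_isMIntegralCurveOn_family (fun _ : Fin 1 => Ξ) x₀
    filter_upwards [hev] with p ⟨γ, h0, _, _, h⟩ using ⟨γ, h0, h⟩
  have h2 : Filter.Tendsto (fun r : ℝ => fun _ : Fin 1 => r) (𝓝[>] 0) (𝓝 0) :=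
    ((continuous_pi fun _ => continuous_id).tendsto 0).mono_left nhdsWithin_le_nhds
  obtain ⟨r, hr, hr0⟩ := ((h2.eventually h1).and self_mem_nhdsWithin).exists
  have hr0' : 0 < r := hr0
  refine exists_isMIntegralCurve_of_isMIntegralCurveOn (contMDiff_realField Ξ) (ε := 2 * r)
    (by positivity) (fun y => ?_) x
  obtain ⟨γ, h0, h⟩ := hr y (Set.mem_univ _)
  refine ⟨γ ∘ (· * r⁻¹), by simp [h0], ?_⟩
  have h3 := h.comp_mul r⁻¹
  have e : r⁻¹ • realField (combine (fun _ : Fin 1 => Ξ) fun _ => r) = realField Ξ := by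
    rw [combine, Fin.sum_univ_one, realField_smul, smul_smul, inv_mul_cancel₀ hr0'.ne', one_smul]
  rw [e] at h3
  refine h3.mono fun s hs => ?_
  rw [Set.mem_ofPred_eq, ← div_eq_mul_inv]
  constructor
  · rw [lt_div_iff₀ hr0']; linarith [hs.1]
  · rw [div_lt_iff₀ hr0']; linarith [hs.2]

/-- The flow of a holomorphic vector field. -/
def flow (Ξ : HolVectorField m M) (s : ℝ) (x : M) : M := (exists_isMIntegralCurve Ξ x).choose s

theorem flow_zero (Ξ : HolVectorField m M) (x : M) : flow Ξ 0 x = x :=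
  (exists_isMIntegralCurve Ξ x).choose_spec.1

theorem isMIntegralCurve_flow (Ξ : HolVectorField m M) (x : M) :
    IsMIntegralCurve (fun s => flow Ξ s x) (realField Ξ) :=
  (exists_isMIntegralCurve Ξ x).choose_spec.2

theorem _root_.IsMIntegralCurve.eq_flow {γ : ℝ → M} (h : IsMIntegralCurve γ (realField Ξ)) (s : ℝ) :
    γ s = flow Ξ s (γ 0) :=
  congrFun (isMIntegralCurve_Ioo_eq_of_contMDiff_boundaryless (t₀ := 0) (contMDiff_realField Ξ) h
    (isMIntegralCurve_flow Ξ _) (flow_zero Ξ _).symm) s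

theorem flow_add (Ξ : HolVectorField m M) (s r : ℝ) (x : M) :
    flow Ξ (s + r) x = flow Ξ s (flow Ξ r x) := by
  have h := ((isMIntegralCurve_flow Ξ x).comp_add r).eq_flow s
  simpa using h

theorem flow_real_smul (Ξ : HolVectorField m M) (r s : ℝ) (x : M) :
    flow ((r : ℂ) • Ξ) s x = flow Ξ (s * r) x := by
  have h := (isMIntegralCurve_flow Ξ x).comp_mul r
  rw [← realField_smul] at h
  have h1 := h.eq_flow s
  simp only [Function.comp_apply, zero_mul, flow_zero] at h1
  exact h1.symm

/-- The time one flow of a finite-dimensional family of vector fields is analytic. -/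
theorem exists_flow_family {d : ℕ} (X : Fin d → HolVectorField m M) (x₀ : M) :
    ∃ Ψ : (Fin d → ℂ) × CSpace m → CSpace m, AnalyticAt ℂ Ψ (0, chartAt (CSpace m) x₀ x₀) ∧
      ∀ᶠ p in 𝓝 ((0 : Fin d → ℝ), x₀),
        Ψ (fun k => (p.1 k : ℂ), chartAt (CSpace m) x₀ p.2) ∈ (chartAt (CSpace m) x₀).target ∧
        flow (combine X p.1) 1 p.2 =
          (chartAt (CSpace m) x₀).symm (Ψ (fun k => (p.1 k : ℂ), chartAt (CSpace m) x₀ p.2)) := by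
  obtain ⟨Ψ, hΨ, hev⟩ := exists_isMIntegralCurveOn_family X x₀
  refine ⟨Ψ, hΨ, ?_⟩
  filter_upwards [hev] with p ⟨γ, h0, h1, h2, h⟩
  refine ⟨h1, ?_⟩
  rw [← h2]
  exact (isMIntegralCurveOn_Ioo_eqOn_of_contMDiff_boundaryless (t₀ := 0) (by norm_num)
    (contMDiff_realField (combine X p.1)) h ((isMIntegralCurve_flow (combine X p.1) p.2).isMIntegralCurveOn _)
    (h0.trans (flow_zero _ _).symm) (by norm_num : (1 : ℝ) ∈ Set.Ioo (-2 : ℝ) 2)).symm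

end Flow

end KahlerBlowup

end

noncomputable section

namespace KahlerBlowup

open Topology

/-! ### Smoothness and holomorphy of the global flow. -/

section SmoothFlow

variable {m : ℕ} {M : Type*} [TopologicalSpace M] [ChartedSpace (CSpace m) M]
  [IsManifold 𝓘(ℂ, CSpace m) ω M] [T2Space M] [CompactSpace M] {Ξ : HolVectorField m M} {x c : M}
  {z : CSpace m}

/-- The time s flow of Ξ is the time one flow of sΞ, so the analytic family for the single field Ξ
describes it for small s. -/
theorem contMDiffAt_flow_zero (Ξ : HolVectorField m M) (x₀ : M) :
    ∀ᶠ p in 𝓝 ((0 : ℝ), x₀),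
      ContMDiffAt (𝓘(ℝ, ℝ).prod 𝓘(ℝ, CSpace m)) 𝓘(ℝ, CSpace m) ∞
        (fun p : ℝ × M => flow Ξ p.1 p.2) p ∧
      ContMDiffAt 𝓘(ℂ, CSpace m) 𝓘(ℂ, CSpace m) ω (flow Ξ p.1) p.2 := by
  obtain ⟨Ψ, hΨ, hev⟩ := exists_flow_family (fun _ : Fin 1 => Ξ) x₀
  have ht : Continuous fun p : ℝ × M => ((fun _ : Fin 1 => p.1), p.2) := by fun_prop
  have hc : ContinuousAt (fun p : ℝ × M =>
      ((fun _ : Fin 1 => (p.1 : ℂ)), chartAt (CSpace m) x₀ p.2)) (0, x₀) := by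
    refine ContinuousAt.prodMk ?_ ?_
    · exact (continuous_pi fun k => Complex.continuous_ofReal.comp continuous_fst).continuousAt
    · exact ContinuousAt.comp (x := ((0 : ℝ), x₀))
        ((chartAt (CSpace m) x₀).continuousAt (mem_chart_source _ _)) continuousAt_snd
  have hv : (fun _ : Fin 1 => ((0 : ℝ) : ℂ)) = 0 := by
    funext k
    simp
  have hΨ' := hΨ.eventually_analyticAt
  rw [← hv] at hΨ'
  have h1 := hc.eventually hΨ'
  have h2 := ht.tendsto ((0 : ℝ), x₀)
  have h3 := (h2.eventually hev).eventually_nhds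
  have h4 : ∀ᶠ p in 𝓝 ((0 : ℝ), x₀), p.2 ∈ (chartAt (CSpace m) x₀).source :=
    continuousAt_snd.eventually ((chartAt (CSpace m) x₀).open_source.mem_nhds (mem_chart_source _ _))
  filter_upwards [h1, h3, h4] with p hp1 hp3 hp4
  have hfl : ∀ᶠ q in 𝓝 p, flow Ξ q.1 q.2 = (chartAt (CSpace m) x₀).symm
      (Ψ (fun _ => (q.1 : ℂ), chartAt (CSpace m) x₀ q.2)) := by
    filter_upwards [hp3] with q hq
    rw [← hq.2, combine, Fin.sum_univ_one, flow_real_smul, one_mul]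
  have hmem := hp3.self_of_nhds.1
  constructor
  · have e1 : ContMDiffAt (𝓘(ℝ, ℝ).prod 𝓘(ℝ, CSpace m)) 𝓘(ℝ, CSpace m) ∞
        (fun q : ℝ × M => chartAt (CSpace m) x₀ q.2) p :=
      ContMDiffAt.comp p ((contMDiffOn_chart (I := 𝓘(ℝ, CSpace m))).contMDiffAt
        ((chartAt (CSpace m) x₀).open_source.mem_nhds hp4)) contMDiffAt_snd
    have e2 : ContMDiffAt (𝓘(ℝ, ℝ).prod 𝓘(ℝ, CSpace m)) 𝓘(ℝ, (Fin 1 → ℂ)) ∞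
        (fun q : ℝ × M => fun _ : Fin 1 => (q.1 : ℂ)) p := by
      have : ContDiff ℝ ∞ (fun r : ℝ => fun _ : Fin 1 => (r : ℂ)) :=
        contDiff_pi.2 fun _ => Complex.ofRealCLM.contDiff
      exact ContMDiffAt.comp p this.contMDiff.contMDiffAt contMDiffAt_fst
    have e3 : ContMDiffAt 𝓘(ℝ, (Fin 1 → ℂ) × CSpace m) 𝓘(ℝ, CSpace m) ∞ Ψ
        (fun _ => (p.1 : ℂ), chartAt (CSpace m) x₀ p.2) :=
      (hp1.contDiffAt.restrict_scalars ℝ).contMDiffAt.of_le le_top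
    have e4 := ContMDiffAt.comp p e3 (e2.prodMk_space e1)
    have e5 := ContMDiffAt.comp p ((contMDiffOn_chart_symm (I := 𝓘(ℝ, CSpace m)) (n := ∞)).contMDiffAt
      ((chartAt (CSpace m) x₀).open_target.mem_nhds hmem)) e4
    exact e5.congr_of_eventuallyEq hfl
  · have e1 : ContMDiffAt 𝓘(ℂ, CSpace m) 𝓘(ℂ, CSpace m) ω (chartAt (CSpace m) x₀) p.2 :=
      (contMDiffOn_chart (I := 𝓘(ℂ, CSpace m))).contMDiffAt
        ((chartAt (CSpace m) x₀).open_source.mem_nhds hp4)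
    have e2 : ContMDiffAt 𝓘(ℂ, CSpace m) 𝓘(ℂ, (Fin 1 → ℂ)) ω
        (fun _ : M => fun _ : Fin 1 => (p.1 : ℂ)) p.2 := contMDiffAt_const
    have e3 : ContMDiffAt 𝓘(ℂ, (Fin 1 → ℂ) × CSpace m) 𝓘(ℂ, CSpace m) ω Ψ
        (fun _ => (p.1 : ℂ), chartAt (CSpace m) x₀ p.2) := hp1.contDiffAt.contMDiffAt
    have e4 := ContMDiffAt.comp p.2 e3 (e2.prodMk_space e1)
    have e5 := ContMDiffAt.comp p.2 ((contMDiffOn_chart_symm (I := 𝓘(ℂ, CSpace m)) (n := ω)).contMDiffAt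
      ((chartAt (CSpace m) x₀).open_target.mem_nhds hmem)) e4
    refine e5.congr_of_eventuallyEq ?_
    have hcs : Continuous fun y : M => (p.1, y) := by fun_prop
    exact (hcs.tendsto p.2).eventually hfl

/-- By compactness the flow is holomorphic on all of M for small times; time s is reached by
iterating the flow of time s/(n+1). -/
theorem contMDiff_flow_complex (Ξ : HolVectorField m M) (s : ℝ) :
    ContMDiff 𝓘(ℂ, CSpace m) 𝓘(ℂ, CSpace m) ω (flow Ξ s) := by
  have h1 : ∀ᶠ r in 𝓝 (0 : ℝ), ∀ x ∈ (Set.univ : Set M),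
      ContMDiffAt 𝓘(ℂ, CSpace m) 𝓘(ℂ, CSpace m) ω (flow Ξ r) x :=
    isCompact_univ.eventually_forall_of_forall_eventually fun x₀ _ =>
      (contMDiffAt_flow_zero Ξ x₀).mono fun _ h => h.2
  have h2 : Filter.Tendsto (fun n : ℕ => s / ((n : ℝ) + 1)) Filter.atTop (𝓝 0) :=
    tendsto_const_nhds.div_atTop
      (Filter.tendsto_atTop_add_const_right _ _ tendsto_natCast_atTop_atTop)
  obtain ⟨n, hn⟩ := (h2.eventually h1).exists
  have h3 : ∀ k : ℕ, ContMDiff 𝓘(ℂ, CSpace m) 𝓘(ℂ, CSpace m) ω (flow Ξ (k * (s / ((n : ℝ) + 1)))) := by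
    intro k
    induction k with
    | zero =>
      have : flow Ξ ((0 : ℕ) * (s / ((n : ℝ) + 1))) = id := by
        funext x
        rw [Nat.cast_zero, zero_mul, flow_zero]
        rfl
      rw [this]
      exact contMDiff_id
    | succ k ih =>
      have : flow Ξ ((k + 1 : ℕ) * (s / ((n : ℝ) + 1))) =
          flow Ξ (s / ((n : ℝ) + 1)) ∘ flow Ξ (k * (s / ((n : ℝ) + 1))) := by
        funext x
        rw [Function.comp_apply, ← flow_add]
        congr 1
        push_cast
        ring
      rw [this]
      exact ContMDiff.comp (fun x => hn x (Set.mem_univ x)) ih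
  have h4 := h3 (n + 1)
  have e : ((n + 1 : ℕ) : ℝ) * (s / ((n : ℝ) + 1)) = s := by
    push_cast
    field_simp
  rwa [e] at h4

/-- The group law reduces joint smoothness at (s, x) to joint smoothness at time zero near the point
reached at time s. -/
theorem contMDiff_flow (Ξ : HolVectorField m M) :
    ContMDiff (𝓘(ℝ, ℝ).prod 𝓘(ℝ, CSpace m)) 𝓘(ℝ, CSpace m) ∞
      (fun p : ℝ × M => flow Ξ p.1 p.2) := by
  rintro ⟨s, x⟩
  have h1 := (contMDiffAt_flow_zero Ξ (flow Ξ s x)).self_of_nhds.1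
  have h2 : ContMDiff 𝓘(ℝ, CSpace m) 𝓘(ℝ, CSpace m) ∞ (flow Ξ s) :=
    (contMDiff_real (contMDiff_flow_complex Ξ s)).of_le le_top
  have h3 : ContMDiffAt (𝓘(ℝ, ℝ).prod 𝓘(ℝ, CSpace m)) (𝓘(ℝ, ℝ).prod 𝓘(ℝ, CSpace m)) ∞
      (fun p : ℝ × M => (p.1 - s, flow Ξ s p.2)) (s, x) := by
    refine ContMDiffAt.prodMk ?_ ?_
    · have : ContDiff ℝ ∞ (fun r : ℝ => r - s) := by fun_prop
      exact ContMDiffAt.comp (s, x) this.contMDiff.contMDiffAt contMDiffAt_fst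
    · exact ContMDiffAt.comp (s, x) h2.contMDiffAt contMDiffAt_snd
  have h4 : ContMDiffAt (𝓘(ℝ, ℝ).prod 𝓘(ℝ, CSpace m)) 𝓘(ℝ, CSpace m) ∞
      (fun p : ℝ × M => flow Ξ (p.1 - s) (flow Ξ s p.2)) (s, x) := by
    refine ContMDiffAt.comp (s, x) (g := fun p : ℝ × M => flow Ξ p.1 p.2) ?_ h3
    simp only [sub_self]
    exact h1
  refine h4.congr_of_eventuallyEq (Filter.Eventually.of_forall fun p => ?_)
  simp only
  rw [← flow_add, sub_add_cancel]

theorem flow_neg_flow (Ξ : HolVectorField m M) (s : ℝ) (x : M) : flow Ξ (-s) (flow Ξ s x) = x := by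
  rw [← flow_add, neg_add_cancel, flow_zero]

theorem flow_flow_neg (Ξ : HolVectorField m M) (s : ℝ) (x : M) : flow Ξ s (flow Ξ (-s) x) = x := by
  rw [← flow_add, add_neg_cancel, flow_zero]

/-- The flow in charts. -/
theorem contDiffAt_inCharts_flow {s : ℝ} (hz : z ∈ (chartAt (CSpace m) c).target) {c' : M}
    (hc' : flow Ξ s ((chartAt (CSpace m) c).symm z) ∈ (chartAt (CSpace m) c').source) :
    ContDiffAt ℝ ∞ (fun p : ℝ × CSpace m => inCharts (CSpace m) (CSpace m) (flow Ξ p.1) c c' p.2)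
      (s, z) := by
  have h1 : ContMDiffAt 𝓘(ℝ, ℝ × CSpace m) 𝓘(ℝ, CSpace m) ∞
      (fun p : ℝ × CSpace m => (chartAt (CSpace m) c).symm p.2) (s, z) :=
    ContMDiffAt.comp (s, z) (I' := 𝓘(ℝ, CSpace m)) (g := (chartAt (CSpace m) c).symm)
      ((contMDiffOn_chart_symm (I := 𝓘(ℝ, CSpace m)) (n := ∞)).contMDiffAt
      ((chartAt (CSpace m) c).open_target.mem_nhds hz)) contDiff_snd.contMDiff.contMDiffAt
  have h2 : ContMDiffAt 𝓘(ℝ, ℝ × CSpace m) (𝓘(ℝ, ℝ).prod 𝓘(ℝ, CSpace m)) ∞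
      (fun p : ℝ × CSpace m => (p.1, (chartAt (CSpace m) c).symm p.2)) (s, z) :=
    ContMDiffAt.prodMk contDiff_fst.contMDiff.contMDiffAt h1
  have h3 := ContMDiffAt.comp (s, z) (contMDiff_flow Ξ (s, (chartAt (CSpace m) c).symm z)) h2
  have h4 := ContMDiffAt.comp (s, z) ((contMDiffOn_chart (I := 𝓘(ℝ, CSpace m)) (n := ∞)).contMDiffAt
        ((chartAt (CSpace m) c').open_source.mem_nhds hc')) h3
  exact h4.contDiffAt

theorem contDiffOn_comp_flow {F : Type*} [NormedAddCommGroup F] [NormedSpace ℝ F] {u : M → F}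
    (Ξ : HolVectorField m M) (hu : ContMDiff 𝓘(ℝ, CSpace m) 𝓘(ℝ, F) ∞ u) (c : M) :
    ContDiffOn ℝ ∞ (fun p : ℝ × CSpace m => u (flow Ξ p.1 ((chartAt (CSpace m) c).symm p.2)))
      (Set.univ ×ˢ (chartAt (CSpace m) c).target) := by
  rintro ⟨s, z⟩ ⟨-, hz⟩
  have h1 : ContMDiffAt 𝓘(ℝ, ℝ × CSpace m) 𝓘(ℝ, CSpace m) ∞
      (fun p : ℝ × CSpace m => (chartAt (CSpace m) c).symm p.2) (s, z) :=
    ContMDiffAt.comp (s, z) (I' := 𝓘(ℝ, CSpace m)) (g := (chartAt (CSpace m) c).symm)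
      ((contMDiffOn_chart_symm (I := 𝓘(ℝ, CSpace m)) (n := ∞)).contMDiffAt
      ((chartAt (CSpace m) c).open_target.mem_nhds hz)) contDiff_snd.contMDiff.contMDiffAt
  have h2 : ContMDiffAt 𝓘(ℝ, ℝ × CSpace m) (𝓘(ℝ, ℝ).prod 𝓘(ℝ, CSpace m)) ∞
      (fun p : ℝ × CSpace m => (p.1, (chartAt (CSpace m) c).symm p.2)) (s, z) :=
    ContMDiffAt.prodMk contDiff_fst.contMDiff.contMDiffAt h1
  have h3 := ContMDiffAt.comp (s, z) (contMDiff_flow Ξ (s, (chartAt (CSpace m) c).symm z)) h2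
  exact (ContMDiffAt.comp (s, z) hu.contMDiffAt h3).contDiffAt.contDiffWithinAt

end SmoothFlow

end KahlerBlowup

end

noncomputable section

namespace KahlerBlowup

open Topology MeasureTheory

/-! ### Smoothness of integrals depending on a parameter. -/

section ParametricIntegral

variable {E : Type} [NormedAddCommGroup E] [NormedSpace ℝ E] [FiniteDimensional ℝ E]
  {F : Type} [NormedAddCommGroup F] [NormedSpace ℝ F] {U : Set E} {f : ℝ × E → F} {z : E}

omit [FiniteDimensional ℝ E] in
theorem fderiv_partial_right {s : ℝ} (h : DifferentiableAt ℝ f (s, z)) :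
    HasFDerivAt (fun w => f (s, w)) ((fderiv ℝ f (s, z)).comp (ContinuousLinearMap.inr ℝ ℝ E)) z :=
  h.hasFDerivAt.comp z ((hasFDerivAt_const s z).prodMk (hasFDerivAt_id z))

/-- The partial derivative with respect to the second variable. -/
def partialRight (f : ℝ × E → F) (p : ℝ × E) : E →L[ℝ] F := fderiv ℝ (fun w => f (p.1, w)) p.2

omit [FiniteDimensional ℝ E] in
theorem ContDiffOn.partialRight (hU : IsOpen U) (hf : ContDiffOn ℝ ∞ f (Set.univ ×ˢ U)) :
    ContDiffOn ℝ ∞ (partialRight f) (Set.univ ×ˢ U) := by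
  have ho : IsOpen ((Set.univ : Set ℝ) ×ˢ U) := isOpen_univ.prod hU
  have h1 : ContDiffOn ℝ ∞ (fderiv ℝ f) (Set.univ ×ˢ U) := hf.fderiv_of_isOpen ho (by simp)
  refine (h1.clm_comp (contDiffOn_const (c := ContinuousLinearMap.inr ℝ ℝ E))).congr ?_
  rintro ⟨s, w⟩ hw
  exact (fderiv_partial_right (hf.differentiableAt_of_isOpen ho hw)).fderiv

theorem hasFDerivAt_intervalIntegral (hU : IsOpen U) (hf : ContDiffOn ℝ ∞ f (Set.univ ×ˢ U))
    (hz : z ∈ U) :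
    HasFDerivAt (fun w => ∫ s in (0 : ℝ)..1, f (s, w)) (∫ s in (0 : ℝ)..1, partialRight f (s, z)) z := by
  have ho : IsOpen ((Set.univ : Set ℝ) ×ˢ U) := isOpen_univ.prod hU
  have hD := (ContDiffOn.partialRight hU hf).continuousOn
  obtain ⟨r, hr, hball⟩ := Metric.nhds_basis_closedBall.mem_iff.1 (hU.mem_nhds hz)
  have hsl : ∀ {G : Type} [TopologicalSpace G] {g : ℝ × E → G}, ContinuousOn g (Set.univ ×ˢ U) →
      ∀ w ∈ U, Continuous fun s => g (s, w) := fun hg w hw =>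
    hg.comp_continuous (by fun_prop) fun s => ⟨Set.mem_univ _, hw⟩
  obtain ⟨C, hC⟩ := (isCompact_Icc (a := (0 : ℝ)) (b := 1)).prod (isCompact_closedBall z r)
    |>.exists_bound_of_continuousOn (hD.mono (Set.prod_mono (Set.subset_univ _) hball))
  refine intervalIntegral.hasFDerivAt_integral_of_dominated_of_fderiv_le (𝕜 := ℝ) (s := Metric.closedBall z r)
    (F' := fun w s => partialRight f (s, w)) (bound := fun _ => C)
    (Metric.closedBall_mem_nhds z hr) ?_ ?_ ?_ ?_ ?_ ?_
  · filter_upwards [hU.mem_nhds hz] with w hw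
    exact (hsl hf.continuousOn w hw).aestronglyMeasurable
  · exact (hsl hf.continuousOn z hz).intervalIntegrable _ _
  · exact (hsl hD z hz).aestronglyMeasurable
  · refine Filter.Eventually.of_forall fun s hs w hw => hC (s, w) ⟨?_, hw⟩
    rw [Set.uIoc_of_le zero_le_one] at hs
    exact ⟨hs.1.le, hs.2⟩
  · exact intervalIntegrable_const
  · refine Filter.Eventually.of_forall fun s _ w hw => ?_
    have h1 := fderiv_partial_right (hf.differentiableAt_of_isOpen ho
      (x := (s, w)) ⟨Set.mem_univ _, hball hw⟩)
    exact h1.differentiableAt.hasFDerivAt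

/-- Repeated differentiation under the integral sign. The induction on the order ranges over all
target spaces, since each derivative takes values in a space of linear maps. -/
theorem contDiffOn_intervalIntegral (hU : IsOpen U) (hf : ContDiffOn ℝ ∞ f (Set.univ ×ˢ U)) :
    ContDiffOn ℝ ∞ (fun w => ∫ s in (0 : ℝ)..1, f (s, w)) U := by
  have key : ∀ n : ℕ, ∀ (G : Type) [NormedAddCommGroup G] [NormedSpace ℝ G] (g : ℝ × E → G),
      ContDiffOn ℝ ∞ g (Set.univ ×ˢ U) →
      ContDiffOn ℝ n (fun w => ∫ s in (0 : ℝ)..1, g (s, w)) U := by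
    intro n
    induction n with
    | zero =>
      intro G _ _ g hg
      exact contDiffOn_zero.2 fun w hw =>
        (hasFDerivAt_intervalIntegral hU hg hw).continuousAt.continuousWithinAt
    | succ n ih =>
      intro G _ _ g hg
      have := (contDiffOn_succ_iff_fderiv_of_isOpen (𝕜 := ℝ) (n := n)
        (f := fun w => ∫ s in (0 : ℝ)..1, g (s, w)) hU).2
      refine this ⟨fun w hw =>
        (hasFDerivAt_intervalIntegral hU hg hw).differentiableAt.differentiableWithinAt, by simp, ?_⟩
      exact (ih _ _ (ContDiffOn.partialRight hU hg)).congr fun w hw =>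
        (hasFDerivAt_intervalIntegral hU hg hw).fderiv
  exact contDiffOn_infty.2 fun n => key n F f hf

end ParametricIntegral

/-! ### The Lie derivative of a Kähler form along a holomorphic gradient flow. -/

section LieDerivative

variable {m : ℕ}

/-- Alternating `2`-forms as bilinear maps. -/
def toBilinear : (CSpace m [⋀^Fin 2]→L[ℝ] ℝ) →L[ℝ] CSpace m →L[ℝ] CSpace m →L[ℝ] ℝ :=
  let e₁ := (continuousMultilinearCurryFin1 ℝ (CSpace m) ℝ).toContinuousLinearEquiv.toContinuousLinearMap
  let e₂ := (continuousMultilinearCurryLeftEquiv ℝ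
    (fun _ : Fin 2 => CSpace m) ℝ).toContinuousLinearEquiv.toContinuousLinearMap
  (ContinuousLinearMap.compL ℝ (CSpace m) _ _ e₁).comp
    (e₂.comp (ContinuousAlternatingMap.toContinuousMultilinearMapCLM ℝ))

theorem toBilinear_apply (β : CSpace m [⋀^Fin 2]→L[ℝ] ℝ) (u v : CSpace m) :
    toBilinear β u v = β ![u, v] := by
  simp only [toBilinear]
  change β (Fin.cons u (Fin.snoc 0 v)) = β ![u, v]
  congr 1
  funext i
  fin_cases i <;> rfl

theorem _root_.HasFDerivAt.clm_comp_left {A B G : Type*} [NormedAddCommGroup A] [NormedSpace ℝ A]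
    [NormedAddCommGroup B] [NormedSpace ℝ B] [NormedAddCommGroup G] [NormedSpace ℝ G] (T : A →L[ℝ] B)
    {b : G → A} {b' : G →L[ℝ] A} {x : G} (h : HasFDerivAt b b' x) :
    HasFDerivAt (fun s => T (b s)) (T.comp b') x := T.hasFDerivAt.comp x h

theorem hasFDerivAt_toBilinear {G : Type*} [NormedAddCommGroup G] [NormedSpace ℝ G]
    {b : G → CSpace m [⋀^Fin 2]→L[ℝ] ℝ} {b' : G →L[ℝ] CSpace m [⋀^Fin 2]→L[ℝ] ℝ} {x : G}
    (h : HasFDerivAt b b' x) :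
    HasFDerivAt (fun s => toBilinear (b s)) (toBilinear.comp b') x :=
  HasFDerivAt.clm_comp_left (A := CSpace m [⋀^Fin 2]→L[ℝ] ℝ) (B := CSpace m →L[ℝ] CSpace m →L[ℝ] ℝ)
    toBilinear h

variable {β : CSpace m → CSpace m [⋀^Fin 2]→L[ℝ] ℝ} {X : CSpace m → CSpace m}
  {u : CSpace m → ℝ} {S : ℝ × CSpace m → CSpace m} {s₀ : ℝ} {z : CSpace m}

/-- The derivative of the pull-back of a closed form by the flow of a field `X` with
`ι_X β = - du ∘ J`. -/
theorem hasDerivAt_pullback_flow (hS : ContDiffAt ℝ 2 S (s₀, z))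
    (hβ : DifferentiableAt ℝ β (S (s₀, z))) (hcl : extDeriv β (S (s₀, z)) = 0)
    (hX : DifferentiableAt ℝ X (S (s₀, z))) (hu : ContDiffAt ℝ 2 u (S (s₀, z)))
    (hXu : ∀ᶠ w in 𝓝 (S (s₀, z)), ∀ v, β w ![X w, v] = - fderiv ℝ u w (Complex.I • v))
    (hflow : ∀ᶠ p in 𝓝 (s₀, z), HasDerivAt (fun s => S (s, p.2)) (X (S p)) p.1)
    (hhol : ∀ᶠ p in 𝓝 (s₀, z), ∀ v,
      fderiv ℝ S p (0, Complex.I • v) = Complex.I • fderiv ℝ S p (0, v)) (v₁ v₂ : CSpace m) :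
    HasDerivAt (fun s => β (S (s, z)) ![fderiv ℝ S (s, z) (0, v₁), fderiv ℝ S (s, z) (0, v₂)])
      (- fderiv ℝ (fderiv ℝ fun w => u (S (s₀, w))) z v₁ (Complex.I • v₂) +
        fderiv ℝ (fderiv ℝ fun w => u (S (s₀, w))) z v₂ (Complex.I • v₁)) s₀ := by
  set y := S (s₀, z) with hy
  set a : CSpace m → CSpace m := fun v => fderiv ℝ S (s₀, z) (0, v) with ha
  have hSd : DifferentiableAt ℝ S (s₀, z) := hS.differentiableAt (by norm_num)
  have hdS : DifferentiableAt ℝ (fderiv ℝ S) (s₀, z) :=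
    (hS.fderiv_right (m := 1) (by norm_num)).differentiableAt (by norm_num)
  have hsym : ∀ p q, fderiv ℝ (fderiv ℝ S) (s₀, z) p q = fderiv ℝ (fderiv ℝ S) (s₀, z) q p :=
    (hS.isSymmSndFDerivAt (by simp)).eq
  have hpath : HasDerivAt (fun s : ℝ => (s, z)) ((1 : ℝ), (0 : CSpace m)) s₀ :=
    (hasDerivAt_id s₀).prodMk (hasDerivAt_const s₀ z)
  have hslice : HasFDerivAt (fun w : CSpace m => (s₀, w)) (ContinuousLinearMap.inr ℝ ℝ (CSpace m)) z :=
    (hasFDerivAt_const s₀ z).prodMk (hasFDerivAt_id z)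
  have hSt : HasDerivAt (fun s => S (s, z)) (X y) s₀ := hflow.self_of_nhds
  -- the derivative of the differential of the flow
  have hL : ∀ v, HasDerivAt (fun s => fderiv ℝ S (s, z) (0, v)) (fderiv ℝ X y (a v)) s₀ := by
    intro v
    have h1 : HasDerivAt (fun s => fderiv ℝ S (s, z)) (fderiv ℝ (fderiv ℝ S) (s₀, z) (1, 0)) s₀ :=
      hdS.hasFDerivAt.comp_hasDerivAt s₀ hpath
    have h2 := h1.clm_apply (hasDerivAt_const s₀ ((0 : ℝ), v))
    simp only [map_zero, add_zero] at h2
    rw [hsym] at h2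
    refine h2.congr_deriv ?_
    have h3 : (fun w => fderiv ℝ S (s₀, w) ((1 : ℝ), (0 : CSpace m))) =ᶠ[𝓝 z] fun w => X (S (s₀, w)) := by
      have hc : ContinuousAt (fun w : CSpace m => (s₀, w)) z := hslice.continuousAt
      have hdiff : ∀ᶠ p in 𝓝 (s₀, z), DifferentiableAt ℝ S p := by
        filter_upwards [hS.eventually (by norm_num)] with p hp using hp.differentiableAt (by norm_num)
      filter_upwards [hc.eventually hflow, hc.eventually hdiff] with w hw hw'
      have h4 : HasDerivAt (fun s => S (s, w)) (fderiv ℝ S (s₀, w) (1, 0)) s₀ :=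
        hw'.hasFDerivAt.comp_hasDerivAt s₀ ((hasDerivAt_id s₀).prodMk (hasDerivAt_const s₀ w))
      exact h4.unique hw
    have h4 : HasFDerivAt (fun w => fderiv ℝ S (s₀, w) ((1 : ℝ), (0 : CSpace m)))
        (((fderiv ℝ (fderiv ℝ S) (s₀, z)).comp (ContinuousLinearMap.inr ℝ ℝ (CSpace m))).flip (1, 0)) z := by
      have h5 : HasFDerivAt (fun w => fderiv ℝ S (s₀, w))
        ((fderiv ℝ (fderiv ℝ S) (s₀, z)).comp (ContinuousLinearMap.inr ℝ ℝ (CSpace m))) z :=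
        hdS.hasFDerivAt.comp z hslice
      have h6 := h5.clm_apply (hasFDerivAt_const ((1 : ℝ), (0 : CSpace m)) z)
      refine h6.congr_fderiv ?_
      ext v
      simp
    have h5 : HasFDerivAt (fun w => X (S (s₀, w)))
        ((fderiv ℝ X y).comp ((fderiv ℝ S (s₀, z)).comp (ContinuousLinearMap.inr ℝ ℝ (CSpace m)))) z :=
      HasFDerivAt.comp z (g := X) hX.hasFDerivAt (hSd.hasFDerivAt.comp z hslice)
    have h6 := (h4.congr_of_eventuallyEq h3.symm).unique h5
    exact congrArg (fun L => L v) h6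
  -- the derivative of the pulled back form
  have hB₀ : HasDerivAt (fun s => β (S (s, z))) (fderiv ℝ β y (X y)) s₀ :=
    HasFDerivAt.comp_hasDerivAt s₀ (l := β) hβ.hasFDerivAt hSt
  have hB : HasDerivAt (fun s => toBilinear (β (S (s, z)))) (toBilinear (fderiv ℝ β y (X y))) s₀ := by
    have h := (hasFDerivAt_toBilinear hB₀.hasFDerivAt).hasDerivAt
    simpa using h
  have hA := (hB.clm_apply (hL v₁)).clm_apply (hL v₂)
  simp only [add_apply, toBilinear_apply] at hA
  refine hA.congr_deriv ?_
  -- the exterior derivative of the contracted form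
  have hd : ∀ p q r, fderiv ℝ (fun w => β w ![q, r]) y p = fderiv ℝ β y p ![q, r] := by
    intro p q r
    have h1 := (ContinuousAlternatingMap.apply ℝ (CSpace m) ℝ ![q, r]).hasFDerivAt.comp y hβ.hasFDerivAt
    exact congrArg (fun L => L p) h1.fderiv
  -- Cartan's formula in coordinates: closedness trades the derivative of β along X for derivatives
  -- in the directions a v₁ and a v₂, which belong to the contracted form.
  have hcyc := fderiv_form_cyclic hβ hcl (X y) (a v₁) (a v₂)
  rw [hd, hd, hd] at hcyc
  have hdu : DifferentiableAt ℝ (fderiv ℝ u) y :=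
    (hu.fderiv_right (m := 1) (by norm_num)).differentiableAt (by norm_num)
  -- The product rule applied to the hypothesis that β contracted with X is -du ∘ J.
  have hcon : ∀ p v, fderiv ℝ β y p ![X y, v] + β y ![fderiv ℝ X y p, v] =
      - fderiv ℝ (fderiv ℝ u) y p (Complex.I • v) := by
    intro p v
    have h1 : HasFDerivAt (fun w => toBilinear (β w)) (toBilinear.comp (fderiv ℝ β y)) y :=
      hasFDerivAt_toBilinear hβ.hasFDerivAt
    have h2 := (h1.clm_apply hX.hasFDerivAt).clm_apply (hasFDerivAt_const v y)
    have h3 : HasFDerivAt (fun w => - fderiv ℝ u w (Complex.I • v))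
        (- (fderiv ℝ (fderiv ℝ u) y).flip (Complex.I • v)) y := by
      have h4 := (hdu.hasFDerivAt.clm_apply (hasFDerivAt_const (Complex.I • v) y)).neg
      refine h4.congr_fderiv ?_
      ext w
      simp
    have h4 : (fun w => - fderiv ℝ u w (Complex.I • v)) =ᶠ[𝓝 y] fun w => toBilinear (β w) (X w) v := by
      filter_upwards [hXu] with w hw
      rw [toBilinear_apply, hw]
    have h5 := congrArg (fun L => L p) ((h2.congr_of_eventuallyEq h4).unique h3)
    simp [toBilinear_apply] at h5
    linarith
  -- the second derivative of the pulled back function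
  have hS₀ : ∀ᶠ w in 𝓝 z, HasFDerivAt (fun w => S (s₀, w))
      ((fderiv ℝ S (s₀, w)).comp (ContinuousLinearMap.inr ℝ ℝ (CSpace m))) w := by
    have hc : ContinuousAt (fun w : CSpace m => (s₀, w)) z := hslice.continuousAt
    have hdiff : ∀ᶠ p in 𝓝 (s₀, z), DifferentiableAt ℝ S p := by
      filter_upwards [hS.eventually (by norm_num)] with p hp using hp.differentiableAt (by norm_num)
    filter_upwards [hc.eventually hdiff] with w hw
    exact hw.hasFDerivAt.comp w ((hasFDerivAt_const s₀ w).prodMk (hasFDerivAt_id w))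
  have hdg : ∀ᶠ w in 𝓝 z, fderiv ℝ (fun w => u (S (s₀, w))) w =
      (fderiv ℝ u (S (s₀, w))).comp ((fderiv ℝ S (s₀, w)).comp (ContinuousLinearMap.inr ℝ ℝ (CSpace m))) := by
    have hc : ContinuousAt (fun w : CSpace m => S (s₀, w)) z := hS₀.self_of_nhds.continuousAt
    have hdiff : ∀ᶠ w in 𝓝 y, DifferentiableAt ℝ u w := by
      filter_upwards [hu.eventually (by norm_num)] with p hp using hp.differentiableAt (by norm_num)
    filter_upwards [hS₀, hc.eventually hdiff] with w hw hw'
    exact (HasFDerivAt.comp w (g := u) hw'.hasFDerivAt hw).fderiv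
  have hQ : ∀ v w, fderiv ℝ (fderiv ℝ fun w => u (S (s₀, w))) z v (Complex.I • w) =
      fderiv ℝ (fderiv ℝ u) y (a v) (Complex.I • a w) +
        fderiv ℝ u y (fderiv ℝ (fderiv ℝ S) (s₀, z) (0, v) (0, Complex.I • w)) := by
    intro v w
    rw [Filter.EventuallyEq.fderiv_eq hdg]
    have h1 : HasFDerivAt (fun w => fderiv ℝ u (S (s₀, w))) _ z :=
      HasFDerivAt.comp z (g := fderiv ℝ u) hdu.hasFDerivAt hS₀.self_of_nhds
    have h2 : HasFDerivAt (fun w => (fderiv ℝ S (s₀, w))) _ z := hdS.hasFDerivAt.comp z hslice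
    have h3 := h1.clm_comp (h2.clm_comp (hasFDerivAt_const (ContinuousLinearMap.inr ℝ ℝ (CSpace m)) z))
    rw [h3.fderiv]
    simp only [add_apply, ContinuousLinearMap.comp_apply, ContinuousLinearMap.compL_apply,
      ContinuousLinearMap.flip_apply, ContinuousLinearMap.inr_apply]
    have h4 := hhol.self_of_nhds w
    simp [ha, h4]
    ring
  -- The differential of the flow is complex linear near the point, hence so is its derivative. By
  -- symmetry of second derivatives the terms containing du then cancel in the antisymmetrised
  -- expression.
  have hsym2 : ∀ v w, fderiv ℝ (fderiv ℝ S) (s₀, z) (0, v) (0, Complex.I • w) =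
      Complex.I • fderiv ℝ (fderiv ℝ S) (s₀, z) (0, v) (0, w) := by
    intro v w
    have hc : ContinuousAt (fun w : CSpace m => (s₀, w)) z := hslice.continuousAt
    have h0 : HasFDerivAt (fun w => (fderiv ℝ S (s₀, w))) _ z := hdS.hasFDerivAt.comp z hslice
    have h1 := h0.clm_apply (hasFDerivAt_const ((0 : ℝ), Complex.I • w) z)
    have h2 := (h0.clm_apply (hasFDerivAt_const ((0 : ℝ), w) z)).const_smul Complex.I
    have h3 := (h2.congr_of_eventuallyEq (by
      filter_upwards [hc.eventually hhol] with q hq using hq w)).unique h1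
    have h4 := congrArg (fun L => L v) h3
    simp at h4
    exact h4.symm
  rw [hQ, hQ, hsym2, hsym2, hsym (0, v₂) (0, v₁)]
  have e1 := hcon (a v₁) (a v₂)
  have e2 := hcon (a v₂) (a v₁)
  have e3 := form2_swap (β y) (a v₁) (fderiv ℝ X y (a v₂))
  simp only [ha] at hcyc e1 e2 e3 ⊢
  linarith

end LieDerivative

end KahlerBlowup

end

noncomputable section

namespace KahlerBlowup

open Topology MeasureTheory

/-! ### Real potentials and their gradients. -/

section RealPotential

variable {m : ℕ} {M : Type*} [TopologicalSpace M] [ChartedSpace (CSpace m) M]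
  [IsManifold 𝓘(ℂ, CSpace m) ω M] {Ξ : HolVectorField m M} {κ : KahlerForm m M} {c x : M}
  {z : CSpace m} {ζ : M → ℂ} {u : M → ℝ}

/-- The right-hand side is -2∂̄ζ(v); the coordinate Hamiltonian equations are summed against the
conjugates of the v k. Its imaginary part, for real ζ, is the gradient equation for -JΞ. -/
theorem KahlerForm.IsHamiltonian.contr_coord (h : κ.IsHamiltonian Ξ ζ)
    (hz : z ∈ (chartAt (CSpace m) c).target) (v : CSpace m) :
    contr (κ.form.inChart c z) (coord ℂ c (vec Ξ) z) v =
      - (fderiv ℝ (ζ ∘ (chartAt (CSpace m) c).symm) z v +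
        Complex.I * fderiv ℝ (ζ ∘ (chartAt (CSpace m) c).symm) z (Complex.I • v)) := by
  have h1 := (eq_smul_cgrad_iff (κ.isLocalKahler c) hz _).1 (h.coord_eq hz)
  have hH : hermOf (κ.form.inChart c z) = κ.herm c z := rfl
  rw [contr_eq_sum (κ.inChart_invariant hz), hH, Finset.sum_comm, fderiv_eq_sum_wd,
    fderiv_eq_sum_wd, Finset.mul_sum, Finset.mul_sum, ← Finset.sum_add_distrib,
    ← Finset.sum_neg_distrib]
  refine Finset.sum_congr rfl fun k _ => ?_
  rw [← Finset.sum_mul]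
  simp only [Pi.smul_apply, smul_eq_mul, map_mul, Complex.conj_I]
  linear_combination (-2 * (starRingEnd ℂ) (v k)) * h1 k +
    (wd (-1) k (ζ ∘ (chartAt (CSpace m) c).symm) z * v k -
      wd 1 k (ζ ∘ (chartAt (CSpace m) c).symm) z * (starRingEnd ℂ) (v k)) * Complex.I_mul_I

omit [IsManifold 𝓘(ℂ, CSpace m) ω M] in
theorem contMDiff_of_ofReal (h : ContMDiff 𝓘(ℝ, CSpace m) 𝓘(ℝ, ℂ) ∞ fun x => (u x : ℂ)) :
    ContMDiff 𝓘(ℝ, CSpace m) 𝓘(ℝ, ℝ) ∞ u :=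
  (Complex.reCLM.contDiff.contMDiff (n := ∞)).comp h

theorem contDiffOn_real_comp_chart_symm (hu : ContMDiff 𝓘(ℝ, CSpace m) 𝓘(ℝ, ℝ) ∞ u) (c : M) :
    ContDiffOn ℝ ∞ (u ∘ (chartAt (CSpace m) c).symm) (chartAt (CSpace m) c).target := fun z hz => by
  have h := (contMDiffAt_iff_comp_chart_symm ((chartAt (CSpace m) c).map_target hz)).1
    (hu ((chartAt (CSpace m) c).symm z))
  rw [(chartAt (CSpace m) c).right_inv hz] at h
  exact h.contDiffWithinAt

/-- If `Ξ` has a real potential `u`, then `-JΞ` is the gradient of `u`. -/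
theorem KahlerForm.IsHamiltonian.form_coord (h : κ.IsHamiltonian Ξ fun x => (u x : ℂ))
    (hz : z ∈ (chartAt (CSpace m) c).target) (v : CSpace m) :
    κ.form.inChart c z ![coord ℂ c (vec ((-Complex.I) • Ξ)) z, v] =
      - fderiv ℝ (u ∘ (chartAt (CSpace m) c).symm) z (Complex.I • v) := by
  have hd : DifferentiableAt ℝ (u ∘ (chartAt (CSpace m) c).symm) z :=
    (contDiffOn_real_comp_chart_symm (contMDiff_of_ofReal h.1) c).differentiableAt_of_isOpen
      (chartAt (CSpace m) c).open_target hz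
  have h1 : ∀ v, fderiv ℝ ((fun x => (u x : ℂ)) ∘ (chartAt (CSpace m) c).symm) z v =
      (fderiv ℝ (u ∘ (chartAt (CSpace m) c).symm) z v : ℂ) := fun v =>
    congrArg (fun L => L v) (Complex.ofRealCLM.hasFDerivAt.comp z hd.hasFDerivAt).fderiv
  have h2 := h.contr_coord hz v
  have h3 : coord ℂ c (vec ((-Complex.I) • Ξ)) z = (-Complex.I) • coord ℂ c (vec Ξ) z :=
    map_smul (fderiv ℂ (inCharts (CSpace m) (CSpace m) (id : M → M) _ c) _) (-Complex.I) _
  have h4 := congrArg Complex.im h2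
  rw [contr, h1, h1] at h4
  simp at h4
  rw [h3, neg_smul, ← neg_one_smul ℝ, form2_smul_left]
  linarith

end RealPotential

/-! ### The form -du ∘ J and its exterior derivative. -/

section DC

variable {m : ℕ} {M : Type*} [TopologicalSpace M] [ChartedSpace (CSpace m) M]
  {c x : M} {z : CSpace m} {u : M → ℝ}

/-- The form `L` as an alternating map in one variable. -/
def oneForm (L : CSpace m →L[ℝ] ℝ) : CSpace m [⋀^Fin 1]→L[ℝ] ℝ :=
  ContinuousAlternatingMap.ofSubsingleton ℝ (CSpace m) ℝ (0 : Fin 1) L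

/-- The form `- du ∘ J`. -/
def dc (u : M → ℝ) : RealForm m M 1 := fun x =>
  oneForm (-((mfderiv 𝓘(ℝ, CSpace m) 𝓘(ℝ, ℝ) u x : CSpace m →L[ℝ] ℝ).comp
    ((Complex.I • ContinuousLinearMap.id ℂ (CSpace m)).restrictScalars ℝ)))

variable [IsManifold 𝓘(ℂ, CSpace m) ω M]

/-- Coordinate changes are holomorphic and commute with i, so the same formula holds in every chart.
-/
theorem dc_inChart (hu : ContMDiff 𝓘(ℝ, CSpace m) 𝓘(ℝ, ℝ) ∞ u)
    (hz : z ∈ (chartAt (CSpace m) c).target) (v : Fin 1 → CSpace m) :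
    (dc u).inChart c z v = - fderiv ℝ (u ∘ (chartAt (CSpace m) c).symm) z (Complex.I • v 0) := by
  set y := (chartAt (CSpace m) c).symm z with hy
  set τ := inCharts (CSpace m) (CSpace m) (id : M → M) c y with hτ
  have hτd : AnalyticAt ℂ τ z := analyticAt_inCharts contMDiff_id_complex hz (mem_chart_source _ _)
  have hτr := fderiv_inCharts_real (φ := (id : M → M)) (c' := y) contMDiff_id_complex hz
    (mem_chart_source _ _)
  have h1 := mfderiv_eq_fderiv_comp_chart_symm ((hu y).mdifferentiableAt (by simp))
  have h2 : u ∘ (chartAt (CSpace m) c).symm =ᶠ[𝓝 z] (u ∘ (chartAt (CSpace m) y).symm) ∘ τ := by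
    filter_upwards [(isOpen_overlap (c := c) (c' := y) (φ := (id : M → M)) continuous_id).mem_nhds
      ⟨hz, mem_chart_source _ _⟩] with w hw
    have := (chartAt (CSpace m) y).left_inv hw.2
    simp only [Function.comp, hτ, inCharts]
    exact congrArg u this.symm
  have hz' : τ z = chartAt (CSpace m) y y := rfl
  have h3 : DifferentiableAt ℝ (u ∘ (chartAt (CSpace m) y).symm) (τ z) :=
    (contDiffOn_real_comp_chart_symm hu y).differentiableAt_of_isOpen
      (chartAt (CSpace m) y).open_target (mem_chart_target _ _)
  have h4 : DifferentiableAt ℝ τ z := hτd.differentiableAt.restrictScalars ℝ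
  rw [(dc u).inChart_eq_apply hz, h2.fderiv_eq, fderiv_comp z h3 h4]
  have h5 : fderiv ℝ τ z (Complex.I • v 0) = Complex.I • fderiv ℝ τ z (v 0) := by
    rw [hτr]
    exact map_smul (fderiv ℂ τ z) Complex.I (v 0)
  rw [ContinuousLinearMap.comp_apply, h5]
  exact congrArg (fun L : CSpace m →L[ℝ] ℝ => - L (Complex.I • fderiv ℝ τ z (v 0))) h1

theorem isSmooth_dc (hu : ContMDiff 𝓘(ℝ, CSpace m) 𝓘(ℝ, ℝ) ∞ u) :
    RealForm.IsSmooth (m := m) (dc u) := by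
  intro c z hz
  refine (contDiffAt_form_of_apply fun v => ?_).contDiffWithinAt
  have h1 : ContDiffOn ℝ ∞ (fderiv ℝ (u ∘ (chartAt (CSpace m) c).symm)) (chartAt (CSpace m) c).target :=
    (contDiffOn_real_comp_chart_symm hu c).fderiv_of_isOpen (chartAt (CSpace m) c).open_target (by simp)
  have h2 : ContDiffAt ℝ ∞ (fun w => - fderiv ℝ (u ∘ (chartAt (CSpace m) c).symm) w (Complex.I • v 0)) z :=
    ((h1.contDiffAt ((chartAt (CSpace m) c).open_target.mem_nhds hz)).clm_apply contDiffAt_const).neg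
  refine h2.congr_of_eventuallyEq ?_
  filter_upwards [(chartAt (CSpace m) c).open_target.mem_nhds hz] with w hw
  exact dc_inChart hu hw v

theorem extDeriv_dc (hu : ContMDiff 𝓘(ℝ, CSpace m) 𝓘(ℝ, ℝ) ∞ u)
    (hz : z ∈ (chartAt (CSpace m) c).target) (v₁ v₂ : CSpace m) :
    extDeriv ((dc u).inChart c) z ![v₁, v₂] =
      - fderiv ℝ (fderiv ℝ (u ∘ (chartAt (CSpace m) c).symm)) z v₁ (Complex.I • v₂) +
        fderiv ℝ (fderiv ℝ (u ∘ (chartAt (CSpace m) c).symm)) z v₂ (Complex.I • v₁) := by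
  have hd : DifferentiableAt ℝ ((dc u).inChart c) z :=
    (isSmooth_dc hu c).differentiableAt_of_isOpen (chartAt (CSpace m) c).open_target hz
  have h := extDeriv_apply hd ![v₁, v₂]
  have h1 : ContDiffOn ℝ ∞ (fderiv ℝ (u ∘ (chartAt (CSpace m) c).symm)) (chartAt (CSpace m) c).target :=
    (contDiffOn_real_comp_chart_symm hu c).fderiv_of_isOpen (chartAt (CSpace m) c).open_target (by simp)
  have h2 : DifferentiableAt ℝ (fderiv ℝ (u ∘ (chartAt (CSpace m) c).symm)) z :=
    h1.differentiableAt_of_isOpen (chartAt (CSpace m) c).open_target hz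
  have h3 : ∀ (v : Fin 1 → CSpace m) (w : CSpace m), fderiv ℝ (fun y => (dc u).inChart c y v) z w =
      - fderiv ℝ (fderiv ℝ (u ∘ (chartAt (CSpace m) c).symm)) z w (Complex.I • v 0) := by
    intro v w
    have h4 := (h2.hasFDerivAt.clm_apply (hasFDerivAt_const (Complex.I • v 0) z)).neg
    have h5 : (fun y => (dc u).inChart c y v) =ᶠ[𝓝 z] fun y =>
        - fderiv ℝ (u ∘ (chartAt (CSpace m) c).symm) y (Complex.I • v 0) := by
      filter_upwards [(chartAt (CSpace m) c).open_target.mem_nhds hz] with w hw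
      exact dc_inChart hu hw v
    rw [h5.fderiv_eq]
    refine (congrArg (fun L => L w) h4.fderiv).trans ?_
    simp
  rw [h, Fin.sum_univ_two, h3, h3]
  have e0 : (0 : Fin 2).removeNth ![v₁, v₂] 0 = v₂ := rfl
  have e1 : (1 : Fin 2).removeNth ![v₁, v₂] 0 = v₁ := rfl
  rw [e0, e1]
  simp

end DC

end KahlerBlowup

end

noncomputable section

namespace KahlerBlowup

open Topology MeasureTheory

/-! ### The gradient flow preserves the Kähler class. -/

section FlowClass

variable {m : ℕ} {M : Type*} [TopologicalSpace M] [ChartedSpace (CSpace m) M]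
  [IsManifold 𝓘(ℂ, CSpace m) ω M] [T2Space M] [CompactSpace M] {Ξ : HolVectorField m M}
  {κ : KahlerForm m M} {c x : M} {z : CSpace m} {u : M → ℝ}

/-- The Lie derivative of the Kähler form along the gradient flow of a real potential. -/
theorem KahlerForm.IsHamiltonian.hasDerivAt_pullback_flow (h : κ.IsHamiltonian Ξ fun x => (u x : ℂ))
    (hz : z ∈ (chartAt (CSpace m) c).target) (v₁ v₂ : CSpace m) (s₀ : ℝ) :
    HasDerivAt (fun s => (RealForm.pullback (flow ((-Complex.I) • Ξ) s) κ.form).inChart c z ![v₁, v₂])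
      (- fderiv ℝ (fderiv ℝ fun w => u (flow ((-Complex.I) • Ξ) s₀ ((chartAt (CSpace m) c).symm w))) z
          v₁ (Complex.I • v₂) +
        fderiv ℝ (fderiv ℝ fun w => u (flow ((-Complex.I) • Ξ) s₀ ((chartAt (CSpace m) c).symm w))) z
          v₂ (Complex.I • v₁)) s₀ := by
  set X := (-Complex.I) • Ξ with hX
  set c' := flow X s₀ ((chartAt (CSpace m) c).symm z) with hc'
  -- The target chart is the preferred one at the end point for time s₀ and stays fixed while time
  -- varies near s₀.
  set S : ℝ × CSpace m → CSpace m := fun p => inCharts (CSpace m) (CSpace m) (flow X p.1) c c' p.2 with hS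
  have hu := contMDiff_of_ofReal h.1
  have hmem : flow X s₀ ((chartAt (CSpace m) c).symm z) ∈ (chartAt (CSpace m) c').source :=
    mem_chart_source _ _
  have hSmem : S (s₀, z) ∈ (chartAt (CSpace m) c').target := (chartAt (CSpace m) c').map_source hmem
  have ho' := (chartAt (CSpace m) c').open_target
  have hcont : ContinuousAt (fun p : ℝ × CSpace m => flow X p.1 ((chartAt (CSpace m) c).symm p.2)) (s₀, z) := by
    have h1 : ContinuousAt (fun p : ℝ × CSpace m => (p.1, (chartAt (CSpace m) c).symm p.2)) (s₀, z) :=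
      continuousAt_fst.prodMk (ContinuousAt.comp (x := (s₀, z))
        ((chartAt (CSpace m) c).continuousAt_symm hz) continuousAt_snd)
    exact ContinuousAt.comp (x := (s₀, z)) (contMDiff_flow X).continuous.continuousAt h1
  have hev : ∀ᶠ p in 𝓝 (s₀, z), p.2 ∈ (chartAt (CSpace m) c).target ∧
      flow X p.1 ((chartAt (CSpace m) c).symm p.2) ∈ (chartAt (CSpace m) c').source :=
    (continuousAt_snd.eventually ((chartAt (CSpace m) c).open_target.mem_nhds hz)).and
      (hcont.eventually ((chartAt (CSpace m) c').open_source.mem_nhds hmem))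
  have hSd : ∀ p : ℝ × CSpace m, p.2 ∈ (chartAt (CSpace m) c).target →
      flow X p.1 ((chartAt (CSpace m) c).symm p.2) ∈ (chartAt (CSpace m) c').source →
      ContDiffAt ℝ ∞ S p := fun p h1 h2 => contDiffAt_inCharts_flow h1 h2
  have hpart : ∀ p : ℝ × CSpace m, p.2 ∈ (chartAt (CSpace m) c).target →
      flow X p.1 ((chartAt (CSpace m) c).symm p.2) ∈ (chartAt (CSpace m) c').source → ∀ v,
      fderiv ℝ S p (0, v) = fderiv ℝ (inCharts (CSpace m) (CSpace m) (flow X p.1) c c') p.2 v :=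
    fun p h1 h2 v => (congrArg (fun L => L v) (fderiv_partial_right (f := S) (s := p.1) (z := p.2)
      ((hSd p h1 h2).differentiableAt (by simp))).fderiv).symm
  have key := KahlerBlowup.hasDerivAt_pullback_flow (S := S) (β := κ.form.inChart c')
    (X := coord ℂ c' (vec X)) (u := u ∘ (chartAt (CSpace m) c').symm) (s₀ := s₀) (z := z)
    ((hSd _ hz hmem).of_le (WithTop.coe_le_coe.2 (le_top : (2 : ℕ∞) ≤ ⊤)))
    ((κ.smooth c').differentiableAt_of_isOpen ho' hSmem) (κ.extDeriv_inChart hSmem)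
    (((X.contDiffOn_coord c').differentiableOn (by simp)).differentiableAt
      (ho'.mem_nhds hSmem) |>.restrictScalars ℝ)
    (((contDiffOn_real_comp_chart_symm hu c').contDiffAt (ho'.mem_nhds hSmem)).of_le
      (WithTop.coe_le_coe.2 (le_top : (2 : ℕ∞) ≤ ⊤)))
    (by
      filter_upwards [ho'.mem_nhds hSmem] with w hw v
      exact h.form_coord hw v)
    (by
      filter_upwards [hev] with p hp
      exact (isMIntegralCurve_flow X _).hasDerivAt_chart (r := p.1) (c := c') hp.2)
    (by
      filter_upwards [hev] with p hp v
      rw [hpart p hp.1 hp.2, hpart p hp.1 hp.2, fderiv_inCharts_real (contMDiff_flow_complex X p.1) hp.1 hp.2]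
      exact map_smul (fderiv ℂ (inCharts (CSpace m) (CSpace m) (flow X p.1) c c') p.2) _ _) v₁ v₂
  have hfun : (fun w => (u ∘ (chartAt (CSpace m) c').symm) (S (s₀, w))) =ᶠ[𝓝 z]
      fun w => u (flow X s₀ ((chartAt (CSpace m) c).symm w)) := by
    have hc : ContinuousAt (fun w : CSpace m => (s₀, w)) z := by fun_prop
    filter_upwards [hc.eventually hev] with w hw
    exact congrArg u ((chartAt (CSpace m) c').left_inv hw.2)
  rw [hfun.fderiv.fderiv_eq] at key
  refine key.congr_of_eventuallyEq ?_
  have hc : ContinuousAt (fun s : ℝ => (s, z)) s₀ := by fun_prop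
  filter_upwards [hc.eventually hev] with s hs
  rw [κ.form.inChart_pullback ((contMDiff_real (contMDiff_flow_complex X s) _).of_le (by simp)) hz hs.2,
    form2_comp, hpart (s, z) hs.1 hs.2, hpart (s, z) hs.1 hs.2]

/-- The average of the potential along the flow. -/
def flowAverage (X : HolVectorField m M) (u : M → ℝ) (x : M) : ℝ := ∫ s in (0 : ℝ)..1, u (flow X s x)

theorem contMDiff_flowAverage (X : HolVectorField m M) (hu : ContMDiff 𝓘(ℝ, CSpace m) 𝓘(ℝ, ℝ) ∞ u) :
    ContMDiff 𝓘(ℝ, CSpace m) 𝓘(ℝ, ℝ) ∞ (flowAverage X u) := by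
  intro x
  refine (contMDiffAt_iff_comp_chart_symm (mem_chart_source (CSpace m) x)).2 ?_
  have h := contDiffOn_intervalIntegral (chartAt (CSpace m) x).open_target (contDiffOn_comp_flow X hu x)
  exact h.contDiffAt ((chartAt (CSpace m) x).open_target.mem_nhds (mem_chart_target _ _))

/-- Differentiation under the integral sign, twice. The continuity in s is what makes the Lie
derivative integrable in the fundamental theorem of calculus. -/
theorem fderiv_fderiv_flowAverage (X : HolVectorField m M)
    (hu : ContMDiff 𝓘(ℝ, CSpace m) 𝓘(ℝ, ℝ) ∞ u) (hz : z ∈ (chartAt (CSpace m) c).target)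
    (v w : CSpace m) :
    Continuous (fun s => fderiv ℝ (fderiv ℝ fun y => u (flow X s ((chartAt (CSpace m) c).symm y))) z v w) ∧
    fderiv ℝ (fderiv ℝ (flowAverage X u ∘ (chartAt (CSpace m) c).symm)) z v w =
      ∫ s in (0 : ℝ)..1, fderiv ℝ (fderiv ℝ fun y => u (flow X s ((chartAt (CSpace m) c).symm y))) z v w := by
  have ho := (chartAt (CSpace m) c).open_target
  have hf := contDiffOn_comp_flow X hu c
  set f := fun p : ℝ × CSpace m => u (flow X p.1 ((chartAt (CSpace m) c).symm p.2)) with hfd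
  have hf1 := ContDiffOn.partialRight ho hf
  have hf2 := ContDiffOn.partialRight ho hf1
  have e1 : fderiv ℝ (flowAverage X u ∘ (chartAt (CSpace m) c).symm) =ᶠ[𝓝 z]
      fun y => ∫ s in (0 : ℝ)..1, partialRight f (s, y) := by
    filter_upwards [ho.mem_nhds hz] with y hy
    exact (hasFDerivAt_intervalIntegral ho hf hy).fderiv
  have e2 := (hasFDerivAt_intervalIntegral ho hf1 hz).fderiv
  have hc : Continuous fun s => partialRight (partialRight f) (s, z) :=
    hf2.continuousOn.comp_continuous (by fun_prop) fun s => ⟨Set.mem_univ _, hz⟩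
  refine ⟨(hc.clm_apply continuous_const).clm_apply continuous_const, ?_⟩
  rw [e1.fderiv_eq, e2, ContinuousLinearMap.intervalIntegral_apply (hc.intervalIntegrable _ _),
    ContinuousLinearMap.intervalIntegral_apply ((hc.clm_apply continuous_const).intervalIntegrable _ _)]
  rfl

/-- The gradient flow of a real potential preserves the Kähler class. -/
theorem KahlerForm.IsHamiltonian.sameClass_pullback_flow (h : κ.IsHamiltonian Ξ fun x => (u x : ℂ)) :
    (κ.pullback (flow ((-Complex.I) • Ξ) 1) (flow ((-Complex.I) • Ξ) (-1))
      (contMDiff_flow_complex _ _) (contMDiff_flow_complex _ _)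
      (fun x => flow_neg_flow _ _ x)).SameClass κ := by
  set X := (-Complex.I) • Ξ with hX
  have hu := contMDiff_of_ofReal h.1
  -- The s-derivative of the pulled back form is d of -d(u ∘ φ_s) ∘ J; integrating over [0, 1] makes
  -- the averaged potential the primitive of the difference.
  refine ⟨dc (flowAverage X u), isSmooth_dc (contMDiff_flowAverage X hu), fun c z hz => ?_⟩
  ext v
  have hv : v = ![v 0, v 1] := by
    funext i
    fin_cases i <;> rfl
  rw [hv, extDeriv_dc (contMDiff_flowAverage X hu) hz]
  obtain ⟨hc1, e1⟩ := fderiv_fderiv_flowAverage X hu hz (v 0) (Complex.I • v 1)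
  obtain ⟨hc2, e2⟩ := fderiv_fderiv_flowAverage X hu hz (v 1) (Complex.I • v 0)
  rw [e1, e2, ← intervalIntegral.integral_neg, ← intervalIntegral.integral_add
    (hc1.fun_neg.intervalIntegrable _ _) (hc2.intervalIntegrable _ _),
    intervalIntegral.integral_eq_sub_of_hasDerivAt
      (fun s _ => h.hasDerivAt_pullback_flow hz (v 0) (v 1) s)
      ((hc1.fun_neg.add hc2).intervalIntegrable _ _)]
  have h0 : flow X 0 = id := funext fun x => flow_zero X x
  rw [← hX, h0, RealForm.pullback_id]
  rfl

omit [IsManifold 𝓘(ℂ, CSpace m) ω M] [T2Space M] [CompactSpace M] in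
theorem KahlerForm.SameClass.trans {κ₁ κ₂ κ₃ : KahlerForm m M} (h : κ₁.SameClass κ₂)
    (h' : κ₂.SameClass κ₃) : κ₁.SameClass κ₃ := by
  obtain ⟨η, hη, hd⟩ := h
  obtain ⟨η', hη', hd'⟩ := h'
  have e : ∀ c, RealForm.inChart (η + η') c = η.inChart c + η'.inChart c := fun c => rfl
  refine ⟨η + η', fun c => ?_, fun c z hz => ?_⟩
  · rw [e]
    exact (hη c).add (hη' c)
  · have ho := (chartAt (CSpace m) c).open_target
    rw [e, extDeriv_add ((hη c).differentiableAt_of_isOpen ho hz)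
      ((hη' c).differentiableAt_of_isOpen ho hz), hd c z hz, hd' c z hz]
    ext v
    exact sub_add_sub_cancel _ _ _

end FlowClass

end KahlerBlowup

end

noncomputable section

namespace KahlerBlowup

open Topology MeasureTheory

/-! ### Transport of the three conditions by an automorphism. -/

section AdmissiblePullback

variable {m n : ℕ} {M : Type*} [TopologicalSpace M] [ChartedSpace (CSpace m) M]
  [IsManifold 𝓘(ℂ, CSpace m) ω M] {κ κ' : KahlerForm m M} {φ ψ : M → M}

/-- A biholomorphic isometry identifies the Hamiltonian vector fields. -/
def hamEquiv (hφ : ContMDiff 𝓘(ℂ, CSpace m) 𝓘(ℂ, CSpace m) ω φ)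
    (hψ : ContMDiff 𝓘(ℂ, CSpace m) 𝓘(ℂ, CSpace m) ω ψ) (hψφ : Function.LeftInverse ψ φ)
    (hφψ : Function.RightInverse ψ φ) (h : κ'.form = RealForm.pullback φ κ.form) :
    κ'.ham ≃ₗ[ℂ] κ.ham where
  toFun Ξ := ⟨pushField φ ψ hφ hψ hψφ hφψ Ξ.1, by
    obtain ⟨ζ, hζ⟩ := Ξ.2
    refine ⟨ζ ∘ ψ, (isHamiltonian_pushField hφ hψ hψφ hφψ h _ _).2 ?_⟩
    rwa [Function.comp_assoc, hψφ.comp_eq_id, Function.comp_id]⟩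
  map_add' Ξ Ξ' := Subtype.ext (map_add (pushField φ ψ hφ hψ hψφ hφψ) _ _)
  map_smul' a Ξ := Subtype.ext (map_smul (pushField φ ψ hφ hψ hψφ hφψ) _ _)
  invFun Ξ := ⟨pushField ψ φ hψ hφ hφψ hψφ Ξ.1, by
    obtain ⟨ζ, hζ⟩ := Ξ.2
    refine ⟨ζ ∘ φ, (isHamiltonian_pushField hφ hψ hψφ hφψ h _ _).1 ?_⟩
    rwa [pushField_pushField]⟩
  left_inv Ξ := Subtype.ext (pushField_pushField hψ hφ hφψ hψφ _)
  right_inv Ξ := Subtype.ext (pushField_pushField hφ hψ hψφ hφψ _)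

variable [CompactSpace M] [Nonempty M] [MeasurableSpace M] [BorelSpace M]

/-- The moment map of κ' at x is ξ(φ x) composed with the identification of Hamiltonian fields; its
mean is zero because φ carries one volume to the other. The conditions at p then follow from those
at φ(p) through this linear isomorphism. -/
theorem admissible_pullback (hφ : ContMDiff 𝓘(ℂ, CSpace m) 𝓘(ℂ, CSpace m) ω φ)
    (hψ : ContMDiff 𝓘(ℂ, CSpace m) 𝓘(ℂ, CSpace m) ω ψ) (hψφ : Function.LeftInverse ψ φ)
    (hφψ : Function.RightInverse ψ φ) (h : κ'.form = RealForm.pullback φ κ.form)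
    {ξ : M → Module.Dual ℂ κ.ham} (hξ : κ.IsMomentMap ξ) {p : Fin n → M} {a : Fin n → ℝ}
    (hg : κ.Generic ξ fun j => φ (p j)) (hb : κ.Balanced ξ (fun j => φ (p j)) a)
    (hp : κ.GeneralPosition fun j => φ (p j)) : κ'.Admissible p a := by
  set e := hamEquiv hφ hψ hψφ hφψ h with he
  have hξ' : ∀ Ξ : κ'.ham, κ'.IsHamiltonian Ξ (fun x => ξ (φ x) (e Ξ)) := fun Ξ =>
    (isHamiltonian_pushField hφ hψ hψφ hφψ h _ _).1 (hξ (e Ξ)).1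
  refine ⟨fun x => e.dualMap (ξ (φ x)), fun Ξ => ⟨hξ' Ξ, ?_⟩, ?_, ?_, ?_⟩
  · have h1 := (hξ (e Ξ)).2
    rw [← map_vol hφ hψ.continuous hψφ hφψ h, integral_map hφ.continuous.aemeasurable
      (hξ (e Ξ)).1.1.continuous.aestronglyMeasurable] at h1
    exact h1
  · have h1 : (Set.range fun j => e.dualMap (ξ (φ (p j)))) =
        e.dualMap.toLinearMap '' Set.range fun j => ξ (φ (p j)) := by
      rw [← Set.range_comp]
      rfl
    have h2 : Submodule.span ℂ (Set.range fun j => ξ (φ (p j))) = ⊤ := hg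
    rw [KahlerForm.Generic, h1, Submodule.span_image, h2, Submodule.map_top]
    exact LinearMap.range_eq_top.2 e.dualMap.surjective
  · have h1 := congrArg e.dualMap hb
    rw [map_sum, map_zero] at h1
    simp only [map_smul] at h1
    exact h1
  · intro Ξ hΞ h0
    have h1 : e ⟨Ξ, hΞ⟩ = 0 := by
      refine Subtype.ext (hp _ (e ⟨Ξ, hΞ⟩).2 fun j => ?_)
      have h2 : vec Ξ (ψ (φ (p j))) = 0 := by
        rw [hψφ]
        exact h0 j
      exact (congrArg (cderiv φ (ψ (φ (p j)))) h2).trans (map_zero _)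
    exact congrArg Subtype.val ((map_eq_zero_iff e e.injective).1 h1)

end AdmissiblePullback

/-! ### Openness of genericity and general position. -/

section OpenConditions

variable {m n d : ℕ} {M : Type*} [TopologicalSpace M] [ChartedSpace (CSpace m) M]
  [IsManifold 𝓘(ℂ, CSpace m) ω M] {κ : KahlerForm m M}

/-- The covectors ξ(p_j) span the dual exactly when no nonzero field is annihilated by all of them.
In a basis this is linear independence of vectors depending continuously on p, an open condition. -/
theorem generic_iff_linearIndependent [Module.Finite ℂ κ.ham] {ξ : M → Module.Dual ℂ κ.ham}
    {Z : Fin d → κ.ham} (hs : Submodule.span ℂ (Set.range Z) = ⊤) (hl : LinearIndependent ℂ Z)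
    (p : Fin n → M) :
    κ.Generic ξ p ↔ LinearIndependent ℂ (fun k => fun j => ξ (p j) (Z k)) := by
  set W := Submodule.span ℂ (Set.range fun j => ξ (p j)) with hW
  have hco : W = ⊤ ↔ W.dualCoannihilator = ⊥ := by
    constructor
    · intro h
      rw [h]
      exact Submodule.dualCoannihilator_top ..
    · intro h
      rw [← Subspace.dualCoannihilator_dualAnnihilator_eq (W := W), h, Submodule.dualAnnihilator_bot]
  have hmem : ∀ Ξ, Ξ ∈ W.dualCoannihilator ↔ ∀ j, ξ (p j) Ξ = 0 := by
    intro Ξ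
    rw [Submodule.mem_dualCoannihilator]
    refine ⟨fun h j => h _ (Submodule.subset_span ⟨j, rfl⟩), fun h f hf => ?_⟩
    have : W ≤ LinearMap.ker (Module.Dual.eval ℂ κ.ham Ξ) :=
      Submodule.span_le.2 (by rintro _ ⟨j, rfl⟩; exact h j)
    exact this hf
  have hsum : ∀ (g : Fin d → ℂ) j, (∑ k, g k • fun j => ξ (p j) (Z k)) j = ξ (p j) (∑ k, g k • Z k) := by
    intro g j
    simp [Finset.sum_apply]
  rw [KahlerForm.Generic, ← hW, hco, Fintype.linearIndependent_iff, Submodule.eq_bot_iff]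
  constructor
  · intro h g hg
    refine Fintype.linearIndependent_iff.1 hl g (h _ ((hmem _).2 fun j => ?_))
    rw [← hsum, hg]
    rfl
  · intro h Ξ hΞ
    obtain ⟨g, rfl⟩ := (Submodule.mem_span_range_iff_exists_fun ℂ).1 (hs ▸ Submodule.mem_top : Ξ ∈ Submodule.span ℂ (Set.range Z))
    have h1 := h g (funext fun j => by rw [hsum]; exact (hmem _).1 hΞ j)
    simp [h1]

theorem coord_eq_zero_iff {c x : M} (v : M → CSpace m) (hx : x ∈ (chartAt (CSpace m) c).source) :
    coord ℂ c v (chartAt (CSpace m) c x) = 0 ↔ v x = 0 := by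
  have h1 : coord ℂ c v (chartAt (CSpace m) c x) =
      fderiv ℂ (inCharts (CSpace m) (CSpace m) (id : M → M) x c) (chartAt (CSpace m) x x) (v x) := by
    rw [coord, (chartAt (CSpace m) c).left_inv hx]
  rw [h1]
  constructor
  · intro h
    by_contra hv
    exact fderiv_inCharts_ne_zero (φ := (id : M → M)) contMDiff_id_complex contMDiff_id_complex
      (fun _ => rfl) (mem_chart_target _ x) (by simpa using hx) hv h
  · intro h
    rw [h, map_zero]

/-- Vanishing at a point can be tested in any chart. The charts c j are independent of p so that,
with them fixed, the coordinate vectors are continuous in p. -/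
theorem generalPosition_iff_linearIndependent {Z : Fin d → κ.ham}
    (hs : Submodule.span ℂ (Set.range Z) = ⊤) (hl : LinearIndependent ℂ Z) {p c : Fin n → M}
    (hp : ∀ j, p j ∈ (chartAt (CSpace m) (c j)).source) :
    κ.GeneralPosition p ↔ LinearIndependent ℂ (fun k => fun j =>
      coord ℂ (c j) (vec (Z k).1) (chartAt (CSpace m) (c j) (p j))) := by
  have hsum : ∀ (g : Fin d → ℂ) j, (∑ k, g k • fun j =>
      coord ℂ (c j) (vec (Z k).1) (chartAt (CSpace m) (c j) (p j))) j =
      coord ℂ (c j) (vec (∑ k, g k • Z k : κ.ham).1) (chartAt (CSpace m) (c j) (p j)) := by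
    intro g j
    have e : ((∑ k, g k • Z k : κ.ham) : HolVectorField m M) = ∑ k, g k • (Z k).1 := by
      simp
    rw [e, coord_sum_smul, Finset.sum_apply]
    rfl
  rw [Fintype.linearIndependent_iff]
  constructor
  · intro h g hg
    refine Fintype.linearIndependent_iff.1 hl g (Subtype.ext (h _ (∑ k, g k • Z k : κ.ham).2 fun j => ?_))
    refine (coord_eq_zero_iff (vec (∑ k, g k • Z k : κ.ham).1) (hp j)).1 ?_
    rw [← hsum, hg]
    rfl
  · intro h Ξ hΞ h0
    obtain ⟨g, hg⟩ := (Submodule.mem_span_range_iff_exists_fun ℂ).1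
      (hs ▸ Submodule.mem_top : (⟨Ξ, hΞ⟩ : κ.ham) ∈ Submodule.span ℂ (Set.range Z))
    have h1 := h g (funext fun j => by
      rw [hsum, hg]
      exact (coord_eq_zero_iff (vec Ξ) (hp j)).2 (h0 j))
    have h2 : (⟨Ξ, hΞ⟩ : κ.ham) = 0 := by
      rw [← hg]
      simp [h1]
    exact congrArg Subtype.val h2

theorem eventually_generic [Module.Finite ℂ κ.ham] {ξ : M → Module.Dual ℂ κ.ham}
    (hξ : ∀ Ξ, Continuous fun x => ξ x Ξ) {Z : Fin d → κ.ham}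
    (hs : Submodule.span ℂ (Set.range Z) = ⊤) (hl : LinearIndependent ℂ Z)
    {p₀ : Fin n → M} (h : κ.Generic ξ p₀) : ∀ᶠ p in 𝓝 p₀, κ.Generic ξ p := by
  have hc : Continuous fun p : Fin n → M => fun k => fun j => ξ (p j) (Z k) :=
    continuous_pi fun k => continuous_pi fun j => (hξ (Z k)).comp (continuous_apply j)
  have h1 := (generic_iff_linearIndependent hs hl p₀).1 h
  filter_upwards [hc.continuousAt.eventually (isOpen_setOfPred_linearIndependent.mem_nhds h1)] with p hp
  exact (generic_iff_linearIndependent hs hl p).2 hp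

theorem eventually_generalPosition {Z : Fin d → κ.ham}
    (hs : Submodule.span ℂ (Set.range Z) = ⊤) (hl : LinearIndependent ℂ Z)
    {p₀ : Fin n → M} (h : κ.GeneralPosition p₀) : ∀ᶠ p in 𝓝 p₀, κ.GeneralPosition p := by
  have hsrc : ∀ᶠ p in 𝓝 p₀, ∀ j, p j ∈ (chartAt (CSpace m) (p₀ j)).source :=
    Filter.eventually_all.2 fun j => (continuous_apply j).continuousAt.eventually
      ((chartAt (CSpace m) (p₀ j)).open_source.mem_nhds (mem_chart_source _ _))
  have hc : ContinuousAt (fun p : Fin n → M => fun k => fun j =>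
      coord ℂ (p₀ j) (vec (Z k).1) (chartAt (CSpace m) (p₀ j) (p j))) p₀ := by
    refine continuousAt_pi.2 fun k => continuousAt_pi.2 fun j => ?_
    have h1 : ContinuousAt (coord ℂ (p₀ j) (vec (Z k).1)) (chartAt (CSpace m) (p₀ j) (p₀ j)) :=
      (HolVectorField.contDiffOn_coord (Z k).1 (p₀ j)).continuousOn.continuousAt
        ((chartAt (CSpace m) (p₀ j)).open_target.mem_nhds (mem_chart_target _ _))
    have h2 : ContinuousAt (fun x => coord ℂ (p₀ j) (vec (Z k).1) (chartAt (CSpace m) (p₀ j) x)) (p₀ j) :=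
      ContinuousAt.comp h1 ((chartAt (CSpace m) (p₀ j)).continuousAt (mem_chart_source _ _))
    exact ContinuousAt.comp (x := p₀) (f := fun p : Fin n → M => p j) h2 (continuous_apply j).continuousAt
  have h1 := (generalPosition_iff_linearIndependent hs hl fun j => mem_chart_source (CSpace m) (p₀ j)).1 h
  filter_upwards [hc.eventually (isOpen_setOfPred_linearIndependent.mem_nhds h1), hsrc] with p hp hp'
  exact (generalPosition_iff_linearIndependent hs hl hp').2 hp

end OpenConditions

end KahlerBlowup

end

noncomputable section

namespace KahlerBlowup

open Topology MeasureTheory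

/-! ### A finite-dimensional form of the implicit function theorem. -/

section ImplicitFunction

/-- The unknown and the equations live in the same finite-dimensional space, so an injective partial
derivative is already invertible. -/
theorem exists_implicit_zero {E F : Type*} [NormedAddCommGroup E] [NormedSpace ℝ E] [CompleteSpace E]
    [NormedAddCommGroup F] [NormedSpace ℝ F] [FiniteDimensional ℝ F] {f : E × F → F} {e₀ : E}
    (hf : ContDiffAt ℝ 1 f (e₀, 0)) (h0 : f (e₀, 0) = 0)
    (hinj : ∀ t, fderiv ℝ f (e₀, 0) (0, t) = 0 → t = 0) :
    ∃ ψ : E → F, Filter.Tendsto ψ (𝓝 e₀) (𝓝 0) ∧ ∀ᶠ e in 𝓝 e₀, f (e, ψ e) = 0 := by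
  have : CompleteSpace F := FiniteDimensional.complete ℝ F
  have hs := hf.hasStrictFDerivAt one_ne_zero
  set A := fderiv ℝ f (e₀, 0) ∘L ContinuousLinearMap.inr ℝ E F with hA
  have hAinj : Function.Injective A.toLinearMap :=
    (injective_iff_map_eq_zero _).2 fun t ht => hinj t ht
  have hinv : A.IsInvertible :=
    ⟨(LinearEquiv.ofInjectiveEndo A.toLinearMap hAinj).toContinuousLinearEquiv, by ext t; rfl⟩
  refine ⟨hs.implicitFunctionOfProdDomain hinv, hs.tendsto_implicitFunctionOfProdDomain hinv, ?_⟩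
  filter_upwards [hs.eventually_apply_implicitFunctionOfProdDomain hinv] with e he
  rw [he, h0]

end ImplicitFunction

/-! ### Real combinations of the basis and their gradient flows. -/

section GradientFlow

variable {m n d : ℕ} {M : Type*} [TopologicalSpace M] [ChartedSpace (CSpace m) M]
  [IsManifold 𝓘(ℂ, CSpace m) ω M] {κ : KahlerForm m M} {Ξ : HolVectorField m M} {u : M → ℝ}

/-- Along its gradient X the potential grows at the rate g(X, X) = ω(X, JX), which is positive where
X is nonzero. -/
theorem KahlerForm.IsHamiltonian.hasDerivAt_comp_flow [T2Space M] [CompactSpace M]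
    (h : κ.IsHamiltonian Ξ fun x => (u x : ℂ)) (x : M) :
    HasDerivAt (fun s => u (flow ((-Complex.I) • Ξ) s x))
      (κ.form.inChart x (chartAt (CSpace m) x x)
        ![coord ℂ x (vec ((-Complex.I) • Ξ)) (chartAt (CSpace m) x x),
          Complex.I • coord ℂ x (vec ((-Complex.I) • Ξ)) (chartAt (CSpace m) x x)]) 0 := by
  set X := (-Complex.I) • Ξ with hX
  have hx := mem_chart_target (CSpace m) x
  have h0 : flow X 0 x = x := flow_zero X x
  have hd : DifferentiableAt ℝ (u ∘ (chartAt (CSpace m) x).symm) (chartAt (CSpace m) x (flow X 0 x)) := by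
    rw [h0]
    exact (contDiffOn_real_comp_chart_symm (contMDiff_of_ofReal h.1) x).differentiableAt_of_isOpen
      (chartAt (CSpace m) x).open_target hx
  have hsrc : flow X 0 x ∈ (chartAt (CSpace m) x).source := by
    rw [h0]
    exact mem_chart_source _ _
  have h1 := (isMIntegralCurve_flow X x).hasDerivAt_chart (c := x) (r := 0) hsrc
  have h2 := HasFDerivAt.comp_hasDerivAt (0 : ℝ) (l := u ∘ (chartAt (CSpace m) x).symm) hd.hasFDerivAt h1
  have h3 : (fun s => u (flow X s x)) =ᶠ[𝓝 0]
      fun s => (u ∘ (chartAt (CSpace m) x).symm) (chartAt (CSpace m) x (flow X s x)) := by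
    have hc : ContinuousAt (fun s => flow X s x) 0 :=
      ((contMDiff_flow X).continuous.comp (by fun_prop : Continuous fun s : ℝ => (s, x))).continuousAt
    filter_upwards [hc.eventually ((chartAt (CSpace m) x).open_source.mem_nhds hsrc)] with s hs
    exact congrArg u ((chartAt (CSpace m) x).left_inv hs).symm
  refine (h2.congr_of_eventuallyEq h3).congr_deriv ?_
  rw [h0, h.form_coord hx, smul_smul, Complex.I_mul_I, neg_one_smul, map_neg, neg_neg]

/-- A real combination of Hamiltonian vector fields. -/
def realComb (Z : Fin d → κ.ham) (t : Fin d → ℝ) : κ.ham := ∑ k, (t k : ℂ) • Z k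

theorem combine_eq_realComb (Z : Fin d → κ.ham) (t : Fin d → ℝ) :
    combine (fun k => (-Complex.I) • (Z k).1) t = (-Complex.I) • (realComb Z t).1 := by
  have e : (realComb Z t).1 = ∑ k, (t k : ℂ) • (Z k).1 := by
    simp [realComb]
  rw [combine, e, Finset.smul_sum]
  exact Finset.sum_congr rfl fun k _ => smul_comm _ _ _

theorem combine_smul (X : Fin d → HolVectorField m M) (r : ℝ) (t : Fin d → ℝ) :
    combine X (r • t) = (r : ℂ) • combine X t := by
  rw [combine, combine, Finset.smul_sum]
  refine Finset.sum_congr rfl fun k _ => ?_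
  rw [smul_smul, Pi.smul_apply, smul_eq_mul, Complex.ofReal_mul]

theorem eq_zero_of_realComb_eq_zero {Z : Fin d → κ.ham} (hl : LinearIndependent ℂ Z) {t : Fin d → ℝ}
    (h : realComb Z t = 0) : t = 0 :=
  funext fun k => Complex.ofReal_eq_zero.1 (Fintype.linearIndependent_iff.1 hl _ h k)

theorem re_apply_realComb {ξ : M → Module.Dual ℂ κ.ham} (Z : Fin d → κ.ham) (t : Fin d → ℝ) (x : M) :
    (ξ x (realComb Z t)).re = ∑ k, t k * (ξ x (Z k)).re := by
  simp [realComb]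

theorem ofReal_re_apply_realComb {ξ : M → Module.Dual ℂ κ.ham} {Z : Fin d → κ.ham}
    (hZ : ∀ k x, (starRingEnd ℂ) (ξ x (Z k)) = ξ x (Z k)) (t : Fin d → ℝ) (x : M) :
    ((ξ x (realComb Z t)).re : ℂ) = ξ x (realComb Z t) := by
  refine Complex.conj_eq_iff_re.1 ?_
  simp [realComb, hZ]

theorem isHamiltonian_realComb [MeasurableSpace M] {ξ : M → Module.Dual ℂ κ.ham}
    (hξ : κ.IsMomentMap ξ) {Z : Fin d → κ.ham}
    (hZ : ∀ k x, (starRingEnd ℂ) (ξ x (Z k)) = ξ x (Z k)) (t : Fin d → ℝ) :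
    κ.IsHamiltonian (realComb Z t) fun x => (((ξ x (realComb Z t)).re : ℝ) : ℂ) := by
  have h := (hξ (realComb Z t)).1
  rwa [← funext (ofReal_re_apply_realComb hZ t)] at h

/-- Evaluated on a basis with real potentials the complex equation has real components, so there are
as many real equations as real flow parameters. -/
theorem balanced_iff_real {ξ : M → Module.Dual ℂ κ.ham} {Z : Fin d → κ.ham}
    (hZ : ∀ k x, (starRingEnd ℂ) (ξ x (Z k)) = ξ x (Z k))
    (hs : Submodule.span ℂ (Set.range Z) = ⊤) (p : Fin n → M) (a : Fin n → ℝ) :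
    κ.Balanced ξ p a ↔ ∀ k, ∑ j, a j ^ (m - 1) * (ξ (p j) (Z k)).re = 0 := by
  have h1 : ∀ k, (∑ j, ((a j ^ (m - 1) : ℝ) : ℂ) • ξ (p j)) (Z k) =
      ((∑ j, a j ^ (m - 1) * (ξ (p j) (Z k)).re : ℝ) : ℂ) := by
    intro k
    rw [LinearMap.sum_apply, Complex.ofReal_sum]
    refine Finset.sum_congr rfl fun j _ => ?_
    rw [LinearMap.smul_apply, smul_eq_mul, Complex.ofReal_mul, Complex.conj_eq_iff_re.1 (hZ k (p j))]
  constructor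
  · intro h k
    have h2 : (∑ j, ((a j ^ (m - 1) : ℝ) : ℂ) • ξ (p j)) (Z k) = 0 := LinearMap.congr_fun h (Z k)
    rw [h1] at h2
    exact_mod_cast h2
  · intro h
    refine LinearMap.ext_on_range hs fun k => ?_
    rw [h1, h k]
    simp

end GradientFlow

/-! ### Restoring the balancing condition by the gradient flow. -/

section FlowedPoints

variable {m n d : ℕ} {M : Type*} [TopologicalSpace M] [ChartedSpace (CSpace m) M]
  [IsManifold 𝓘(ℂ, CSpace m) ω M] [T2Space M] [CompactSpace M]

theorem flow_combine_zero (X : Fin d → HolVectorField m M) (s : ℝ) (x : M) :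
    flow (combine X 0) s x = x := by
  have h := combine_smul X 0 0
  rw [zero_smul] at h
  rw [h, flow_real_smul, mul_zero, flow_zero]

/-- Ensures that for small parameters the flowed points stay in the open sets where genericity and
general position hold. -/
theorem continuousAt_flow_combine (X : Fin d → HolVectorField m M) (p₀ : Fin n → M) :
    ContinuousAt (fun q : (Fin d → ℝ) × (Fin n → M) => fun j => flow (combine X q.1) 1 (q.2 j)) (0, p₀) := by
  refine continuousAt_pi.2 fun j => ?_
  obtain ⟨Ψ, hΨ, hev⟩ := exists_flow_family X (p₀ j)
  have hv : (fun k => (((0 : Fin d → ℝ) k : ℝ) : ℂ)) = 0 := by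
    funext k
    simp
  have hm := hev.self_of_nhds.1
  have hc : ContinuousAt (fun p : (Fin d → ℝ) × M =>
      ((fun k => (p.1 k : ℂ)), chartAt (CSpace m) (p₀ j) p.2)) (0, p₀ j) := by
    refine ContinuousAt.prodMk ?_ ?_
    · exact (continuous_pi fun k => Complex.continuous_ofReal.comp
        ((continuous_apply k).comp continuous_fst)).continuousAt
    · exact ContinuousAt.comp (x := ((0 : Fin d → ℝ), p₀ j))
        ((chartAt (CSpace m) (p₀ j)).continuousAt (mem_chart_source _ _)) continuousAt_snd
  simp only [hv] at hm
  have h1 : ContinuousAt (fun p : (Fin d → ℝ) × M => (chartAt (CSpace m) (p₀ j)).symm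
      (Ψ (fun k => (p.1 k : ℂ), chartAt (CSpace m) (p₀ j) p.2))) (0, p₀ j) := by
    refine ContinuousAt.comp (x := ((0 : Fin d → ℝ), p₀ j)) (g := (chartAt (CSpace m) (p₀ j)).symm) ?_
      (ContinuousAt.comp (x := ((0 : Fin d → ℝ), p₀ j)) (g := Ψ) ?_ hc)
    · simp only [hv]
      exact (chartAt (CSpace m) (p₀ j)).continuousAt_symm hm
    · simp only [hv]
      exact hΨ.continuousAt
  have h2 : ContinuousAt (fun p : (Fin d → ℝ) × M => flow (combine X p.1) 1 p.2) (0, p₀ j) :=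
    h1.congr (by filter_upwards [hev] with p hp using hp.2.symm)
  have h3 : Continuous fun q : (Fin d → ℝ) × (Fin n → M) => (q.1, q.2 j) := by fun_prop
  exact ContinuousAt.comp (x := ((0 : Fin d → ℝ), p₀)) h2 h3.continuousAt

/-- The gradient flow can be used to restore the balancing condition near a solution. -/
theorem exists_balancing_flow [MeasurableSpace M] {κ : KahlerForm m M} {ξ : M → Module.Dual ℂ κ.ham}
    (hξ : κ.IsMomentMap ξ) {Z : Fin d → κ.ham}
    (hZ : ∀ k x, (starRingEnd ℂ) (ξ x (Z k)) = ξ x (Z k))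
    (hs : Submodule.span ℂ (Set.range Z) = ⊤) (hl : LinearIndependent ℂ Z) {p₀ : Fin n → M}
    {a₀ : Fin n → ℝ} (ha₀ : ∀ j, 0 < a₀ j) (hb : κ.Balanced ξ p₀ a₀) (hp : κ.GeneralPosition p₀) :
    ∃ T : (Fin n → M) × (Fin n → ℝ) → Fin d → ℝ, Filter.Tendsto T (𝓝 (p₀, a₀)) (𝓝 0) ∧
      ∀ᶠ q in 𝓝 (p₀, a₀), κ.Balanced ξ
        (fun j => flow ((-Complex.I) • (realComb Z (T q)).1) 1 (q.1 j)) q.2 := by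
  set X : Fin d → HolVectorField m M := fun k => (-Complex.I) • (Z k).1 with hX
  choose Ψ hΨ hev using fun j => exists_flow_family X (p₀ j)
  have hv : (fun k => (((0 : Fin d → ℝ) k : ℝ) : ℂ)) = 0 := by
    funext k
    simp
  set e₀ : (Fin n → CSpace m) × (Fin n → ℝ) := (fun j => chartAt (CSpace m) (p₀ j) (p₀ j), a₀) with he₀
  -- The balancing equations at the flowed points, written in charts around the p₀ j so that the
  -- implicit function theorem in normed spaces applies.
  set f : ((Fin n → CSpace m) × (Fin n → ℝ)) × (Fin d → ℝ) → (Fin d → ℝ) := fun q i =>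
    ∑ j, q.1.2 j ^ (m - 1) * (ξ ((chartAt (CSpace m) (p₀ j)).symm
      (Ψ j (fun k => (q.2 k : ℂ), q.1.1 j))) (Z i)).re with hf
  have hu : ∀ Ξ : κ.ham, ContMDiff 𝓘(ℝ, CSpace m) 𝓘(ℝ, ℝ) ∞ (fun x => (ξ x Ξ).re) := fun Ξ =>
    (Complex.reCLM.contDiff.contMDiff (n := ∞)).comp (hξ Ξ).1.1
  have hfs : ContDiffAt ℝ 1 f (e₀, 0) := by
    refine contDiffAt_pi.2 fun i => ContDiffAt.sum fun j _ => ContDiffAt.mul ?_ ?_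
    · have : ContDiff ℝ 1 (fun q : ((Fin n → CSpace m) × (Fin n → ℝ)) × (Fin d → ℝ) => q.1.2 j) := by
        fun_prop
      exact this.contDiffAt.pow _
    · have hm := (hev j).self_of_nhds.1
      simp only [hv] at hm
      have h1 : ContDiff ℝ 1 (fun q : ((Fin n → CSpace m) × (Fin n → ℝ)) × (Fin d → ℝ) =>
          ((fun k => (q.2 k : ℂ)), q.1.1 j)) := by
        refine ContDiff.prodMk (contDiff_pi.2 fun k => ?_) (by fun_prop)
        exact Complex.ofRealCLM.contDiff.comp (by fun_prop)
      have h2 : ContDiffAt ℝ 1 (Ψ j) (0, chartAt (CSpace m) (p₀ j) (p₀ j)) :=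
        ((hΨ j).contDiffAt.restrict_scalars ℝ).of_le le_top
      have h3 := (contDiffOn_real_comp_chart_symm (hu (Z i)) (p₀ j)).contDiffAt
        ((chartAt (CSpace m) (p₀ j)).open_target.mem_nhds hm)
      rw [← hv] at h2 h3
      have h4 := ContDiffAt.comp (e₀, (0 : Fin d → ℝ)) (g := Ψ j) h2 h1.contDiffAt
      exact ContDiffAt.comp (e₀, (0 : Fin d → ℝ))
        (g := (fun x => (ξ x (Z i)).re) ∘ (chartAt (CSpace m) (p₀ j)).symm)
        (h3.of_le (WithTop.coe_le_coe.2 (le_top : (1 : ℕ∞) ≤ ⊤))) h4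
  have hfeq : ∀ᶠ q in 𝓝 ((p₀, a₀), (0 : Fin d → ℝ)), ∀ i,
      f ((fun j => chartAt (CSpace m) (p₀ j) (q.1.1 j), q.1.2), q.2) i =
        ∑ j, q.1.2 j ^ (m - 1) * (ξ (flow (combine X q.2) 1 (q.1.1 j)) (Z i)).re := by
    have h1 : ∀ᶠ q in 𝓝 ((p₀, a₀), (0 : Fin d → ℝ)), ∀ j, flow (combine X q.2) 1 (q.1.1 j) =
        (chartAt (CSpace m) (p₀ j)).symm
          (Ψ j (fun k => (q.2 k : ℂ), chartAt (CSpace m) (p₀ j) (q.1.1 j))) := by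
      refine Filter.eventually_all.2 fun j => ?_
      have hc : Continuous fun q : ((Fin n → M) × (Fin n → ℝ)) × (Fin d → ℝ) => (q.2, q.1.1 j) := by
        fun_prop
      exact ((hc.tendsto ((p₀, a₀), 0)).eventually (hev j)).mono fun q hq => hq.2
    filter_upwards [h1] with q hq i
    exact Finset.sum_congr rfl fun j _ => by rw [hq j]
  have hf0 : f (e₀, 0) = 0 := by
    funext i
    have h1 := hfeq.self_of_nhds i
    simp only [flow_combine_zero] at h1
    exact h1.trans ((balanced_iff_real hZ hs p₀ a₀).1 hb i)
  have hinj : ∀ t, fderiv ℝ f (e₀, 0) (0, t) = 0 → t = 0 := by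
    intro t ht
    have hline : HasDerivAt (fun s : ℝ => (e₀, s • t)) (0, t) 0 := by
      refine (hasDerivAt_const (0 : ℝ) e₀).prodMk ?_
      simpa using (hasDerivAt_id (0 : ℝ)).smul_const t
    have hd1 : HasDerivAt (fun s : ℝ => f (e₀, s • t)) 0 0 := by
      have h1 : HasFDerivAt f (fderiv ℝ f (e₀, 0)) (e₀, (0 : ℝ) • t) := by
        rw [zero_smul]
        exact (hfs.differentiableAt one_ne_zero).hasFDerivAt
      rw [← ht]
      exact h1.comp_hasDerivAt (0 : ℝ) hline
    -- Pairing with t itself turns the system into the weighted sum of the potential of `realComb Z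
    -- t` along its own gradient flow, so the derivative is a sum of squares.
    have hd2 : HasDerivAt (fun s : ℝ => ∑ i, t i * f (e₀, s • t) i) 0 0 := by
      have h1 := HasDerivAt.fun_sum (u := Finset.univ) fun i _ =>
        ((hasDerivAt_pi.1 hd1 i).const_mul (t i))
      simpa using h1
    have hd3 := HasDerivAt.fun_sum (u := Finset.univ) fun j _ =>
      ((isHamiltonian_realComb hξ hZ t).hasDerivAt_comp_flow (p₀ j)).const_mul (a₀ j ^ (m - 1))
    have heq : (fun s : ℝ => ∑ i, t i * f (e₀, s • t) i) =ᶠ[𝓝 0] fun s => ∑ j, a₀ j ^ (m - 1) *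
        (ξ (flow ((-Complex.I) • (realComb Z t).1) s (p₀ j)) (realComb Z t)).re := by
      have hc : ContinuousAt (fun s : ℝ => ((p₀, a₀), s • t)) 0 := by fun_prop
      have h0 : ((p₀, a₀), (0 : ℝ) • t) = ((p₀, a₀), (0 : Fin d → ℝ)) := by rw [zero_smul]
      have h1 := hc.tendsto
      rw [h0] at h1
      filter_upwards [h1.eventually hfeq] with s hs'
      simp only [he₀, hs', combine_smul, flow_real_smul, one_mul, hX, combine_eq_realComb,
        re_apply_realComb, Finset.mul_sum]
      rw [Finset.sum_comm]
      exact Finset.sum_congr rfl fun j _ => Finset.sum_congr rfl fun i _ => by ring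
    have hsum := (hd3.congr_of_eventuallyEq heq).unique hd2
    have hnn : ∀ j, 0 ≤ κ.form.inChart (p₀ j) (chartAt (CSpace m) (p₀ j) (p₀ j))
        ![coord ℂ (p₀ j) (vec ((-Complex.I) • (realComb Z t).1)) (chartAt (CSpace m) (p₀ j) (p₀ j)),
          Complex.I • coord ℂ (p₀ j) (vec ((-Complex.I) • (realComb Z t).1))
            (chartAt (CSpace m) (p₀ j) (p₀ j))] := by
      intro j
      by_cases h0 : coord ℂ (p₀ j) (vec ((-Complex.I) • (realComb Z t).1))
          (chartAt (CSpace m) (p₀ j) (p₀ j)) = 0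
      · rw [h0, smul_zero, form2_self]
      · exact (κ.inChart_pos (mem_chart_target _ _) _ h0).le
    -- Every weighted square vanishes, and the weights are positive; thus the field is zero at all
    -- the points and general position forces it to be zero.
    have hz := (Finset.sum_eq_zero_iff_of_nonneg fun j _ =>
      mul_nonneg (pow_nonneg (ha₀ j).le _) (hnn j)).1 hsum
    refine eq_zero_of_realComb_eq_zero hl (Subtype.ext (hp _ (realComb Z t).2 fun j => ?_))
    have h1 := (mul_eq_zero.1 (hz j (Finset.mem_univ j))).resolve_left (pow_pos (ha₀ j) _).ne'
    have h2 : coord ℂ (p₀ j) (vec ((-Complex.I) • (realComb Z t).1))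
        (chartAt (CSpace m) (p₀ j) (p₀ j)) = 0 := by
      by_contra h0
      exact (κ.inChart_pos (mem_chart_target _ _) _ h0).ne' h1
    have h3 : (-Complex.I) • vec (realComb Z t).1 (p₀ j) = 0 :=
      (coord_eq_zero_iff (vec ((-Complex.I) • (realComb Z t).1)) (mem_chart_source _ _)).1 h2
    exact (smul_eq_zero.1 h3).resolve_left (neg_ne_zero.2 Complex.I_ne_zero)
  obtain ⟨ψ, hψ, hψ0⟩ := exists_implicit_zero hfs hf0 hinj
  have hcE : Filter.Tendsto (fun q : (Fin n → M) × (Fin n → ℝ) =>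
      ((fun j => chartAt (CSpace m) (p₀ j) (q.1 j)), q.2)) (𝓝 (p₀, a₀)) (𝓝 e₀) := by
    have : ContinuousAt (fun q : (Fin n → M) × (Fin n → ℝ) =>
      ((fun j => chartAt (CSpace m) (p₀ j) (q.1 j)), q.2)) (p₀, a₀) := by
      refine ContinuousAt.prodMk (continuousAt_pi.2 fun j => ?_) continuousAt_snd
      exact ContinuousAt.comp (x := (p₀, a₀)) (f := fun q : (Fin n → M) × (Fin n → ℝ) => q.1 j)
        ((chartAt (CSpace m) (p₀ j)).continuousAt (mem_chart_source _ _))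
        ((continuous_apply j).comp continuous_fst).continuousAt
    exact this
  refine ⟨fun q => ψ ((fun j => chartAt (CSpace m) (p₀ j) (q.1 j)), q.2), hψ.comp hcE, ?_⟩
  have h1 : Filter.Tendsto (fun q : (Fin n → M) × (Fin n → ℝ) =>
      (q, ψ ((fun j => chartAt (CSpace m) (p₀ j) (q.1 j)), q.2))) (𝓝 (p₀, a₀))
      (𝓝 ((p₀, a₀), 0)) :=
    Filter.tendsto_id.prodMk_nhds (hψ.comp hcE)
  filter_upwards [h1.eventually hfeq, hcE.eventually hψ0] with q hq hq0
  refine (balanced_iff_real hZ hs _ _).2 fun i => ?_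
  have h2 := hq i
  rw [hq0] at h2
  simp only [hX, combine_eq_realComb] at h2
  exact h2.symm

end FlowedPoints

end KahlerBlowup

end

noncomputable section

namespace KahlerBlowup

open Topology MeasureTheory

/-! ### Openness of the set of admissible configurations. -/

section Openness

variable {m n : ℕ} {M : Type*} [TopologicalSpace M] [ChartedSpace (CSpace m) M]
  [IsManifold 𝓘(ℂ, CSpace m) ω M]

/-- Genericity exhibits a finite spanning set of the dual, so finiteness of 𝔥 needs no elliptic
theory. -/
theorem finite_ham_of_generic {κ : KahlerForm m M} {ξ : M → Module.Dual ℂ κ.ham} {p : Fin n → M}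
    (h : κ.Generic ξ p) : Module.Finite ℂ κ.ham := by
  have : Module.Finite ℂ (Module.Dual ℂ κ.ham) :=
    Module.Finite.of_fg_top (h ▸ Submodule.fg_span (Set.finite_range fun j => ξ (p j)))
  exact Module.finite_dual_iff ℂ |>.1 this

variable [T2Space M] [CompactSpace M] [ConnectedSpace M] [MeasurableSpace M] [BorelSpace M]

/-- Near an admissible configuration for a Kähler form of constant scalar curvature, all
configurations are admissible for the pull-backs of the form by suitable automorphisms. -/
theorem eventually_exists_admissible {κ : KahlerForm m M} (hκ : ∃ s : ℝ, ∀ x, κ.scal x = s)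
    {p₀ : Fin n → M} {a₀ : Fin n → ℝ} (ha₀ : ∀ j, 0 < a₀ j) (h : κ.Admissible p₀ a₀) :
    ∀ᶠ q in 𝓝 (p₀, a₀), ∃ κ' : KahlerForm m M, κ'.SameClass κ ∧ (∀ x, κ'.scal x = κ.scal x) ∧
      κ'.Admissible q.1 q.2 := by
  obtain ⟨ξ, hξ, hg, hb, hp⟩ := h
  have := finite_ham_of_generic hg
  obtain ⟨d, Z, hZ, hs, hl⟩ := hξ.exists_real_basis hκ
  obtain ⟨T, hT, hev⟩ := exists_balancing_flow hξ hZ hs hl ha₀ hb hp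
  have hT' : Filter.Tendsto (fun q : (Fin n → M) × (Fin n → ℝ) => (T q, q.1)) (𝓝 (p₀, a₀))
      (𝓝 ((0 : Fin d → ℝ), p₀)) := hT.prodMk_nhds continuousAt_fst
  have hQ := (continuousAt_flow_combine (fun k => (-Complex.I) • (Z k).1) p₀).tendsto
  simp only [flow_combine_zero] at hQ
  have h1 := (hQ.comp hT').eventually (eventually_generic
    (fun Ξ => (hξ Ξ).1.1.continuous) hs hl hg)
  have h2 := (hQ.comp hT').eventually (eventually_generalPosition hs hl hp)
  filter_upwards [hev, h1, h2] with q hq0 hq1 hq2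
  simp only [Function.comp_apply, combine_eq_realComb] at hq1 hq2
  -- The new form is the pull-back of κ by the time one gradient flow with parameter T q, for which
  -- balancing holds at the flowed points.
  refine ⟨_, (isHamiltonian_realComb hξ hZ (T q)).sameClass_pullback_flow, fun x => ?_,
    admissible_pullback (contMDiff_flow_complex _ _) (contMDiff_flow_complex _ (-1))
      (fun x => flow_neg_flow _ _ x) (fun x => flow_flow_neg _ _ x) rfl hξ hq1 hq0 hq2⟩
  obtain ⟨s, hs'⟩ := hκ
  rw [KahlerForm.scal_pullback (contMDiff_flow_complex _ _) rfl, hs', hs']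

end Openness

end KahlerBlowup

end

theorem theorem4 (m n : ℕ) {M : Type*} [TopologicalSpace M] [T2Space M] [CompactSpace M]
    [ConnectedSpace M] [ChartedSpace (KahlerBlowup.CSpace m) M]
    [IsManifold 𝓘(ℂ, KahlerBlowup.CSpace m) ω M] [MeasurableSpace M] [BorelSpace M]
    (κ : KahlerBlowup.KahlerForm m M) (hκ : ∃ s : ℝ, ∀ x : M, κ.scal x = s)
    (hn : Module.rank ℂ κ.ham + 1 ≤ (n : Cardinal)) :
    IsOpen {q : {p : Fin n → M // Function.Injective p} × {a : Fin n → ℝ // ∀ j, 0 < a j} |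
      ∃ κ' : KahlerBlowup.KahlerForm m M, κ'.SameClass κ ∧ (∀ x : M, κ'.scal x = κ.scal x) ∧
        κ'.Admissible q.1.1 q.2.1} := by
  refine isOpen_iff_mem_nhds.2 ?_
  rintro ⟨⟨p₀, hp₀⟩, ⟨a₀, ha₀⟩⟩ ⟨κ₀, hclass, hscal, hadm⟩
  obtain ⟨s, hs⟩ := hκ
  -- The perturbation starts from κ₀, for which the base configuration is admissible and which may
  -- differ from κ; class and scalar curvature are carried back to κ by transitivity.
  have h1 := KahlerBlowup.eventually_exists_admissible ⟨s, fun x => (hscal x).trans (hs x)⟩ ha₀ hadm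
  have hc : Continuous fun q : {p : Fin n → M // Function.Injective p} ×
      {a : Fin n → ℝ // ∀ j, 0 < a j} => (q.1.1, q.2.1) := by fun_prop
  refine Filter.mem_of_superset ((hc.tendsto (⟨p₀, hp₀⟩, ⟨a₀, ha₀⟩)).eventually h1) ?_
  rintro q ⟨κ', h2, h3, h4⟩
  exact ⟨κ', h2.trans hclass, fun x => (h3 x).trans (hscal x), h4⟩
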